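/- **Setting.** Let $d\ge 1$, $m\ge 1$, $n\ge 2$ be integers. For vectors and multi-indices write $|u|=\sum_i|u_i|$; for $x\in\mathbb C^d$ and a real scalar $\alpha$ write $x^{\boldsymbol\alpha}=\prod_{i=1}^d x_i^{\alpha}$, so that $x^{\mathbf 1}=x_1\cdots x_d$. For $\phi,\rho>0$ let $$\mathcal D_{\phi,\rho;x}=\{x\in\mathbb C^d:\ |\arg x_i|<\tfrac{\pi}{2}+\phi,\ |x_i|>\rho,\ i=1,\dots,d\}.$$ Fix $T>0$, $\rho_0>0$, $\epsilon>0$, and consider, for $f=(f_1,\dots,f_m)$, the normalized quasilinear system $$\partial_t f+\mathcal P(\partial_x)f=\sum_{q}b_q(x,t,f)\prod_{l=1}^m\ \prod_{1\le|j|\le n}\bigl(\partial_x^{j}f_l\bigr)^{q_{l,j}}+r(x,t),\qquad f(x,0)=f_I(x).\tag{1.a}$$ Here $j$ runs over the multi-indices in $\mathbb N^d$ with $1\le |j|\le n$, the sum is over the (finitely many) families $q=(q_{l,j})$ of nonnegative integers with $\sum_{l,j}|j|\,q_{l,j}\le n$, and $\mathcal P=\mathrm{diag}(\mathcal P_1,\dots,\mathcal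 P_m)$ with complex polynomials $\mathcal P_j$ of degree at most $n$; $\mathcal P_{n;j}$ denotes the part of $\mathcal P_j$ that is homogeneous of degree $n$. **Assumptions.** 1. $\phi\in(0,\frac{\pi}{2n})$ is such that $\Re\,\mathcal P_{n;j}(-p)>0$ for all $j$ and all $p\in\mathbb C^d\setminus\{0\}$ each of whose components is either $0$ or satisfies $|\arg p_i|\le\phi$. 2. For every $t\in[0,T]$, $b_q(\cdot,t,\cdot)$ is analytic in $\mathcal D_{\frac{\pi}{2n},\rho_0;x}\times\{y\in\mathbb C^m:|y|<\epsilon\}$, with expansion $b_q(x,t,y)=\sum_{k\in\mathbb N^m}b_{q,k}(x,t)\,y^k$, and $r(\cdot,t)$ and $f_I$ are analytic in $\mathcal D_{\frac{\pi}{2n},\rho_0;x}$. All $b_q(x,\cdot,y)$ and $r(x,\cdot)$ are continuous on $[0,T]$. Terms free of $f$ are collected in $r$, that is, $b_{0,0}=0$. 3. There are constants $\alpha_r\ge 1$ and $\alpha_q>0$ such that $$\sup|x^{\boldsymbol\alpha_r}r(x,t)|<\infty,\qquad \sup|x^{\boldsymbol\alpha_r}f_I(x)|<\infty,\qquad \sup_{q,k}\,\sup|x^{\boldsymbol\alpha_q}b_{q,k}(x,t)|<\infty,$$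 where the suprema are over $x\in\mathcal D_{\frac{\pi}{2n},\rho_0;x}$ and $t\in[0,T]$. For $\rho\ge\rho_0$, call $f$ a *decaying solution on $\mathcal D_{\phi,\rho;x}$* if it is a classical solution of (1.a) on $\mathcal D_{\phi,\rho;x}\times[0,T]$ with values in $\{|y|<\epsilon\}$ such that (a) $f(\cdot,t)$ is analytic in $\mathcal D_{\phi,\rho;x}$ for every $t\in[0,T]$ and (b) $|x^{\mathbf 1}|\,|f(x,t)|$ is bounded on $\mathcal D_{\phi,\rho;x}\times[0,T]$. **Theorem.** Under these assumptions: * (existence for large $|x|$) there is $\rho_1\ge\rho_0$ such that for every $\rho\ge\rho_1$ the system (1.a) has a decaying solution on $\mathcal D_{\phi,\rho;x}$; * (uniqueness) for every $\rho\ge\rho_0$ there is at most one decaying solution on $\mathcal D_{\phi,\rho;x}$; * (decay) for every $\rho\ge\rho_0$, a decaying solution $f$ on $\mathcal D_{\phi,\rho;x}$ satisfies $f=O(x^{-\boldsymbol\alpha_r})$ in $\mathcal D_{\phi,\tilde\rho;x}$ for large $\tilde\rho$: there are $\tilde\rho\ge\rho$ and $K$ with $|f(x,t)|\le K\,|x^{-\boldsymbol\alpha_r}|$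 for all $x\in\mathcal D_{\phi,\tilde\rho;x}$ and $t\in[0,T]$. -/

import Mathlib

/-- The `ℓ¹` length `|u| = ∑ᵢ |uᵢ|` of a complex vector. -/
noncomputable def l1norm {k : ℕ} (u : Fin k → ℂ) : ℝ := ∑ i, ‖u i‖

/-- `|x^𝛂| = ∏ᵢ |xᵢ|^α`, the modulus of `x₁^α ⋯ x_d^α`, for a real scalar `α`. -/
noncomputable def absPow {d : ℕ} (x : Fin d → ℂ) (α : ℝ) : ℝ := ∏ i, ‖x i‖ ^ α

/-- The polysector `{x ∈ ℂᵈ : |arg xᵢ| < π/2 + φ, |xᵢ| > ρ for all i}`. -/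
def polysector (d : ℕ) (φ ρ : ℝ) : Set (Fin d → ℂ) :=
  {x | ∀ i, |Complex.arg (x i)| < Real.pi / 2 + φ ∧ ρ < ‖x i‖}

/-- The partial derivative `∂g/∂xᵢ` of a function of `d` complex variables. -/
noncomputable def partialDeriv {d : ℕ} (i : Fin d) (g : (Fin d → ℂ) → ℂ) : (Fin d → ℂ) → ℂ :=
  fun x => fderiv ℂ g x (Pi.single i 1)

/-- `∂ₓ^j g = ∂_{x₁}^{j₁} ∂_{x₂}^{j₂} ⋯ ∂_{x_d}^{j_d} g` for a multiindex `j`. -/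
noncomputable def multiDeriv {d : ℕ} (j : Fin d → ℕ) (g : (Fin d → ℂ) → ℂ) : (Fin d → ℂ) → ℂ :=
  (List.finRange d).foldr (fun i h => (partialDeriv i)^[j i] h) g

/-- The constant coefficient differential operator `P(∂ₓ)` attached to a polynomial `P`. -/
noncomputable def polyDiffOp {d : ℕ} (P : MvPolynomial (Fin d) ℂ) (g : (Fin d → ℂ) → ℂ) :
    (Fin d → ℂ) → ℂ :=
  fun x => ∑ k ∈ P.support, P.coeff k * multiDeriv (fun i => k i) g x

/-- The multiindices `j ∈ ℕᵈ` with `1 ≤ |j| ≤ n`. -/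
def multiIdx (d n : ℕ) : Finset (Fin d → ℕ) :=
  (Fintype.piFinset fun _ => Finset.range (n + 1)).filter
    fun j => 1 ≤ ∑ i, j i ∧ ∑ i, j i ≤ n

theorem mem_multiIdx {d n : ℕ} (j : Fin d → ℕ) :
    j ∈ multiIdx d n ↔ 1 ≤ ∑ i, j i ∧ ∑ i, j i ≤ n := by
  simp only [multiIdx, Finset.mem_filter, Fintype.mem_piFinset, Finset.mem_range,
    and_iff_right_iff_imp]
  intro h i
  have := Finset.single_le_sum (f := j) (fun _ _ => Nat.zero_le _) (Finset.mem_univ i)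
  omega

/-- The exponents `q = (q_{l,j})`, `1 ≤ l ≤ m`, `1 ≤ |j| ≤ n`, with `∑ |j| q_{l,j} ≤ n`. -/
def expIdx (d m n : ℕ) : Finset (Fin m → multiIdx d n → ℕ) :=
  (Fintype.piFinset fun _ => Fintype.piFinset fun _ => Finset.range (n + 1)).filter
    fun q => ∑ l, ∑ j : multiIdx d n, (∑ i, j.1 i) * q l j ≤ n

theorem mem_expIdx {d m n : ℕ} (q : Fin m → multiIdx d n → ℕ) :
    q ∈ expIdx d m n ↔ ∑ l, ∑ j : multiIdx d n, (∑ i, j.1 i) * q l j ≤ n := by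
  simp only [expIdx, Finset.mem_filter, Fintype.mem_piFinset, Finset.mem_range,
    and_iff_right_iff_imp]
  intro h l j
  have h1 := Finset.single_le_sum
    (f := fun l => ∑ j : multiIdx d n, (∑ i, j.1 i) * q l j)
    (fun _ _ => Nat.zero_le _) (Finset.mem_univ l)
  have h2 := Finset.single_le_sum
    (f := fun j : multiIdx d n => (∑ i, j.1 i) * q l j)
    (fun _ _ => Nat.zero_le _) (Finset.mem_univ j)
  have h3 := Nat.le_mul_of_pos_left (q l j) ((mem_multiIdx j.1).1 j.2).1
  omega

/-- The data of the Cauchy problem for `f = (f₁, …, f_m)`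
`∂ₜ f + 𝒫(∂ₓ) f = ∑_q b_q(x, t, f) ∏_{l,j} (∂ₓ^j f_l)^{q_{l,j}} + r(x, t)`, `f(x, 0) = f_I(x)`,
with `𝒫 = diag(P₁, …, P_m)` and `q` ranging over `expIdx d m n`. -/
structure QuasilinearData (d m n : ℕ) where
  P : Fin m → MvPolynomial (Fin d) ℂ
  b : (Fin m → multiIdx d n → ℕ) → (Fin d → ℂ) → ℝ → (Fin m → ℂ) → (Fin m → ℂ)
  r : (Fin d → ℂ) → ℝ → (Fin m → ℂ)
  fI : (Fin d → ℂ) → (Fin m → ℂ)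

/-- `c` is the family of Taylor coefficients of `g` at `0`:
`g(y) = ∑_k c_k y^k` (absolutely convergent) for `|y| < ε`. -/
def HasTaylorCoeffs {m : ℕ} (g : (Fin m → ℂ) → (Fin m → ℂ)) (ε : ℝ)
    (c : (Fin m → ℕ) → (Fin m → ℂ)) : Prop :=
  ∀ y, l1norm y < ε → HasSum (fun k : Fin m → ℕ => (∏ l, y l ^ k l) • c k) (g y)

/-- The standing assumptions: cone condition on the principal part, analyticity, and algebraic
decay of the coefficients, of the inhomogeneous term and of the initial data. -/
structure StandingAssumptions {d m n : ℕ} (S : QuasilinearData d m n)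
    (φ ρ₀ ε T αr : ℝ) (αq : (Fin m → multiIdx d n → ℕ) → ℝ) : Prop where
  order_le : ∀ l, (S.P l).totalDegree ≤ n
  phi_pos : 0 < φ
  phi_lt : φ < Real.pi / (2 * n)
  /-- the principal parts satisfy `Re P_{n;l}(-p) > 0` on the closed polysector minus `0` -/
  cone : ∀ l, ∀ p : Fin d → ℂ, p ≠ 0 → (∀ i, |Complex.arg (p i)| ≤ φ) →
    0 < (MvPolynomial.eval (-p) (MvPolynomial.homogeneousComponent n (S.P l))).re
  b_analytic : ∀ q ∈ expIdx d m n, ∀ t ∈ Set.Icc 0 T,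
    AnalyticOnNhd ℂ (fun z : (Fin d → ℂ) × (Fin m → ℂ) => S.b q z.1 t z.2)
      (polysector d (Real.pi / (2 * n)) ρ₀ ×ˢ {y | l1norm y < ε})
  r_analytic : ∀ t ∈ Set.Icc 0 T,
    AnalyticOnNhd ℂ (fun x => S.r x t) (polysector d (Real.pi / (2 * n)) ρ₀)
  fI_analytic : AnalyticOnNhd ℂ S.fI (polysector d (Real.pi / (2 * n)) ρ₀)
  b_continuous : ∀ q ∈ expIdx d m n, ∀ x ∈ polysector d (Real.pi / (2 * n)) ρ₀,
    ∀ y, l1norm y < ε → ContinuousOn (fun t => S.b q x t y) (Set.Icc 0 T)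
  r_continuous : ∀ x ∈ polysector d (Real.pi / (2 * n)) ρ₀,
    ContinuousOn (fun t => S.r x t) (Set.Icc 0 T)
  /-- the normalization `b_{0,0} = 0`: terms free of `f` are collected in `r` -/
  b_zero : ∀ x ∈ polysector d (Real.pi / (2 * n)) ρ₀, ∀ t ∈ Set.Icc 0 T, S.b 0 x t 0 = 0
  one_le_αr : 1 ≤ αr
  αq_pos : ∀ q ∈ expIdx d m n, 0 < αq q
  r_bound : ∃ Ar : ℝ, ∀ x ∈ polysector d (Real.pi / (2 * n)) ρ₀, ∀ t ∈ Set.Icc 0 T,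
    absPow x αr * l1norm (S.r x t) ≤ Ar
  fI_bound : ∃ Af : ℝ, ∀ x ∈ polysector d (Real.pi / (2 * n)) ρ₀,
    absPow x αr * l1norm (S.fI x) ≤ Af
  /-- the Taylor coefficients `b_{q,k}(x, t)` of `b_q(x, t, ·)` obey a bound uniform in `k` -/
  b_bound : ∃ Ab : ℝ, ∀ q ∈ expIdx d m n, ∀ x ∈ polysector d (Real.pi / (2 * n)) ρ₀,
    ∀ t ∈ Set.Icc 0 T, ∃ c : (Fin m → ℕ) → (Fin m → ℂ),
      HasTaylorCoeffs (S.b q x t) ε c ∧ ∀ k, absPow x (αq q) * l1norm (c k) ≤ Ab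

/-- `f` is a solution on `𝒟_{φ,ρ} × [0, T]`, analytic in `x` and with `|x₁ ⋯ x_d| |f|` bounded.
The clause `mem_domain` says that the coefficients `b_q(x, t, f(x, t))` are defined. -/
structure IsDecayingSolution {d m n : ℕ} (S : QuasilinearData d m n) (φ ρ ε T : ℝ)
    (f : (Fin d → ℂ) → ℝ → (Fin m → ℂ)) : Prop where
  analytic : ∀ t ∈ Set.Icc 0 T, AnalyticOnNhd ℂ (fun x => f x t) (polysector d φ ρ)
  bounded : ∃ A : ℝ, ∀ x ∈ polysector d φ ρ, ∀ t ∈ Set.Icc 0 T,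
    (∏ i, ‖x i‖) * l1norm (f x t) ≤ A
  mem_domain : ∀ x ∈ polysector d φ ρ, ∀ t ∈ Set.Icc 0 T, l1norm (f x t) < ε
  initial : ∀ x ∈ polysector d φ ρ, f x 0 = S.fI x
  equation : ∀ x ∈ polysector d φ ρ, ∀ t ∈ Set.Icc 0 T,
    HasDerivWithinAt (fun s => f x s)
      (fun l => - polyDiffOp (S.P l) (fun y => f y t l) x
        + ∑ q ∈ expIdx d m n, S.b q x t (f x t) l *
            ∏ l' : Fin m, ∏ j : multiIdx d n,
              (multiDeriv j.1 (fun y => f y t l') x) ^ q l' j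
        + S.r x t l)
      (Set.Icc 0 T) t

/-! The proof works in the Borel plane. A solution is sought as a Laplace transform f(x,t) = ∫
F(p,t) e^{-p·x} dp, with F defined on a product of sectors |arg pᵢ| ≤ σ. There ∂ₓ^j becomes
multiplication by (-p)^j and products become convolutions, so for each p the system is a scalar
equation in t. By Duhamel, F(p,t) = e^{-P(-p)t} F_I(p) + ∫₀ᵗ e^{-P(-p)(t-τ)} (N(F) + r̂)(p,τ) dτ,
where F_I and r̂ are the Borel transforms of the data and N is the nonlinearity written with
convolutions.

Three facts make this a contraction. (1) By compactness the cone condition persists on a slightly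
larger sector, σ > φ, and gives Re P(-p) ≥ c|p|ⁿ - C₀ there (`exists_cone_bound`). The time integral
then absorbs a factor (1+|p|)ⁿ (`IsKernel.duhamel`), which is all that the derivatives can produce,
since ∑|j|q_{l,j} ≤ n. (2) The product weight built from s^γ e^{Rs} (1+Rs)^{-(γ+2)}, suitably
normalized, has a self-convolution bounded by itself (`rayWeight_conv_le`), so functions bounded by
it form an algebra under convolution (`IsKernel.conv`). (3) A coefficient that is O(x^{-α}) with α >
0 has a Borel transform with the integrable singularity |p|^{α-1}, and convolution with it costs a
factor that tends to 0 as R → ∞ (`IsSectorial.conv_kernel`, `tendsto_coefConst`). The normalization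
b_{0,0} = 0 removes the only monomial without a factor F, so the Lipschitz constant of N can be made
arbitrarily small (`StandingAssumptions.exists_lipschitz`).

Borel transforms are taken along Hankel contours. They do not depend on the radii, and radii of the
form a + 1/|pᵢ| give the bound ∏ |pᵢ|^{α-1} e^{3a|pᵢ|}. Fubini and Cauchy's formula show that the
Laplace transform inverts them (`IsSectorial.laplace_borel`).

Existence: successive approximations with γ = α_r - 1 produce F. Integrating along the rotated rays
arg pᵢ = ±σ yields an analytic function on |arg xᵢ| < π/2 + φ for large |xᵢ|, and Euler's Gamma
integral gives the bound O(x^{-α_r}). The equation is checked on a product of half planes and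
carried over by the identity theorem.

Uniqueness: decaying solutions are O(x^{-1}), hence Laplace transforms of kernels with γ = 0 on the
positive orthant. Injectivity of the Laplace transform turns the equation for the difference of two
solutions into a Duhamel formula, and the contraction halves the size of that difference
indefinitely. Decay then follows, because every decaying solution agrees with the constructed one
for large |x|. -/

section

open Set Filter MeasureTheory Topology

/-! ### Parameter integrals, product contours, Cauchy's theorem on strips -/

/-- Holomorphy of a parameter integral of holomorphic functions with locally uniform domination. -/
theorem differentiableOn_integral_of_dominated {α : Type*} [MeasurableSpace α] {μ : Measure α}
    {U : Set ℂ} (hU : IsOpen U) {f : ℂ → α → ℂ}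
    (hmeas : ∀ z ∈ U, AEStronglyMeasurable (f z) μ)
    (hdiff : ∀ᵐ a ∂μ, DifferentiableOn ℂ (fun z => f z a) U)
    (hbd : ∀ z₀ ∈ U, ∃ r > 0, ∃ B : α → ℝ, Integrable B μ ∧
      ∀ᵐ a ∂μ, ∀ z ∈ Metric.ball z₀ r, z ∈ U → ‖f z a‖ ≤ B a) :
    DifferentiableOn ℂ (fun z => ∫ a, f z a ∂μ) U := by
  intro z₀ hz₀
  obtain ⟨r, hr, B, hBi, hB⟩ := hbd z₀ hz₀
  obtain ⟨r', hr', hsub⟩ := Metric.isOpen_iff.1 hU z₀ hz₀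
  -- Halving leaves room for a disc of radius ρ/2 around every point of the ball of radius ρ;
  -- Cauchy's estimate on these discs bounds the derivative.
  set ρ := min r r' / 2 with hρ
  have hρ0 : 0 < ρ := by positivity
  have hmem : ∀ z ∈ Metric.ball z₀ ρ, ∀ v ∈ Metric.closedBall z (ρ / 2),
      v ∈ Metric.ball z₀ r ∧ v ∈ U := by
    intro z hz v hv
    have h1 : dist v z₀ < min r r' := by
      have := dist_triangle v z z₀
      rw [Metric.mem_ball] at hz; rw [Metric.mem_closedBall] at hv
      linarith
    exact ⟨Metric.mem_ball.2 (h1.trans_le (min_le_left _ _)),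
      hsub (Metric.mem_ball.2 (h1.trans_le (min_le_right _ _)))⟩
  have hball : ∀ z ∈ Metric.ball z₀ ρ, z ∈ U := fun z hz =>
    (hmem z hz z (Metric.mem_closedBall_self (by positivity))).2
  have key := hasDerivAt_integral_of_dominated_loc_of_deriv_le (μ := μ) (F := f)
    (F' := fun z a => deriv (fun z => f z a) z) (x₀ := z₀) (s := Metric.ball z₀ ρ)
    (bound := fun a => B a / (ρ / 2)) (Metric.ball_mem_nhds _ hρ0) ?_ ?_ ?_ ?_ ?_ ?_
  · exact key.2.differentiableAt.differentiableWithinAt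
  · filter_upwards [hU.mem_nhds hz₀] with z hz using hmeas z hz
  · refine hBi.mono' (hmeas z₀ hz₀) ?_
    filter_upwards [hB] with a ha using ha z₀ (Metric.mem_ball_self hr) hz₀
  -- Measurability of the derivative in the parameter: it is an a.e. limit of measurable difference
  -- quotients with increments ρ/(n+2).
  · have hlim : Tendsto (fun n : ℕ => (ρ / ((n : ℝ) + 2) : ℂ)) atTop (𝓝[≠] 0) := by
      rw [tendsto_nhdsWithin_iff]
      constructor
      · have h1 : Tendsto (fun n : ℕ => ρ / ((n : ℝ) + 2)) atTop (𝓝 0) :=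
          Tendsto.div_atTop tendsto_const_nhds
            (tendsto_atTop_add_const_right _ _ tendsto_natCast_atTop_atTop)
        have := (Complex.continuous_ofReal.tendsto 0).comp h1
        simpa [Function.comp_def] using this
      · refine Eventually.of_forall fun n => ?_
        have : ((n : ℝ) + 2 : ℂ) ≠ 0 := by
          have : (0 : ℝ) < (n : ℝ) + 2 := by positivity
          exact_mod_cast this.ne'
        have h2 : (ρ : ℂ) ≠ 0 := by exact_mod_cast hρ0.ne'
        exact div_ne_zero h2 this
    refine aestronglyMeasurable_of_tendsto_ae atTop
      (f := fun (n : ℕ) a => (ρ / ((n : ℝ) + 2) : ℂ)⁻¹ • (f (z₀ + (ρ / ((n : ℝ) + 2) : ℂ)) a - f z₀ a))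
      (fun n => ?_) ?_
    · refine AEStronglyMeasurable.const_smul
        (AEStronglyMeasurable.sub (hmeas _ (hball _ ?_)) (hmeas _ hz₀)) (ρ / ((n : ℝ) + 2) : ℂ)⁻¹
      rw [Metric.mem_ball, dist_eq_norm, add_sub_cancel_left]
      have : (ρ / ((n : ℝ) + 2) : ℂ) = ((ρ / ((n : ℝ) + 2) : ℝ) : ℂ) := by push_cast; rfl
      rw [this, Complex.norm_real, Real.norm_of_nonneg (by positivity)]
      exact div_lt_self hρ0 (by have : (0 : ℝ) ≤ n := by positivity
                                linarith)
    · filter_upwards [hdiff] with a ha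
      have hd := (ha.differentiableAt (hU.mem_nhds hz₀)).hasDerivAt
      have := hd.tendsto_slope_zero.comp hlim
      simpa [Function.comp_def] using this
  · filter_upwards [hdiff, hB] with a ha hBa z hz
    refine Complex.norm_deriv_le_of_forall_mem_sphere_norm_le (by positivity) ?_ ?_
    · refine DifferentiableOn.diffContOnCl ?_
      refine ha.mono fun v hv => (hmem z hz v ?_).2
      exact Metric.closure_ball_subset_closedBall hv
    · intro v hv
      have := hmem z hz v (Metric.sphere_subset_closedBall hv)
      exact hBa v this.1 this.2
  · exact hBi.div_const _
  · filter_upwards [hdiff] with a ha z hz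
    exact (ha.differentiableAt (hU.mem_nhds (hball z hz))).hasDerivAt

/-- A locally bounded function, holomorphic in the first and continuous in the second variable, is
jointly continuous. -/
theorem continuousOn_prod_of_differentiableOn {E : Type*} [NormedAddCommGroup E] [NormedSpace ℂ E]
    {U : Set E} (hU : IsOpen U) {I : Set ℝ} {g : E → ℝ → ℂ}
    (hd : ∀ t ∈ I, DifferentiableOn ℂ (fun x => g x t) U)
    (hc : ∀ x ∈ U, ContinuousOn (g x) I)
    (hb : ∀ x ∈ U, ∃ r > 0, ∃ M : ℝ, ∀ y ∈ Metric.ball x r, y ∈ U → ∀ t ∈ I, ‖g y t‖ ≤ M) :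
    ContinuousOn (fun z : E × ℝ => g z.1 z.2) (U ×ˢ I) := by
  rintro ⟨x₀, t₀⟩ ⟨hx₀, ht₀⟩
  obtain ⟨r, hr, M, hM⟩ := hb x₀ hx₀
  obtain ⟨r', hr', hsub⟩ := Metric.isOpen_iff.1 hU x₀ hx₀
  set ρ := min r r' with hρ
  have hρ0 : 0 < ρ := by positivity
  have hin : Metric.ball x₀ ρ ⊆ U := (Metric.ball_subset_ball (min_le_right _ _)).trans hsub
  -- Schwarz's lemma: a holomorphic map whose values stay within 2M of its central value is
  -- Lipschitz, with a constant independent of t.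
  have hlip : ∀ t ∈ I, ∀ x ∈ Metric.ball x₀ ρ, dist (g x t) (g x₀ t) ≤ (2 * M) / ρ * dist x x₀ := by
    intro t ht x hx
    refine Complex.dist_le_div_mul_dist_of_mapsTo_ball ((hd t ht).mono hin) ?_ hx
    intro y hy
    have h1 := hM y (Metric.ball_subset_ball (min_le_left _ _) hy) (hin hy) t ht
    have h2 := hM x₀ (Metric.mem_ball_self hr) hx₀ t ht
    rw [Metric.mem_closedBall, dist_eq_norm]
    exact (norm_sub_le _ _).trans (by linarith)
  have ht : Tendsto (fun z : E × ℝ => g x₀ z.2) (𝓝[U ×ˢ I] (x₀, t₀)) (𝓝 (g x₀ t₀)) := by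
    refine ((hc x₀ hx₀) t₀ ht₀).tendsto.comp ?_
    refine tendsto_nhdsWithin_iff.2 ⟨?_, ?_⟩
    · exact (continuous_snd.tendsto _).mono_left nhdsWithin_le_nhds
    · filter_upwards [self_mem_nhdsWithin] with z hz using hz.2
  refine tendsto_of_tendsto_of_dist ht ?_
  refine squeeze_zero' (g := fun z : E × ℝ => (2 * M) / ρ * dist z.1 x₀) (Eventually.of_forall fun _ => dist_nonneg) ?_ ?_
  · have : ∀ᶠ z : E × ℝ in 𝓝[U ×ˢ I] (x₀, t₀), z.1 ∈ Metric.ball x₀ ρ :=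
      ((continuous_fst.tendsto (x₀, t₀)).mono_left nhdsWithin_le_nhds).eventually
        (Metric.ball_mem_nhds _ hρ0)
    filter_upwards [self_mem_nhdsWithin, this] with z hz hz1
    rw [dist_comm]
    exact hlip z.2 hz.2 z.1 hz1
  · have : Tendsto (fun z : E × ℝ => (2 * M) / ρ * dist z.1 x₀) (𝓝 (x₀, t₀)) (𝓝 ((2 * M) / ρ * dist x₀ x₀)) := by
      refine Continuous.tendsto (f := fun z : E × ℝ => (2 * M) / ρ * dist z.1 x₀) ?_ (x₀, t₀)
      fun_prop
    simpa using this.mono_left nhdsWithin_le_nhds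

/-- If two families of weighted curves integrate all one-variable slices of `G` to the same value,
then so do the product families. -/
theorem integral_pi_eq_of_slices : ∀ {d : ℕ} (μ ν : Fin d → Measure ℝ) [∀ i, SigmaFinite (μ i)]
    [∀ i, SigmaFinite (ν i)] (y y' k k' : Fin d → ℝ → ℂ) (w : Fin d → ℂ → ℝ)
    (G : (Fin d → ℂ) → ℂ) (C : ℝ), (∀ i, Measurable (y i)) → (∀ i, Measurable (y' i)) →
    (∀ i, Measurable (k i)) → (∀ i, Measurable (k' i)) → Measurable G → 
    (∀ x, ‖G x‖ ≤ C * ∏ i, w i (x i)) →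
    (∀ i, Integrable (fun u => w i (y i u) * ‖k i u‖) (μ i)) →
    (∀ i, Integrable (fun u => w i (y' i u) * ‖k' i u‖) (ν i)) →
    (∀ i x, ∫ u, G (Function.update x i (y i u)) * k i u ∂μ i =
      ∫ u, G (Function.update x i (y' i u)) * k' i u ∂ν i) →
    ∫ u, G (fun i => y i (u i)) * ∏ i, k i (u i) ∂Measure.pi μ =
      ∫ u, G (fun i => y' i (u i)) * ∏ i, k' i (u i) ∂Measure.pi ν := by
  intro d
  induction d with
  | zero =>
    intro μ ν _ _ y y' k k' w G C _ _ _ _ _ _ _ _ _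
    simp only [Measure.pi_of_empty _ (x := (finZeroElim : (i : Fin 0) → ℝ)), integral_dirac, Finset.univ_eq_empty,
      Finset.prod_empty]
    congr 2
    exact Subsingleton.elim _ _
  | succ d ih =>
    intro μ ν _ _ y y' k k' w G C hy hy' hk hk' hG hGb hi hi' hs
    have hcons : ∀ z : ℂ, Measurable fun x : Fin d → ℂ => G (Fin.cons z x) := by
      intro z
      refine hG.comp (measurable_pi_iff.2 fun i => ?_)
      refine Fin.cases ?_ (fun j => ?_) i
      · simp
      · simpa using measurable_pi_apply j
    have main : ∀ (μ : Fin (d + 1) → Measure ℝ) [∀ i, SigmaFinite (μ i)] (y k : Fin (d + 1) → ℝ → ℂ),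
        (∀ i, Measurable (y i)) → (∀ i, Measurable (k i)) → (∀ i, Integrable (fun u => w i (y i u) * ‖k i u‖) (μ i)) →
        ∫ u, G (fun i => y i (u i)) * ∏ i, k i (u i) ∂Measure.pi μ =
        ∫ u, k 0 u.1 * (G (Fin.cons (y 0 u.1) fun i => y i.succ (u.2 i)) * ∏ i : Fin d, k i.succ (u.2 i))
          ∂((μ 0).prod (Measure.pi fun i : Fin d => μ i.succ)) := by
      intro μ _ y k hy hk hi
      rw [← ((measurePreserving_piFinSuccAbove μ 0).symm).integral_comp']
      refine integral_congr_ae (Eventually.of_forall fun u => ?_)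
      simp only [MeasurableEquiv.piFinSuccAbove_symm_apply, Fin.insertNthEquiv,
        Fin.prod_univ_succ, Fin.insertNth_zero, Equiv.coe_fn_mk, Fin.cons_succ,
        Fin.cons_zero]
      have : (fun i => y i ((Fin.cons u.1 u.2 : (i : Fin (d+1)) → ℝ) i)) =
        Fin.cons (y 0 u.1) fun i => y i.succ (u.2 i) := ?_
      · change G (fun i => y i ((Fin.cons u.1 u.2 : (i : Fin (d+1)) → ℝ) i)) *
          (k 0 u.1 * ∏ x : Fin d, k x.succ (u.2 x)) = _
        rw [this]
        ring
      · funext i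
        refine Fin.cases ?_ (fun j => ?_) i <;> simp
    have meas : ∀ (a : ℝ → ℂ) (b c : Fin d → ℝ → ℂ) (e : ℝ → ℂ), Measurable a → (∀ i, Measurable (b i)) →
        (∀ i, Measurable (c i)) → Measurable e → Measurable fun u : ℝ × (Fin d → ℝ) =>
          e u.1 * (G (Fin.cons (a u.1) fun i => b i (u.2 i)) * ∏ i : Fin d, c i (u.2 i)) := by
      intro a b c e ha hb hc he
      refine (he.comp measurable_fst).mul (Measurable.mul ?_ ?_)
      · refine hG.comp (measurable_pi_iff.2 fun i => ?_)
        refine Fin.cases ?_ (fun j => ?_) i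
        · simpa [Function.comp_def] using ha.comp measurable_fst
        · simpa [Function.comp_def] using (hb j).comp ((measurable_pi_apply j).comp measurable_snd)
      · exact Finset.measurable_prod _ fun j _ => (hc j).comp ((measurable_pi_apply j).comp measurable_snd)
    have bound : ∀ (a e : ℂ) (b c : Fin d → ℂ), ‖e * (G (Fin.cons a b) * ∏ i, c i)‖ ≤
        C * ((w 0 a * ‖e‖) * ∏ i, (w i.succ (b i) * ‖c i‖)) := by
      intro a e b c
      rw [norm_mul, norm_mul, norm_prod, Finset.prod_mul_distrib]
      have := hGb (Fin.cons a b)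
      rw [Fin.prod_univ_succ] at this
      simp only [Fin.cons_zero, Fin.cons_succ] at this
      calc ‖e‖ * (‖G (Fin.cons a b)‖ * ∏ i, ‖c i‖)
          ≤ ‖e‖ * ((C * (w 0 a * ∏ i, w i.succ (b i))) * ∏ i, ‖c i‖) := by gcongr
        _ = _ := by ring
    have integ : ∀ (μ : Measure ℝ) (ν : Fin d → Measure ℝ) [SigmaFinite μ] [∀ i, SigmaFinite (ν i)]
        (a e : ℝ → ℂ) (b c : Fin d → ℝ → ℂ), Measurable a → (∀ i, Measurable (b i)) →
        (∀ i, Measurable (c i)) → Measurable e → Integrable (fun u => w 0 (a u) * ‖e u‖) μ →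
        (∀ i, Integrable (fun u => w i.succ (b i u) * ‖c i u‖) (ν i)) →
        Integrable (fun u : ℝ × (Fin d → ℝ) =>
          e u.1 * (G (Fin.cons (a u.1) fun i => b i (u.2 i)) * ∏ i : Fin d, c i (u.2 i)))
          (μ.prod (Measure.pi ν)) := by
      intro μ ν _ _ a e b c ha hb hc he h1 h2
      refine Integrable.mono' ((h1.mul_prod (Integrable.fintype_prod h2)).const_mul C)
        (meas a b c e ha hb hc he).aestronglyMeasurable (Eventually.of_forall fun u => ?_)
      exact bound _ _ _ _
    rw [main μ y k hy hk hi, main ν y' k' hy' hk' hi',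
      integral_prod _ (integ _ _ _ _ _ _ (hy 0) (fun i => hy i.succ) (fun i => hk i.succ) (hk 0) (hi 0) fun i => hi i.succ),
      integral_prod_symm _ (integ _ _ _ _ _ _ (hy' 0) (fun i => hy' i.succ) (fun i => hk' i.succ) (hk' 0) (hi' 0) fun i => hi' i.succ)]
    -- With the first coordinate frozen, the other d curves are exchanged by induction. Fubini then
    -- moves the first curve inside, where its own slice identity applies.
    have inner : ∀ z : ℂ, ∫ v, G (Fin.cons z fun i => y i.succ (v i)) * ∏ i : Fin d, k i.succ (v i)
          ∂(Measure.pi fun i : Fin d => μ i.succ) =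
        ∫ v, G (Fin.cons z fun i => y' i.succ (v i)) * ∏ i : Fin d, k' i.succ (v i)
          ∂(Measure.pi fun i : Fin d => ν i.succ) := by
      intro z
      refine ih (fun i => μ i.succ) (fun i => ν i.succ) (fun i => y i.succ) (fun i => y' i.succ)
        (fun i => k i.succ) (fun i => k' i.succ) (fun i => w i.succ) (fun x => G (Fin.cons z x))
        (C * w 0 z) (fun i => hy i.succ) (fun i => hy' i.succ) (fun i => hk i.succ) (fun i => hk' i.succ)
        (hcons z) (fun x => ?_) (fun i => hi i.succ) (fun i => hi' i.succ) (fun i x => ?_)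
      · have := hGb (Fin.cons z x)
        rw [Fin.prod_univ_succ] at this
        simpa [mul_assoc] using this
      · have := hs i.succ (Fin.cons z x)
        simpa only [← Fin.cons_update] using this
    calc _ = ∫ u, k 0 u * ∫ v, (G (Fin.cons (y 0 u) fun i => y' i.succ (v i)) * ∏ i : Fin d, k' i.succ (v i))
              ∂(Measure.pi fun i : Fin d => ν i.succ) ∂μ 0 := by
            refine integral_congr_ae (Eventually.of_forall fun u => ?_)
            simp only
            rw [integral_const_mul, inner]
      _ = ∫ u, ∫ v, k 0 u * (G (Fin.cons (y 0 u) fun i => y' i.succ (v i)) * ∏ i : Fin d, k' i.succ (v i))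
              ∂(Measure.pi fun i : Fin d => ν i.succ) ∂μ 0 := by
            simp_rw [integral_const_mul]
      _ = ∫ v, ∫ u, k 0 u * (G (Fin.cons (y 0 u) fun i => y' i.succ (v i)) * ∏ i : Fin d, k' i.succ (v i))
              ∂μ 0 ∂(Measure.pi fun i : Fin d => ν i.succ) := by
            refine integral_integral_swap (f := fun (u : ℝ) (v : Fin d → ℝ) => k 0 u * (G (Fin.cons (y 0 u) fun i => y' i.succ (v i)) * ∏ i : Fin d, k' i.succ (v i))) ?_
            exact integ _ _ _ _ _ _ (hy 0) (fun i => hy' i.succ) (fun i => hk' i.succ) (hk 0) (hi 0) fun i => hi' i.succ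
      _ = _ := by
            refine integral_congr_ae (Eventually.of_forall fun v => ?_)
            have := hs 0 (Fin.cons 0 fun i => y' i.succ (v i))
            simp only [Fin.update_cons_zero] at this
            have e1 : ∀ (μ : Measure ℝ) (y k : ℝ → ℂ), ∫ u, k u * (G (Fin.cons (y u) fun i => y' i.succ (v i)) * ∏ i : Fin d, k' i.succ (v i)) ∂μ
               = (∫ u, (G (Fin.cons (y u) fun i => y' i.succ (v i))) * k u ∂μ) * ∏ i : Fin d, k' i.succ (v i) := by
              intro μ y k
              rw [← integral_mul_const]
              congr 1; funext u; ring
            simp only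
            rw [e1, e1, this]

open Complex in
/-- Cauchy's theorem on a half strip. -/
theorem integral_halfStrip_eq {κ : ℂ → ℂ} {A θ₁ θ₂ : ℝ} (hθ : θ₁ ≤ θ₂)
    (hd : DifferentiableOn ℂ κ {w | A ≤ w.re ∧ θ₁ ≤ w.im ∧ w.im ≤ θ₂}) {b : ℝ → ℝ}
    (hb : Tendsto b atTop (𝓝 0)) (hκ : ∀ᶠ u : ℝ in atTop, ∀ θ ∈ Icc θ₁ θ₂, ‖κ (u + θ * I)‖ ≤ b u)
    (h₁ : IntegrableOn (fun u : ℝ => κ (u + θ₁ * I)) (Ioi A))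
    (h₂ : IntegrableOn (fun u : ℝ => κ (u + θ₂ * I)) (Ioi A)) :
    (∫ u in Ioi A, κ (u + θ₁ * I)) - (∫ u in Ioi A, κ (u + θ₂ * I)) =
      I * ∫ θ in θ₁..θ₂, κ (A + θ * I) := by
  have e : ∀ M ≥ A, (∫ u in A..M, κ (u + θ₁ * I)) - (∫ u in A..M, κ (u + θ₂ * I)) +
      I * (∫ θ in θ₁..θ₂, κ (M + θ * I)) = I * ∫ θ in θ₁..θ₂, κ (A + θ * I) := by
    intro M hM
    have := integral_boundary_rect_eq_zero_of_differentiableOn κ (A + θ₁ * I) (M + θ₂ * I) ?_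
    · simp only [add_re, ofReal_re, mul_re, I_re, mul_zero, ofReal_im, I_im, mul_one, sub_self,
        add_zero, add_im, mul_im, zero_add, smul_eq_mul] at this
      linear_combination this
    · refine hd.mono ?_
      intro w hw
      simp only [add_re, ofReal_re, mul_re, I_re, mul_zero, ofReal_im, I_im, mul_one, sub_self,
        add_zero, add_im, mul_im, zero_add, uIcc_of_le hM, uIcc_of_le hθ] at hw
      exact ⟨hw.1.1, hw.2⟩
  have hz : Tendsto (fun M : ℝ => I * ∫ θ in θ₁..θ₂, κ (M + θ * I)) atTop (𝓝 0) := by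
    rw [tendsto_zero_iff_norm_tendsto_zero]
    have hb' := hb.mul_const |θ₂ - θ₁|
    rw [zero_mul] at hb'
    refine squeeze_zero' (Eventually.of_forall fun _ => norm_nonneg _) ?_ hb'
    filter_upwards [hκ] with M hM
    rw [norm_mul, norm_I, one_mul]
    refine intervalIntegral.norm_integral_le_of_norm_le_const fun θ h => ?_
    rw [uIoc_of_le hθ] at h
    exact hM θ ⟨h.1.le, h.2⟩
  have t1 := intervalIntegral_tendsto_integral_Ioi A h₁ tendsto_id
  have t2 := intervalIntegral_tendsto_integral_Ioi A h₂ tendsto_id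
  have := (t1.sub t2).add hz
  rw [add_zero] at this
  refine tendsto_nhds_unique this (Tendsto.congr' ?_ tendsto_const_nhds)
  filter_upwards [eventually_ge_atTop A] with M hM
  exact (e M hM).symm

open Complex in
/-- Cauchy's theorem on a strip. -/
theorem integral_strip_eq {κ : ℂ → ℂ} {θ₁ θ₂ : ℝ} (hθ : θ₁ ≤ θ₂)
    (hc : ContinuousOn κ {w | θ₁ ≤ w.im ∧ w.im ≤ θ₂})
    (hd : DifferentiableOn ℂ κ {w | θ₁ < w.im ∧ w.im < θ₂}) {b : ℝ → ℝ}
    (hb : Tendsto b atTop (𝓝 0)) (hb' : Tendsto b atBot (𝓝 0))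
    (hκ : ∀ u : ℝ, ∀ θ ∈ Icc θ₁ θ₂, ‖κ (u + θ * I)‖ ≤ b u)
    (h₁ : Integrable (fun u : ℝ => κ (u + θ₁ * I)))
    (h₂ : Integrable (fun u : ℝ => κ (u + θ₂ * I))) :
    (∫ u : ℝ, κ (u + θ₁ * I)) = ∫ u : ℝ, κ (u + θ₂ * I) := by
  have e : ∀ M ≥ (0 : ℝ), (∫ u in (-M)..M, κ (u + θ₁ * I)) - (∫ u in (-M)..M, κ (u + θ₂ * I)) +
      (I * (∫ θ in θ₁..θ₂, κ (M + θ * I)) - I * ∫ θ in θ₁..θ₂, κ ((-M : ℝ) + θ * I)) = 0 := by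
    intro M hM
    have := integral_boundary_rect_eq_zero_of_continuousOn_of_differentiableOn κ ((-M : ℝ) + θ₁ * I) (M + θ₂ * I) ?_ ?_
    · simp only [add_re, ofReal_re, mul_re, I_re, mul_zero, ofReal_im, I_im, mul_one, sub_self,
        add_zero, add_im, mul_im, zero_add, smul_eq_mul] at this
      linear_combination this
    · refine hc.mono ?_
      intro w hw
      simp only [add_re, ofReal_re, mul_re, I_re, mul_zero, ofReal_im, I_im, mul_one, sub_self,
        add_zero, add_im, mul_im, zero_add, uIcc_of_le hθ] at hw
      exact hw.2
    · refine hd.mono ?_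
      intro w hw
      simp only [add_re, ofReal_re, mul_re, I_re, mul_zero, ofReal_im, I_im, mul_one, sub_self,
        add_zero, add_im, mul_im, zero_add, min_eq_left hθ, max_eq_right hθ] at hw
      exact hw.2
  have hz : ∀ (c : ℝ → ℝ), Tendsto (fun M => b (c M)) atTop (𝓝 0) →
      Tendsto (fun M : ℝ => I * ∫ θ in θ₁..θ₂, κ (c M + θ * I)) atTop (𝓝 0) := by
    intro c hbc
    rw [tendsto_zero_iff_norm_tendsto_zero]
    have hb' := hbc.mul_const |θ₂ - θ₁|
    rw [zero_mul] at hb'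
    refine squeeze_zero' (Eventually.of_forall fun _ => norm_nonneg _) ?_ hb'
    filter_upwards with M
    rw [norm_mul, norm_I, one_mul]
    refine intervalIntegral.norm_integral_le_of_norm_le_const fun θ h => ?_
    rw [uIoc_of_le hθ] at h
    exact hκ _ θ ⟨h.1.le, h.2⟩
  have t1 := intervalIntegral_tendsto_integral h₁ tendsto_neg_atTop_atBot tendsto_id
  have t2 := intervalIntegral_tendsto_integral h₂ tendsto_neg_atTop_atBot tendsto_id
  have := (t1.sub t2).add ((hz (fun M => M) hb).sub (hz (fun M => -M) (hb'.comp tendsto_neg_atTop_atBot)))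
  rw [sub_zero, add_zero] at this
  refine sub_eq_zero.1 (tendsto_nhds_unique this (Tendsto.congr' ?_ tendsto_const_nhds))
  filter_upwards [eventually_ge_atTop 0] with M hM
  exact (e M hM).symm

/-- Analyticity of an integral of exponentials of linear forms. -/
theorem analyticAt_integral_cexp {α : Type*} [MeasurableSpace α] {μ : Measure α}
    {E : Type*} [NormedAddCommGroup E] [NormedSpace ℂ E] {l : α → (E →L[ℂ] ℂ)} {g : α → ℂ}
    (hl : AEStronglyMeasurable l μ) (hg : AEStronglyMeasurable g μ) {x₀ : E} {r : ℝ} (hr : 0 < r)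
    (hi : Integrable (fun s => ‖g s‖ * Real.exp ((l s x₀).re + r * ‖l s‖)) μ) :
    AnalyticAt ℂ (fun x => ∫ s, g s * Complex.exp (l s x) ∂μ) x₀ := by
  lift r to NNReal using hr.le
  have hr' : 0 < r := by exact_mod_cast hr
  set G : α → ℂ := fun s => g s * Complex.exp (l s x₀) with hG
  have hlx : AEStronglyMeasurable (fun s => l s x₀) μ :=
    (ContinuousLinearMap.apply ℂ ℂ x₀).continuous.comp_aestronglyMeasurable hl
  have hGm : AEStronglyMeasurable G μ :=
    hg.mul (Complex.continuous_exp.comp_aestronglyMeasurable hlx)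
  have hGn : ∀ s, ‖G s‖ = ‖g s‖ * Real.exp ((l s x₀).re) := fun s => by
    rw [hG, norm_mul, Complex.norm_exp]
  have hi' : Integrable (fun s => ‖G s‖ * Real.exp (r * ‖l s‖)) μ := by
    simpa only [hGn, Real.exp_add, mul_assoc] using hi
  -- Φ n l is the multilinear map (v₁, …, vₙ) ↦ ∏ l(vᵢ). The power series at x₀ has n-th term ∫ G(s)
  -- Φ n (l s) / n! dμ, the exponential of l s being expanded around x₀.
  let Φ : ∀ n : ℕ, (E →L[ℂ] ℂ) → ContinuousMultilinearMap ℂ (fun _ : Fin n => E) ℂ := fun n l =>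
    (ContinuousMultilinearMap.mkPiAlgebraFin ℂ n ℂ).compContinuousLinearMap fun _ => l
  have hΦc : ∀ n, Continuous (Φ n) := fun n => by
    have h1 := (ContinuousMultilinearMap.compContinuousLinearMapContinuousMultilinear ℂ
      (fun _ : Fin n => E) (fun _ : Fin n => ℂ) ℂ).cont
    have h2 : Continuous fun l : E →L[ℂ] ℂ => fun _ : Fin n => l := by fun_prop
    exact (ContinuousLinearMap.apply ℂ _ (ContinuousMultilinearMap.mkPiAlgebraFin ℂ n ℂ)).continuous.comp
      (h1.comp h2)
  have hΦn : ∀ n l, ‖Φ n l‖ ≤ ‖l‖ ^ n := fun n l => by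
    refine (ContinuousMultilinearMap.norm_compContinuousLinearMap_le _ _).trans ?_
    simp
  have hΦa : ∀ n l y, Φ n l (fun _ => y) = (l y) ^ n := fun n l y => by
    simp [Φ]
  let M : ∀ n : ℕ, α → ContinuousMultilinearMap ℂ (fun _ : Fin n => E) ℂ := fun n s =>
    (G s * (n.factorial : ℂ)⁻¹) • Φ n (l s)
  -- One term of an exponential series is at most its sum, so a single integrable majorant serves
  -- all n.
  have hterm : ∀ n s, ‖G s‖ / n.factorial * (‖l s‖ * r) ^ n ≤ ‖G s‖ * Real.exp (r * ‖l s‖) := by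
    intro n s
    have := Real.pow_div_factorial_le_exp (‖l s‖ * r) (by positivity) n
    calc _ = ‖G s‖ * ((‖l s‖ * r) ^ n / n.factorial) := by ring
      _ ≤ _ := by rw [mul_comm (r : ℝ)]; gcongr
  have hMn : ∀ n s, ‖M n s‖ ≤ ‖G s‖ / n.factorial * ‖l s‖ ^ n := fun n s => by
    rw [show M n s = (G s * (n.factorial : ℂ)⁻¹) • Φ n (l s) from rfl, norm_smul, norm_mul, norm_inv, Complex.norm_natCast, ← div_eq_mul_inv]
    gcongr
    exact hΦn _ _
  have hMb : ∀ n s, ‖M n s‖ ≤ (‖G s‖ * Real.exp (r * ‖l s‖)) * ((r : ℝ) ^ n)⁻¹ := fun n s => by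
    refine (hMn n s).trans ?_
    rw [← div_eq_mul_inv, le_div_iff₀ (by positivity), mul_assoc, ← mul_pow]
    exact hterm n s
  have hMi : ∀ n, Integrable (M n) μ := fun n => by
    refine Integrable.mono' (hi'.mul_const _)
      ((hGm.mul aestronglyMeasurable_const).smul ((hΦc n).comp_aestronglyMeasurable hl)) (Eventually.of_forall (hMb n))
  let p : FormalMultilinearSeries ℂ E ℂ := fun n => ∫ s, M n s ∂μ
  have hp : HasFPowerSeriesOnBall (fun x => ∫ s, g s * Complex.exp (l s x) ∂μ) p x₀ r := by
    refine ⟨?_, by exact_mod_cast hr', ?_⟩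
    · refine FormalMultilinearSeries.le_radius_of_bound p
        (∫ s, ‖G s‖ * Real.exp (r * ‖l s‖) ∂μ) fun n => ?_
      have : ‖p n‖ ≤ ∫ s, (‖G s‖ * Real.exp (r * ‖l s‖)) * ((r : ℝ) ^ n)⁻¹ ∂μ :=
        norm_integral_le_of_norm_le (hi'.mul_const _) (Eventually.of_forall (hMb n))
      rw [integral_mul_const, ← div_eq_mul_inv, le_div_iff₀ (by positivity)] at this
      exact this
    · intro y hy
      have hy' : ‖y‖ ≤ r := by
        have : ‖y‖ < r := by simpa [Metric.mem_eball, edist_zero_right, enorm_lt_coe] using hy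
        exact this.le
      have hpy : ∀ n, (p n fun _ => y) = ∫ s, G s * ((l s y) ^ n * (n.factorial : ℂ)⁻¹) ∂μ := fun n => by
        rw [ContinuousMultilinearMap.integral_apply (hMi n)]
        congr 1; funext s
        simp only [M, smul_apply, hΦa, smul_eq_mul]
        ring
      have hfac : ∀ s, HasSum (fun n : ℕ => (‖l s‖ * r) ^ n / n.factorial) (Real.exp (‖l s‖ * r)) := by
        intro s
        rw [Real.exp_eq_exp_ℝ]
        exact NormedSpace.expSeries_div_hasSum_exp _
      simp_rw [hpy]
      refine hasSum_integral_of_dominated_convergence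
        (bound := fun (n : ℕ) s => ‖G s‖ * ((‖l s‖ * r) ^ n / n.factorial)) ?_ ?_ ?_ ?_ ?_
      · intro n
        refine hGm.mul (((AEStronglyMeasurable.pow ?_ n).mul aestronglyMeasurable_const))
        exact (ContinuousLinearMap.apply ℂ ℂ y).continuous.comp_aestronglyMeasurable hl
      · intro n
        refine Eventually.of_forall fun s => ?_
        rw [norm_mul, norm_mul (_ ^ n), norm_pow, norm_inv, Complex.norm_natCast, ← div_eq_mul_inv]
        gcongr
        exact ((l s).le_opNorm y).trans (by gcongr)
      · exact Eventually.of_forall fun s => (hfac s).summable.mul_left _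
      · refine hi'.congr (Eventually.of_forall fun s => ?_)
        simp only
        rw [tsum_mul_left, (hfac s).tsum_eq, mul_comm (r : ℝ)]
      · refine Eventually.of_forall fun s => ?_
        have : g s * Complex.exp (l s (x₀ + y)) = G s * Complex.exp (l s y) := by
          rw [map_add, Complex.exp_add, hG]; ring
        rw [this]
        refine HasSum.mul_left _ ?_
        rw [Complex.exp_eq_exp_ℂ]
        simp_rw [← div_eq_mul_inv]
        exact NormedSpace.expSeries_div_hasSum_exp _
  exact hp.analyticAt

/-! ### Sectors and polysectors -/

/-- The sector `|arg z| < π/2 + φ`, `|z| > ρ` of the complex plane. -/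
def sector (φ ρ : ℝ) : Set ℂ := {z | |Complex.arg z| < Real.pi / 2 + φ ∧ ρ < ‖z‖}

/-- The bound φ ≤ π/2 keeps the sector off the negative real axis, where the argument is
discontinuous. -/
theorem isOpen_sector {φ ρ : ℝ} (hφ : φ ≤ Real.pi / 2) (hρ : 0 ≤ ρ) : IsOpen (sector φ ρ) := by
  rw [isOpen_iff_mem_nhds]
  rintro z ⟨h1, h2⟩
  have hz : z ∈ Complex.slitPlane := by
    rw [Complex.mem_slitPlane_iff_arg]
    refine ⟨fun h => ?_, norm_pos_iff.1 (hρ.trans_lt h2)⟩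
    rw [h, abs_of_pos Real.pi_pos] at h1
    linarith
  have c1 := (Complex.continuousAt_arg hz).abs.eventually (gt_mem_nhds h1)
  have c2 := (continuous_norm.tendsto z).eventually (lt_mem_nhds h2)
  filter_upwards [c1, c2] with y hy1 hy2 using ⟨hy1, hy2⟩

/-- Logarithmic coordinates make the sector the image of a convex half strip. Its connectedness,
needed for the identity theorem, follows. -/
theorem sector_eq_image {φ ρ : ℝ} (hφ : φ ≤ Real.pi / 2) (hρ : 0 < ρ) :
    sector φ ρ = Complex.exp '' (Ioi (Real.log ρ) ×ℂ Ioo (-(Real.pi / 2 + φ)) (Real.pi / 2 + φ)) := by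
  ext z
  constructor
  · rintro ⟨h1, h2⟩
    have hz : z ≠ 0 := norm_pos_iff.1 (hρ.trans h2)
    refine ⟨Complex.log z, ?_, Complex.exp_log hz⟩
    rw [Complex.mem_reProdIm, Complex.log_re, Complex.log_im]
    exact ⟨Real.log_lt_log hρ h2, abs_lt.1 h1⟩
  · rintro ⟨w, ⟨h1, h2⟩, rfl⟩
    simp only [mem_preimage, mem_Ioi, mem_Ioo] at h1 h2
    have : Complex.arg (Complex.exp w) = w.im := by
      rw [← Complex.log_im, Complex.log_exp (by linarith) (by linarith)]
    refine ⟨?_, ?_⟩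
    · rw [this]; exact abs_lt.2 h2
    · rw [Complex.norm_exp]; exact (Real.log_lt_iff_lt_exp hρ).1 h1

theorem isPreconnected_sector {φ ρ : ℝ} (hφ : φ ≤ Real.pi / 2) (hρ : 0 < ρ) :
    IsPreconnected (sector φ ρ) := by
  rw [sector_eq_image hφ hρ]
  refine IsPreconnected.image ?_ _ Complex.continuous_exp.continuousOn
  have h1 : Convex ℝ (Complex.re ⁻¹' Ioi (Real.log ρ)) := (convex_Ioi _).linear_preimage Complex.reLm
  have h2 : Convex ℝ (Complex.im ⁻¹' Ioo (-(Real.pi / 2 + φ)) (Real.pi / 2 + φ)) :=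
    (convex_Ioo _ _).linear_preimage Complex.imLm
  exact (h1.inter h2).isPreconnected

theorem polysector_eq_pi (d : ℕ) (φ ρ : ℝ) : polysector d φ ρ = Set.pi univ fun _ => sector φ ρ := by
  ext x; simp [polysector, sector]

theorem isOpen_polysector {d : ℕ} {φ ρ : ℝ} (hφ : φ ≤ Real.pi / 2) (hρ : 0 ≤ ρ) :
    IsOpen (polysector d φ ρ) := by
  rw [polysector_eq_pi]
  exact isOpen_set_pi finite_univ fun _ _ => isOpen_sector hφ hρ

theorem isPreconnected_polysector {d : ℕ} {φ ρ : ℝ} (hφ : φ ≤ Real.pi / 2) (hρ : 0 < ρ) :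
    IsPreconnected (polysector d φ ρ) := by
  rw [polysector_eq_pi]
  exact isPreconnected_univ_pi fun _ => isPreconnected_sector hφ hρ

theorem polysector_mono {d : ℕ} {φ φ' ρ ρ' : ℝ} (hφ : φ ≤ φ') (hρ : ρ' ≤ ρ) :
    polysector d φ ρ ⊆ polysector d φ' ρ' := fun _ hx i =>
  ⟨(hx i).1.trans_le (by linarith), hρ.trans_lt (hx i).2⟩

theorem mem_sector_of_lt_re {φ ρ : ℝ} (hφ : 0 ≤ φ) (hρ : 0 ≤ ρ) {z : ℂ} (hz : ρ < z.re) :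
    z ∈ sector φ ρ := by
  refine ⟨?_, hz.trans_le (Complex.re_le_norm z)⟩
  have := Complex.abs_arg_lt_pi_div_two_iff.2 (Or.inl (hρ.trans_lt hz))
  linarith

/-! ### The Hankel contour in logarithmic coordinates -/

/-- The distance along the rays of the Hankel contour, in logarithmic coordinates. -/
noncomputable def hankelRe (ψ u : ℝ) : ℝ := max (|u| - ψ) 0

/-- The Hankel contour in logarithmic coordinates: the boundary of the half strip `Re w ≥ 0`,
`|Im w| ≤ ψ`. -/
noncomputable def hankelLog (ψ u : ℝ) : ℂ := hankelRe ψ u + (max (-ψ) (min u ψ) : ℝ) * Complex.I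

/-- The velocity of `hankelLog`. -/
noncomputable def hankelVel (ψ u : ℝ) : ℂ := if u ≤ -ψ then -1 else if u ≤ ψ then Complex.I else 1

theorem hankelRe_nonneg (ψ u : ℝ) : 0 ≤ hankelRe ψ u := le_max_right _ _

theorem continuous_hankelRe (ψ : ℝ) : Continuous (hankelRe ψ) := by unfold hankelRe; fun_prop

theorem continuous_hankelLog (ψ : ℝ) : Continuous (hankelLog ψ) := by
  unfold hankelLog
  have := continuous_hankelRe ψ
  fun_prop

theorem measurable_hankelVel (ψ : ℝ) : Measurable (hankelVel ψ) := by
  unfold hankelVel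
  exact Measurable.ite measurableSet_Iic measurable_const
    (Measurable.ite measurableSet_Iic measurable_const measurable_const)

theorem norm_hankelVel (ψ u : ℝ) : ‖hankelVel ψ u‖ = 1 := by
  unfold hankelVel; split_ifs <;> simp

@[simp] theorem hankelLog_re (ψ u : ℝ) : (hankelLog ψ u).re = hankelRe ψ u := by simp [hankelLog]

@[simp] theorem hankelLog_im (ψ u : ℝ) : (hankelLog ψ u).im = max (-ψ) (min u ψ) := by
  simp [hankelLog]

theorem integrable_exp_neg_hankelRe (ψ : ℝ) {δ : ℝ} (hδ : 0 < δ) :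
    Integrable fun u => Real.exp (-δ * hankelRe ψ u) := by
  have h1 : IntegrableOn (fun u : ℝ => Real.exp (-δ * |u|)) (Ioi 0) := by
    refine (exp_neg_integrableOn_Ioi 0 hδ).congr_fun (fun u hu => ?_) measurableSet_Ioi
    simp only; rw [abs_of_pos hu]
  have h2 : Integrable fun u : ℝ => Real.exp (-δ * |u|) := by
    rw [← integrableOn_univ, ← Iic_union_Ioi (a := (0 : ℝ)), integrableOn_union]
    refine ⟨?_, h1⟩
    rw [integrableOn_Iic_iff_integrableOn_Iio]
    have := (Measure.measurePreserving_neg (volume : Measure ℝ)).integrableOn_comp_preimage (f := fun u : ℝ => Real.exp (-δ * |u|))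
      (MeasurableEquiv.neg ℝ).measurableEmbedding (s := Ioi 0)
    rw [← this] at h1
    simpa [Function.comp_def] using h1
  refine (h2.const_mul (Real.exp (δ * ψ))).mono' ?_ (Eventually.of_forall fun u => ?_)
  · have := continuous_hankelRe ψ
    exact Continuous.aestronglyMeasurable (by fun_prop)
  · rw [Real.norm_of_nonneg (Real.exp_pos _).le, ← Real.exp_add]
    refine Real.exp_le_exp.2 ?_
    have : |u| - ψ ≤ hankelRe ψ u := le_max_left _ _
    nlinarith

theorem hankelLog_of_ge {ψ u : ℝ} (hψ : 0 ≤ ψ) (hu : ψ ≤ u) :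
    hankelLog ψ u = (u - ψ : ℝ) + ψ * Complex.I := by
  rw [hankelLog, hankelRe, abs_of_nonneg (hψ.trans hu), max_eq_left (by linarith), min_eq_right hu,
    max_eq_right (by linarith)]

theorem hankelLog_of_le {ψ u : ℝ} (hψ : 0 ≤ ψ) (hu : u ≤ -ψ) :
    hankelLog ψ u = (-u - ψ : ℝ) + (-ψ : ℝ) * Complex.I := by
  rw [hankelLog, hankelRe, abs_of_nonpos (by linarith), max_eq_left (by linarith), min_eq_left (by linarith),
    max_eq_left (by linarith)]

theorem hankelLog_of_mem {ψ u : ℝ} (hu : u ∈ Icc (-ψ) ψ) :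
    hankelLog ψ u = u * Complex.I := by
  rw [hankelLog, hankelRe, max_eq_right (by have := abs_le.2 hu; linarith), min_eq_left hu.2,
    max_eq_right hu.1]
  simp

/-- A Hankel contour integral in terms of its three smooth parts. -/
theorem integral_hankel {κ : ℂ → ℂ} {ψ : ℝ} (hψ : 0 < ψ)
    (hi : Integrable fun u => κ (hankelLog ψ u) * hankelVel ψ u) :
    ∫ u, κ (hankelLog ψ u) * hankelVel ψ u =
      (∫ v in Ioi (0 : ℝ), κ (v + ψ * Complex.I)) - (∫ v in Ioi (0 : ℝ), κ (v + (-ψ : ℝ) * Complex.I))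
      + Complex.I * ∫ θ in (-ψ)..ψ, κ (θ * Complex.I) := by
  have e1 : ∫ u in Ioi ψ, κ (hankelLog ψ u) * hankelVel ψ u = ∫ v in Ioi (0 : ℝ), κ (v + ψ * Complex.I) := by
    have := (measurePreserving_add_right volume ψ).setIntegral_preimage_emb
      (measurableEmbedding_addRight ψ) (fun u => κ (hankelLog ψ u) * hankelVel ψ u) (Ioi ψ)
    rw [← this]
    rw [show (fun x => x + ψ) ⁻¹' Ioi ψ = Ioi 0 by ext; simp]
    refine setIntegral_congr_fun measurableSet_Ioi fun v hv => ?_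
    simp only [mem_Ioi] at hv
    rw [hankelLog_of_ge hψ.le (by linarith), hankelVel, if_neg (by linarith), if_neg (by linarith)]
    simp
  have e2 : ∫ u in Iic (-ψ), κ (hankelLog ψ u) * hankelVel ψ u =
      - ∫ v in Ioi (0 : ℝ), κ (v + (-ψ : ℝ) * Complex.I) := by
    have := (Measure.measurePreserving_sub_left (volume : Measure ℝ) (-ψ)).setIntegral_preimage_emb
      (MeasurableEquiv.subLeft (-ψ)).measurableEmbedding (fun u => κ (hankelLog ψ u) * hankelVel ψ u) (Iic (-ψ))
    rw [← this, ← integral_neg, ← integral_Ici_eq_integral_Ioi]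
    rw [show (fun x => -ψ - x) ⁻¹' Iic (-ψ) = Ici 0 by ext; simp]
    refine setIntegral_congr_fun measurableSet_Ici fun v hv => ?_
    simp only [mem_Ici] at hv
    rw [hankelLog_of_le hψ.le (by linarith), hankelVel, if_pos (by linarith)]
    rw [show (-(-ψ - v) - ψ) = v by ring]
    ring
  have e3 : ∫ u in Ioc (-ψ) ψ, κ (hankelLog ψ u) * hankelVel ψ u =
      Complex.I * ∫ θ in (-ψ)..ψ, κ (θ * Complex.I) := by
    rw [intervalIntegral.integral_of_le (by linarith), ← integral_const_mul]
    refine setIntegral_congr_fun measurableSet_Ioc fun v hv => ?_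
    simp only [mem_Ioc] at hv
    rw [hankelLog_of_mem ⟨hv.1.le, hv.2⟩, hankelVel, if_neg (by linarith), if_pos hv.2, mul_comm]
  rw [← setIntegral_univ, ← Iic_union_Ioi (a := -ψ), setIntegral_union (Iic_disjoint_Ioi le_rfl) measurableSet_Ioi
    hi.integrableOn hi.integrableOn, ← Ioc_union_Ioi_eq_Ioi (b := ψ) (by linarith : -ψ ≤ ψ),
    setIntegral_union (Ioc_disjoint_Ioi le_rfl) measurableSet_Ioi
    hi.integrableOn hi.integrableOn, e1, e2, e3]
  ring

/-- A continuous function with exponential decay along a half strip is integrable along its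
horizontal lines. -/
theorem integrableOn_line {κ : ℂ → ℂ} {θ δ C : ℝ} (hδ : 0 < δ)
    (hc : ContinuousOn (fun u : ℝ => κ (u + θ * Complex.I)) (Ici 0))
    (hb : ∀ᶠ u : ℝ in atTop, ‖κ (u + θ * Complex.I)‖ ≤ C * Real.exp (-δ * u)) :
    IntegrableOn (fun u : ℝ => κ (u + θ * Complex.I)) (Ioi 0) := by
  have h1 : IntegrableOn (fun u : ℝ => ‖κ (u + θ * Complex.I)‖) (Ioi 0) := by
    refine integrable_of_isBigO_exp_neg hδ hc.norm ?_
    refine Asymptotics.IsBigO.of_bound C ?_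
    filter_upwards [hb] with u hu
    rwa [norm_norm, Real.norm_of_nonneg (Real.exp_pos _).le]
  refine (integrable_norm_iff ?_).1 h1
  exact (hc.mono Ioi_subset_Ici_self).aestronglyMeasurable measurableSet_Ioi

/-- Cauchy's theorem for the Hankel contour. -/
theorem integral_hankel_eq_zero {κ : ℂ → ℂ} {ψ δ C : ℝ} (hψ : 0 < ψ) (hδ : 0 < δ)
    (hd : DifferentiableOn ℂ κ {w | 0 ≤ w.re ∧ -ψ ≤ w.im ∧ w.im ≤ ψ})
    (hb : ∀ᶠ u : ℝ in atTop, ∀ θ ∈ Icc (-ψ) ψ, ‖κ (u + θ * Complex.I)‖ ≤ C * Real.exp (-δ * u))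
    (hi : Integrable fun u => κ (hankelLog ψ u) * hankelVel ψ u) :
    ∫ u, κ (hankelLog ψ u) * hankelVel ψ u = 0 := by
  have hline : ∀ θ ∈ Icc (-ψ) ψ, IntegrableOn (fun u : ℝ => κ (u + θ * Complex.I)) (Ioi 0) := by
    intro θ hθ
    refine integrableOn_line hδ ?_ (hb.mono fun u hu => hu θ hθ)
    refine hd.continuousOn.comp (by fun_prop) fun u hu => ?_
    simpa using ⟨hu, hθ.1, hθ.2⟩
  have hlim : Tendsto (fun u : ℝ => C * Real.exp (-δ * u)) atTop (𝓝 0) := by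
    have : Tendsto (fun u : ℝ => -δ * u) atTop atBot :=
      tendsto_id.const_mul_atTop_of_neg (by linarith)
    simpa using (Real.tendsto_exp_atBot.comp this).const_mul C
  have := integral_halfStrip_eq (A := 0) (θ₁ := -ψ) (θ₂ := ψ) (by linarith) hd hlim hb (hline _ ⟨le_rfl, by linarith⟩)
    (hline _ ⟨by linarith, le_rfl⟩)
  rw [integral_hankel hψ hi]
  simp only [Complex.ofReal_zero, zero_add] at this
  linear_combination -this

open Complex in
/-- The winding integral for the Hankel contour. -/
theorem integral_hankel_winding {ψ a : ℝ} {x : ℂ} (hψ : Real.pi / 2 ≤ ψ) (hψ' : ψ ≤ Real.pi) (ha : 0 < a)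
    (hx : a < x.re) (hi : Integrable fun u => x / (a * exp (hankelLog ψ u) - x) * hankelVel ψ u) :
    ∫ u, x / (a * exp (hankelLog ψ u) - x) * hankelVel ψ u = -(2 * Real.pi * I) := by
  have hpi := Real.pi_pos
  set κ : ℂ → ℂ := fun w => x / (a * exp w - x) with hκ
  have hxn : a < ‖x‖ := hx.trans_le (re_le_norm x)
  have hre : ∀ θ : ℝ, Real.pi / 2 ≤ |θ| → |θ| ≤ Real.pi → Real.cos θ ≤ 0 := by
    intro θ h1 h2
    rw [← Real.cos_abs]
    exact Real.cos_nonpos_of_pi_div_two_le_of_le h1 (by linarith)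
  -- The strips ψ ≤ |Im w| ≤ π carry no pole: there Re(a e^w) ≤ 0 < a < Re x. The opening of the
  -- contour can therefore be widened to π.
  have hne : ∀ w : ℂ, Real.pi / 2 ≤ |w.im| → |w.im| ≤ Real.pi → a * exp w - x ≠ 0 := by
    intro w h1 h2 h
    have := congrArg re (sub_eq_zero.1 h)
    rw [re_ofReal_mul, exp_re] at this
    have h3 := hre _ h1 h2
    have : a * (Real.exp w.re * Real.cos w.im) ≤ 0 :=
      mul_nonpos_of_nonneg_of_nonpos ha.le (mul_nonpos_of_nonneg_of_nonpos (Real.exp_pos _).le h3)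
    linarith
  have hdiff : ∀ w : ℂ, Real.pi / 2 ≤ |w.im| → |w.im| ≤ Real.pi → DifferentiableAt ℂ κ w := by
    intro w h1 h2
    have := hne w h1 h2
    simp only [hκ]
    fun_prop (disch := assumption)
  have hbound : ∀ᶠ u : ℝ in atTop, ∀ θ : ℝ, ‖κ (u + θ * I)‖ ≤ (2 * ‖x‖ / a) * Real.exp (-1 * u) := by
    have : Tendsto (fun u : ℝ => a * Real.exp u) atTop atTop :=
      Real.tendsto_exp_atTop.const_mul_atTop ha
    filter_upwards [this.eventually_ge_atTop (2 * ‖x‖)] with u hu θ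
    have h1 : ‖a * exp (u + θ * I)‖ = a * Real.exp u := by
      rw [norm_mul, norm_real, Real.norm_of_nonneg ha.le, norm_exp]; simp
    have h2 : a * Real.exp u / 2 ≤ ‖a * exp (u + θ * I) - x‖ := by
      have := norm_sub_norm_le (a * exp (u + θ * I)) x
      rw [h1] at this; linarith
    simp only [hκ, norm_div]
    have h3 : 0 < a * Real.exp u / 2 := by positivity
    calc ‖x‖ / ‖a * exp (u + θ * I) - x‖ ≤ ‖x‖ / (a * Real.exp u / 2) := by gcongr
      _ = _ := by rw [neg_one_mul, Real.exp_neg]; field_simp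
  have hlim : Tendsto (fun u : ℝ => (2 * ‖x‖ / a) * Real.exp (-1 * u)) atTop (𝓝 0) := by
    have : Tendsto (fun u : ℝ => -1 * u) atTop atBot :=
      tendsto_id.const_mul_atTop_of_neg (by norm_num)
    simpa using (Real.tendsto_exp_atBot.comp this).const_mul (2 * ‖x‖ / a)
  have hline : ∀ θ : ℝ, Real.pi / 2 ≤ |θ| → |θ| ≤ Real.pi → IntegrableOn (fun u : ℝ => κ (u + θ * I)) (Ioi 0) := by
    intro θ h1 h2
    refine integrableOn_line one_pos ?_ (hbound.mono fun u hu => hu θ)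
    refine ContinuousOn.comp (g := κ) (t := {w | w.im = θ}) ?_ (by fun_prop) fun u hu => ?_
    · intro w hw
      rw [← show w.im = θ from hw] at h1 h2
      exact (hdiff w h1 h2).continuousAt.continuousWithinAt
    · simp
  have a1 : |ψ| = ψ := abs_of_nonneg (by linarith)
  have a2 : |Real.pi| = Real.pi := abs_of_nonneg hpi.le
  have s1 := integral_halfStrip_eq (κ := κ) (A := 0) (θ₁ := ψ) (θ₂ := Real.pi) hψ'
    (fun w hw => (hdiff w (by rw [abs_of_nonneg] <;> linarith [hw.2.1]) (by rw [abs_of_nonneg] <;> linarith [hw.2.1, hw.2.2])).differentiableWithinAt)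
    hlim (hbound.mono fun u hu θ _ => hu θ) (hline _ (by rwa [a1]) (by rwa [a1])) (hline _ (by rw [a2]; linarith) (by rw [a2]))
  have s2 := integral_halfStrip_eq (κ := κ) (A := 0) (θ₁ := -Real.pi) (θ₂ := -ψ) (by linarith)
    (fun w hw => (hdiff w (by rw [abs_of_nonpos] <;> linarith [hw.2.2]) (by rw [abs_of_nonpos] <;> linarith [hw.2.1, hw.2.2])).differentiableWithinAt)
    hlim (hbound.mono fun u hu θ _ => hu θ) (hline _ (by rw [abs_neg, a2]; linarith) (by rw [abs_neg, a2])) (hline _ (by rwa [abs_neg, a1]) (by rwa [abs_neg, a1]))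
  -- At opening π the two rays coincide and their contributions cancel, which leaves the full circle
  -- |y| = a.
  have hper : ∀ u : ℂ, κ (u + (-Real.pi : ℝ) * I) = κ (u + Real.pi * I) := by
    intro u
    have : exp (u + (-Real.pi : ℝ) * I) = exp (u + Real.pi * I) := by
      rw [← exp_periodic (u + (-Real.pi : ℝ) * I)]
      congr 1; push_cast; ring
    simp only [hκ, this]
  have hcont : Continuous fun θ : ℝ => κ (θ * I) := by
    have : ∀ θ : ℝ, a * exp (θ * I) - x ≠ 0 := by
      intro θ h
      have := congrArg norm (sub_eq_zero.1 h)
      rw [norm_mul, norm_real, Real.norm_of_nonneg ha.le, norm_exp_ofReal_mul_I] at this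
      linarith
    simp only [hκ]
    exact Continuous.div (by fun_prop) (by fun_prop) this
  -- Mean value property: x lies outside the closed disc |y| ≤ a, so the average of x/(y - x) over
  -- the circle is its value -1 at y = 0.
  have hmean : ∫ θ in (-Real.pi)..Real.pi, κ (θ * I) = -(2 * Real.pi) := by
    have hp : Function.Periodic (fun θ : ℝ => κ (θ * I)) (2 * Real.pi) := by
      intro θ
      have : exp ((θ + 2 * Real.pi : ℝ) * I) = exp (θ * I) := by
        rw [← exp_periodic (θ * I)]; congr 1; push_cast; ring
      simp only [hκ, this]
    have h1 := hp.intervalIntegral_add_eq (-Real.pi) 0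
    rw [show -Real.pi + 2 * Real.pi = Real.pi by ring, zero_add] at h1
    rw [h1]
    have hne' : ∀ y ∈ Metric.closedBall (0 : ℂ) a, y - x ≠ 0 := by
      intro y hy h
      rw [sub_eq_zero.1 h, mem_closedBall_zero_iff] at hy
      linarith
    have h2 : DiffContOnCl ℂ (fun y : ℂ => x / (y - x)) (Metric.ball 0 |a|) := by
      rw [abs_of_pos ha]
      refine DifferentiableOn.diffContOnCl fun y hy => ?_
      have := hne' y (Metric.closure_ball_subset_closedBall hy)
      exact DifferentiableAt.differentiableWithinAt (by fun_prop (disch := assumption))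
    have h3 := h2.circleAverage
    rw [Real.circleAverage_def] at h3
    simp only [circleMap_zero] at h3
    have hx0 : x ≠ 0 := norm_pos_iff.1 (ha.trans hxn)
    rw [zero_sub, div_neg, div_self hx0] at h3
    have h4 : (2 * Real.pi)⁻¹ ≠ 0 := by positivity
    have h5 := congrArg (fun z : ℂ => (2 * Real.pi) • z) h3
    simp only [smul_smul, mul_inv_cancel₀ (by positivity : 2 * Real.pi ≠ 0), one_smul] at h5
    simp only [hκ]
    rw [h5]; simp
  rw [integral_hankel (κ := κ) (by linarith) hi]
  have hI : ∀ p q : ℝ, IntervalIntegrable (fun θ : ℝ => κ (θ * I)) volume p q := fun p q => hcont.intervalIntegrable _ _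
  have t1 := intervalIntegral.integral_add_adjacent_intervals (hI (-Real.pi) (-ψ)) (hI (-ψ) ψ)
  have t2 := intervalIntegral.integral_add_adjacent_intervals (hI (-Real.pi) ψ) (hI ψ Real.pi)
  simp only [ofReal_zero, zero_add] at s1 s2
  simp_rw [hper] at s2
  linear_combination s1 + s2 + I * t1 + I * t2 + I * hmean

/-- The Hankel contour: the arc `|y| = a`, `|arg y| ≤ ψ` and the two rays bounding it. -/
noncomputable def hankel (ψ a u : ℝ) : ℂ := a * Complex.exp (hankelLog ψ u)

theorem continuous_hankel (ψ a : ℝ) : Continuous (hankel ψ a) := by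
  have := continuous_hankelLog ψ
  unfold hankel
  fun_prop

theorem norm_hankel {ψ a : ℝ} (ha : 0 < a) (u : ℝ) :
    ‖hankel ψ a u‖ = a * Real.exp (hankelRe ψ u) := by
  rw [hankel, norm_mul, Complex.norm_real, Real.norm_of_nonneg ha.le, Complex.norm_exp, hankelLog_re]

theorem le_norm_hankel {ψ a : ℝ} (ha : 0 < a) (u : ℝ) : a ≤ ‖hankel ψ a u‖ := by
  rw [norm_hankel ha]
  exact le_mul_of_one_le_right ha.le (Real.one_le_exp (hankelRe_nonneg _ _))

/-- The whole closed half strip, not only its boundary, goes into the sector; this permits contour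
deformations in logarithmic coordinates. -/
theorem mul_exp_mem_sector {ψ a φ ρ : ℝ} (hψφ : ψ < Real.pi / 2 + φ) (hψπ : ψ < Real.pi)
    (hρ : 0 ≤ ρ) (ha : ρ < a) {w : ℂ} (hw : 0 ≤ w.re) (hw' : -ψ ≤ w.im ∧ w.im ≤ ψ) :
    a * Complex.exp w ∈ sector φ ρ := by
  have ha0 : 0 < a := hρ.trans_lt ha
  constructor
  · rw [Complex.arg_real_mul _ ha0, ← Complex.log_im, Complex.log_exp (by linarith) (by linarith)]
    rw [abs_lt]; constructor <;> linarith
  · rw [norm_mul, Complex.norm_real, Real.norm_of_nonneg ha0.le, Complex.norm_exp]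
    exact ha.trans_le (le_mul_of_one_le_right ha0.le (Real.one_le_exp hw))

theorem hankel_mem_sector {ψ a φ ρ : ℝ} (hψ : 0 ≤ ψ) (hψφ : ψ < Real.pi / 2 + φ) (hψπ : ψ < Real.pi)
    (hρ : 0 ≤ ρ) (ha : ρ < a) (u : ℝ) : hankel ψ a u ∈ sector φ ρ := by
  refine mul_exp_mem_sector hψφ hψπ hρ ha ?_ ?_
  · rw [hankelLog_re]; exact hankelRe_nonneg _ _
  · rw [hankelLog_im]
    exact ⟨le_max_left _ _, max_le (by linarith) (min_le_right _ _)⟩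

/-- On the Hankel contour of opening `π/2 + σ'`, the exponential `exp (p y)` decays for
`|arg p| ≤ σ < σ'`. -/
theorem re_mul_hankel_le {σ σ' a : ℝ} (hσ : σ < σ') (hs : σ + σ' ≤ Real.pi / 2) (ha : 0 < a) {p : ℂ}
    (hp : |Complex.arg p| ≤ σ) (u : ℝ) :
    (p * hankel (Real.pi / 2 + σ') a u).re ≤
      ‖p‖ * a * ((1 + Real.sin (σ' - σ)) - Real.sin (σ' - σ) * Real.exp (hankelRe (Real.pi / 2 + σ') u)) := by
  set ψ := Real.pi / 2 + σ' with hψ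
  set c := Real.sin (σ' - σ) with hc
  have hpi := Real.pi_pos
  have hσ0 : 0 ≤ σ := (abs_nonneg _).trans hp
  have hc0 : 0 ≤ c := Real.sin_nonneg_of_nonneg_of_le_pi (by linarith) (by linarith)
  have hE : 1 ≤ Real.exp (hankelRe ψ u) := Real.one_le_exp (hankelRe_nonneg _ _)
  have e1 : p * hankel ψ a u = ((‖p‖ * a : ℝ) : ℂ) * Complex.exp (hankelLog ψ u + Complex.arg p * Complex.I) := by
    conv_lhs => rw [← Complex.norm_mul_exp_arg_mul_I p]
    rw [hankel, Complex.exp_add]; push_cast; ring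
  rw [e1, Complex.re_ofReal_mul, Complex.exp_re]
  simp only [Complex.add_re, hankelLog_re, Complex.mul_re, Complex.ofReal_re, Complex.I_re, mul_zero,
    Complex.ofReal_im, Complex.I_im, mul_one, sub_self, add_zero, Complex.add_im, hankelLog_im, Complex.mul_im]
  refine mul_le_mul_of_nonneg_left ?_ (by positivity)
  have hab := abs_le.1 hp
  -- `hs` keeps σ' + b in the range where the sine increases, so σ' + b ≥ σ' - σ yields the bound.
  have hsin : ∀ b, |b| ≤ σ → c ≤ Real.sin (σ' + b) := by
    intro b hb
    have := abs_le.1 hb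
    refine Real.sin_le_sin_of_le_of_le_pi_div_two (by linarith) (by linarith) (by linarith)
  -- On the arc only cos ≤ 1 is used, which accounts for the summand 1 + c. On the rays the total
  -- angle exceeds π/2 in modulus by at least σ' - σ, so its cosine is at most -c.
  by_cases h : |u| ≤ ψ
  · have : hankelRe ψ u = 0 := by rw [hankelRe, max_eq_right (by linarith)]
    rw [this, Real.exp_zero]
    have := Real.cos_le_one (max (-ψ) (min u ψ) + p.arg)
    linarith
  · push Not at h
    have hcos : Real.cos (max (-ψ) (min u ψ) + p.arg) ≤ -c := by
      rcases le_or_gt 0 u with hu | hu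
      · rw [abs_of_nonneg hu] at h
        rw [min_eq_right h.le, max_eq_right (by linarith)]
        have := hsin p.arg hp
        rw [hψ, show Real.pi / 2 + σ' + p.arg = σ' + p.arg + Real.pi / 2 by ring, Real.cos_add_pi_div_two]
        linarith
      · rw [abs_of_neg hu] at h
        rw [min_eq_left (by linarith), max_eq_left (by linarith), ← Real.cos_neg]
        have := hsin (-p.arg) (by rwa [abs_neg])
        rw [hψ, show -(-(Real.pi / 2 + σ') + p.arg) = σ' + -p.arg + Real.pi / 2 by ring, Real.cos_add_pi_div_two]
        linarith
    nlinarith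

/-! ### The one-dimensional Borel transform -/

/-- The kernel of the one-dimensional Borel transform. -/
noncomputable def borelKernel (ψ a : ℝ) (p : ℂ) (u : ℝ) : ℂ :=
  (2 * Real.pi * Complex.I)⁻¹ * Complex.exp (p * hankel ψ a u) * hankel ψ a u * hankelVel ψ u

theorem measurable_borelKernel (ψ a : ℝ) (p : ℂ) : Measurable (borelKernel ψ a p) := by
  unfold borelKernel
  have := (continuous_hankel ψ a).measurable
  have := measurable_hankelVel ψ
  fun_prop

/-- In the logarithmic parameter the decay along the rays is doubly exponential, at rate ‖p‖ a
sin(σ' - σ); the possible growth on the arc goes into the prefactor. -/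
theorem norm_borelKernel_le {σ σ' a : ℝ} (hσ : σ < σ') (hs : σ + σ' ≤ Real.pi / 2) (ha : 0 < a) {p : ℂ}
    (hp : |Complex.arg p| ≤ σ) (u : ℝ) :
    ‖borelKernel (Real.pi / 2 + σ') a p u‖ ≤ a * Real.exp (‖p‖ * a * (1 + Real.sin (σ' - σ))) *
      (Real.exp (hankelRe (Real.pi / 2 + σ') u) *
        Real.exp (-(‖p‖ * a * Real.sin (σ' - σ)) * Real.exp (hankelRe (Real.pi / 2 + σ') u))) := by
  have h2 : ‖(2 * Real.pi * Complex.I)⁻¹‖ ≤ 1 := by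
    rw [norm_inv, norm_mul, norm_mul, Complex.norm_I, Complex.norm_real, Real.norm_of_nonneg Real.pi_pos.le]
    refine inv_le_one_of_one_le₀ ?_
    have := Real.pi_gt_three
    simp; linarith
  rw [borelKernel, norm_mul, norm_mul, norm_mul, norm_hankelVel, mul_one, norm_hankel ha, Complex.norm_exp]
  calc _ ≤ 1 * Real.exp (‖p‖ * a * ((1 + Real.sin (σ' - σ)) - Real.sin (σ' - σ) * Real.exp (hankelRe (Real.pi / 2 + σ') u))) * (a * Real.exp (hankelRe (Real.pi / 2 + σ') u)) := by
        gcongr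
        exact re_mul_hankel_le hσ hs ha hp u
    _ = _ := by
        rw [mul_sub, sub_eq_add_neg, Real.exp_add]; ring_nf

/-- From e^x ≥ x²/2: the doubly exponential factor beats the growth e^v of the line element and
still leaves simple exponential decay. -/
theorem exp_mul_exp_neg_le {k : ℝ} (hk : 0 < k) (v : ℝ) :
    Real.exp v * Real.exp (-k * Real.exp v) ≤ 2 / k ^ 2 * Real.exp (-1 * v) := by
  have h1 := Real.quadratic_le_exp_of_nonneg (x := k * Real.exp v) (by positivity)
  have h2 : 0 < Real.exp v := Real.exp_pos v
  rw [neg_mul, Real.exp_neg, neg_one_mul, Real.exp_neg, ← div_eq_mul_inv, ← div_eq_mul_inv,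
    div_le_div_iff₀ (Real.exp_pos _) h2]
  have h3 : (k * Real.exp v) ^ 2 / 2 ≤ Real.exp (k * Real.exp v) := by
    have : 0 < k * Real.exp v := by positivity
    linarith
  rw [div_mul_eq_mul_div, le_div_iff₀ (by positivity)]
  nlinarith

theorem integrable_hankel_exp (ψ : ℝ) {k : ℝ} (hk : 0 < k) :
    Integrable fun u => Real.exp (hankelRe ψ u) * Real.exp (-k * Real.exp (hankelRe ψ u)) := by
  refine ((integrable_exp_neg_hankelRe ψ one_pos).const_mul (2 / k ^ 2)).mono' ?_
    (Eventually.of_forall fun u => ?_)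
  · have := continuous_hankelRe ψ
    exact Continuous.aestronglyMeasurable (by fun_prop)
  · rw [Real.norm_of_nonneg (by positivity)]
    exact exp_mul_exp_neg_le hk _

theorem rpow_norm_hankel_le {ψ a α : ℝ} (ha : 0 < a) (hα : 0 ≤ α) (u : ℝ) :
    ‖hankel ψ a u‖ ^ (-α) ≤ a ^ (-α) :=
  Real.rpow_le_rpow_of_nonpos ha (le_norm_hankel ha u) (by linarith)

theorem norm_rpow_mul_borelKernel_le {σ σ' a α : ℝ} (hσ : σ < σ') (hs : σ + σ' ≤ Real.pi / 2) (ha : 0 < a) (hα : 0 ≤ α) {p : ℂ} (hp : |Complex.arg p| ≤ σ) (u : ℝ) :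
    ‖hankel (Real.pi / 2 + σ') a u‖ ^ (-α) * ‖borelKernel (Real.pi / 2 + σ') a p u‖ ≤
     (a ^ (-α) * (a * Real.exp (‖p‖ * a * (1 + Real.sin (σ' - σ))))) *
      (Real.exp (hankelRe (Real.pi / 2 + σ') u) *
        Real.exp (-(‖p‖ * a * Real.sin (σ' - σ)) * Real.exp (hankelRe (Real.pi / 2 + σ') u))) := by
  calc _ ≤ a ^ (-α) * (a * Real.exp (‖p‖ * a * (1 + Real.sin (σ' - σ))) *
      (Real.exp (hankelRe (Real.pi / 2 + σ') u) *
        Real.exp (-(‖p‖ * a * Real.sin (σ' - σ)) * Real.exp (hankelRe (Real.pi / 2 + σ') u)))) := by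
        exact mul_le_mul (rpow_norm_hankel_le ha hα u) (norm_borelKernel_le hσ hs ha hp u)
          (norm_nonneg _) (by positivity)
    _ = _ := by ring

theorem integrable_rpow_mul_borelKernel {σ σ' a α : ℝ} (hσ : σ < σ') (hs : σ + σ' ≤ Real.pi / 2) (ha : 0 < a) (hα : 0 ≤ α) {p : ℂ} (hp : |Complex.arg p| ≤ σ) (hp0 : p ≠ 0) :
    Integrable fun u => ‖hankel (Real.pi / 2 + σ') a u‖ ^ (-α) * ‖borelKernel (Real.pi / 2 + σ') a p u‖ := by
  have hσ0 : 0 ≤ σ := (abs_nonneg _).trans hp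
  have hc : 0 < Real.sin (σ' - σ) := Real.sin_pos_of_pos_of_lt_pi (by linarith) (by linarith [Real.pi_pos])
  have hp1 : 0 < ‖p‖ := norm_pos_iff.2 hp0
  refine ((integrable_hankel_exp (Real.pi / 2 + σ') (k := ‖p‖ * a * Real.sin (σ' - σ)) (by positivity)).const_mul
    (a ^ (-α) * (a * Real.exp (‖p‖ * a * (1 + Real.sin (σ' - σ)))))).mono' ?_ (Eventually.of_forall fun u => ?_)
  · refine Measurable.aestronglyMeasurable ?_
    have := (continuous_hankel (Real.pi / 2 + σ') a).measurable
    have := measurable_borelKernel (Real.pi / 2 + σ') a p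
    fun_prop
  · rw [Real.norm_of_nonneg (by positivity)]
    exact norm_rpow_mul_borelKernel_le hσ hs ha hα hp u

/-- The one-dimensional Borel transform does not depend on the radius of the contour. -/
theorem integral_borelKernel_shift {φ ρ σ σ' a a' α C : ℝ} {h : ℂ → ℂ} (hσ : σ < σ') (hs : σ + σ' ≤ Real.pi / 2) (hσφ : σ' < φ) (hσπ : σ' < Real.pi / 2) (hρ : 0 ≤ ρ) (hα : 0 ≤ α)
    (ha : ρ < a) (haa : a ≤ a') (hh : DifferentiableOn ℂ h (sector φ ρ))
    (hb : ∀ z ∈ sector φ ρ, ‖h z‖ ≤ C * ‖z‖ ^ (-α)) {p : ℂ} (hp : |Complex.arg p| ≤ σ) (hp0 : p ≠ 0) :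
    ∫ u, h (hankel (Real.pi / 2 + σ') a u) * borelKernel (Real.pi / 2 + σ') a p u =
      ∫ u, h (hankel (Real.pi / 2 + σ') a' u) * borelKernel (Real.pi / 2 + σ') a' p u := by
  set ψ := Real.pi / 2 + σ' with hψd
  have hpi := Real.pi_pos
  have hσ0 : 0 ≤ σ := (abs_nonneg _).trans hp
  have hψ : 0 < ψ := by linarith
  have hψφ : ψ < Real.pi / 2 + φ := by linarith
  have hψπ : ψ < Real.pi := by linarith
  have ha0 : 0 < a := hρ.trans_lt ha
  have ha'0 : 0 < a' := ha0.trans_le haa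
  let κ : ℝ → ℂ → ℂ := fun a w => h (a * Complex.exp w) *
    ((2 * Real.pi * Complex.I)⁻¹ * Complex.exp (p * (a * Complex.exp w)) * (a * Complex.exp w))
  have hκ : ∀ a u, h (hankel ψ a u) * borelKernel ψ a p u = κ a (hankelLog ψ u) * hankelVel ψ u := by
    intro a u
    simp only [κ, borelKernel, hankel]; ring
  have hint : ∀ a, ρ < a → Integrable fun u => κ a (hankelLog ψ u) * hankelVel ψ u := by
    intro a ha
    simp_rw [← hκ]
    refine ((integrable_rpow_mul_borelKernel hσ hs (hρ.trans_lt ha) hα hp hp0).const_mul C).mono' ?_ (Eventually.of_forall fun u => ?_)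
    · refine AEStronglyMeasurable.mul (Continuous.aestronglyMeasurable ?_) (measurable_borelKernel _ _ _).aestronglyMeasurable
      exact hh.continuousOn.comp_continuous (continuous_hankel ψ a) (hankel_mem_sector hψ.le hψφ hψπ hρ ha)
    · rw [norm_mul, ← mul_assoc]
      gcongr
      exact hb _ (hankel_mem_sector hψ.le hψφ hψπ hρ ha u)
  have hdiff : ∀ a, ρ < a → DifferentiableOn ℂ (κ a) {w | 0 ≤ w.re ∧ -ψ ≤ w.im ∧ w.im ≤ ψ} := by
    intro a ha
    refine DifferentiableOn.mul ?_ (by fun_prop)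
    exact hh.comp (by fun_prop) fun w hw => mul_exp_mem_sector hψφ hψπ hρ ha hw.1 hw.2
  have hlineint : ∀ a, ρ < a → IntegrableOn (fun v : ℝ => κ a (v + ψ * Complex.I)) (Ioi 0) ∧
      IntegrableOn (fun v : ℝ => κ a (v + (-ψ : ℝ) * Complex.I)) (Ioi 0) := by
    intro a ha
    have h1 := hint a ha
    constructor
    · have h2 := (measurePreserving_add_right volume ψ).integrableOn_comp_preimage
        (measurableEmbedding_addRight ψ) (f := fun u => κ a (hankelLog ψ u) * hankelVel ψ u) (s := Ioi ψ)
      have h3 := h2.2 h1.integrableOn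
      rw [show (fun x => x + ψ) ⁻¹' Ioi ψ = Ioi 0 by ext; simp] at h3
      refine h3.congr_fun (fun v hv => ?_) measurableSet_Ioi
      simp only [mem_Ioi] at hv
      simp only [Function.comp]
      rw [hankelLog_of_ge hψ.le (by linarith), hankelVel, if_neg (by linarith), if_neg (by linarith)]
      simp
    · have h2 := (Measure.measurePreserving_sub_left (volume : Measure ℝ) (-ψ)).integrableOn_comp_preimage
        (MeasurableEquiv.subLeft (-ψ)).measurableEmbedding (f := fun u => κ a (hankelLog ψ u) * hankelVel ψ u) (s := Iic (-ψ))
      have h3 := (h2.2 h1.integrableOn).neg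
      rw [show (fun x => -ψ - x) ⁻¹' Iic (-ψ) = Ici 0 by ext; simp] at h3
      refine (h3.mono_set Ioi_subset_Ici_self).congr_fun (fun v hv => ?_) measurableSet_Ioi
      simp only [mem_Ioi] at hv
      simp only [Function.comp, Pi.neg_apply]
      rw [hankelLog_of_le hψ.le (by linarith), hankelVel, if_pos (by linarith)]
      rw [show (-(-ψ - v) - ψ) = v by ring]
      ring
  simp_rw [hκ]
  have ha' : ρ < a' := ha.trans_le haa
  rw [integral_hankel hψ (hint a ha), integral_hankel hψ (hint a' ha')]
  -- Passing from radius a to a' translates the half strip by L. The two contour integrals differ by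
  -- a boundary integral over the rectangle [0, L] × [-ψ, ψ], which vanishes by Cauchy's theorem.
  set L := Real.log (a' / a) with hL
  have hL0 : 0 ≤ L := Real.log_nonneg ((one_le_div ha0).2 haa)
  have hLe : (a : ℂ) * Complex.exp L = a' := by
    rw [← Complex.ofReal_exp, Real.exp_log (by positivity)]
    rw [← Complex.ofReal_mul]; congr 1; field_simp
  have hshift : ∀ w : ℂ, κ a' w = κ a (L + w) := by
    intro w
    simp only [κ]
    rw [Complex.exp_add, ← mul_assoc (a : ℂ), hLe]
  have hsplit : ∀ θ : ℝ, IntegrableOn (fun v : ℝ => κ a (v + θ * Complex.I)) (Ioi 0) →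
      ∫ v in Ioi (0 : ℝ), κ a (v + θ * Complex.I) = (∫ v in (0 : ℝ)..L, κ a (v + θ * Complex.I)) +
        ∫ v in Ioi (0 : ℝ), κ a' (v + θ * Complex.I) := by
    intro θ hi
    rw [show Ioi (0 : ℝ) = Ioc 0 L ∪ Ioi L from (Ioc_union_Ioi_eq_Ioi hL0).symm] at hi
    conv_lhs => rw [← Ioc_union_Ioi_eq_Ioi hL0, setIntegral_union (Ioc_disjoint_Ioi (le_refl L)) measurableSet_Ioi
      (hi.mono_set subset_union_left) (hi.mono_set subset_union_right), ← intervalIntegral.integral_of_le hL0]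
    congr 1
    have := (measurePreserving_add_right volume L).setIntegral_preimage_emb
      (measurableEmbedding_addRight L) (fun v : ℝ => κ a (v + θ * Complex.I)) (Ioi L)
    rw [← this, show (fun x : ℝ => x + L) ⁻¹' Ioi L = Ioi (0 : ℝ) by ext; simp]
    refine setIntegral_congr_fun measurableSet_Ioi fun v hv => ?_
    simp only [hshift]
    congr 1; push_cast; ring
  rw [hsplit ψ (hlineint a ha).1, hsplit (-ψ) (hlineint a ha).2]
  have hrect := Complex.integral_boundary_rect_eq_zero_of_differentiableOn (κ a) ((-ψ : ℝ) * Complex.I) (L + ψ * Complex.I) ?_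
  · simp only [Complex.add_re, Complex.ofReal_re, Complex.mul_re, Complex.I_re, mul_zero, Complex.ofReal_im, Complex.I_im, mul_one, sub_self,
        add_zero, Complex.add_im, Complex.mul_im, zero_add, smul_eq_mul, Complex.ofReal_zero] at hrect
    simp_rw [hshift (_ * Complex.I)]
    linear_combination -hrect
  · refine (hdiff a ha).mono ?_
    intro w hw
    simp only [Complex.add_re, Complex.ofReal_re, Complex.mul_re, Complex.I_re, mul_zero, Complex.ofReal_im, Complex.I_im, mul_one, sub_self,
        add_zero, Complex.add_im, Complex.mul_im, zero_add, uIcc_of_le hL0, uIcc_of_le (by linarith : -ψ ≤ ψ)] at hw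
    exact ⟨hw.1.1, hw.2⟩

/-! ### Cauchy's formula along the Hankel contour -/

theorem re_hankel_le {σ' a : ℝ} (hσ' : 0 < σ') (hs : σ' ≤ Real.pi / 2) (ha : 0 < a) (u : ℝ) :
    (hankel (Real.pi / 2 + σ') a u).re ≤
      a * ((1 + Real.sin σ') - Real.sin σ' * Real.exp (hankelRe (Real.pi / 2 + σ') u)) := by
  have := re_mul_hankel_le (σ := 0) (p := 1) hσ' (by simpa using hs) ha (by simp) u
  simpa using this

/-- The Hankel contour stays at distance at least `m eᵛ` to the left of the half plane
`Re x > a`. -/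
theorem exists_le_re_sub_hankel {σ' a X : ℝ} (hσ' : 0 < σ') (hs : σ' ≤ Real.pi / 2) (ha : 0 < a) (hX : a < X) :
    ∃ m > 0, ∀ u, m * Real.exp (hankelRe (Real.pi / 2 + σ') u) ≤ X - (hankel (Real.pi / 2 + σ') a u).re := by
  have hc : 0 < Real.sin σ' := Real.sin_pos_of_pos_of_lt_pi hσ' (by linarith [Real.pi_pos])
  -- With E = e^v ≥ 1 the difference is at least (X - a) + a sin σ' (E - 1), and this dominates m E
  -- when m is the smaller of the two coefficients.
  refine ⟨min (X - a) (a * Real.sin σ'), by rw [gt_iff_lt, lt_min_iff]; exact ⟨by linarith, by positivity⟩, fun u => ?_⟩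
  have h1 := re_hankel_le hσ' hs ha u
  have hE : 1 ≤ Real.exp (hankelRe (Real.pi / 2 + σ') u) := Real.one_le_exp (hankelRe_nonneg _ _)
  set E := Real.exp (hankelRe (Real.pi / 2 + σ') u)
  set m := min (X - a) (a * Real.sin σ')
  have h2 : m ≤ X - a := min_le_left _ _
  have h3 : m ≤ a * Real.sin σ' := min_le_right _ _
  nlinarith

/-- The kernel of Cauchy's formula along the Hankel contour. -/
noncomputable def cauchyKernel (ψ a : ℝ) (x : ℂ) (u : ℝ) : ℂ :=
  (2 * Real.pi * Complex.I)⁻¹ * hankel ψ a u * hankelVel ψ u / (x - hankel ψ a u)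

theorem measurable_cauchyKernel (ψ a : ℝ) (x : ℂ) : Measurable (cauchyKernel ψ a x) := by
  unfold cauchyKernel
  have := (continuous_hankel ψ a).measurable
  have := measurable_hankelVel ψ
  fun_prop

theorem norm_two_pi_I_inv_le : ‖(2 * Real.pi * Complex.I)⁻¹‖ ≤ 1 := by
  rw [norm_inv, norm_mul, norm_mul, Complex.norm_I, Complex.norm_real, Real.norm_of_nonneg Real.pi_pos.le]
  refine inv_le_one_of_one_le₀ ?_
  have := Real.pi_gt_three
  simp; linarith

theorem rpow_norm_hankel_eq {ψ a α : ℝ} (ha : 0 < a) (u : ℝ) :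
    ‖hankel ψ a u‖ ^ (-α) = a ^ (-α) * Real.exp (-α * hankelRe ψ u) := by
  rw [norm_hankel ha, Real.mul_rpow ha.le (Real.exp_pos _).le, ← Real.exp_mul, mul_comm (hankelRe ψ u)]

/-- The Cauchy kernel is merely bounded along the contour, since |x - y| is bounded below by a
multiple of |y|. All integrability comes from |y|^{-α}, whence α > 0. -/
theorem integrable_rpow_mul_cauchyKernel {σ' a α : ℝ} {x : ℂ} (hσ' : 0 < σ') (hs : σ' ≤ Real.pi / 2) (ha : 0 < a)
    (hα : 0 < α) (hx : a < x.re) :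
    Integrable fun u => ‖hankel (Real.pi / 2 + σ') a u‖ ^ (-α) * ‖cauchyKernel (Real.pi / 2 + σ') a x u‖ := by
  obtain ⟨m, hm, hmu⟩ := exists_le_re_sub_hankel hσ' hs ha hx
  set ψ := Real.pi / 2 + σ'
  refine ((integrable_exp_neg_hankelRe ψ hα).const_mul (a ^ (-α) * (a / m))).mono' ?_ (Eventually.of_forall fun u => ?_)
  · refine Measurable.aestronglyMeasurable ?_
    have := (continuous_hankel ψ a).measurable
    have := measurable_cauchyKernel ψ a x
    fun_prop
  · rw [Real.norm_of_nonneg (by positivity), rpow_norm_hankel_eq ha, cauchyKernel, norm_div, norm_mul, norm_mul, norm_hankelVel, mul_one,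
      norm_hankel ha]
    have h1 : m * Real.exp (hankelRe ψ u) ≤ ‖x - hankel ψ a u‖ := by
      have := Complex.re_le_norm (x - hankel ψ a u)
      rw [Complex.sub_re] at this
      exact (hmu u).trans this
    have h0 := Real.exp_pos (hankelRe ψ u)
    calc _ ≤ a ^ (-α) * Real.exp (-α * hankelRe ψ u) * (1 * (a * Real.exp (hankelRe ψ u)) / (m * Real.exp (hankelRe ψ u))) := by
          gcongr
          exact norm_two_pi_I_inv_le
      _ = _ := by field_simp

/-- Cauchy's formula along the Hankel contour. -/
theorem integral_cauchyKernel {φ ρ σ' a α C : ℝ} {h : ℂ → ℂ} {x : ℂ} (hσ' : 0 < σ')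
    (hσφ : σ' < φ) (hφ : φ ≤ Real.pi / 2) (hρ : 0 ≤ ρ) (hα : 0 < α) (ha : ρ < a) (hx : a < x.re)
    (hh : DifferentiableOn ℂ h (sector φ ρ)) (hb : ∀ z ∈ sector φ ρ, ‖h z‖ ≤ C * ‖z‖ ^ (-α)) :
    ∫ u, h (hankel (Real.pi / 2 + σ') a u) * cauchyKernel (Real.pi / 2 + σ') a x u = h x := by
  have hpi := Real.pi_pos
  have hs : σ' ≤ Real.pi / 2 := by linarith
  have ha0 : 0 < a := hρ.trans_lt ha
  obtain ⟨m, hm, hmu⟩ := exists_le_re_sub_hankel hσ' hs ha0 hx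
  have hint := integrable_rpow_mul_cauchyKernel (α := α) (x := x) hσ' hs ha0 hα hx
  have hint1 := integrable_rpow_mul_cauchyKernel (α := 1) (x := x) hσ' hs ha0 one_pos hx
  set ψ := Real.pi / 2 + σ' with hψd
  have hψ : 0 < ψ := by positivity
  have hψφ : ψ < Real.pi / 2 + φ := by linarith
  have hψπ : ψ < Real.pi := by linarith
  have hxs : x ∈ sector φ ρ := mem_sector_of_lt_re (by linarith) hρ (ha.trans hx)
  have hx0 : x ≠ 0 := by rintro rfl; simp at hx; linarith
  have hne : ∀ u, x - hankel ψ a u ≠ 0 := by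
    intro u h0
    have := hmu u
    rw [← Complex.sub_re, h0] at this
    have : 0 < m * Real.exp (hankelRe ψ u) := by positivity
    simp at *; linarith
  have hy0 : ∀ u, hankel ψ a u ≠ 0 := fun u => norm_pos_iff.1 (ha0.trans_le (le_norm_hankel ha0 u))
  have hmem : ∀ u, hankel ψ a u ∈ sector φ ρ := hankel_mem_sector hψ.le hψφ hψπ hρ ha
  -- the function with the pole removed
  let G : ℂ → ℂ := fun y => h y - h x * (x / y)
  have hGx : G x = 0 := by simp [G, div_self hx0]
  have hG : DifferentiableOn ℂ G (sector φ ρ) := by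
    refine hh.sub (DifferentiableOn.const_mul ?_ _)
    refine DifferentiableOn.div (by fun_prop) (by fun_prop) fun y hy => ?_
    exact norm_pos_iff.1 (hρ.trans_lt hy.2)
  -- Subtracting h(x)·x/y instead of the constant h(x) cancels the pole at x and keeps decay at
  -- infinity. What remains to be computed is the winding integral of x/(y - x).
  have hk : DifferentiableOn ℂ (dslope G x) (sector φ ρ) :=
    (Complex.differentiableOn_dslope ((isOpen_sector hφ hρ).mem_nhds hxs)).2 hG
  have hkv : ∀ y, y ≠ x → dslope G x y = G y / (y - x) := by
    intro y hy
    rw [dslope_of_ne _ hy, slope_def_field, hGx, sub_zero]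
  let κ : ℂ → ℂ := fun w => dslope G x (a * Complex.exp w) * (a * Complex.exp w)
  have hκd : DifferentiableOn ℂ κ {w | 0 ≤ w.re ∧ -ψ ≤ w.im ∧ w.im ≤ ψ} := by
    refine DifferentiableOn.mul ?_ (by fun_prop)
    exact hk.comp (by fun_prop) fun w hw => mul_exp_mem_sector hψφ hψπ hρ ha hw.1 hw.2
  have hκu : ∀ u, κ (hankelLog ψ u) * hankelVel ψ u =
      (2 * Real.pi * Complex.I) * (-(h (hankel ψ a u) * cauchyKernel ψ a x u)
        + h x * x * ((hankel ψ a u)⁻¹ * cauchyKernel ψ a x u)) := by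
    intro u
    have h1 := hne u
    have h2 := hy0 u
    have h4 : hankel ψ a u - x ≠ 0 := by rw [← neg_sub]; exact neg_ne_zero.2 h1
    have h3 : (2 * Real.pi * Complex.I : ℂ) ≠ 0 := by simp [Real.pi_ne_zero]
    simp only [κ]
    rw [← hankel, hkv _ (sub_ne_zero.1 h4)]
    simp only [G, cauchyKernel]
    rw [← neg_sub (hankel ψ a u) x]
    generalize hankel ψ a u = y at *
    generalize (2 * Real.pi * Complex.I : ℂ) = e at *
    field_simp
    ring
  have hI1 : Integrable fun u => h (hankel ψ a u) * cauchyKernel ψ a x u := by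
    refine (hint.const_mul C).mono' ?_ (Eventually.of_forall fun u => ?_)
    · refine AEStronglyMeasurable.mul (Continuous.aestronglyMeasurable ?_) (measurable_cauchyKernel _ _ _).aestronglyMeasurable
      exact hh.continuousOn.comp_continuous (continuous_hankel ψ a) hmem
    · rw [norm_mul, ← mul_assoc]
      gcongr
      exact hb _ (hmem u)
  have hI2 : Integrable fun u => (hankel ψ a u)⁻¹ * cauchyKernel ψ a x u := by
    refine hint1.mono' ?_ (Eventually.of_forall fun u => ?_)
    · have := (continuous_hankel ψ a).measurable
      have := measurable_cauchyKernel ψ a x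
      exact Measurable.aestronglyMeasurable (by fun_prop)
    · rw [norm_mul, norm_inv, Real.rpow_neg_one]
  have hIκ : Integrable fun u => κ (hankelLog ψ u) * hankelVel ψ u := by
    simp_rw [hκu]
    exact (hI1.neg.add (hI2.const_mul _)).const_mul _
  have hbound : ∀ᶠ u : ℝ in atTop, ∀ θ ∈ Icc (-ψ) ψ, ‖κ (u + θ * Complex.I)‖ ≤
      (2 * (|C| * a ^ (-α) + ‖h x‖ * (‖x‖ * a ^ (-1 : ℝ)))) * Real.exp (-(min α 1) * u) := by
    have ht : Tendsto (fun u : ℝ => a * Real.exp u) atTop atTop :=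
      Real.tendsto_exp_atTop.const_mul_atTop ha0
    filter_upwards [ht.eventually_gt_atTop (2 * ‖x‖), eventually_ge_atTop 0] with u hu hu0 θ hθ
    set y := a * Complex.exp (u + θ * Complex.I) with hy
    have hyn : ‖y‖ = a * Real.exp u := by
      rw [hy, norm_mul, Complex.norm_real, Real.norm_of_nonneg ha0.le, Complex.norm_exp]; simp
    have hys : y ∈ sector φ ρ := mul_exp_mem_sector hψφ hψπ hρ ha (by simpa using hu0) (by simpa using hθ)
    have hsub : ‖y‖ / 2 ≤ ‖y - x‖ := by
      have := norm_sub_norm_le y x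
      linarith
    have hyx : y ≠ x := by rintro h; rw [h] at hyn; have := norm_nonneg x; linarith
    have hy0 : 0 < ‖y‖ := by rw [hyn]; positivity
    have hpow : ∀ β : ℝ, min α 1 ≤ β → ‖y‖ ^ (-β) ≤ a ^ (-β) * Real.exp (-(min α 1) * u) := by
      intro β hβ
      rw [hyn, Real.mul_rpow ha0.le (Real.exp_pos _).le, ← Real.exp_mul]
      exact mul_le_mul_of_nonneg_left (Real.exp_le_exp.2 (by nlinarith)) (by positivity)
    have hGn : ‖G y‖ ≤ (|C| * a ^ (-α) + ‖h x‖ * (‖x‖ * a ^ (-1 : ℝ))) * Real.exp (-(min α 1) * u) := by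
      calc ‖G y‖ ≤ ‖h y‖ + ‖h x * (x / y)‖ := norm_sub_le _ _
        _ ≤ |C| * ‖y‖ ^ (-α) + ‖h x‖ * (‖x‖ * ‖y‖ ^ (-1 : ℝ)) := by
            refine add_le_add ((hb y hys).trans ?_) ?_
            · gcongr; exact le_abs_self C
            · rw [norm_mul, norm_div, Real.rpow_neg_one, div_eq_mul_inv]
        _ ≤ |C| * (a ^ (-α) * Real.exp (-(min α 1) * u)) + ‖h x‖ * (‖x‖ * (a ^ (-1 : ℝ) * Real.exp (-(min α 1) * u))) := by
            gcongr
            · exact hpow α (min_le_left _ _)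
            · exact hpow 1 (min_le_right _ _)
        _ = _ := by ring
    have : ‖κ (u + θ * Complex.I)‖ = ‖G y‖ * (‖y‖ / ‖y - x‖) := by
      simp only [κ]
      rw [← hy, hkv y hyx, norm_mul, norm_div]; ring
    rw [this]
    have h5 : ‖y‖ / ‖y - x‖ ≤ 2 := by
      rw [div_le_iff₀ (by linarith)]; linarith
    calc _ ≤ ‖G y‖ * 2 := by gcongr
      _ ≤ _ := by nlinarith [hGn]
  have hzero := integral_hankel_eq_zero hψ (lt_min hα one_pos) hκd hbound hIκ
  simp_rw [hκu] at hzero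
  have h3 : (2 * Real.pi * Complex.I : ℂ) ≠ 0 := by simp [Real.pi_ne_zero]
  have hI1n : Integrable fun u => -(h (hankel ψ a u) * cauchyKernel ψ a x u) := hI1.neg
  rw [integral_const_mul, integral_add hI1n (hI2.const_mul _), integral_neg, integral_const_mul] at hzero
  have hw : ∀ u, x / (a * Complex.exp (hankelLog ψ u) - x) * hankelVel ψ u =
      -(2 * Real.pi * Complex.I) * x * ((hankel ψ a u)⁻¹ * cauchyKernel ψ a x u) := by
    intro u
    have h1 := hne u
    have h2 := hy0 u
    have h4 : hankel ψ a u - x ≠ 0 := by rw [← neg_sub]; exact neg_ne_zero.2 h1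
    rw [← hankel, cauchyKernel, ← neg_sub (hankel ψ a u) x]
    generalize hankel ψ a u = y at *
    generalize (2 * Real.pi * Complex.I : ℂ) = e at *
    field_simp
  have hwind := integral_hankel_winding (ψ := ψ) (a := a) (x := x) (by linarith) hψπ.le ha0 hx (by
    simp_rw [hw]; exact hI2.const_mul _)
  simp_rw [hw] at hwind
  rw [integral_const_mul] at hwind
  have hz := (mul_eq_zero.1 hzero).resolve_left h3
  have hw2 : x * ∫ u, (hankel ψ a u)⁻¹ * cauchyKernel ψ a x u = 1 := by
    have : -(2 * Real.pi * Complex.I) * (x * ∫ u, (hankel ψ a u)⁻¹ * cauchyKernel ψ a x u) = -(2 * Real.pi * Complex.I) * 1 := by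
      rw [← mul_assoc, hwind]; ring
    exact mul_left_cancel₀ (neg_ne_zero.2 h3) this
  linear_combination -hz + h x * hw2

/-! ### Several variables: Borel and Laplace transforms, sectorial functions -/

/-- A version of `integral_pi_eq_of_slices` for a function which is only controlled on a product of
sets containing the curves. -/
theorem integral_pi_eq_of_slices_on {d : ℕ} (μ ν : Fin d → Measure ℝ) [∀ i, SigmaFinite (μ i)]
    [∀ i, SigmaFinite (ν i)] (y y' k k' : Fin d → ℝ → ℂ) (w : ℂ → ℝ) (U : Set ℂ)
    (G : (Fin d → ℂ) → ℂ) (C : ℝ) (hy : ∀ i, Measurable (y i)) (hy' : ∀ i, Measurable (y' i))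
    (hk : ∀ i, Measurable (k i)) (hk' : ∀ i, Measurable (k' i)) (hU : MeasurableSet U)
    (hw : ∀ z, 0 ≤ w z) (hyU : ∀ i, ∀ᵐ u ∂μ i, y i u ∈ U) (hyU' : ∀ i, ∀ᵐ u ∂ν i, y' i u ∈ U)
    (hG : ContinuousOn G (Set.pi univ fun _ => U)) (hGb : ∀ x ∈ Set.pi univ fun _ => U, ‖G x‖ ≤ C * ∏ i, w (x i))
    (hi : ∀ i, Integrable (fun u => w (y i u) * ‖k i u‖) (μ i))
    (hi' : ∀ i, Integrable (fun u => w (y' i u) * ‖k' i u‖) (ν i))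
    (hs : ∀ i x, (∀ j ≠ i, x j ∈ U) → ∫ u, G (Function.update x i (y i u)) * k i u ∂μ i =
      ∫ u, G (Function.update x i (y' i u)) * k' i u ∂ν i) :
    ∫ u, G (fun i => y i (u i)) * ∏ i, k i (u i) ∂Measure.pi μ =
      ∫ u, G (fun i => y' i (u i)) * ∏ i, k' i (u i) ∂Measure.pi ν := by
  classical
  have hP : MeasurableSet (Set.pi univ fun _ : Fin d => U) := MeasurableSet.univ_pi fun _ => hU
  set P : Set (Fin d → ℂ) := Set.pi univ fun _ => U with hPd
  have hGm : Measurable (P.indicator G) := by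
    rw [← Set.piecewise_eq_indicator]
    exact hG.measurable_piecewise continuousOn_const hP
  have hae : ∀ (μ : Fin d → Measure ℝ) [∀ i, SigmaFinite (μ i)] (y k : Fin d → ℝ → ℂ), (∀ i, ∀ᵐ u ∂μ i, y i u ∈ U) →
      ∫ u, G (fun i => y i (u i)) * ∏ i, k i (u i) ∂Measure.pi μ =
      ∫ u, P.indicator G (fun i => y i (u i)) * ∏ i, k i (u i) ∂Measure.pi μ := by
    intro μ _ y k h
    refine integral_congr_ae ?_
    have : ∀ᵐ u ∂Measure.pi μ, ∀ i, y i (u i) ∈ U :=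
      eventually_countable_forall.2 fun i => (Measure.quasiMeasurePreserving_eval μ i).ae (h i)
    filter_upwards [this] with u hu
    rw [indicator_of_mem (show (fun i => y i (u i)) ∈ P from fun i _ => hu i)]
  rw [hae μ y k hyU, hae ν y' k' hyU']
  -- The global version is applied to G extended by zero; a slice with another coordinate outside U
  -- then vanishes identically.
  refine integral_pi_eq_of_slices μ ν y y' k k' (fun _ => w) (P.indicator G) |C| hy hy' hk hk' hGm ?_ hi hi' ?_
  · intro x
    by_cases hx : x ∈ P
    · rw [indicator_of_mem hx]
      refine (hGb x hx).trans (mul_le_mul_of_nonneg_right (le_abs_self C) ?_)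
      exact Finset.prod_nonneg fun i _ => hw _
    · rw [indicator_of_notMem hx, norm_zero]
      exact mul_nonneg (abs_nonneg _) (Finset.prod_nonneg fun i _ => hw _)
  · intro i x
    by_cases hx : ∀ j ≠ i, x j ∈ U
    · have hmem : ∀ z ∈ U, Function.update x i z ∈ P := by
        intro z hz j _
        by_cases hj : j = i
        · subst hj; simpa using hz
        · simpa [hj] using hx j hj
      have e : ∀ (μ : Fin d → Measure ℝ) (y k : Fin d → ℝ → ℂ), (∀ i, ∀ᵐ u ∂μ i, y i u ∈ U) →
          ∫ u, P.indicator G (Function.update x i (y i u)) * k i u ∂μ i =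
          ∫ u, G (Function.update x i (y i u)) * k i u ∂μ i := by
        intro μ y k h
        refine integral_congr_ae ?_
        filter_upwards [h i] with u hu
        rw [indicator_of_mem (hmem _ hu)]
      rw [e μ y k hyU, e ν y' k' hyU', hs i x hx]
    · have hnot : ∀ z, Function.update x i z ∉ P := by
        intro z hz
        refine hx fun j hj => ?_
        simpa [hj] using hz j (mem_univ _)
      simp [indicator_of_notMem (hnot _)]

/-- The closed polysector `|arg pᵢ| ≤ σ`, `pᵢ ≠ 0`. -/
def csector (d : ℕ) (σ : ℝ) : Set (Fin d → ℂ) := {p | ∀ i, p i ≠ 0 ∧ |Complex.arg (p i)| ≤ σ}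

/-- The open sector `|arg z| < σ`, `z ≠ 0`. -/
def osector (σ : ℝ) : Set ℂ := {z | z ≠ 0 ∧ |Complex.arg z| < σ}

theorem isOpen_osector {σ : ℝ} (hσ : σ ≤ Real.pi) : IsOpen (osector σ) := by
  refine isOpen_iff_mem_nhds.2 fun z hz => ?_
  have hs : z ∈ Complex.slitPlane := by
    rw [Complex.mem_slitPlane_iff_arg]
    exact ⟨fun h => by have := hz.2; rw [h, abs_of_pos Real.pi_pos] at this; linarith, hz.1⟩
  have h1 := ((Complex.continuousAt_arg hs).abs).eventually (gt_mem_nhds hz.2)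
  filter_upwards [h1, isOpen_ne.mem_nhds hz.1] with w hw hw0 using ⟨hw0, hw⟩

/-- Functions on the Borel plane: jointly continuous on the closed polysector, and holomorphic in
each variable. -/
structure IsBorel {d : ℕ} (σ T : ℝ) (F : (Fin d → ℂ) → ℝ → ℂ) : Prop where
  cont : ContinuousOn (fun z : (Fin d → ℂ) × ℝ => F z.1 z.2) (csector d σ ×ˢ Icc 0 T)
  holo : ∀ t ∈ Icc 0 T, ∀ p ∈ csector d σ, ∀ i,
    DifferentiableOn ℂ (fun z => F (Function.update p i z) t) (osector σ)

/-- Functions which are jointly continuous, holomorphic in each space variable and `O(x^{-α})`. -/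
structure IsSectorial {d : ℕ} (φ ρ T α C : ℝ) (g : (Fin d → ℂ) → ℝ → ℂ) : Prop where
  cont : ContinuousOn (fun z : (Fin d → ℂ) × ℝ => g z.1 z.2) (polysector d φ ρ ×ˢ Icc 0 T)
  holo : ∀ t ∈ Icc 0 T, ∀ x ∈ polysector d φ ρ, ∀ i,
    DifferentiableOn ℂ (fun z => g (Function.update x i z) t) (sector φ ρ)
  bound : ∀ x ∈ polysector d φ ρ, ∀ t ∈ Icc 0 T, ‖g x t‖ ≤ C * ∏ i, ‖x i‖ ^ (-α)

/-- Lebesgue measure on the positive orthant. -/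
noncomputable abbrev orthant (d : ℕ) : Measure (Fin d → ℝ) :=
  Measure.pi fun _ => volume.restrict (Ioi 0)

/-- The Laplace transform along the rays `arg pᵢ = θᵢ`. -/
noncomputable def laplace {d : ℕ} (θ : Fin d → ℝ) (F : (Fin d → ℂ) → ℂ) (x : Fin d → ℂ) : ℂ :=
  ∫ s, F (fun i => s i * Complex.exp (θ i * Complex.I)) *
    ∏ i, (Complex.exp (θ i * Complex.I) * Complex.exp (-(s i * Complex.exp (θ i * Complex.I) * x i)))
    ∂orthant d

/-- The Borel transform along Hankel contours of radii `aᵢ`. -/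
noncomputable def borelTransform {d : ℕ} (σ' : ℝ) (a : Fin d → ℝ) (g : (Fin d → ℂ) → ℂ) (p : Fin d → ℂ) : ℂ :=
  ∫ u, g (fun i => hankel (Real.pi / 2 + σ') (a i) (u i)) *
    ∏ i, borelKernel (Real.pi / 2 + σ') (a i) (p i) (u i) ∂(Measure.pi fun _ => volume)

theorem update_mem_polysector {d : ℕ} {φ ρ : ℝ} {x : Fin d → ℂ} {i : Fin d} {z : ℂ} (hz : z ∈ sector φ ρ)
    (hx : ∀ j ≠ i, x j ∈ sector φ ρ) : Function.update x i z ∈ polysector d φ ρ := by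
  intro j
  by_cases hj : j = i
  · subst hj; simpa [sector] using hz
  · simpa [hj, sector] using hx j hj

theorem laplace_zero {d : ℕ} (F : (Fin d → ℂ) → ℂ) (x : Fin d → ℂ) :
    laplace 0 F x = ∫ s, F (fun i => (s i : ℂ)) * ∏ i, Complex.exp (-(s i * x i)) ∂orthant d := by
  simp [laplace]

namespace IsSectorial

variable {d : ℕ} {φ ρ T α C : ℝ} {g : (Fin d → ℂ) → ℝ → ℂ}

theorem continuousOn (h : IsSectorial φ ρ T α C g) {t : ℝ} (ht : t ∈ Icc 0 T) :
    ContinuousOn (fun x => g x t) (polysector d φ ρ) :=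
  h.cont.comp (f := fun x => (x, t)) (by fun_prop) fun x hx => ⟨hx, ht⟩

/-- Reduction to one variable with the same decay exponent, as the contour lemmas need. The i-th
entry of x is irrelevant, so a large real number is put there before `holo` is used. -/
theorem slice (h : IsSectorial φ ρ T α C g) (hφ : 0 ≤ φ) (hρ : 0 ≤ ρ) {t : ℝ} (ht : t ∈ Icc 0 T)
    {i : Fin d} {x : Fin d → ℂ} (hx : ∀ j ≠ i, x j ∈ sector φ ρ) :
    DifferentiableOn ℂ (fun z => g (Function.update x i z) t) (sector φ ρ) ∧
    ∃ C', ∀ z ∈ sector φ ρ, ‖g (Function.update x i z) t‖ ≤ C' * ‖z‖ ^ (-α) := by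
  have hz : ((ρ + 1 : ℝ) : ℂ) ∈ sector φ ρ := mem_sector_of_lt_re hφ hρ (by simp)
  constructor
  · have := h.holo t ht _ (update_mem_polysector hz hx) i
    simpa using this
  · refine ⟨C * ∏ j ∈ Finset.univ.erase i, ‖x j‖ ^ (-α), fun z hz => ?_⟩
    refine (h.bound _ (update_mem_polysector hz hx) t ht).trans (le_of_eq ?_)
    rw [← Finset.mul_prod_erase _ _ (Finset.mem_univ i), Function.update_self, mul_assoc, mul_comm (‖z‖ ^ (-α))]
    congr 2
    refine Finset.prod_congr rfl fun j hj => ?_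
    rw [Function.update_of_ne (Finset.ne_of_mem_erase hj)]

/-- The Borel transform does not depend on the radii of the contours. -/
theorem borel_eq (h : IsSectorial φ ρ T α C g) {σ σ' : ℝ} (h1 : σ < σ') (h2 : σ' < φ)
    (h3 : φ ≤ Real.pi / 4) (hρ : 0 ≤ ρ) (hα : 0 ≤ α) {a a' : Fin d → ℝ} (ha : ∀ i, ρ < a i) (ha' : ∀ i, ρ < a' i)
    {p : Fin d → ℂ} (hp : p ∈ csector d σ) {t : ℝ} (ht : t ∈ Icc 0 T) :
    borelTransform σ' a (fun x => g x t) p = borelTransform σ' a' (fun x => g x t) p := by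
  rcases isEmpty_or_nonempty (Fin d) with hd | ⟨⟨i₀⟩⟩
  · have : a = a' := Subsingleton.elim _ _
    rw [this]
  have hσ : 0 ≤ σ := (abs_nonneg _).trans (hp i₀).2
  have hpi := Real.pi_pos
  have hs : σ + σ' ≤ Real.pi / 2 := by linarith
  have hP : Set.pi univ (fun _ : Fin d => sector φ ρ) = polysector d φ ρ := (polysector_eq_pi d φ ρ).symm
  have hmem : ∀ a, ρ < a → ∀ u, hankel (Real.pi / 2 + σ') a u ∈ sector φ ρ := fun a ha u =>
    hankel_mem_sector (by linarith) (by linarith) (by linarith) hρ ha u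
  unfold borelTransform
  refine integral_pi_eq_of_slices_on (fun _ => volume) (fun _ => volume) _ _ _ _ (fun z => ‖z‖ ^ (-α)) (sector φ ρ) (fun x => g x t) C
    (fun i => (continuous_hankel _ _).measurable) (fun i => (continuous_hankel _ _).measurable)
    (fun i => measurable_borelKernel _ _ _) (fun i => measurable_borelKernel _ _ _)
    (isOpen_sector (by linarith) hρ).measurableSet (fun z => by positivity)
    (fun i => Eventually.of_forall (hmem _ (ha i))) (fun i => Eventually.of_forall (hmem _ (ha' i))) ?_ ?_
    (fun i => integrable_rpow_mul_borelKernel h1 hs (hρ.trans_lt (ha i)) hα (hp i).2 (hp i).1)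
    (fun i => integrable_rpow_mul_borelKernel h1 hs (hρ.trans_lt (ha' i)) hα (hp i).2 (hp i).1) ?_
  · rw [hP]; exact h.continuousOn ht
  · rw [hP]; exact fun x hx => h.bound x hx t ht
  · intro i x hx
    obtain ⟨hd, C', hC'⟩ := h.slice (by linarith) hρ ht hx
    rcases le_total (a i) (a' i) with hle | hle
    · exact integral_borelKernel_shift h1 hs h2 (by linarith) hρ hα (ha i) hle hd hC' (hp i).2 (hp i).1
    · exact (integral_borelKernel_shift h1 hs h2 (by linarith) hρ hα (ha' i) hle hd hC' (hp i).2 (hp i).1).symm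

end IsSectorial

/-! ### Bounds and regularity of the Borel transform -/

/-- The constant in the bound of the Borel transform. -/
noncomputable def borelConst (σ σ' : ℝ) : ℝ :=
  Real.exp 2 * ∫ u, Real.exp (hankelRe (Real.pi / 2 + σ') u) *
    Real.exp (-(Real.sin (σ' - σ)) * Real.exp (hankelRe (Real.pi / 2 + σ') u))

theorem borelConst_nonneg (σ σ' : ℝ) : 0 ≤ borelConst σ σ' :=
  mul_nonneg (Real.exp_pos _).le (integral_nonneg fun u => by positivity)

/-- The radius a = a₀ + 1/|p| is adapted to p: since |p| a = 1 + a₀|p| ≥ 1, the decay rate along the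
rays is bounded below independently of p, and a^{1-α} produces |p|^{α-1}. The factor e^{3a₀|p|}
collects the growth on the arc, which costs 2a₀|p|, and the power (1 + a₀|p|)^{1-α}. -/
theorem integral_rpow_mul_borelKernel_le {σ σ' a₀ α : ℝ} (h1 : σ < σ')
    (hs : σ + σ' ≤ Real.pi / 2) (ha : 0 < a₀) (hα : 0 ≤ α) {p : ℂ} (hp : |Complex.arg p| ≤ σ) (hp0 : p ≠ 0) :
    ∫ u, ‖hankel (Real.pi / 2 + σ') (a₀ + ‖p‖⁻¹) u‖ ^ (-α) * ‖borelKernel (Real.pi / 2 + σ') (a₀ + ‖p‖⁻¹) p u‖ ≤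
      borelConst σ σ' * (‖p‖ ^ (α - 1) * Real.exp (3 * a₀ * ‖p‖)) := by
  have hσ0 : 0 ≤ σ := (abs_nonneg _).trans hp
  have hpi := Real.pi_pos
  have hc : 0 < Real.sin (σ' - σ) := Real.sin_pos_of_pos_of_lt_pi (by linarith) (by linarith)
  have hc1 : Real.sin (σ' - σ) ≤ 1 := Real.sin_le_one _
  have hp1 : 0 < ‖p‖ := norm_pos_iff.2 hp0
  set a := a₀ + ‖p‖⁻¹ with had
  have ha0 : 0 < a := by positivity
  have hq : ‖p‖ * a = 1 + a₀ * ‖p‖ := by rw [had]; field_simp; ring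
  have hap : 0 < a₀ * ‖p‖ := by positivity
  have hkey : a ^ (-α) * (a * Real.exp (‖p‖ * a * (1 + Real.sin (σ' - σ)))) ≤
      Real.exp 2 * (‖p‖ ^ (α - 1) * Real.exp (3 * a₀ * ‖p‖)) := by
    have e1 : a ^ (-α) * a = ‖p‖ ^ (α - 1) * (1 + a₀ * ‖p‖) ^ (1 - α) := by
      have : a = (1 + a₀ * ‖p‖) * ‖p‖⁻¹ := by rw [← hq]; field_simp
      rw [show a ^ (-α) * a = a ^ (1 - α) by
        rw [show (1 : ℝ) - α = -α + 1 by ring, Real.rpow_add_one ha0.ne'],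
        this, Real.mul_rpow (by positivity) (by positivity), Real.inv_rpow hp1.le, ← Real.rpow_neg hp1.le, mul_comm]
      congr 2; ring
    have e2 : (1 + a₀ * ‖p‖) ^ (1 - α) ≤ Real.exp (a₀ * ‖p‖) := by
      calc (1 + a₀ * ‖p‖) ^ (1 - α) ≤ (1 + a₀ * ‖p‖) ^ (1 : ℝ) :=
            Real.rpow_le_rpow_of_exponent_le (by linarith) (by linarith)
        _ ≤ _ := by rw [Real.rpow_one]; linarith [Real.add_one_le_exp (a₀ * ‖p‖)]
    have e3 : Real.exp (‖p‖ * a * (1 + Real.sin (σ' - σ))) ≤ Real.exp (2 + 2 * (a₀ * ‖p‖)) := by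
      rw [hq]; exact Real.exp_le_exp.2 (by nlinarith)
    rw [← mul_assoc, e1]
    calc _ ≤ ‖p‖ ^ (α - 1) * Real.exp (a₀ * ‖p‖) * Real.exp (2 + 2 * (a₀ * ‖p‖)) := by gcongr
      _ = _ := by
        rw [show 3 * a₀ * ‖p‖ = a₀ * ‖p‖ + 2 * (a₀ * ‖p‖) by ring, Real.exp_add, Real.exp_add]; ring
  calc _ ≤ ∫ u, (Real.exp 2 * (‖p‖ ^ (α - 1) * Real.exp (3 * a₀ * ‖p‖))) * (Real.exp (hankelRe (Real.pi / 2 + σ') u) *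
        Real.exp (-(Real.sin (σ' - σ)) * Real.exp (hankelRe (Real.pi / 2 + σ') u))) := by
        refine integral_mono (integrable_rpow_mul_borelKernel h1 hs ha0 hα hp hp0)
          ((integrable_hankel_exp _ hc).const_mul _) fun u => ?_
        refine (norm_rpow_mul_borelKernel_le h1 hs ha0 hα hp u).trans ?_
        have hE := Real.exp_pos (hankelRe (Real.pi / 2 + σ') u)
        refine mul_le_mul hkey ?_ (by positivity) (by positivity)
        refine mul_le_mul_of_nonneg_left (Real.exp_le_exp.2 ?_) hE.le
        rw [hq]
        refine mul_le_mul_of_nonneg_right ?_ hE.le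
        nlinarith
    _ = _ := by rw [integral_const_mul, borelConst]; ring

namespace IsSectorial

variable {d : ℕ} {φ ρ T α C : ℝ} {g : (Fin d → ℂ) → ℝ → ℂ}

theorem aestronglyMeasurable_integrand (h : IsSectorial φ ρ T α C g) {σ' : ℝ} (h0 : 0 ≤ σ') (h2 : σ' < φ)
    (h3 : φ ≤ Real.pi / 4) (hρ : 0 ≤ ρ) {a : Fin d → ℝ} (ha : ∀ i, ρ < a i) (p : Fin d → ℂ) {t : ℝ} (ht : t ∈ Icc 0 T) :
    AEStronglyMeasurable (fun u : Fin d → ℝ => g (fun i => hankel (Real.pi / 2 + σ') (a i) (u i)) t *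
      ∏ i, borelKernel (Real.pi / 2 + σ') (a i) (p i) (u i)) (Measure.pi fun _ => volume) := by
  have hpi := Real.pi_pos
  refine AEStronglyMeasurable.mul (Continuous.aestronglyMeasurable ?_) (Measurable.aestronglyMeasurable ?_)
  · refine (h.continuousOn ht).comp_continuous ?_ fun u i => ?_
    · exact continuous_pi fun i => (continuous_hankel _ _).comp (continuous_apply i)
    · exact hankel_mem_sector (by linarith) (by linarith) (by linarith) hρ (ha i) _
  · exact Finset.measurable_prod _ fun i _ => (measurable_borelKernel _ _ _).comp (measurable_pi_apply i)

theorem norm_integrand_le (h : IsSectorial φ ρ T α C g) {σ' : ℝ} (h0 : 0 ≤ σ') (h2 : σ' < φ)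
    (h3 : φ ≤ Real.pi / 4) (hρ : 0 ≤ ρ) {a : Fin d → ℝ} (ha : ∀ i, ρ < a i) (p : Fin d → ℂ) {t : ℝ} (ht : t ∈ Icc 0 T)
    (u : Fin d → ℝ) :
    ‖g (fun i => hankel (Real.pi / 2 + σ') (a i) (u i)) t *
      ∏ i, borelKernel (Real.pi / 2 + σ') (a i) (p i) (u i)‖ ≤
    C * ∏ i, (‖hankel (Real.pi / 2 + σ') (a i) (u i)‖ ^ (-α) *
      ‖borelKernel (Real.pi / 2 + σ') (a i) (p i) (u i)‖) := by
  have hpi := Real.pi_pos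
  rw [norm_mul, norm_prod, Finset.prod_mul_distrib, ← mul_assoc]
  refine mul_le_mul_of_nonneg_right ?_ (Finset.prod_nonneg fun _ _ => norm_nonneg _)
  · exact h.bound _ (fun i => hankel_mem_sector (by linarith) (by linarith) (by linarith) hρ (ha i) _) t ht

/-- The bound of the Borel transform. -/
theorem norm_borel_le (h : IsSectorial φ ρ T α C g) {σ σ' : ℝ} (h00 : 0 ≤ σ) (h1 : σ < σ') (h2 : σ' < φ)
    (h3 : φ ≤ Real.pi / 4) (hρ : 0 ≤ ρ) (hα : 0 ≤ α) (hC : 0 ≤ C) {a : ℝ} (ha : ρ < a)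
    {p : Fin d → ℂ} (hp : p ∈ csector d σ) {t : ℝ} (ht : t ∈ Icc 0 T) :
    ‖borelTransform σ' (fun _ => a) (fun x => g x t) p‖ ≤
      C * ∏ i, (borelConst σ σ' * (‖p i‖ ^ (α - 1) * Real.exp (3 * a * ‖p i‖))) := by
  have hpi := Real.pi_pos
  have ha0 : 0 < a := hρ.trans_lt ha
  have hs : σ + σ' ≤ Real.pi / 2 := by linarith
  have hb : ∀ i, ρ < a + ‖p i‖⁻¹ := fun i => ha.trans_le (by simp)
  -- Independence of the radii allows a different contour for each p and each coordinate.
  rw [h.borel_eq h1 h2 h3 hρ hα (fun _ => ha) hb hp ht, borelTransform]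
  have hI := fun i => integrable_rpow_mul_borelKernel (σ := σ) (σ' := σ') (a := a + ‖p i‖⁻¹) (α := α) h1 hs (hρ.trans_lt (hb i)) hα (hp i).2 (hp i).1
  refine (norm_integral_le_of_norm_le ((Integrable.fintype_prod hI).const_mul C)
    (Eventually.of_forall fun u => h.norm_integrand_le (by linarith) h2 h3 hρ hb p ht u)).trans ?_
  rw [integral_const_mul, integral_fintype_prod_eq_prod (f := fun i u => ‖hankel (Real.pi / 2 + σ') (a + ‖p i‖⁻¹) u‖ ^ (-α) *
    ‖borelKernel (Real.pi / 2 + σ') (a + ‖p i‖⁻¹) (p i) u‖)]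
  refine mul_le_mul_of_nonneg_left (Finset.prod_le_prod (fun i _ => integral_nonneg fun u => by positivity) fun i _ => ?_) hC
  exact integral_rpow_mul_borelKernel_le h1 hs ha0 hα (hp i).2 (hp i).1

/-- For regularity, unlike for the sharp bound, the contour stays fixed, so p enters only through
exponentials. On a region m ≤ |pᵢ| ≤ M the lower bounds control the decay rate and the upper bounds
the prefactor, which gives locally uniform domination. -/
theorem isBorel (h : IsSectorial φ ρ T α C g) {σ σ' : ℝ} (h00 : 0 ≤ σ) (h1 : σ < σ') (h2 : σ' < φ)
    (h3 : φ ≤ Real.pi / 4) (hρ : 0 ≤ ρ) (hα : 0 ≤ α) (hC : 0 ≤ C) {a : ℝ} (ha : ρ < a) :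
    IsBorel σ T fun p t => borelTransform σ' (fun _ : Fin d => a) (fun x => g x t) p := by
  have hpi := Real.pi_pos
  have ha0 : 0 < a := hρ.trans_lt ha
  have hs : σ + σ' ≤ Real.pi / 2 := by linarith
  have hc : 0 < Real.sin (σ' - σ) := Real.sin_pos_of_pos_of_lt_pi (by linarith) (by linarith)
  set ψ := Real.pi / 2 + σ' with hψ
  have hmem : ∀ u, hankel ψ a u ∈ sector φ ρ := hankel_mem_sector (by linarith) (by linarith) (by linarith) hρ ha
  -- the locally uniform majorant
  let B : (Fin d → ℝ) → (Fin d → ℝ) → (Fin d → ℝ) → ℝ := fun m M u =>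
    C * ∏ i, ((a ^ (-α) * (a * Real.exp (M i * a * (1 + Real.sin (σ' - σ))))) *
      (Real.exp (hankelRe ψ (u i)) * Real.exp (-(m i * a * Real.sin (σ' - σ)) * Real.exp (hankelRe ψ (u i)))))
  have hBi : ∀ m M : Fin d → ℝ, (∀ i, 0 < m i) → Integrable (B m M) (Measure.pi fun _ => volume) := by
    intro m M hm
    refine Integrable.const_mul ?_ C
    refine Integrable.fintype_prod (f := fun i u => (a ^ (-α) * (a * Real.exp (M i * a * (1 + Real.sin (σ' - σ))))) *
      (Real.exp (hankelRe ψ u) * Real.exp (-(m i * a * Real.sin (σ' - σ)) * Real.exp (hankelRe ψ u)))) fun i => ?_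
    exact (integrable_hankel_exp ψ (by have := hm i; positivity)).const_mul _
  have hB : ∀ (m M : Fin d → ℝ) (p : Fin d → ℂ) (t : ℝ), t ∈ Icc 0 T → p ∈ csector d σ → (∀ i, m i ≤ ‖p i‖ ∧ ‖p i‖ ≤ M i) →
      ∀ u : Fin d → ℝ, ‖g (fun i => hankel ψ a (u i)) t * ∏ i, borelKernel ψ a (p i) (u i)‖ ≤ B m M u := by
    intro m M p t ht hp hpm u
    refine (h.norm_integrand_le (by linarith) h2 h3 hρ (fun _ => ha) p ht u).trans ?_
    refine mul_le_mul_of_nonneg_left (Finset.prod_le_prod (fun i _ => by positivity) fun i _ => ?_) hC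
    refine (norm_rpow_mul_borelKernel_le h1 hs ha0 hα (hp i).2 (u i)).trans ?_
    have hE := Real.exp_pos (hankelRe ψ (u i))
    have := hpm i
    gcongr
    · exact this.2
    · exact this.1
  constructor
  · rintro ⟨p₀, t₀⟩ ⟨hp₀, ht₀⟩
    have hn : ∀ i, 0 < ‖p₀ i‖ := fun i => norm_pos_iff.2 (hp₀ i).1
    have hev : ∀ᶠ z : (Fin d → ℂ) × ℝ in 𝓝[csector d σ ×ˢ Icc 0 T] (p₀, t₀),
        z ∈ csector d σ ×ˢ Icc 0 T ∧ ∀ i, ‖p₀ i‖ / 2 ≤ ‖z.1 i‖ ∧ ‖z.1 i‖ ≤ 2 * ‖p₀ i‖ := by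
      refine (eventually_mem_nhdsWithin).and (nhdsWithin_le_nhds (eventually_all.2 fun i => ?_))
      have hc : Continuous fun z : (Fin d → ℂ) × ℝ => ‖z.1 i‖ := by fun_prop
      have h1 := hc.continuousAt.eventually (lt_mem_nhds (show ‖p₀ i‖ / 2 < ‖(p₀, t₀).1 i‖ by have := hn i; simp only; linarith))
      have h2 := hc.continuousAt.eventually (gt_mem_nhds (show ‖(p₀, t₀).1 i‖ < 2 * ‖p₀ i‖ by have := hn i; simp only; linarith))
      filter_upwards [h1, h2] with z h1 h2 using ⟨h1.le, h2.le⟩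
    refine continuousWithinAt_of_dominated (bound := B (fun i => ‖p₀ i‖ / 2) (fun i => 2 * ‖p₀ i‖)) ?_ ?_
      (hBi _ _ fun i => by have := hn i; positivity) ?_
    · filter_upwards [hev] with z hz
      exact h.aestronglyMeasurable_integrand (by linarith) h2 h3 hρ (fun _ => ha) z.1 hz.1.2
    · filter_upwards [hev] with z hz
      exact Eventually.of_forall fun u => hB _ _ z.1 z.2 hz.1.2 hz.1.1 hz.2 u
    · refine Eventually.of_forall fun u => ContinuousWithinAt.mul ?_ ?_
      · have hc := h.cont ((fun i => hankel ψ a (u i)), t₀) ⟨fun i => hmem (u i), ht₀⟩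
        exact hc.comp (f := fun z : (Fin d → ℂ) × ℝ => ((fun i => hankel ψ a (u i)), z.2)) (x := (p₀, t₀)) (by fun_prop) fun z hz => ⟨fun i => hmem (u i), hz.2⟩
      · refine Continuous.continuousWithinAt (continuous_finsetProd _ fun i _ => ?_)
        unfold borelKernel
        fun_prop
  · intro t ht p₀ hp₀ i
    refine differentiableOn_integral_of_dominated (isOpen_osector (by linarith)) ?_ ?_ ?_
    · intro z hz
      exact h.aestronglyMeasurable_integrand (by linarith) h2 h3 hρ (fun _ => ha) _ ht
    · refine Eventually.of_forall fun u => DifferentiableOn.const_mul ?_ _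
      refine DifferentiableOn.fun_finsetProd fun j _ => ?_
      unfold borelKernel
      by_cases hj : j = i
      · subst hj; simp only [Function.update_self]; fun_prop
      · simp only [Function.update_of_ne hj]; fun_prop
    · intro z₀ hz₀
      have hn : 0 < ‖z₀‖ := norm_pos_iff.2 hz₀.1
      refine ⟨‖z₀‖ / 2, by positivity, B (fun j => if j = i then ‖z₀‖ / 2 else ‖p₀ j‖) (fun j => if j = i then 2 * ‖z₀‖ else ‖p₀ j‖),
        hBi _ _ fun j => ?_, Eventually.of_forall fun u z hz hzU => ?_⟩
      · have := norm_pos_iff.2 (hp₀ j).1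
        split_ifs <;> positivity
      · refine hB _ _ _ t ht (fun j => ?_) (fun j => ?_) u
        · by_cases hj : j = i
          · subst hj; simpa using ⟨hzU.1, hzU.2.le⟩
          · simpa [hj] using hp₀ j
        · by_cases hj : j = i
          · subst hj
            simp only [Function.update_self, if_true]
            rw [Metric.mem_ball, dist_eq_norm] at hz
            have e1 := norm_sub_norm_le z z₀
            have e2 := norm_sub_norm_le z₀ z
            rw [norm_sub_rev] at e2
            constructor <;> linarith
          · simp [hj]

end IsSectorial

/-! ### Laplace inversion of the Borel transform -/

theorem integrableOn_borelKernel_mul_exp {ψ a u : ℝ} {x : ℂ} (h : (hankel ψ a u).re < x.re) :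
    IntegrableOn (fun s : ℝ => borelKernel ψ a s u * Complex.exp (-(s * x))) (Ioi 0) := by
  have e : (fun s : ℝ => borelKernel ψ a s u * Complex.exp (-(s * x))) =
      fun s : ℝ => ((2 * Real.pi * Complex.I)⁻¹ * hankel ψ a u * hankelVel ψ u) * Complex.exp ((hankel ψ a u - x) * s) := by
    ext s
    rw [borelKernel, show (hankel ψ a u - x) * s = s * hankel ψ a u + -(s * x) by ring, Complex.exp_add]; ring
  rw [e]
  exact (integrableOn_exp_mul_complex_Ioi (by simpa using h) 0).const_mul _

/-- In s the integrand is a constant times e^{(y-x)s}, with y on the contour to the left of x. The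
Laplace integral of the Borel kernel is therefore the Cauchy kernel. -/
theorem integral_borelKernel_mul_exp {ψ a u : ℝ} {x : ℂ} (h : (hankel ψ a u).re < x.re) :
    ∫ s : ℝ in Ioi 0, borelKernel ψ a s u * Complex.exp (-(s * x)) = cauchyKernel ψ a x u := by
  have e : (fun s : ℝ => borelKernel ψ a s u * Complex.exp (-(s * x))) =
      fun s : ℝ => ((2 * Real.pi * Complex.I)⁻¹ * hankel ψ a u * hankelVel ψ u) * Complex.exp ((hankel ψ a u - x) * s) := by
    ext s
    rw [borelKernel, show (hankel ψ a u - x) * s = s * hankel ψ a u + -(s * x) by ring, Complex.exp_add]; ring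
  rw [e, integral_const_mul, integral_exp_mul_complex_Ioi (by simpa using h) 0, cauchyKernel, ← neg_sub x, div_neg]
  simp [div_eq_mul_inv]

theorem integral_norm_borelKernel_mul_exp {ψ a u : ℝ} {x : ℂ} (h : (hankel ψ a u).re < x.re) :
    ∫ s : ℝ in Ioi 0, ‖borelKernel ψ a s u * Complex.exp (-(s * x))‖ =
      ‖(2 * Real.pi * Complex.I)⁻¹ * hankel ψ a u * hankelVel ψ u‖ / (x.re - (hankel ψ a u).re) := by
  have e : (fun s : ℝ => ‖borelKernel ψ a s u * Complex.exp (-(s * x))‖) =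
      fun s : ℝ => ‖(2 * Real.pi * Complex.I)⁻¹ * hankel ψ a u * hankelVel ψ u‖ * Real.exp (((hankel ψ a u).re - x.re) * s) := by
    ext s
    have e1 : borelKernel ψ a s u * Complex.exp (-(s * x)) = ((2 * Real.pi * Complex.I)⁻¹ * hankel ψ a u * hankelVel ψ u) * Complex.exp ((hankel ψ a u - x) * s) := by
      rw [borelKernel, show (hankel ψ a u - x) * s = s * hankel ψ a u + -(s * x) by ring, Complex.exp_add]; ring
    rw [e1, norm_mul, Complex.norm_exp]
    simp
  rw [e, integral_const_mul, integral_exp_mul_Ioi (by linarith) 0, ← neg_sub x.re]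
  simp only [mul_zero, Real.exp_zero, neg_div_neg_eq]
  ring

namespace IsSectorial

variable {d : ℕ} {φ ρ T α C : ℝ} {g : (Fin d → ℂ) → ℝ → ℂ}

/-- The Laplace transform inverts the Borel transform. -/
theorem laplace_borel (h : IsSectorial φ ρ T α C g) {σ' : ℝ} (h0 : 0 < σ') (h2 : σ' < φ)
    (h3 : φ ≤ Real.pi / 4) (hρ : 0 ≤ ρ) (hα : 0 < α) {a : ℝ} (ha : ρ < a)
    {t : ℝ} (ht : t ∈ Icc 0 T) {x : Fin d → ℂ} (hx : ∀ i, a < (x i).re) :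
    laplace 0 (borelTransform σ' (fun _ => a) (fun x => g x t)) x = g x t := by
  have hpi := Real.pi_pos
  have ha0 : 0 < a := hρ.trans_lt ha
  have hs : σ' ≤ Real.pi / 2 := by linarith
  set ψ := Real.pi / 2 + σ' with hψ
  have hmem : ∀ u, hankel ψ a u ∈ sector φ ρ := hankel_mem_sector (by linarith) (by linarith) (by linarith) hρ ha
  have hP : Set.pi univ (fun _ : Fin d => sector φ ρ) = polysector d φ ρ := (polysector_eq_pi d φ ρ).symm
  have hm := fun i => exists_le_re_sub_hankel h0 hs ha0 (hx i)
  choose m hm0 hm using hm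
  have hlt : ∀ i u, (hankel ψ a u).re < (x i).re := fun i u => by
    have := hm i u
    have := mul_pos (hm0 i) (Real.exp_pos (hankelRe ψ u))
    linarith
  have hgm : Continuous fun u : Fin d → ℝ => g (fun i => hankel ψ a (u i)) t :=
    (h.continuousOn ht).comp_continuous (continuous_pi fun i => (continuous_hankel _ _).comp (continuous_apply i)) fun u i => hmem _
  let f : (Fin d → ℝ) × (Fin d → ℝ) → ℂ := fun z => g (fun i => hankel ψ a (z.2 i)) t *
    ∏ i, (borelKernel ψ a (z.1 i) (z.2 i) * Complex.exp (-(z.1 i * x i)))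
  have hfm : Measurable f := by
    refine Measurable.mul (hgm.measurable.comp measurable_snd) (Finset.measurable_prod _ fun i _ => ?_)
    unfold borelKernel
    have := (continuous_hankel ψ a).measurable
    have := measurable_hankelVel ψ
    fun_prop
  have hprod : ∀ u : Fin d → ℝ, Integrable (fun s : Fin d → ℝ => ∏ i, (borelKernel ψ a (s i) (u i) * Complex.exp (-(s i * x i)))) (orthant d) := 
    fun u => Integrable.fintype_prod (f := fun i (s : ℝ) => borelKernel ψ a s (u i) * Complex.exp (-(s * x i)))
      fun i => integrableOn_borelKernel_mul_exp (hlt i _)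
  -- Hypothesis of Fubini: integrating |f| over s first costs a/mᵢ per coordinate, uniformly in u;
  -- the remaining factor ∏ |yᵢ|^{-α} is integrable because α > 0.
  have hfi : Integrable f ((orthant d).prod (Measure.pi fun _ => volume)) := by
    rw [integrable_prod_iff' hfm.aestronglyMeasurable]
    refine ⟨Eventually.of_forall fun u => (hprod u).const_mul (g (fun i => hankel ψ a (u i)) t), ?_⟩
    have hb : Integrable (fun u : Fin d → ℝ => C * ∏ i, ((a ^ (-α) * (a / m i)) * Real.exp (-α * hankelRe ψ (u i)))) (Measure.pi fun _ => volume) :=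
      (Integrable.fintype_prod (f := fun i u => (a ^ (-α) * (a / m i)) * Real.exp (-α * hankelRe ψ u))
        fun i => (integrable_exp_neg_hankelRe ψ hα).const_mul _).const_mul C
    refine hb.mono' ?_ (Eventually.of_forall fun u => ?_)
    · exact hfm.norm.aestronglyMeasurable.prod_swap.integral_prod_right'
    · rw [Real.norm_of_nonneg (integral_nonneg fun _ => norm_nonneg _)]
      simp only [f, norm_mul, norm_prod]
      rw [integral_const_mul]
      have e := integral_fintype_prod_eq_prod (μ := fun _ : Fin d => volume.restrict (Ioi (0:ℝ))) (𝕜 := ℝ)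
        (fun i (s : ℝ) => ‖borelKernel ψ a s (u i)‖ * ‖Complex.exp (-(s * x i))‖)
      rw [e]
      have e2 : ∀ i, ∫ s : ℝ in Ioi 0, ‖borelKernel ψ a s (u i)‖ * ‖Complex.exp (-(s * x i))‖ ≤ a / m i := by
        intro i
        have := integral_norm_borelKernel_mul_exp (hlt i (u i))
        simp only [norm_mul] at this ⊢
        rw [this]
        have hn : ‖(2 * Real.pi * Complex.I : ℂ)⁻¹‖ ≤ 1 := norm_two_pi_I_inv_le
        have hE := Real.exp_pos (hankelRe ψ (u i))
        have hmE := mul_pos (hm0 i) hE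
        rw [norm_hankelVel, norm_hankel ha0, mul_one]
        have h4 := hm i (u i)
        calc _ ≤ 1 * (a * Real.exp (hankelRe ψ (u i))) / (m i * Real.exp (hankelRe ψ (u i))) := by gcongr
          _ = a / m i := by rw [one_mul, mul_div_mul_right _ _ hE.ne']
      calc _ ≤ (C * ∏ i, ‖hankel ψ a (u i)‖ ^ (-α)) * ∏ i, (a / m i) := by
            refine mul_le_mul (h.bound _ (fun i => hmem _) t ht) (Finset.prod_le_prod (fun i _ => integral_nonneg fun s => by positivity) fun i _ => e2 i)
              (Finset.prod_nonneg fun i _ => integral_nonneg fun s => by positivity) ((norm_nonneg _).trans (h.bound _ (fun i => hmem (u i)) t ht))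
        _ = _ := by
            simp only [rpow_norm_hankel_eq ha0]
            rw [mul_assoc, ← Finset.prod_mul_distrib]
            congr 1
            exact Finset.prod_congr rfl fun i _ => by ring
  calc laplace 0 (borelTransform σ' (fun _ => a) (fun x => g x t)) x
      = ∫ s, ∫ u, f (s, u) ∂(Measure.pi fun _ => volume) ∂(orthant d) := by
        rw [laplace_zero]
        refine integral_congr_ae (Eventually.of_forall fun s => ?_)
        simp only [borelTransform, f]
        rw [← integral_mul_const]
        refine integral_congr_ae (Eventually.of_forall fun u => ?_)
        simp only [Finset.prod_mul_distrib]
        ring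
    _ = ∫ u, ∫ s, f (s, u) ∂(orthant d) ∂(Measure.pi fun _ => volume) := integral_integral_swap hfi
    _ = ∫ u, g (fun i => hankel ψ a (u i)) t * ∏ i, cauchyKernel ψ a (x i) (u i) ∂(Measure.pi fun _ => volume) := by
        refine integral_congr_ae (Eventually.of_forall fun u => ?_)
        simp only [f]
        rw [integral_const_mul]
        have e := integral_fintype_prod_eq_prod (μ := fun _ : Fin d => volume.restrict (Ioi (0:ℝ))) (𝕜 := ℂ)
          (fun i (s : ℝ) => borelKernel ψ a s (u i) * Complex.exp (-(s * x i)))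
        rw [e]
        congr 1
        exact Finset.prod_congr rfl fun i _ => integral_borelKernel_mul_exp (hlt i _)
    -- Point evaluation is regarded as a constant curve with a Dirac mass, so the slice principle
    -- applies with the one-variable Cauchy formula as input.
    _ = ∫ u, g (fun i => x i) t * ∏ i : Fin d, (1 : ℂ) ∂(Measure.pi fun _ : Fin d => Measure.dirac (0 : ℝ)) := by
        refine integral_pi_eq_of_slices_on (fun _ => volume) (fun _ => Measure.dirac 0) (fun _ => hankel ψ a) (fun i _ => x i)
          (fun i => cauchyKernel ψ a (x i)) (fun _ _ => 1) (fun z => ‖z‖ ^ (-α)) (sector φ ρ) (fun x => g x t) C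
          (fun i => (continuous_hankel _ _).measurable) (fun i => measurable_const)
          (fun i => measurable_cauchyKernel _ _ _) (fun i => measurable_const)
          (isOpen_sector (by linarith) hρ).measurableSet (fun z => by positivity)
          (fun i => Eventually.of_forall hmem) (fun i => Eventually.of_forall fun _ => mem_sector_of_lt_re (by linarith) hρ (by linarith [hx i])) ?_ ?_
          (fun i => integrable_rpow_mul_cauchyKernel h0 hs ha0 hα (hx i))
          (fun i => ?_) ?_
        · rw [hP]; exact h.continuousOn ht
        · rw [hP]; exact fun x hx => h.bound x hx t ht
        · simp only [norm_one, mul_one]; exact integrable_const _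
        · intro i x' hx'
          obtain ⟨hd, C', hC'⟩ := h.slice (by linarith) hρ ht hx'
          rw [integral_cauchyKernel h0 h2 (by linarith) hρ hα ha (hx i) hd hC']
          simp
    _ = g x t := by simp

end IsSectorial

/-! ### Laplace transforms of functions of exponential growth -/

/-- The one-dimensional growth function `(1 + s)ᵃ s^γ e^{Rs}`. -/
noncomputable def expWeight (a : ℕ) (γ R s : ℝ) : ℝ := (1 + s) ^ a * s ^ γ * Real.exp (R * s)

theorem expWeight_nonneg {a : ℕ} {γ R s : ℝ} (hs : 0 ≤ s) : 0 ≤ expWeight a γ R s := by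
  unfold expWeight; positivity

theorem measurable_expWeight {a : ℕ} {γ R : ℝ} : Measurable (expWeight a γ R) := by
  unfold expWeight; fun_prop

theorem exists_one_add_pow_mul_exp_le (a : ℕ) {δ : ℝ} (hδ0 : 0 < δ) :
    ∃ M : ℝ, 0 ≤ M ∧ ∀ s : ℝ, 0 ≤ s → (1 + s) ^ a * Real.exp (-(δ * s)) ≤ M := by
  refine ⟨a.factorial / min 1 δ ^ a * Real.exp δ, by positivity, fun s hs => ?_⟩
  have hm : 0 < min 1 δ := lt_min one_pos hδ0
  have h1 : (min 1 δ * (1 + s)) ^ a / a.factorial ≤ Real.exp (min 1 δ * (1 + s)) :=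
    Real.pow_div_factorial_le_exp _ (by positivity) _
  have h2 : Real.exp (min 1 δ * (1 + s)) ≤ Real.exp (δ + δ * s) :=
    Real.exp_le_exp.2 (by nlinarith [min_le_right 1 δ])
  rw [Real.exp_add] at h2
  rw [div_le_iff₀ (by positivity), mul_pow] at h1
  have h3 : Real.exp (δ * s) * Real.exp (-(δ * s)) = 1 := by rw [← Real.exp_add]; simp
  rw [show (a.factorial : ℝ) / min 1 δ ^ a * Real.exp δ = a.factorial * Real.exp δ / min 1 δ ^ a by ring, le_div_iff₀ (by positivity)]
  have h4 := h1.trans (mul_le_mul_of_nonneg_right h2 (by positivity : (0:ℝ) ≤ a.factorial))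
  calc _ = (min 1 δ ^ a * (1 + s) ^ a) * Real.exp (-(δ * s)) := by ring
    _ ≤ (Real.exp δ * Real.exp (δ * s) * a.factorial) * Real.exp (-(δ * s)) := by gcongr
    _ = (a.factorial * Real.exp δ) * (Real.exp (δ * s) * Real.exp (-(δ * s))) := by ring
    _ = _ := by rw [h3, mul_one]

/-- Half of the margin X - R absorbs the polynomial and the other half keeps the integral convergent
at infinity; γ > -1 gives integrability at 0. -/
theorem integrableOn_expWeight_mul_exp {a : ℕ} {γ R X : ℝ} (hγ : -1 < γ) (hX : R < X) :
    IntegrableOn (fun s => expWeight a γ R s * Real.exp (-(X * s))) (Ioi 0) := by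
  set δ := (X - R) / 2 with hδ
  have hδ0 : 0 < δ := by rw [hδ]; linarith
  obtain ⟨M, hM0, hM⟩ := exists_one_add_pow_mul_exp_le a hδ0
  have hi : IntegrableOn (fun s : ℝ => M * (s ^ γ * Real.exp (-δ * s ^ (1 : ℝ)))) (Ioi 0) :=
    (integrableOn_rpow_mul_exp_neg_mul_rpow hγ one_pos hδ0).const_mul M
  refine hi.mono' (measurable_expWeight.mul (by fun_prop)).aestronglyMeasurable ?_
  filter_upwards [ae_restrict_mem measurableSet_Ioi] with s hs
  have hs : 0 < s := hs
  rw [Real.norm_of_nonneg (mul_nonneg (expWeight_nonneg hs.le) (Real.exp_pos _).le), expWeight, Real.rpow_one]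
  calc _ = ((1 + s) ^ a * Real.exp (-(δ * s))) * (s ^ γ * Real.exp (-δ * s)) := by
        have : Real.exp (R * s) * Real.exp (-(X * s)) = Real.exp (-(δ * s)) * Real.exp (-δ * s) := by
          rw [← Real.exp_add, ← Real.exp_add, hδ]; ring_nf
        linear_combination ((1 + s) ^ a * s ^ γ) * this
    _ ≤ _ := by gcongr; exact hM s hs.le

/-- Continuous functions on the closed polysector of controlled growth. -/
structure HasExpGrowth {d : ℕ} (σ : ℝ) (a : ℕ) (γ R C : ℝ) (F : (Fin d → ℂ) → ℂ) : Prop where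
  cont : ContinuousOn F (csector d σ)
  bound : ∀ p ∈ csector d σ, ‖F p‖ ≤ C * ∏ i, expWeight a γ R ‖p i‖

/-- The integrand of the Laplace transform. -/
noncomputable def laplaceIntegrand {d : ℕ} (θ : Fin d → ℝ) (F : (Fin d → ℂ) → ℂ) (x : Fin d → ℂ) (s : Fin d → ℝ) : ℂ :=
  F (fun i => s i * Complex.exp (θ i * Complex.I)) *
    ∏ i, (Complex.exp (θ i * Complex.I) * Complex.exp (-(s i * Complex.exp (θ i * Complex.I) * x i)))

theorem laplace_eq {d : ℕ} (θ : Fin d → ℝ) (F : (Fin d → ℂ) → ℂ) (x : Fin d → ℂ) :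
    laplace θ F x = ∫ s, laplaceIntegrand θ F x s ∂orthant d := rfl

theorem arg_ofReal_mul_exp {s θ : ℝ} (hs : 0 < s) (hθ : |θ| < Real.pi) :
    Complex.arg (s * Complex.exp (θ * Complex.I)) = θ := by
  rw [abs_lt] at hθ
  rw [Complex.exp_mul_I]
  exact Complex.arg_mul_cos_add_sin_mul_I hs ⟨hθ.1, hθ.2.le⟩

theorem ray_mem_csector {d : ℕ} {σ : ℝ} (hσ : σ < Real.pi) {θ : Fin d → ℝ} (hθ : ∀ i, |θ i| ≤ σ) {s : Fin d → ℝ}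
    (hs : ∀ i, 0 < s i) : (fun i => s i * Complex.exp (θ i * Complex.I)) ∈ csector d σ := by
  intro i
  constructor
  · simp [(hs i).ne']
  · rw [arg_ofReal_mul_exp (hs i) ((hθ i).trans_lt hσ)]; exact hθ i

theorem ae_orthant_pos (d : ℕ) : ∀ᵐ s ∂orthant d, ∀ i, 0 < s i := by
  refine eventually_countable_forall.2 fun i => ?_
  have := (Measure.quasiMeasurePreserving_eval (fun _ : Fin d => volume.restrict (Ioi (0 : ℝ))) i).ae (ae_restrict_mem measurableSet_Ioi)
  filter_upwards [this] with s hs using hs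

theorem orthant_eq (d : ℕ) : orthant d = volume.restrict (Set.pi univ fun _ : Fin d => Ioi (0 : ℝ)) := by
  rw [volume_pi, Measure.restrict_pi_pi]

theorem measurableSet_orthant (d : ℕ) : MeasurableSet (Set.pi univ fun _ : Fin d => Ioi (0 : ℝ)) :=
  MeasurableSet.univ_pi fun _ => measurableSet_Ioi

theorem norm_ray {s θ : ℝ} (hs : 0 ≤ s) : ‖(s : ℂ) * Complex.exp (θ * Complex.I)‖ = s := by
  rw [norm_mul, Complex.norm_exp_ofReal_mul_I, mul_one, Complex.norm_real, Real.norm_of_nonneg hs]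

theorem norm_ray_exp {s θ : ℝ} (z : ℂ) :
    ‖Complex.exp (θ * Complex.I) * Complex.exp (-(s * Complex.exp (θ * Complex.I) * z))‖ =
      Real.exp (-((Complex.exp (θ * Complex.I) * z).re * s)) := by
  rw [norm_mul, Complex.norm_exp_ofReal_mul_I, one_mul, Complex.norm_exp, mul_assoc]
  congr 1
  rw [Complex.neg_re, Complex.re_ofReal_mul, mul_comm]

namespace HasExpGrowth

variable {d : ℕ} {σ : ℝ} {a : ℕ} {γ R C : ℝ} {F : (Fin d → ℂ) → ℂ}

theorem aestronglyMeasurable (h : HasExpGrowth σ a γ R C F) (hσ : σ < Real.pi) {θ : Fin d → ℝ} (hθ : ∀ i, |θ i| ≤ σ) :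
    AEStronglyMeasurable (fun s : Fin d → ℝ => F (fun i => s i * Complex.exp (θ i * Complex.I))) (orthant d) := by
  rw [orthant_eq]
  refine ContinuousOn.aestronglyMeasurable ?_ (measurableSet_orthant d)
  exact h.cont.comp (f := fun s : Fin d → ℝ => fun i => s i * Complex.exp (θ i * Complex.I)) (by fun_prop)
    fun s hs => ray_mem_csector hσ hθ fun i => hs i (mem_univ i)

theorem aestronglyMeasurable_integrand (h : HasExpGrowth σ a γ R C F) (hσ : σ < Real.pi) {θ : Fin d → ℝ} (hθ : ∀ i, |θ i| ≤ σ)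
    (x : Fin d → ℂ) : AEStronglyMeasurable (laplaceIntegrand θ F x) (orthant d) := by
  refine (h.aestronglyMeasurable hσ hθ).mul (Continuous.aestronglyMeasurable ?_)
  fun_prop

theorem norm_integrand_le (h : HasExpGrowth σ a γ R C F) (hσ : σ < Real.pi) {θ : Fin d → ℝ} (hθ : ∀ i, |θ i| ≤ σ)
    (x : Fin d → ℂ) {s : Fin d → ℝ} (hs : ∀ i, 0 < s i) : ‖laplaceIntegrand θ F x s‖ ≤
      C * ∏ i, (expWeight a γ R (s i) * Real.exp (-((Complex.exp (θ i * Complex.I) * x i).re * s i))) := by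
  rw [laplaceIntegrand, norm_mul, norm_prod, Finset.prod_mul_distrib, ← mul_assoc]
  simp only [norm_ray_exp]
  refine mul_le_mul_of_nonneg_right ?_ (Finset.prod_nonneg fun _ _ => (Real.exp_pos _).le)
  have := h.bound _ (ray_mem_csector hσ hθ hs)
  simpa only [norm_ray (hs _).le] using this

theorem integrable_bound {X : Fin d → ℝ} (hγ : -1 < γ) (hX : ∀ i, R < X i) :
    Integrable (fun s : Fin d → ℝ => C * ∏ i, (expWeight a γ R (s i) * Real.exp (-(X i * s i)))) (orthant d) :=
  (Integrable.fintype_prod (f := fun i s => expWeight a γ R s * Real.exp (-(X i * s)))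
    fun i => integrableOn_expWeight_mul_exp hγ (hX i)).const_mul C

theorem integrable_integrand (h : HasExpGrowth σ a γ R C F) (hγ : -1 < γ) (hσ : σ < Real.pi) {θ : Fin d → ℝ} (hθ : ∀ i, |θ i| ≤ σ)
    {x : Fin d → ℂ} (hx : ∀ i, R < (Complex.exp (θ i * Complex.I) * x i).re) :
    Integrable (laplaceIntegrand θ F x) (orthant d) := by
  refine (integrable_bound (C := C) (a := a) hγ hx).mono' (h.aestronglyMeasurable_integrand hσ hθ x) ?_
  filter_upwards [ae_orthant_pos d] with s hs using h.norm_integrand_le hσ hθ x hs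

theorem norm_laplace_le (h : HasExpGrowth σ a γ R C F) (hγ : -1 < γ) (hσ : σ < Real.pi) {θ : Fin d → ℝ} (hθ : ∀ i, |θ i| ≤ σ)
    {x : Fin d → ℂ} (hx : ∀ i, R < (Complex.exp (θ i * Complex.I) * x i).re) :
    ‖laplace θ F x‖ ≤ C * ∏ i, ∫ s in Ioi 0, expWeight a γ R s * Real.exp (-((Complex.exp (θ i * Complex.I) * x i).re * s)) := by
  rw [laplace_eq]
  refine (norm_integral_le_of_norm_le (integrable_bound (C := C) (a := a) hγ hx) ?_).trans_eq ?_
  · filter_upwards [ae_orthant_pos d] with s hs using h.norm_integrand_le hσ hθ x hs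
  · rw [integral_const_mul]
    congr 1
    exact integral_fintype_prod_eq_prod (μ := fun _ : Fin d => volume.restrict (Ioi (0:ℝ))) (𝕜 := ℝ)
      (fun i (s : ℝ) => expWeight a γ R s * Real.exp (-((Complex.exp (θ i * Complex.I) * x i).re * s)))

/-- The integrand is a fixed function times the exponential of a linear form in x, so
`analyticAt_integral_cexp` applies. The gap between R and the real parts provides the radius of
convergence. -/
theorem analyticAt_laplace (h : HasExpGrowth σ a γ R C F) (hγ : -1 < γ) (hσ : σ < Real.pi) {θ : Fin d → ℝ} (hθ : ∀ i, |θ i| ≤ σ)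
    {x : Fin d → ℂ} (hx : ∀ i, R < (Complex.exp (θ i * Complex.I) * x i).re) :
    AnalyticAt ℂ (laplace θ F) x := by
  rcases isEmpty_or_nonempty (Fin d) with hd | hd
  · have : laplace θ F = fun _ => laplace θ F 0 := by ext y; congr 1; exact Subsingleton.elim _ _
    rw [this]; exact analyticAt_const
  obtain ⟨X, hX⟩ : ∃ X, R < X ∧ ∀ i, X < (Complex.exp (θ i * Complex.I) * x i).re := by
    obtain ⟨i₀, hi₀⟩ := Finite.exists_min fun i => (Complex.exp (θ i * Complex.I) * x i).re
    obtain ⟨X, h1, h2⟩ := exists_between (hx i₀)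
    exact ⟨X, h1, fun i => h2.trans_le (hi₀ i)⟩
  obtain ⟨Y, hRY, hYX⟩ := exists_between hX.1
  let l : (Fin d → ℝ) → ((Fin d → ℂ) →L[ℂ] ℂ) := fun s =>
    ∑ i, (-(s i * Complex.exp (θ i * Complex.I))) • ContinuousLinearMap.proj (R := ℂ) i
  have hl : Continuous l := by fun_prop
  have hls : ∀ s y, l s y = ∑ i, -(s i * Complex.exp (θ i * Complex.I)) * y i := by
    intro s y; simp [l]
  have hln : ∀ s : Fin d → ℝ, (∀ i, 0 < s i) → ‖l s‖ ≤ ∑ i, s i := by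
    intro s hs
    refine (norm_sum_le _ _).trans (Finset.sum_le_sum fun i _ => ?_)
    rw [norm_smul, norm_neg, norm_ray (hs i).le]
    refine mul_le_of_le_one_right (hs i).le ?_
    refine ContinuousLinearMap.opNorm_le_bound _ zero_le_one fun y => ?_
    simpa using norm_le_pi_norm y i
  have e : laplace θ F = fun y => ∫ s, (F (fun i => s i * Complex.exp (θ i * Complex.I)) * ∏ i, Complex.exp (θ i * Complex.I)) * Complex.exp (l s y) ∂orthant d := by
    ext y
    rw [laplace_eq]
    refine integral_congr_ae (Eventually.of_forall fun s => ?_)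
    simp only [laplaceIntegrand, Finset.prod_mul_distrib, hls, Complex.exp_sum, neg_mul]
    ring
  rw [e]
  have hg : AEStronglyMeasurable (fun s : Fin d → ℝ => F (fun i => s i * Complex.exp (θ i * Complex.I)) * ∏ i, Complex.exp (θ i * Complex.I)) (orthant d) :=
    (h.aestronglyMeasurable hσ hθ).mul_const _
  refine analyticAt_integral_cexp (r := X - Y) hl.aestronglyMeasurable hg (by linarith) ?_
  refine (integrable_bound (C := C) (a := a) (X := fun _ => Y) hγ (fun _ => hRY)).mono' ?_ ?_
  · refine hg.norm.mul (Continuous.aestronglyMeasurable ?_)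
    refine Real.continuous_exp.comp (Continuous.add ?_ (by fun_prop))
    simp only [hls]; fun_prop
  · filter_upwards [ae_orthant_pos d] with s hs
    rw [Real.norm_of_nonneg (by positivity), norm_mul, norm_prod, Finset.prod_mul_distrib, ← mul_assoc]
    simp only [Complex.norm_exp_ofReal_mul_I, Finset.prod_const_one, mul_one]
    have hb := h.bound _ (ray_mem_csector hσ hθ hs)
    simp only [norm_ray (hs _).le] at hb
    refine mul_le_mul hb ?_ (Real.exp_pos _).le ((norm_nonneg _).trans hb)
    rw [← Real.exp_sum]
    refine Real.exp_le_exp.2 ?_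
    rw [hls, Complex.re_sum]
    calc _ ≤ ∑ i, (-(s i * Complex.exp (θ i * Complex.I)) * x i).re + (X - Y) * ∑ i, s i := by
          exact add_le_add le_rfl (mul_le_mul_of_nonneg_left (hln s hs) (by linarith))
      _ ≤ _ := by
          rw [Finset.mul_sum, ← Finset.sum_add_distrib]
          refine Finset.sum_le_sum fun i _ => ?_
          rw [neg_mul, mul_assoc, Complex.neg_re, Complex.re_ofReal_mul]
          nlinarith [hX.2 i, hs i]

end HasExpGrowth

/-! ### Rotation of the rays of integration -/

theorem re_exp_mul_I_mul (θ : ℝ) (x : ℂ) :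
    (Complex.exp (θ * Complex.I) * x).re = x.re * Real.cos θ - x.im * Real.sin θ := by
  rw [Complex.exp_mul_I]
  simp [Complex.cos_ofReal_re, Complex.sin_ofReal_re]; ring

/-- In ψ the quantity is a sinusoid: its value at ψ, times sin(A+B), equals sin A times the value at
ψ - B plus sin B times the value at ψ + A. Together with sin(A+B) ≤ sin A + sin B, a nonnegative
lower bound at both ends persists in between. -/
theorem le_re_exp_mul_of_between {θ θ' ψ X : ℝ} {x : ℂ} (h1 : θ ≤ ψ) (h2 : ψ ≤ θ') (h3 : θ' - θ < Real.pi) (hX : 0 ≤ X)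
    (hx : X ≤ (Complex.exp (θ * Complex.I) * x).re) (hx' : X ≤ (Complex.exp (θ' * Complex.I) * x).re) :
    X ≤ (Complex.exp (ψ * Complex.I) * x).re := by
  rcases eq_or_lt_of_le h1 with rfl | h1
  · exact hx
  obtain ⟨B, rfl⟩ : ∃ B, θ = ψ - B := ⟨ψ - θ, by ring⟩
  obtain ⟨A, rfl⟩ : ∃ A, θ' = ψ + A := ⟨θ' - ψ, by ring⟩
  have hA : 0 ≤ A := by linarith
  have hB : 0 < B := by linarith
  have sA : 0 ≤ Real.sin A := Real.sin_nonneg_of_nonneg_of_le_pi hA (by linarith)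
  have sB : 0 ≤ Real.sin B := Real.sin_nonneg_of_nonneg_of_le_pi hB.le (by linarith)
  have sAB : 0 < Real.sin (A + B) := Real.sin_pos_of_pos_of_lt_pi (by linarith) (by linarith)
  rw [re_exp_mul_I_mul] at hx hx' ⊢
  have e : Real.sin (A + B) * (x.re * Real.cos ψ - x.im * Real.sin ψ) =
      Real.sin A * (x.re * Real.cos (ψ - B) - x.im * Real.sin (ψ - B)) +
      Real.sin B * (x.re * Real.cos (ψ + A) - x.im * Real.sin (ψ + A)) := by
    rw [Real.cos_sub, Real.sin_sub, Real.cos_add, Real.sin_add, Real.sin_add]; ring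
  have h4 : Real.sin (A + B) ≤ Real.sin A + Real.sin B := by
    rw [Real.sin_add]
    nlinarith [Real.cos_le_one A, Real.cos_le_one B]
  refine le_of_mul_le_mul_left ?_ sAB
  rw [e]
  nlinarith [mul_le_mul_of_nonneg_left hx sA, mul_le_mul_of_nonneg_left hx' sB, mul_le_mul_of_nonneg_right h4 hX]

theorem integral_exp_smul_comp_exp (g : ℝ → ℂ) : ∫ u, (Real.exp u : ℂ) * g (Real.exp u) = ∫ s in Ioi 0, g s := by
  symm
  have h := integral_image_eq_integral_abs_deriv_smul MeasurableSet.univ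
    (fun x _ => (Real.hasDerivAt_exp x).hasDerivWithinAt) Real.exp_injective.injOn g
  rw [image_univ, Real.range_exp] at h
  simpa [abs_of_pos (Real.exp_pos _)] using h

theorem integrable_exp_smul_comp_exp (g : ℝ → ℂ) :
    (Integrable fun u : ℝ => (Real.exp u : ℂ) * g (Real.exp u)) ↔ IntegrableOn g (Ioi 0) := by
  symm
  have h := integrableOn_image_iff_integrableOn_abs_deriv_smul MeasurableSet.univ
    (fun x _ => (Real.hasDerivAt_exp x).hasDerivWithinAt) Real.exp_injective.injOn g
  rw [image_univ, Real.range_exp] at h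
  simpa [abs_of_pos (Real.exp_pos _)] using h

/-- With s = e^u this limit and the next one dispose of the vertical sides of the strip in
`integral_ray_eq`: here s → ∞, there s → 0, where γ > -1 is needed. -/
theorem tendsto_mul_expWeight_atTop {a : ℕ} {γ R X : ℝ} (hX : R < X) :
    Tendsto (fun s => s * (expWeight a γ R s * Real.exp (-(X * s)))) atTop (𝓝 0) := by
  have hδ0 : 0 < (X - R) / 2 := by linarith
  obtain ⟨M, hM0, hM⟩ := exists_one_add_pow_mul_exp_le a hδ0
  have h := (tendsto_rpow_mul_exp_neg_mul_atTop_nhds_zero (γ + 1) _ hδ0).const_mul M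
  rw [mul_zero] at h
  refine squeeze_zero' ?_ ?_ h
  · filter_upwards [eventually_gt_atTop 0] with s hs
    exact mul_nonneg hs.le (mul_nonneg (expWeight_nonneg hs.le) (Real.exp_pos _).le)
  · filter_upwards [eventually_gt_atTop 0] with s hs
    have := hM s hs.le
    calc _ = ((1 + s) ^ a * Real.exp (-((X - R) / 2 * s))) * (s ^ (γ + 1) * Real.exp (-((X - R) / 2) * s)) := by
          have : Real.exp (R * s) * Real.exp (-(X * s)) = Real.exp (-((X - R) / 2 * s)) * Real.exp (-((X - R) / 2) * s) := by
            rw [← Real.exp_add, ← Real.exp_add]; ring_nf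
          rw [expWeight, Real.rpow_add_one hs.ne']
          linear_combination ((1 + s) ^ a * s ^ γ * s) * this
      _ ≤ _ := by gcongr

theorem tendsto_mul_expWeight_zero {a : ℕ} {γ R X : ℝ} (hγ : -1 < γ) :
    Tendsto (fun s => s * (expWeight a γ R s * Real.exp (-(X * s)))) (𝓝[>] 0) (𝓝 0) := by
  have h1 : ContinuousAt (fun s : ℝ => (1 + s) ^ a * s ^ (γ + 1) * Real.exp (R * s) * Real.exp (-(X * s))) 0 := by
    have : ContinuousAt (fun s : ℝ => s ^ (γ + 1)) 0 := Real.continuousAt_rpow_const _ _ (Or.inr (by linarith))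
    fun_prop
  have h2 := h1.tendsto.mono_left (nhdsWithin_le_nhds (s := Ioi 0))
  rw [Real.zero_rpow (by linarith)] at h2
  simp only [mul_zero, zero_mul] at h2
  refine h2.congr' ?_
  filter_upwards [self_mem_nhdsWithin] with s hs
  have hs : 0 < s := hs
  rw [expWeight, Real.rpow_add_one hs.ne']; ring

/-- One-dimensional rotation of the ray of integration. -/
theorem integral_ray_eq {f : ℂ → ℂ} {σ γ R C θ θ' : ℝ} {a : ℕ} {x : ℂ} (hσ : σ < Real.pi / 2) (hγ : -1 < γ) (hR : 0 ≤ R)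
    (hf : ContinuousOn f {z | z ≠ 0 ∧ |Complex.arg z| ≤ σ}) (hd : DifferentiableOn ℂ f (osector σ))
    (hb : ∀ z, z ≠ 0 → |Complex.arg z| ≤ σ → ‖f z‖ ≤ C * expWeight a γ R ‖z‖)
    (hθ : |θ| ≤ σ) (hθ' : |θ'| ≤ σ) (hx : R < (Complex.exp (θ * Complex.I) * x).re)
    (hx' : R < (Complex.exp (θ' * Complex.I) * x).re) (hle : θ ≤ θ') :
    ∫ s in Ioi (0 : ℝ), f (s * Complex.exp (θ * Complex.I)) * (Complex.exp (θ * Complex.I) * Complex.exp (-(s * Complex.exp (θ * Complex.I) * x))) =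
    ∫ s in Ioi (0 : ℝ), f (s * Complex.exp (θ' * Complex.I)) * (Complex.exp (θ' * Complex.I) * Complex.exp (-(s * Complex.exp (θ' * Complex.I) * x))) := by
  have hpi := Real.pi_pos
  obtain ⟨X, hRX, hX, hX'⟩ : ∃ X, R < X ∧ X ≤ (Complex.exp (θ * Complex.I) * x).re ∧ X ≤ (Complex.exp (θ' * Complex.I) * x).re :=
    ⟨_, lt_min hx hx', min_le_left _ _, min_le_right _ _⟩
  -- In logarithmic coordinates the rays at angles θ and θ' are horizontal lines, and the rotation
  -- becomes Cauchy's theorem on the strip between them.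
  let κ : ℂ → ℂ := fun w => Complex.exp w * (f (Complex.exp w) * Complex.exp (-(Complex.exp w * x)))
  rw [abs_le] at hθ hθ'
  have harg : ∀ w : ℂ, θ ≤ w.im ∧ w.im ≤ θ' → Complex.arg (Complex.exp w) = w.im := fun w hw => by
    rw [Complex.arg_exp, toIocMod_eq_self]
    constructor <;> linarith [hw.1, hw.2]
  have hmem : ∀ w : ℂ, θ ≤ w.im ∧ w.im ≤ θ' → Complex.exp w ≠ 0 ∧ |Complex.arg (Complex.exp w)| ≤ σ := fun w hw => by
    refine ⟨Complex.exp_ne_zero w, ?_⟩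
    rw [harg w hw, abs_le]; constructor <;> linarith [hw.1, hw.2]
  have hbase : ∀ (ψ : ℝ) (u : ℝ), κ (u + ψ * Complex.I) = (Real.exp u : ℂ) * (f ((Real.exp u : ℝ) * Complex.exp (ψ * Complex.I)) *
      (Complex.exp (ψ * Complex.I) * Complex.exp (-((Real.exp u : ℝ) * Complex.exp (ψ * Complex.I) * x)))) := by
    intro ψ u
    simp only [κ, Complex.exp_add, ← Complex.ofReal_exp]
    ring
  have hint : ∀ ψ : ℝ, |ψ| ≤ σ → X ≤ (Complex.exp (ψ * Complex.I) * x).re → 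
      IntegrableOn (fun s : ℝ => f (s * Complex.exp (ψ * Complex.I)) * (Complex.exp (ψ * Complex.I) * Complex.exp (-(s * Complex.exp (ψ * Complex.I) * x)))) (Ioi 0) := by
    intro ψ hψ hX
    have hmem : ∀ s ∈ Ioi (0 : ℝ), (s : ℂ) * Complex.exp (ψ * Complex.I) ∈ {z | z ≠ 0 ∧ |Complex.arg z| ≤ σ} := fun s hs => by
      have hs : 0 < s := hs
      refine ⟨by simp [hs.ne'], ?_⟩
      rw [arg_ofReal_mul_exp hs (by linarith)]; exact hψ
    refine ((integrableOn_expWeight_mul_exp (a := a) hγ hRX).const_mul C).mono' ?_ ?_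
    · refine ContinuousOn.aestronglyMeasurable ?_ measurableSet_Ioi
      refine ContinuousOn.mul (hf.comp (by fun_prop) hmem) (by fun_prop)
    · filter_upwards [ae_restrict_mem measurableSet_Ioi] with s hs
      have hs' : 0 < s := hs
      have := hb _ (hmem s hs).1 (hmem s hs).2
      rw [norm_ray hs'.le] at this
      rw [norm_mul, norm_ray_exp, ← mul_assoc]
      refine mul_le_mul this (Real.exp_le_exp.2 ?_) (Real.exp_pos _).le ((norm_nonneg _).trans this)
      nlinarith
  have key := integral_strip_eq (κ := κ) hle ?_ ?_ (b := fun u => C * (Real.exp u * (expWeight a γ R (Real.exp u) * Real.exp (-(X * Real.exp u))))) ?_ ?_ ?_ ?_ ?_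
  · simp only [hbase] at key
    rw [integral_exp_smul_comp_exp fun s => f (s * Complex.exp (θ * Complex.I)) * (Complex.exp (θ * Complex.I) * Complex.exp (-(s * Complex.exp (θ * Complex.I) * x))),
      integral_exp_smul_comp_exp fun s => f (s * Complex.exp (θ' * Complex.I)) * (Complex.exp (θ' * Complex.I) * Complex.exp (-(s * Complex.exp (θ' * Complex.I) * x)))] at key
    exact key
  · refine ContinuousOn.mul (by fun_prop) (ContinuousOn.mul (hf.comp (by fun_prop) hmem) (by fun_prop))
  · refine DifferentiableOn.mul (by fun_prop) (DifferentiableOn.mul (hd.comp (by fun_prop) fun w hw => ?_) (by fun_prop))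
    refine ⟨Complex.exp_ne_zero w, ?_⟩
    rw [harg w ⟨hw.1.le, hw.2.le⟩, abs_lt]; constructor <;> linarith [hw.1, hw.2]
  · simpa using ((tendsto_mul_expWeight_atTop (a := a) (γ := γ) hRX).comp Real.tendsto_exp_atTop).const_mul C
  · simpa using ((tendsto_mul_expWeight_zero (a := a) (R := R) (X := X) hγ).comp Real.tendsto_exp_atBot_nhdsGT).const_mul C
  · intro u ψ hψ
    have hψσ : |ψ| ≤ σ := by rw [abs_le]; constructor <;> linarith [hψ.1, hψ.2]
    have hXψ := le_re_exp_mul_of_between hψ.1 hψ.2 (by linarith) (hR.trans hRX.le) hX hX'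
    have hs := Real.exp_pos u
    have := hb ((Real.exp u : ℝ) * Complex.exp (ψ * Complex.I)) (by simp) (by rw [arg_ofReal_mul_exp hs (by linarith)]; exact hψσ)
    rw [norm_ray hs.le] at this
    rw [hbase, norm_mul, norm_mul, norm_ray_exp, Complex.norm_real, Real.norm_of_nonneg hs.le, ← mul_assoc C, mul_comm C, mul_assoc, ← mul_assoc C]
    refine mul_le_mul_of_nonneg_left ?_ hs.le
    refine mul_le_mul this (Real.exp_le_exp.2 ?_) (Real.exp_pos _).le ((norm_nonneg _).trans this)
    nlinarith
  · simp only [hbase]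
    exact (integrable_exp_smul_comp_exp fun s => f (s * Complex.exp (θ * Complex.I)) * (Complex.exp (θ * Complex.I) * Complex.exp (-(s * Complex.exp (θ * Complex.I) * x)))).2
      (hint θ (abs_le.2 hθ) hX)
  · simp only [hbase]
    exact (integrable_exp_smul_comp_exp fun s => f (s * Complex.exp (θ' * Complex.I)) * (Complex.exp (θ' * Complex.I) * Complex.exp (-(s * Complex.exp (θ' * Complex.I) * x)))).2
      (hint θ' (abs_le.2 hθ') hX')

theorem update_mem_csector {d : ℕ} {σ : ℝ} {p : Fin d → ℂ} {i : Fin d} {z : ℂ} (hz : z ≠ 0 ∧ |Complex.arg z| ≤ σ)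
    (hp : ∀ j ≠ i, p j ≠ 0 ∧ |Complex.arg (p j)| ≤ σ) : Function.update p i z ∈ csector d σ := by
  intro j
  by_cases hj : j = i
  · subst hj; simpa using hz
  · simpa [hj] using hp j hj

/-- The Laplace transform does not depend on the ray of integration. -/
theorem HasExpGrowth.laplace_rotate {d : ℕ} {σ : ℝ} {a : ℕ} {γ R C : ℝ} {F : (Fin d → ℂ) → ℂ} (h : HasExpGrowth σ a γ R C F)
    (hd : ∀ p ∈ csector d σ, ∀ i, DifferentiableOn ℂ (fun z => F (Function.update p i z)) (osector σ))
    (hσ0 : 0 ≤ σ) (hσ : σ < Real.pi / 2) (hγ : -1 < γ) (hR : 0 ≤ R) {θ θ' : Fin d → ℝ} (hθ : ∀ i, |θ i| ≤ σ) (hθ' : ∀ i, |θ' i| ≤ σ)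
    {x : Fin d → ℂ} (hx : ∀ i, R < (Complex.exp (θ i * Complex.I) * x i).re) (hx' : ∀ i, R < (Complex.exp (θ' i * Complex.I) * x i).re) :
    laplace θ F x = laplace θ' F x := by
  have hpi := Real.pi_pos
  have hmem : ∀ ψ : ℝ, |ψ| ≤ σ → ∀ᵐ s : ℝ ∂volume.restrict (Ioi 0), (s : ℂ) * Complex.exp (ψ * Complex.I) ∈ {z | z ≠ 0 ∧ |Complex.arg z| ≤ σ} := by
    intro ψ hψ
    filter_upwards [ae_restrict_mem measurableSet_Ioi] with s hs
    have hs : 0 < s := hs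
    refine ⟨by simp [hs.ne'], ?_⟩
    rw [arg_ofReal_mul_exp hs (by linarith)]; exact hψ
  have hU : Set.pi univ (fun _ : Fin d => {z : ℂ | z ≠ 0 ∧ |Complex.arg z| ≤ σ}) = csector d σ := by
    ext p; simp [csector]
  have hint : ∀ (ψ : ℝ) (z : ℂ), |ψ| ≤ σ → R < (Complex.exp (ψ * Complex.I) * z).re → IntegrableOn (fun s : ℝ =>
      |expWeight a γ R ‖(s : ℂ) * Complex.exp (ψ * Complex.I)‖| * ‖Complex.exp (ψ * Complex.I) * Complex.exp (-(s * Complex.exp (ψ * Complex.I) * z))‖) (Ioi 0) := by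
    intro ψ z hψ hz
    refine (integrableOn_expWeight_mul_exp (a := a) hγ hz).congr ?_
    filter_upwards [ae_restrict_mem measurableSet_Ioi] with s hs
    have hs : 0 < s := hs
    rw [norm_ray_exp, norm_ray hs.le, abs_of_nonneg (expWeight_nonneg hs.le)]
  refine integral_pi_eq_of_slices_on (fun _ => volume.restrict (Ioi 0)) (fun _ => volume.restrict (Ioi 0))
    (fun i s => s * Complex.exp (θ i * Complex.I)) (fun i s => s * Complex.exp (θ' i * Complex.I))
    (fun i s => Complex.exp (θ i * Complex.I) * Complex.exp (-(s * Complex.exp (θ i * Complex.I) * x i)))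
    (fun i s => Complex.exp (θ' i * Complex.I) * Complex.exp (-(s * Complex.exp (θ' i * Complex.I) * x i)))
    (fun z => |expWeight a γ R ‖z‖|) {z | z ≠ 0 ∧ |Complex.arg z| ≤ σ} F C (fun i => by fun_prop) (fun i => by fun_prop)
    (fun i => by fun_prop) (fun i => by fun_prop) ?_ (fun z => abs_nonneg _) (fun i => hmem _ (hθ i)) (fun i => hmem _ (hθ' i)) ?_ ?_
    (fun i => hint _ _ (hθ i) (hx i)) (fun i => hint _ _ (hθ' i) (hx' i)) ?_
  · exact (measurableSet_singleton (0 : ℂ)).compl.inter (measurableSet_le (Complex.measurable_arg.norm) measurable_const)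
  · rw [hU]; exact h.cont
  · rw [hU]; intro p hp
    simpa only [abs_of_nonneg (expWeight_nonneg (norm_nonneg _))] using h.bound p hp
  · intro i p hp
    have h1 : (1 : ℂ) ≠ 0 ∧ |Complex.arg 1| ≤ σ := by simpa using hσ0
    have hd' : DifferentiableOn ℂ (fun z => F (Function.update p i z)) (osector σ) := by
      simpa using hd _ (update_mem_csector h1 hp) i
    have hc' : ContinuousOn (fun z => F (Function.update p i z)) {z | z ≠ 0 ∧ |Complex.arg z| ≤ σ} :=
      h.cont.comp (f := fun z => Function.update p i z) (by fun_prop) fun z hz => update_mem_csector hz hp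
    have hb' : ∀ z, z ≠ 0 → |Complex.arg z| ≤ σ → ‖F (Function.update p i z)‖ ≤
        (C * ∏ j ∈ Finset.univ.erase i, expWeight a γ R ‖p j‖) * expWeight a γ R ‖z‖ := by
      intro z hz hz'
      refine (h.bound _ (update_mem_csector ⟨hz, hz'⟩ hp)).trans (le_of_eq ?_)
      rw [← Finset.mul_prod_erase _ _ (Finset.mem_univ i), Function.update_self, mul_assoc, mul_comm (expWeight a γ R ‖z‖)]
      congr 2
      refine Finset.prod_congr rfl fun j hj => ?_
      rw [Function.update_of_ne (Finset.ne_of_mem_erase hj)]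
    rcases le_total (θ i) (θ' i) with hle | hle
    · exact integral_ray_eq hσ hγ hR hc' hd' hb' (hθ i) (hθ' i) (hx i) (hx' i) hle
    · exact (integral_ray_eq hσ hγ hR hc' hd' hb' (hθ' i) (hθ i) (hx' i) (hx i) hle).symm

/-! ### Derivatives of Laplace transforms -/

/-- The product of the half planes `Re xᵢ > R`. -/
def halfSpace (d : ℕ) (R : ℝ) : Set (Fin d → ℂ) := {x | ∀ i, R < (x i).re}

theorem isOpen_halfSpace (d : ℕ) (R : ℝ) : IsOpen (halfSpace d R) := by
  have : halfSpace d R = ⋂ i, {x | R < (x i).re} := by ext; simp [halfSpace]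
  rw [this]
  exact isOpen_iInter_of_finite fun i => isOpen_lt continuous_const (by fun_prop)

theorem halfSpace_mono {d : ℕ} {R R' : ℝ} (h : R ≤ R') : halfSpace d R' ⊆ halfSpace d R :=
  fun _ hx i => h.trans_lt (hx i)

/-- Lets a polynomial factor in the sup norm be absorbed into the product of one-dimensional growth
functions. -/
theorem one_add_norm_le_prod {d : ℕ} (p : Fin d → ℂ) : 1 + ‖p‖ ≤ ∏ i, (1 + ‖p i‖) := by
  rcases isEmpty_or_nonempty (Fin d) with hd | hd
  · have : p = 0 := Subsingleton.elim _ _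
    simp [this]
  obtain ⟨i₀, hi₀⟩ := Finite.exists_max fun i => ‖p i‖
  have h1 : ‖p‖ ≤ ‖p i₀‖ := (pi_norm_le_iff_of_nonneg (norm_nonneg _)).2 hi₀
  have h2 : 1 + ‖p i₀‖ ≤ ∏ i, (1 + ‖p i‖) := by
    rw [← Finset.mul_prod_erase _ _ (Finset.mem_univ i₀)]
    refine le_mul_of_one_le_right (by positivity) (Finset.one_le_prod fun i _ => ?_)
    linarith [norm_nonneg (p i)]
  linarith

namespace HasExpGrowth

variable {d : ℕ} {σ : ℝ} {a : ℕ} {γ R C : ℝ} {F : (Fin d → ℂ) → ℂ}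

theorem mul_left (h : HasExpGrowth σ a γ R C F) {m : (Fin d → ℂ) → ℂ} {M : ℝ} {b : ℕ} (hm : ContinuousOn m (csector d σ))
    (hM : ∀ p ∈ csector d σ, ‖m p‖ ≤ M * (1 + ‖p‖) ^ b) : HasExpGrowth σ (a + b) γ R (M * C) fun p => m p * F p := by
  refine ⟨hm.mul h.cont, fun p hp => ?_⟩
  have h1 := h.bound p hp
  have h0 := (norm_nonneg _).trans h1
  have hM0 : 0 ≤ M := by
    have := (norm_nonneg _).trans (hM p hp)
    exact nonneg_of_mul_nonneg_left this (by positivity)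
  rw [norm_mul]
  calc _ ≤ (M * (1 + ‖p‖) ^ b) * (C * ∏ i, expWeight a γ R ‖p i‖) := mul_le_mul (hM p hp) h1 (norm_nonneg _) ((norm_nonneg _).trans (hM p hp))
    _ ≤ (M * (∏ i, (1 + ‖p i‖)) ^ b) * (C * ∏ i, expWeight a γ R ‖p i‖) := by
        refine mul_le_mul_of_nonneg_right ?_ h0
        gcongr
        exact one_add_norm_le_prod p
    _ = M * C * ∏ i, expWeight (a + b) γ R ‖p i‖ := by
        have : ∀ i, expWeight (a + b) γ R ‖p i‖ = (1 + ‖p i‖) ^ b * expWeight a γ R ‖p i‖ := fun i => by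
          unfold expWeight; ring
        simp only [this, Finset.prod_mul_distrib, Finset.prod_pow]
        ring

theorem mul_coord (h : HasExpGrowth σ a γ R C F) (i : Fin d) : HasExpGrowth σ (a + 1) γ R C fun p => -p i * F p := by
  have := h.mul_left (m := fun p => -p i) (M := 1) (b := 1) (by fun_prop) fun p _ => by
    have := norm_le_pi_norm p i
    rw [norm_neg]; linarith
  rwa [one_mul] at this

theorem integrable_integrand_zero (h : HasExpGrowth σ a γ R C F) (hγ : -1 < γ) (hσ0 : 0 ≤ σ) (hσ : σ < Real.pi)
    {x : Fin d → ℂ} (hx : x ∈ halfSpace d R) : Integrable (laplaceIntegrand 0 F x) (orthant d) :=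
  h.integrable_integrand hγ hσ (θ := 0) (by simpa using fun _ => hσ0) (by simpa [halfSpace] using hx)

theorem analyticAt_laplace_zero (h : HasExpGrowth σ a γ R C F) (hγ : -1 < γ) (hσ0 : 0 ≤ σ) (hσ : σ < Real.pi)
    {x : Fin d → ℂ} (hx : x ∈ halfSpace d R) : AnalyticAt ℂ (laplace 0 F) x :=
  h.analyticAt_laplace hγ hσ (θ := 0) (by simpa using fun _ => hσ0) (by simpa [halfSpace] using hx)

theorem partialDeriv_laplace (h : HasExpGrowth σ a γ R C F) (hγ : -1 < γ) (hσ0 : 0 ≤ σ) (hσ : σ < Real.pi) (i : Fin d)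
    {x : Fin d → ℂ} (hx : x ∈ halfSpace d R) :
    partialDeriv i (laplace 0 F) x = laplace 0 (fun p => -p i * F p) x := by
  have h0 : ∀ i : Fin d, |(0 : Fin d → ℝ) i| ≤ σ := by simpa using fun _ => hσ0
  have hd : HasDerivAt (fun z : ℂ => laplace 0 F (x + z • Pi.single i 1)) (partialDeriv i (laplace 0 F) x) 0 := by
    have h1 : HasFDerivAt (laplace 0 F) (fderiv ℂ (laplace 0 F) x) (x + (0 : ℂ) • Pi.single i 1) := by
      simpa using (h.analyticAt_laplace_zero hγ hσ0 hσ hx).differentiableAt.hasFDerivAt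
    have h2 : HasDerivAt (fun z : ℂ => x + z • (Pi.single i 1 : Fin d → ℂ)) (Pi.single i 1) 0 := by
      simpa using ((hasDerivAt_id (0 : ℂ)).smul_const (Pi.single i 1 : Fin d → ℂ)).const_add x
    exact h1.comp_hasDerivAt 0 h2
  -- Only the i-th coordinate varies, so only there is part of the margin above R spent on a uniform
  -- majorant.
  obtain ⟨Y, hRY, hYX⟩ := exists_between (hx i)
  set r := (x i).re - Y
  have hr : 0 < r := by simp only [r]; linarith
  have hmem : ∀ z ∈ Metric.ball (0 : ℂ) r, ∀ j, (if j = i then Y else (x j).re) ≤ ((x + z • Pi.single i 1 : Fin d → ℂ) j).re := by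
    intro z hz j
    have hz' : |z.re| < r := (Complex.abs_re_le_norm z).trans_lt (by simpa using hz)
    rw [abs_lt] at hz'
    by_cases hj : j = i
    · subst hj; simp; simp only [r] at hz'; linarith
    · simp [hj]
  have key := (hasDerivAt_integral_of_dominated_loc_of_deriv_le (μ := orthant d) (𝕜 := ℂ) (x₀ := (0 : ℂ))
    (F := fun z s => laplaceIntegrand 0 F (x + z • Pi.single i 1) s)
    (F' := fun z s => laplaceIntegrand 0 (fun p => -p i * F p) (x + z • Pi.single i 1) s)
    (bound := fun s => C * ∏ j, (expWeight (a + 1) γ R (s j) * Real.exp (-((if j = i then Y else (x j).re) * s j))))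
    (Metric.ball_mem_nhds (0 : ℂ) hr) ?_ ?_ ?_ ?_ ?_ ?_).2
  · have := hd.unique key
    rw [zero_smul, add_zero] at this
    exact this
  · exact Eventually.of_forall fun z => h.aestronglyMeasurable_integrand hσ h0 _
  · simpa using h.integrable_integrand_zero hγ hσ0 hσ hx
  · exact (h.mul_coord i).aestronglyMeasurable_integrand hσ h0 _
  · filter_upwards [ae_orthant_pos d] with s hs z hz
    refine ((h.mul_coord i).norm_integrand_le hσ h0 _ hs).trans ?_
    rw [Finset.prod_mul_distrib, Finset.prod_mul_distrib, ← mul_assoc, ← mul_assoc]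
    refine mul_le_mul_of_nonneg_left (Finset.prod_le_prod (fun j _ => (Real.exp_pos _).le) fun j _ => Real.exp_le_exp.2 ?_) ?_
    · have := mul_le_mul_of_nonneg_right (hmem z hz j) (hs j).le
      simpa using this
    · have := (h.mul_coord i).bound _ (ray_mem_csector hσ h0 hs)
      simp only [norm_ray (hs _).le] at this
      exact (norm_nonneg _).trans this
  · refine integrable_bound hγ fun j => ?_
    split_ifs
    · exact hRY
    · exact hx j
  · refine Eventually.of_forall fun s z _ => ?_
    simp only [laplaceIntegrand, Pi.zero_apply, Complex.ofReal_zero, zero_mul, Complex.exp_zero, mul_one, one_mul, ← Complex.exp_sum]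
    have h1 : HasDerivAt (fun z : ℂ => ∑ j, -((s j : ℂ) * (x + z • Pi.single i 1 : Fin d → ℂ) j)) (-(s i : ℂ)) z := by
      have e : (fun z : ℂ => ∑ j, -((s j : ℂ) * (x + z • Pi.single i 1 : Fin d → ℂ) j)) = fun z => (∑ j, -((s j : ℂ) * x j)) + z * (-(s i : ℂ)) := by
        ext z
        have : ∀ j, -((s j : ℂ) * (x + z • Pi.single i 1 : Fin d → ℂ) j) = -((s j : ℂ) * x j) + (if j = i then z * (-(s i : ℂ)) else 0) := by
          intro j
          by_cases hj : j = i
          · subst hj; simp; ring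
          · simp [hj]
        simp only [this, Finset.sum_add_distrib, Finset.sum_ite_eq', Finset.mem_univ, if_true]
      rw [e]
      simpa using ((hasDerivAt_id z).mul_const (-(s i : ℂ))).const_add (∑ j, -((s j : ℂ) * x j))
    have h2 := (h1.cexp).const_mul (F fun i => (s i : ℂ))
    refine h2.congr_deriv ?_
    ring

end HasExpGrowth

/-- Derivatives are local. This matters because Laplace representations are available on half spaces
only, not as identities of functions on ℂᵈ. -/
theorem partialDeriv_congr {d : ℕ} {i : Fin d} {g g' : (Fin d → ℂ) → ℂ} {U : Set (Fin d → ℂ)} (hU : IsOpen U) (h : EqOn g g' U) :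
    EqOn (partialDeriv i g) (partialDeriv i g') U := fun x hx => by
  unfold partialDeriv
  rw [(h.eventuallyEq_of_mem (hU.mem_nhds hx)).fderiv_eq]

theorem iterate_partialDeriv_congr {d : ℕ} {i : Fin d} {g g' : (Fin d → ℂ) → ℂ} {U : Set (Fin d → ℂ)} (hU : IsOpen U) (h : EqOn g g' U) (k : ℕ) :
    EqOn ((partialDeriv i)^[k] g) ((partialDeriv i)^[k] g') U := by
  induction k with
  | zero => exact h
  | succ k ih => rw [Function.iterate_succ_apply', Function.iterate_succ_apply']; exact partialDeriv_congr hU ih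

theorem multiDeriv_congr {d : ℕ} {j : Fin d → ℕ} {g g' : (Fin d → ℂ) → ℂ} {U : Set (Fin d → ℂ)} (hU : IsOpen U) (h : EqOn g g' U) :
    EqOn (multiDeriv j g) (multiDeriv j g') U := by
  unfold multiDeriv
  induction List.finRange d with
  | nil => exact h
  | cons i l ih => exact iterate_partialDeriv_congr hU ih _

theorem polyDiffOp_congr {d : ℕ} {P : MvPolynomial (Fin d) ℂ} {g g' : (Fin d → ℂ) → ℂ} {U : Set (Fin d → ℂ)} (hU : IsOpen U) (h : EqOn g g' U) :
    EqOn (polyDiffOp P g) (polyDiffOp P g') U := fun x hx => by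
  unfold polyDiffOp
  exact Finset.sum_congr rfl fun k _ => by rw [multiDeriv_congr hU h hx]

/-- The monomial `(-p)^j`. -/
noncomputable def negPow {d : ℕ} (j : Fin d → ℕ) (p : Fin d → ℂ) : ℂ := ∏ i, (-p i) ^ j i

theorem continuous_negPow {d : ℕ} (j : Fin d → ℕ) : Continuous (negPow j) := by
  unfold negPow; fun_prop

theorem norm_negPow_le {d : ℕ} (j : Fin d → ℕ) (p : Fin d → ℂ) : ‖negPow j p‖ ≤ (1 + ‖p‖) ^ ∑ i, j i := by
  rw [negPow, norm_prod, ← Finset.prod_pow_eq_pow_sum]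
  refine Finset.prod_le_prod (fun i _ => norm_nonneg _) fun i _ => ?_
  rw [norm_pow, norm_neg]
  have := norm_le_pi_norm p i
  gcongr
  linarith

theorem eval_neg_eq_sum {d : ℕ} (P : MvPolynomial (Fin d) ℂ) (p : Fin d → ℂ) :
    MvPolynomial.eval (-p) P = ∑ k ∈ P.support, P.coeff k * negPow (fun i => k i) p := by
  rw [MvPolynomial.eval_eq']; rfl

theorem continuous_eval_neg {d : ℕ} (P : MvPolynomial (Fin d) ℂ) : Continuous fun p : Fin d → ℂ => MvPolynomial.eval (-p) P := by
  simp only [eval_neg_eq_sum]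
  exact continuous_finsetSum _ fun k _ => continuous_const.mul (continuous_negPow _)

theorem exists_norm_eval_neg_le {d n : ℕ} (P : MvPolynomial (Fin d) ℂ) (hP : P.totalDegree ≤ n) :
    ∃ M : ℝ, 0 < M ∧ ∀ p : Fin d → ℂ, ‖MvPolynomial.eval (-p) P‖ ≤ M * (1 + ‖p‖) ^ n := by
  refine ⟨1 + ∑ k ∈ P.support, ‖P.coeff k‖, by positivity, fun p => ?_⟩
  rw [eval_neg_eq_sum]
  refine (norm_sum_le _ _).trans ?_
  calc _ ≤ ∑ k ∈ P.support, ‖P.coeff k‖ * (1 + ‖p‖) ^ n := by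
        refine Finset.sum_le_sum fun k hk => ?_
        rw [norm_mul]
        refine mul_le_mul_of_nonneg_left ((norm_negPow_le _ p).trans ?_) (norm_nonneg _)
        refine pow_le_pow_right₀ (by linarith [norm_nonneg p]) ?_
        have := MvPolynomial.le_totalDegree hk
        rw [Finsupp.sum_fintype _ _ (fun _ => rfl)] at this
        exact this.trans hP
    _ ≤ _ := by rw [← Finset.sum_mul]; gcongr; linarith

namespace HasExpGrowth

variable {d : ℕ} {σ : ℝ} {a : ℕ} {γ R C : ℝ} {F : (Fin d → ℂ) → ℂ}

theorem iterate_partialDeriv_laplace (h : HasExpGrowth σ a γ R C F) (hγ : -1 < γ) (hσ0 : 0 ≤ σ) (hσ : σ < Real.pi) (i : Fin d) (k : ℕ) :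
    HasExpGrowth σ (a + k) γ R C (fun p => (-p i) ^ k * F p) ∧
    EqOn ((partialDeriv i)^[k] (laplace 0 F)) (laplace 0 fun p => (-p i) ^ k * F p) (halfSpace d R) := by
  induction k with
  | zero => simp only [pow_zero, one_mul]; exact ⟨h, fun _ _ => rfl⟩
  | succ k ih =>
    have e : (fun p : Fin d → ℂ => (-p i) ^ (k + 1) * F p) = fun p => -p i * ((-p i) ^ k * F p) := by ext p; ring
    rw [e]
    refine ⟨ih.1.mul_coord i, fun x hx => ?_⟩
    rw [Function.iterate_succ_apply', partialDeriv_congr (isOpen_halfSpace d R) ih.2 hx, ih.1.partialDeriv_laplace hγ hσ0 hσ i hx]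

/-- Induction along the list that defines `multiDeriv`: each step multiplies the kernel by a power
of -pᵢ. Only the polynomial exponent of the growth bound changes, so it is left existential. -/
theorem multiDeriv_laplace (h : HasExpGrowth σ a γ R C F) (hγ : -1 < γ) (hσ0 : 0 ≤ σ) (hσ : σ < Real.pi) (j : Fin d → ℕ) :
    EqOn (multiDeriv j (laplace 0 F)) (laplace 0 fun p => negPow j p * F p) (halfSpace d R) := by
  have key : ∀ l : List (Fin d), (∃ b, HasExpGrowth σ b γ R C (fun p => (l.map fun i => (-p i) ^ j i).prod * F p)) ∧
      EqOn (l.foldr (fun i h => (partialDeriv i)^[j i] h) (laplace 0 F)) (laplace 0 fun p => (l.map fun i => (-p i) ^ j i).prod * F p) (halfSpace d R) := by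
    intro l
    induction l with
    | nil => simp only [List.map_nil, List.prod_nil, one_mul]; exact ⟨⟨a, h⟩, fun _ _ => rfl⟩
    | cons i l ih =>
      obtain ⟨⟨b, hb⟩, he⟩ := ih
      have e : (fun p : Fin d → ℂ => ((i :: l).map fun i => (-p i) ^ j i).prod * F p) = fun p => (-p i) ^ j i * ((l.map fun i => (-p i) ^ j i).prod * F p) := by
        ext p; rw [List.map_cons, List.prod_cons]; ring
      rw [e]
      obtain ⟨h1, h2⟩ := hb.iterate_partialDeriv_laplace hγ hσ0 hσ i (j i)
      exact ⟨⟨_, h1⟩, (iterate_partialDeriv_congr (isOpen_halfSpace d R) he (j i)).trans h2⟩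
  have e : negPow j = fun p => ((List.finRange d).map fun i => (-p i) ^ j i).prod := by
    ext p; rw [negPow, Fin.prod_univ_def]
  rw [e]
  exact (key (List.finRange d)).2

theorem mul_negPow (h : HasExpGrowth σ a γ R C F) (j : Fin d → ℕ) :
    HasExpGrowth σ (a + ∑ i, j i) γ R C fun p => negPow j p * F p := by
  have := h.mul_left (m := negPow j) (M := 1) (b := ∑ i, j i) (continuous_negPow j).continuousOn fun p _ => by
    rw [one_mul]; exact norm_negPow_le j p
  rwa [one_mul] at this

theorem polyDiffOp_laplace (h : HasExpGrowth σ a γ R C F) (hγ : -1 < γ) (hσ0 : 0 ≤ σ) (hσ : σ < Real.pi) (P : MvPolynomial (Fin d) ℂ) :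
    EqOn (polyDiffOp P (laplace 0 F)) (laplace 0 fun p => MvPolynomial.eval (-p) P * F p) (halfSpace d R) := by
  intro x hx
  unfold polyDiffOp
  rw [laplace_eq]
  have e : (laplaceIntegrand 0 fun p => MvPolynomial.eval (-p) P * F p) x =
      fun s => ∑ k ∈ P.support, P.coeff k * laplaceIntegrand 0 (fun p => negPow (fun i => k i) p * F p) x s := by
    ext s
    simp only [laplaceIntegrand, eval_neg_eq_sum, Finset.sum_mul]
    exact Finset.sum_congr rfl fun k _ => by ring
  rw [e, integral_finsetSum]
  · refine Finset.sum_congr rfl fun k _ => ?_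
    rw [integral_const_mul, h.multiDeriv_laplace hγ hσ0 hσ _ hx, laplace_eq]
  · intro k _
    exact ((h.mul_negPow fun i => k i).integrable_integrand_zero hγ hσ0 hσ hx).const_mul _

end HasExpGrowth

/-! ### Convolution and injectivity of the Laplace transform -/

theorem laplaceIntegrand_zero {d : ℕ} (F : (Fin d → ℂ) → ℂ) (x : Fin d → ℂ) (s : Fin d → ℝ) :
    laplaceIntegrand 0 F x s = F (fun i => (s i : ℂ)) * ∏ i, Complex.exp (-(s i * x i)) := by
  simp [laplaceIntegrand]

theorem ofReal_mem_csector {d : ℕ} {σ : ℝ} (hσ : 0 ≤ σ) {s : Fin d → ℝ} (hs : ∀ i, 0 < s i) :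
    (fun i => (s i : ℂ)) ∈ csector d σ := fun i => by
  refine ⟨by simp [(hs i).ne'], ?_⟩
  rw [Complex.arg_ofReal_of_nonneg (hs i).le]; simpa using hσ

/-- A diagonal change of variables. -/
theorem integral_diagonal {d : ℕ} (h : (Fin d → ℝ) → ℂ) {s : Fin d → ℝ} (hs : ∀ i, 0 < s i) :
    ∫ v, h v = (∏ i, (s i : ℂ)) * ∫ u : Fin d → ℝ, h (fun i => s i * u i) := by
  have hdet : (Matrix.diagonal s).det = ∏ i, s i := Matrix.det_diagonal
  have hpos : 0 < ∏ i, s i := Finset.prod_pos fun i _ => hs i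
  have h1 := Real.smul_map_diagonal_volume_pi (D := s) (by rw [hdet]; exact hpos.ne')
  conv_lhs => rw [← h1]
  rw [integral_smul_measure, hdet, abs_of_pos hpos, ENNReal.toReal_ofReal hpos.le]
  have hT : (Matrix.toLin' (Matrix.diagonal s) : (Fin d → ℝ) → (Fin d → ℝ)) = fun u i => s i * u i := by
    ext u i; simp [Matrix.toLin'_apply, Matrix.mulVec_diagonal]
  have hemb : MeasurableEmbedding (fun (u : Fin d → ℝ) i => s i * u i) := by
    have : (fun (u : Fin d → ℝ) i => s i * u i) = (MeasurableEquiv.piCongrRight fun i => (Homeomorph.mulLeft₀ (s i) (hs i).ne').toMeasurableEquiv) := by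
      ext u i; rfl
    rw [this]; exact MeasurableEquiv.measurableEmbedding _
  rw [hT, hemb.integral_map]
  rw [Complex.real_smul, Complex.ofReal_prod]

/-- The open unit cube. -/
noncomputable abbrev unitCube (d : ℕ) : Measure (Fin d → ℝ) :=
  Measure.pi fun _ => volume.restrict (Ioo 0 1)

theorem unitCube_eq (d : ℕ) : unitCube d = volume.restrict (Set.pi univ fun _ : Fin d => Ioo (0 : ℝ) 1) := by
  rw [volume_pi, Measure.restrict_pi_pi]

theorem ae_unitCube (d : ℕ) : ∀ᵐ u ∂unitCube d, ∀ i, u i ∈ Ioo (0 : ℝ) 1 := by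
  refine eventually_countable_forall.2 fun i => ?_
  exact (Measure.quasiMeasurePreserving_eval (fun _ : Fin d => volume.restrict (Ioo (0 : ℝ) 1)) i).ae (ae_restrict_mem measurableSet_Ioo)

/-- The multiplicative convolution on the Borel plane. -/
noncomputable def borelConv {d : ℕ} (F G : (Fin d → ℂ) → ℂ) (p : Fin d → ℂ) : ℂ :=
  ∫ u, (∏ i, p i) * (F (fun i => u i * p i) * G (fun i => (1 - u i : ℝ) * p i)) ∂unitCube d

/-- The Laplace transform turns convolutions into products. -/
theorem laplace_borelConv {d : ℕ} {F G : (Fin d → ℂ) → ℂ} {x : Fin d → ℂ}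
    (hF : Integrable (laplaceIntegrand 0 F x) (orthant d)) (hG : Integrable (laplaceIntegrand 0 G x) (orthant d)) :
    laplace 0 (borelConv F G) x = laplace 0 F x * laplace 0 G x := by
  set Q : Set (Fin d → ℝ) := Set.pi univ fun _ => Ioi 0 with hQ
  have hQm : MeasurableSet Q := measurableSet_orthant d
  rw [orthant_eq, ← hQ, ← IntegrableOn, ← integrable_indicator_iff hQm] at hF hG
  have hL : ∀ F, laplace 0 F x = ∫ s, Q.indicator (laplaceIntegrand 0 F x) s := fun F => by
    rw [integral_indicator hQm, laplace_eq, orthant_eq]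
  rw [hL F, hL G, hL]
  have h := integral_convolution (ContinuousLinearMap.mul ℂ ℂ) (μ := volume) (ν := volume) hF hG
  rw [ContinuousLinearMap.mul_apply'] at h
  rw [← h]
  refine integral_congr_ae (Eventually.of_forall fun s => ?_)
  simp only [convolution, ContinuousLinearMap.mul_apply']
  by_cases hs : s ∈ Q
  · have hs0 : ∀ i, 0 < s i := fun i => hs i (mem_univ i)
    -- The substitution vᵢ = sᵢ uᵢ turns the additive convolution over the box below s into an
    -- integral over the unit cube, a form that makes sense for complex p.
    rw [indicator_of_mem hs, integral_diagonal _ hs0, laplaceIntegrand_zero, borelConv, unitCube_eq,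
      ← integral_indicator (MeasurableSet.univ_pi fun _ => measurableSet_Ioo), ← integral_const_mul, ← integral_mul_const]
    refine integral_congr_ae (Eventually.of_forall fun u => ?_)
    simp only
    by_cases hu : u ∈ Set.pi univ fun _ : Fin d => Ioo (0 : ℝ) 1
    · have h1 : (fun i => s i * u i) ∈ Q := fun i _ => mul_pos (hs0 i) (hu i (mem_univ i)).1
      have h2 : (s - fun i => s i * u i) ∈ Q := fun i _ => by
        have := mul_lt_mul_of_pos_left (hu i (mem_univ i)).2 (hs0 i)
        simp only [Pi.sub_apply, mem_Ioi]; linarith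
      rw [indicator_of_mem hu, indicator_of_mem h1, indicator_of_mem h2, laplaceIntegrand_zero, laplaceIntegrand_zero]
      have e1 : (fun i => ((s i * u i : ℝ) : ℂ)) = fun i => (u i : ℂ) * s i := by ext i; push_cast; ring
      have e2 : (fun i => (((s - fun i => s i * u i) i : ℝ) : ℂ)) = fun i => ((1 - u i : ℝ) : ℂ) * s i := by
        ext i; simp only [Pi.sub_apply]; push_cast; ring
      rw [e1, e2]
      have e3 : (∏ i, Complex.exp (-(s i * x i))) = (∏ i, Complex.exp (-((s i * u i : ℝ) * x i))) * ∏ i, Complex.exp (-(((s - fun i => s i * u i) i : ℝ) * x i)) := by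
        rw [← Finset.prod_mul_distrib]
        refine Finset.prod_congr rfl fun i _ => ?_
        rw [← Complex.exp_add]; congr 1; simp only [Pi.sub_apply]; push_cast; ring
      rw [e3]; ring
    · rw [indicator_of_notMem hu, zero_mul]
      simp only [Set.mem_pi, mem_univ, true_imp_iff, not_forall] at hu
      obtain ⟨i, hi⟩ := hu
      by_cases h0 : 0 < u i
      · have : 1 ≤ u i := by by_contra hc; exact hi ⟨h0, not_le.1 hc⟩
        have h2 : (s - fun i => s i * u i) ∉ Q := fun hmem => by
          have := hmem i (mem_univ i)
          simp only [Pi.sub_apply, mem_Ioi] at this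
          nlinarith [hs0 i]
        rw [indicator_of_notMem h2]; simp
      · have h2 : (fun i => s i * u i) ∉ Q := fun hmem => by
          have := hmem i (mem_univ i)
          simp only [mem_Ioi] at this
          exact h0 (pos_of_mul_pos_right this (hs0 i).le)
        rw [indicator_of_notMem h2]; simp
  · rw [indicator_of_notMem hs]
    symm
    refine integral_eq_zero_of_ae (Eventually.of_forall fun v => ?_)
    simp only [Pi.zero_apply]
    by_cases hv : v ∈ Q
    · have : s - v ∉ Q := fun hsv => hs fun i _ => by
        have h1 := hv i (mem_univ i)
        have h2 := hsv i (mem_univ i)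
        simp only [Pi.sub_apply, mem_Ioi] at h1 h2 ⊢
        linarith
      rw [indicator_of_notMem this, mul_zero]
    · rw [indicator_of_notMem hv, zero_mul]

open FourierTransform RealInnerProductSpace in
/-- Injectivity of the Laplace transform. -/
theorem HasExpGrowth.eq_zero_of_laplace_eq_zero {d : ℕ} {σ : ℝ} {a : ℕ} {γ R C : ℝ} {F : (Fin d → ℂ) → ℂ} (h : HasExpGrowth σ a γ R C F)
    (hγ : -1 < γ) (hσ0 : 0 ≤ σ) (hσ : σ < Real.pi) (hF : ∀ x ∈ halfSpace d R, laplace 0 F x = 0) {s : Fin d → ℝ} (hs : ∀ i, 0 < s i) :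
    F (fun i => (s i : ℂ)) = 0 := by
  set Q : Set (Fin d → ℝ) := Set.pi univ fun _ => Ioi 0 with hQ
  have hQm : MeasurableSet Q := measurableSet_orthant d
  have hQo : IsOpen Q := isOpen_set_pi finite_univ fun _ _ => isOpen_Ioi
  set x₀ : Fin d → ℂ := fun _ => ((R + 1 : ℝ) : ℂ)
  let g : (Fin d → ℝ) → ℂ := Q.indicator (laplaceIntegrand 0 F x₀)
  have hx₀ : x₀ ∈ halfSpace d R := fun i => by simp [x₀]
  have hg : Integrable g := by
    have := h.integrable_integrand_zero hγ hσ0 hσ hx₀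
    rwa [orthant_eq, ← hQ, ← IntegrableOn, ← integrable_indicator_iff hQm] at this
  let f : EuclideanSpace ℝ (Fin d) → ℂ := fun v => g (WithLp.ofLp v)
  have hmp := PiLp.volume_preserving_ofLp (Fin d)
  have hf : Integrable f := hmp.integrable_comp_of_integrable hg
  -- On the vertical lines xᵢ = R + 1 + 2πi wᵢ the Laplace transform is the Fourier transform of g,
  -- so Fourier inversion at a point of continuity gives the vanishing.
  have hFour : 𝓕 f = 0 := by
    ext w
    rw [Real.fourier_eq]
    have e : ∀ v : EuclideanSpace ℝ (Fin d), Real.fourierChar (-⟪v, w⟫) • f v =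
        (fun u : Fin d → ℝ => Q.indicator (laplaceIntegrand 0 F (fun i => x₀ i + 2 * Real.pi * w i * Complex.I)) u) (WithLp.ofLp v) := by
      intro v
      simp only [f, g]
      by_cases hv : WithLp.ofLp v ∈ Q
      · rw [indicator_of_mem hv, indicator_of_mem hv, laplaceIntegrand_zero, laplaceIntegrand_zero, Circle.smul_def, Real.fourierChar_apply, smul_eq_mul, mul_left_comm]
        congr 1
        rw [← Complex.exp_sum, ← Complex.exp_sum, ← Complex.exp_add, PiLp.inner_apply]
        congr 1
        push_cast
        rw [mul_neg, Finset.mul_sum, neg_mul, Finset.sum_mul, ← Finset.sum_neg_distrib, ← Finset.sum_add_distrib]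
        refine Finset.sum_congr rfl fun i _ => ?_
        simp only [RCLike.inner_apply, conj_trivial]
        push_cast
        ring
      · rw [indicator_of_notMem hv, indicator_of_notMem hv, smul_zero]
    simp only [e]
    have hemb : MeasurableEmbedding (@WithLp.ofLp 2 (Fin d → ℝ)) := (MeasurableEquiv.toLp 2 (Fin d → ℝ)).symm.measurableEmbedding
    rw [hmp.integral_comp hemb, integral_indicator hQm, hQ, ← orthant_eq, ← laplace_eq]
    exact hF _ fun i => by simp [x₀]
  have hcont : ContinuousAt f (WithLp.toLp 2 s) := by
    have h1 : ContinuousAt g s := by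
      have : ContinuousOn (laplaceIntegrand 0 F x₀) Q := by
        have e : laplaceIntegrand 0 F x₀ = fun s => F (fun i => (s i : ℂ)) * ∏ i, Complex.exp (-(s i * x₀ i)) := by
          ext s; exact laplaceIntegrand_zero _ _ _
        rw [e]
        refine ContinuousOn.mul ?_ (by fun_prop)
        exact h.cont.comp (f := fun s : Fin d → ℝ => fun i => (s i : ℂ)) (by fun_prop) fun s hs => ofReal_mem_csector hσ0 fun i => hs i (mem_univ i)
      have hsQ : s ∈ Q := fun i _ => hs i
      refine ((this.continuousAt (hQo.mem_nhds hsQ))).congr ?_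
      filter_upwards [hQo.mem_nhds hsQ] with u hu
      simp only [g]; rw [indicator_of_mem hu]
    exact ContinuousAt.comp (f := @WithLp.ofLp 2 (Fin d → ℝ)) h1 (PiLp.continuous_ofLp 2 _).continuousAt
  have key := hf.fourierInv_fourier_eq (by rw [hFour]; exact integrable_zero _ _ _) hcont
  have hz : (𝓕⁻ (0 : EuclideanSpace ℝ (Fin d) → ℂ)) (WithLp.toLp 2 s) = 0 := by
    rw [Real.fourierInv_eq]; simp
  rw [hFour, hz] at key
  have hsQ : s ∈ Q := fun i _ => hs i
  simp only [f, g] at key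
  rw [indicator_of_mem hsQ, laplaceIntegrand_zero] at key
  refine (mul_eq_zero.1 key.symm).resolve_right ?_
  exact Finset.prod_ne_zero_iff.2 fun i _ => Complex.exp_ne_zero _

/-! ### The weight and its convolution inequalities -/

/-- The one-dimensional weight; it is normalized so that its self-convolution is at most itself. -/
noncomputable def rayWeight (γ R s : ℝ) : ℝ :=
  R / 2 ^ (γ + 3) * (s ^ γ * Real.exp (R * s) * (1 + R * s) ^ (-(γ + 2)))

theorem rayWeight_nonneg {γ R s : ℝ} (hR : 0 < R) (hs : 0 ≤ s) : 0 ≤ rayWeight γ R s := by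
  unfold rayWeight; positivity

theorem continuousOn_rayWeight {γ R : ℝ} (hγ : 0 ≤ γ) (hR : 0 < R) : ContinuousOn (rayWeight γ R) (Ici 0) := by
  unfold rayWeight
  refine ContinuousOn.mul continuousOn_const (ContinuousOn.mul (ContinuousOn.mul ?_ (by fun_prop)) ?_)
  · exact ContinuousOn.rpow_const continuousOn_id fun _ _ => Or.inr hγ
  · refine ContinuousOn.rpow_const (by fun_prop) fun s hs => Or.inl ?_
    have : 0 ≤ R * s := mul_nonneg hR.le hs
    positivity

theorem rayWeight_le {γ R s : ℝ} (hR : 0 < R) (hγ : 0 ≤ γ) (hs : 0 ≤ s) :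
    rayWeight γ R s ≤ R / 2 ^ (γ + 3) * (s ^ γ * Real.exp (R * s)) := by
  unfold rayWeight
  refine mul_le_mul_of_nonneg_left ?_ (by positivity)
  refine mul_le_of_le_one_right (by positivity) ?_
  have : 0 ≤ R * s := by positivity
  exact Real.rpow_le_one_of_one_le_of_nonpos (by linarith) (by linarith)

/-- The pointwise inequality behind `rayWeight_conv_le`. -/
theorem rayWeight_mul_le_of_le_half {γ R s u : ℝ} (hR : 1 ≤ R) (hγ : 0 ≤ γ) (hs : 0 ≤ s) (hu : 0 ≤ u) (hu' : u ≤ 1 / 2) :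
    s * (rayWeight γ R (u * s) * rayWeight γ R ((1 - u) * s)) ≤
      rayWeight γ R s * (1 / 2 * (R * s * ((1 + R * s * u) ^ 2)⁻¹)) := by
  have hR0 : 0 < R := by linarith
  have h1 : ((1 - u) * s) ^ γ ≤ s ^ γ := Real.rpow_le_rpow (by nlinarith) (by nlinarith) hγ
  -- For u ≤ 1/2 the far factor retains at least half of 1 + Rs.
  have h2 : (1 + R * ((1 - u) * s)) ^ (-(γ + 2)) ≤ 2 ^ (γ + 2) * (1 + R * s) ^ (-(γ + 2)) := by
    have : (1 + R * ((1 - u) * s)) ^ (-(γ + 2)) ≤ ((1 + R * s) / 2) ^ (-(γ + 2)) := by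
      refine Real.rpow_le_rpow_of_nonpos (by positivity) ?_ (by linarith)
      nlinarith [mul_nonneg hR0.le hs, mul_nonneg (mul_nonneg hR0.le hs) (by linarith : 0 ≤ 1 / 2 - u)]
    refine this.trans_eq ?_
    rw [Real.div_rpow (by positivity) (by norm_num), Real.rpow_neg (by norm_num : (0:ℝ) ≤ 2), div_inv_eq_mul, mul_comm]
  -- Since R ≥ 1, us is at most 1 + Rus. The power γ cancels, and the near factor is bounded by an
  -- inverse square.
  have h3 : (u * s) ^ γ * (1 + R * (u * s)) ^ (-(γ + 2)) ≤ ((1 + R * s * u) ^ 2)⁻¹ := by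
    have hx : 0 ≤ R * (u * s) := by positivity
    have h4 : (u * s) ^ γ ≤ (1 + R * (u * s)) ^ γ := Real.rpow_le_rpow (by positivity) (by nlinarith [mul_nonneg hu hs]) hγ
    have h5 : (1 + R * (u * s)) ^ γ * (1 + R * (u * s)) ^ (-(γ + 2)) = ((1 + R * s * u) ^ 2)⁻¹ := by
      rw [← Real.rpow_add (by positivity), show γ + -(γ + 2) = -(2 : ℝ) by ring, Real.rpow_neg (by positivity), show R * (u * s) = R * s * u by ring]
      norm_cast
    rw [← h5]; gcongr
  have hexp : Real.exp (R * (u * s)) * Real.exp (R * ((1 - u) * s)) = Real.exp (R * s) := by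
    rw [← Real.exp_add]; ring_nf
  -- The normalization: 2^{γ+2} pays for the halving of 1 + Rs, and the extra 2 for the two halves
  -- of the interval.
  have h23 : (2 : ℝ) ^ (γ + 3) = 2 ^ (γ + 2) * 2 := by rw [← Real.rpow_add_one (by norm_num)]; ring_nf
  unfold rayWeight
  calc _ = (R / 2 ^ (γ + 3)) ^ 2 * s * ((u * s) ^ γ * (1 + R * (u * s)) ^ (-(γ + 2))) *
        (((1 - u) * s) ^ γ * (1 + R * ((1 - u) * s)) ^ (-(γ + 2))) * (Real.exp (R * (u * s)) * Real.exp (R * ((1 - u) * s))) := by ring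
    _ ≤ (R / 2 ^ (γ + 3)) ^ 2 * s * ((1 + R * s * u) ^ 2)⁻¹ * (s ^ γ * (2 ^ (γ + 2) * (1 + R * s) ^ (-(γ + 2)))) * Real.exp (R * s) := by
        rw [hexp]
        have : 0 ≤ 1 - u := by linarith
        gcongr
    _ = _ := by
        have : (2 : ℝ) ^ (γ + 2) ≠ 0 := by positivity
        rw [h23]; field_simp

theorem integral_inv_sq_le {b : ℝ} (hb : 0 ≤ b) : ∫ u in (0 : ℝ)..1, b * ((1 + b * u) ^ 2)⁻¹ ≤ 1 := by
  have h : ∀ u ∈ uIcc (0 : ℝ) 1, HasDerivAt (fun u => -(1 + b * u)⁻¹) (b * ((1 + b * u) ^ 2)⁻¹) u := by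
    intro u hu
    rw [uIcc_of_le zero_le_one] at hu
    have hne : 1 + b * u ≠ 0 := by have := mul_nonneg hb hu.1; positivity
    have h1 : HasDerivAt (fun u : ℝ => 1 + b * u) b u := by simpa using ((hasDerivAt_id u).const_mul b).const_add 1
    refine (h1.inv hne).neg.congr_deriv ?_
    field_simp
  have hc : ContinuousOn (fun u : ℝ => b * ((1 + b * u) ^ 2)⁻¹) (uIcc 0 1) := by
    refine ContinuousOn.mul continuousOn_const (ContinuousOn.inv₀ (by fun_prop) fun u hu => ?_)
    rw [uIcc_of_le zero_le_one] at hu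
    have := mul_nonneg hb hu.1
    positivity
  rw [intervalIntegral.integral_eq_sub_of_hasDerivAt h hc.intervalIntegrable]
  have : 0 ≤ (1 + b)⁻¹ := by positivity
  simp; linarith

theorem integrableOn_rayWeight_mul {γ R s : ℝ} (hγ : 0 ≤ γ) (hR : 0 < R) (hs : 0 ≤ s) :
    IntegrableOn (fun u => rayWeight γ R (u * s) * rayWeight γ R ((1 - u) * s)) (Ioo 0 1) := by
  refine (ContinuousOn.integrableOn_Icc ?_).mono_set Ioo_subset_Icc_self
  refine ContinuousOn.mul ((continuousOn_rayWeight hγ hR).comp (by fun_prop) fun u hu => ?_)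
    ((continuousOn_rayWeight hγ hR).comp (by fun_prop) fun u hu => ?_)
  · exact mul_nonneg hu.1 hs
  · exact mul_nonneg (by linarith [hu.2]) hs

/-- The self-convolution of the weight is at most the weight. -/
theorem rayWeight_conv_le {γ R s : ℝ} (hγ : 0 ≤ γ) (hR : 1 ≤ R) (hs : 0 ≤ s) :
    s * ∫ u in Ioo (0 : ℝ) 1, rayWeight γ R (u * s) * rayWeight γ R ((1 - u) * s) ≤ rayWeight γ R s := by
  have hR0 : 0 < R := by linarith
  have hb : 0 ≤ R * s := by positivity
  have hW := rayWeight_nonneg (γ := γ) hR0 hs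
  have hc : Continuous fun u : ℝ => |u| := continuous_abs
  have hcont : ∀ f : ℝ → ℝ, Continuous f → (∀ u ∈ Icc (0:ℝ) 1, 0 ≤ f u) → ContinuousOn (fun u => R * s * ((1 + R * s * f u) ^ 2)⁻¹) (Icc 0 1) := by
    intro f hf h0
    refine ContinuousOn.mul continuousOn_const (ContinuousOn.inv₀ (by fun_prop) fun u hu => ?_)
    have := mul_nonneg hb (h0 u hu)
    positivity
  have hi1 := (hcont (fun u => u) continuous_id fun u hu => hu.1).integrableOn_Icc (μ := volume)
  have hi2 := (hcont (fun u => 1 - u) (by fun_prop) fun u hu => by linarith [hu.2]).integrableOn_Icc (μ := volume)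
  have hI : ∫ u in Ioo (0 : ℝ) 1, R * s * ((1 + R * s * u) ^ 2)⁻¹ ≤ 1 := by
    rw [← integral_Ioc_eq_integral_Ioo, ← intervalIntegral.integral_of_le zero_le_one]
    exact integral_inv_sq_le hb
  have hI' : ∫ u in Ioo (0 : ℝ) 1, R * s * ((1 + R * s * (1 - u)) ^ 2)⁻¹ ≤ 1 := by
    rw [← integral_Ioc_eq_integral_Ioo, ← intervalIntegral.integral_of_le zero_le_one,
      intervalIntegral.integral_comp_sub_left (fun u => R * s * ((1 + R * s * u) ^ 2)⁻¹) 1]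
    simpa using integral_inv_sq_le hb
  rw [← integral_const_mul]
  -- The sum of the majorants for the two halves dominates on the whole interval, so the integral
  -- need not be split. Each of the two integrals is at most 1.
  calc _ ≤ ∫ u in Ioo (0 : ℝ) 1, rayWeight γ R s * (1 / 2 * (R * s * ((1 + R * s * u) ^ 2)⁻¹ + R * s * ((1 + R * s * (1 - u)) ^ 2)⁻¹)) := by
        refine setIntegral_mono_on ((integrableOn_rayWeight_mul hγ hR0 hs).const_mul s)
          ((((hi1.add hi2).mono_set Ioo_subset_Icc_self).const_mul _).const_mul _) measurableSet_Ioo fun u hu => ?_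
        rcases le_total u (1 / 2) with h | h
        · refine (rayWeight_mul_le_of_le_half hR hγ hs hu.1.le h).trans (mul_le_mul_of_nonneg_left ?_ hW)
          have : 0 ≤ R * s * ((1 + R * s * (1 - u)) ^ 2)⁻¹ := by positivity
          linarith
        · have := rayWeight_mul_le_of_le_half (u := 1 - u) hR hγ hs (by linarith [hu.2]) (by linarith)
          rw [show 1 - (1 - u) = u by ring] at this
          calc _ = s * (rayWeight γ R ((1 - u) * s) * rayWeight γ R (u * s)) := by ring
            _ ≤ _ := this
            _ ≤ _ := by
              refine mul_le_mul_of_nonneg_left ?_ hW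
              have : 0 ≤ R * s * ((1 + R * s * u) ^ 2)⁻¹ := by positivity
              linarith
    _ = rayWeight γ R s * (1 / 2 * ((∫ u in Ioo (0 : ℝ) 1, R * s * ((1 + R * s * u) ^ 2)⁻¹) + ∫ u in Ioo (0 : ℝ) 1, R * s * ((1 + R * s * (1 - u)) ^ 2)⁻¹)) := by
        rw [integral_const_mul, integral_const_mul, integral_add (hi1.mono_set Ioo_subset_Icc_self) (hi2.mono_set Ioo_subset_Icc_self)]
    _ ≤ rayWeight γ R s * 1 := mul_le_mul_of_nonneg_left (by linarith) hW
    _ = _ := mul_one _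

/-- From 1 + y ≤ 4N e^{y/(4N)}, raised to the power N. -/
theorem one_add_rpow_mul_exp_le {N y : ℝ} (hN : 1 ≤ N) (hy : 0 ≤ y) : (1 + y) ^ N * Real.exp (-(y / 4)) ≤ (4 * N) ^ N := by
  have h1 : 1 + y ≤ 4 * N * Real.exp (y / (4 * N)) := by
    have := Real.add_one_le_exp (y / (4 * N))
    have h2 : 4 * N * (y / (4 * N) + 1) = y + 4 * N := by field_simp
    nlinarith
  have h2 : (1 + y) ^ N ≤ (4 * N) ^ N * Real.exp (y / 4) := by
    calc _ ≤ (4 * N * Real.exp (y / (4 * N))) ^ N := Real.rpow_le_rpow (by positivity) h1 (by linarith)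
      _ = _ := by
        rw [Real.mul_rpow (by positivity) (Real.exp_pos _).le, ← Real.exp_mul]
        congr 2; field_simp
  calc _ ≤ (4 * N) ^ N * Real.exp (y / 4) * Real.exp (-(y / 4)) := by gcongr
    _ = _ := by rw [mul_assoc, ← Real.exp_add]; simp

/-- Comparison of pure exponential growth with the weight. -/
theorem rpow_mul_exp_le_rayWeight {γ R A s : ℝ} (hγ : 0 ≤ γ) (hR : 1 ≤ R) (hA : 2 * A ≤ R) (hs : 0 ≤ s) :
    s ^ γ * Real.exp (A * s) ≤ (4 * (γ + 2)) ^ (γ + 2) * 2 ^ (γ + 3) / R * rayWeight γ R s := by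
  have hy : 0 ≤ R * s := by positivity
  have h1 := one_add_rpow_mul_exp_le (N := γ + 2) (y := R * s) (by linarith) hy
  have h2 : Real.exp (A * s) ≤ Real.exp (R * s) * Real.exp (-(R * s / 4)) := by
    rw [← Real.exp_add]; exact Real.exp_le_exp.2 (by nlinarith)
  have h3 : Real.exp (-(R * s / 4)) ≤ (4 * (γ + 2)) ^ (γ + 2) * (1 + R * s) ^ (-(γ + 2)) := by
    rw [Real.rpow_neg (by positivity), ← div_eq_mul_inv, le_div_iff₀ (by positivity), mul_comm]; exact h1
  unfold rayWeight
  calc _ ≤ s ^ γ * (Real.exp (R * s) * ((4 * (γ + 2)) ^ (γ + 2) * (1 + R * s) ^ (-(γ + 2)))) := by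
        refine mul_le_mul_of_nonneg_left (h2.trans ?_) (by positivity)
        gcongr
    _ = _ := by field_simp

theorem integrableOn_rpow_mul_rayWeight {γ R A α s : ℝ} (hγ : 0 ≤ γ) (hR : 0 < R) (hα : 0 < α) (hs : 0 < s) :
    IntegrableOn (fun u => (u * s) ^ (α - 1) * Real.exp (A * (u * s)) * rayWeight γ R ((1 - u) * s)) (Ioo 0 1) := by
  have h1 : IntegrableOn (fun u : ℝ => u ^ (α - 1)) (Icc 0 1) := by
    rw [integrableOn_Icc_iff_integrableOn_Ioc, ← intervalIntegrable_iff_integrableOn_Ioc_of_le zero_le_one]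
    exact intervalIntegral.intervalIntegrable_rpow' (by linarith)
  have h2 : ContinuousOn (fun u : ℝ => s ^ (α - 1) * Real.exp (A * (u * s)) * rayWeight γ R ((1 - u) * s)) (Icc 0 1) := by
    refine ContinuousOn.mul (by fun_prop) ((continuousOn_rayWeight hγ hR).comp (by fun_prop) fun u hu => ?_)
    exact mul_nonneg (by linarith [hu.2]) hs.le
  refine ((h1.mul_continuousOn h2 isCompact_Icc).mono_set Ioo_subset_Icc_self).congr_fun (fun u hu => ?_) measurableSet_Ioo
  simp only
  rw [Real.mul_rpow hu.1.le hs.le]; ring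

/-- Convolution of the weight with an integrable singularity. -/
theorem rpow_conv_rayWeight_le {γ R A α s : ℝ} (hγ : 0 ≤ γ) (hR : 1 ≤ R) (hA : 2 * A ≤ R) (hα : 0 < α) (hs : 0 < s) :
    s * ∫ u in Ioo (0 : ℝ) 1, (u * s) ^ (α - 1) * Real.exp (A * (u * s)) * rayWeight γ R ((1 - u) * s) ≤
      ((4 * (γ + 2)) ^ (γ + 2) * Real.Gamma α * (4 / R) ^ α) * rayWeight γ R s := by
  have hR0 : 0 < R := by linarith
  have hW := rayWeight_nonneg (γ := γ) hR0 hs.le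
  set c := (4 * (γ + 2)) ^ (γ + 2) with hc
  have hc0 : 0 ≤ c := by positivity
  have hpt : ∀ u ∈ Ioo (0 : ℝ) 1, (u * s) ^ (α - 1) * Real.exp (A * (u * s)) * rayWeight γ R ((1 - u) * s) ≤
      c * rayWeight γ R s * ((u * s) ^ (α - 1) * Real.exp (-(R / 4 * (u * s)))) := by
    intro u hu
    have hu0 := hu.1.le
    have hu1 : 0 ≤ 1 - u := by linarith [hu.2]
    have h1 : ((1 - u) * s) ^ γ ≤ s ^ γ := Real.rpow_le_rpow (by positivity) (by nlinarith) hγ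
    -- Submultiplicativity: 1 + Rs ≤ (1 + Rus)(1 + R(1-u)s).
    have h2 : (1 + R * ((1 - u) * s)) ^ (-(γ + 2)) ≤ (1 + R * (u * s)) ^ (γ + 2) * (1 + R * s) ^ (-(γ + 2)) := by
      rw [Real.rpow_neg (by positivity), Real.rpow_neg (by positivity), ← div_eq_mul_inv, le_div_iff₀ (by positivity), inv_mul_le_iff₀ (by positivity),
        ← Real.mul_rpow (by positivity) (by positivity)]
      refine Real.rpow_le_rpow (by positivity) ?_ (by linarith)
      nlinarith [mul_nonneg (mul_nonneg hR0.le (mul_nonneg hu0 hs.le)) (mul_nonneg hR0.le (mul_nonneg hu1 hs.le))]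
    have h3 := one_add_rpow_mul_exp_le (N := γ + 2) (y := R * (u * s)) (by linarith) (by positivity)
    rw [← hc] at h3
    -- Because A ≤ R/2, a factor e^{-Rus/2} is left over. One half of it pays for (1 + Rus)^{γ+2},
    -- and the other half gives the Gamma integral with its factor (4/R)^α.
    have hexp : Real.exp (A * (u * s)) * Real.exp (R * ((1 - u) * s)) ≤ Real.exp (R * s) * Real.exp (-(R * (u * s) / 4)) * Real.exp (-(R / 4 * (u * s))) := by
      rw [← Real.exp_add, ← Real.exp_add, ← Real.exp_add]
      refine Real.exp_le_exp.2 ?_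
      nlinarith [mul_nonneg hu0 hs.le]
    unfold rayWeight
    calc _ = R / 2 ^ (γ + 3) * (u * s) ^ (α - 1) * ((1 - u) * s) ^ γ * (1 + R * ((1 - u) * s)) ^ (-(γ + 2)) * (Real.exp (A * (u * s)) * Real.exp (R * ((1 - u) * s))) := by ring
      _ ≤ R / 2 ^ (γ + 3) * (u * s) ^ (α - 1) * s ^ γ * ((1 + R * (u * s)) ^ (γ + 2) * (1 + R * s) ^ (-(γ + 2))) *
          (Real.exp (R * s) * Real.exp (-(R * (u * s) / 4)) * Real.exp (-(R / 4 * (u * s)))) := by gcongr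
      _ = ((1 + R * (u * s)) ^ (γ + 2) * Real.exp (-(R * (u * s) / 4))) * (R / 2 ^ (γ + 3) * (u * s) ^ (α - 1) * s ^ γ * (1 + R * s) ^ (-(γ + 2)) *
          (Real.exp (R * s) * Real.exp (-(R / 4 * (u * s))))) := by ring
      _ ≤ c * (R / 2 ^ (γ + 3) * (u * s) ^ (α - 1) * s ^ γ * (1 + R * s) ^ (-(γ + 2)) *
          (Real.exp (R * s) * Real.exp (-(R / 4 * (u * s))))) := by gcongr
      _ = _ := by ring
  have hR4 : 0 < R / 4 := by positivity
  have hGi : IntegrableOn (fun v : ℝ => v ^ (α - 1) * Real.exp (-(R / 4 * v))) (Ioi 0) := by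
    have := integrableOn_rpow_mul_exp_neg_mul_rpow (s := α - 1) (by linarith) one_pos hR4
    simpa using this
  have hG : ∫ v in Ioi (0 : ℝ), v ^ (α - 1) * Real.exp (-(R / 4 * v)) = (4 / R) ^ α * Real.Gamma α := by
    rw [Real.integral_rpow_mul_exp_neg_mul_Ioi hα hR4]; congr 2; field_simp
  have hGi' : IntegrableOn (fun u : ℝ => (u * s) ^ (α - 1) * Real.exp (-(R / 4 * (u * s)))) (Ioi 0) := by
    have := (integrableOn_Ioi_comp_mul_right_iff (fun v : ℝ => v ^ (α - 1) * Real.exp (-(R / 4 * v))) 0 hs).2 (by simpa using hGi)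
    exact this
  have hI : s * ∫ u in Ioo (0 : ℝ) 1, (u * s) ^ (α - 1) * Real.exp (-(R / 4 * (u * s))) ≤ (4 / R) ^ α * Real.Gamma α := by
    have h1 : ∫ u in Ioo (0 : ℝ) 1, (u * s) ^ (α - 1) * Real.exp (-(R / 4 * (u * s))) ≤ ∫ u in Ioi (0 : ℝ), (u * s) ^ (α - 1) * Real.exp (-(R / 4 * (u * s))) := by
      refine setIntegral_mono_set hGi' ?_ (Eventually.of_forall fun u hu => hu.1)
      filter_upwards [ae_restrict_mem measurableSet_Ioi] with u hu
      have hu : 0 < u := hu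
      simp only [Pi.zero_apply]; positivity
    have h2 := integral_comp_mul_right_Ioi (fun v : ℝ => v ^ (α - 1) * Real.exp (-(R / 4 * v))) 0 hs
    rw [h2, zero_mul, hG, smul_eq_mul] at h1
    calc _ ≤ s * (s⁻¹ * ((4 / R) ^ α * Real.Gamma α)) := by gcongr
      _ = _ := by field_simp
  calc _ ≤ s * ∫ u in Ioo (0 : ℝ) 1, c * rayWeight γ R s * ((u * s) ^ (α - 1) * Real.exp (-(R / 4 * (u * s)))) := by
        refine mul_le_mul_of_nonneg_left ?_ hs.le
        exact setIntegral_mono_on (integrableOn_rpow_mul_rayWeight hγ hR0 hα hs)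
          ((hGi'.mono_set fun u hu => hu.1).const_mul _) measurableSet_Ioo hpt
    _ = c * rayWeight γ R s * (s * ∫ u in Ioo (0 : ℝ) 1, (u * s) ^ (α - 1) * Real.exp (-(R / 4 * (u * s)))) := by
        rw [integral_const_mul]; ring
    _ ≤ c * rayWeight γ R s * ((4 / R) ^ α * Real.Gamma α) := by gcongr
    _ = _ := by ring

/-! ### Functions on the Borel plane and kernels -/

theorem smul_mem_csector {d : ℕ} {σ : ℝ} {p : Fin d → ℂ} (hp : p ∈ csector d σ) {u : Fin d → ℝ} (hu : ∀ i, 0 < u i) :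
    (fun i => (u i : ℂ) * p i) ∈ csector d σ := fun i => by
  refine ⟨mul_ne_zero (by simp [(hu i).ne']) (hp i).1, ?_⟩
  rw [Complex.arg_real_mul _ (hu i)]; exact (hp i).2

theorem update_mem_csector_of_mem {d : ℕ} {σ : ℝ} {p : Fin d → ℂ} (hp : p ∈ csector d σ) {i : Fin d} {z : ℂ} (hz : z ∈ osector σ) :
    Function.update p i z ∈ csector d σ :=
  update_mem_csector ⟨hz.1, hz.2.le⟩ fun j _ => hp j

theorem differentiable_update {d : ℕ} (p : Fin d → ℂ) (i : Fin d) : Differentiable ℂ fun z : ℂ => Function.update p i z := by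
  refine differentiable_pi.2 fun j => ?_
  by_cases hj : j = i
  · subst hj; simp only [Function.update_self]; fun_prop
  · simp only [Function.update_of_ne hj]; fun_prop

namespace IsBorel

variable {d : ℕ} {σ T : ℝ} {F G : (Fin d → ℂ) → ℝ → ℂ}

theorem add (hF : IsBorel σ T F) (hG : IsBorel σ T G) : IsBorel σ T fun p t => F p t + G p t :=
  ⟨hF.cont.add hG.cont, fun t ht p hp i => (hF.holo t ht p hp i).add (hG.holo t ht p hp i)⟩

theorem sub (hF : IsBorel σ T F) (hG : IsBorel σ T G) : IsBorel σ T fun p t => F p t - G p t :=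
  ⟨hF.cont.sub hG.cont, fun t ht p hp i => (hF.holo t ht p hp i).sub (hG.holo t ht p hp i)⟩

theorem mul (hF : IsBorel σ T F) (hG : IsBorel σ T G) : IsBorel σ T fun p t => F p t * G p t :=
  ⟨hF.cont.mul hG.cont, fun t ht p hp i => (hF.holo t ht p hp i).mul (hG.holo t ht p hp i)⟩

theorem of_differentiable {m : (Fin d → ℂ) → ℂ} (hm : Differentiable ℂ m) : IsBorel σ T fun p (_ : ℝ) => m p :=
  ⟨(hm.continuous.comp continuous_fst).continuousOn, fun _ _ p _ i => (hm.comp (differentiable_update p i)).differentiableOn⟩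

theorem congr (hF : IsBorel σ T F) (h : ∀ p ∈ csector d σ, ∀ t ∈ Icc 0 T, G p t = F p t) : IsBorel σ T G :=
  ⟨hF.cont.congr fun z hz => h z.1 hz.1 z.2 hz.2, fun t ht p hp i =>
    (hF.holo t ht p hp i).congr fun _ hz => h _ (update_mem_csector_of_mem hp hz) t ht⟩

theorem continuousOn (hF : IsBorel σ T F) {t : ℝ} (ht : t ∈ Icc 0 T) : ContinuousOn (fun p => F p t) (csector d σ) :=
  hF.cont.comp (f := fun p => (p, t)) (by fun_prop) fun _ hp => ⟨hp, ht⟩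

theorem continuousOn_time (hF : IsBorel σ T F) {p : Fin d → ℂ} (hp : p ∈ csector d σ) : ContinuousOn (fun t => F p t) (Icc 0 T) :=
  hF.cont.comp (f := fun t => (p, t)) (by fun_prop) fun _ ht => ⟨hp, ht⟩

/-- Continuity of w makes the majorants locally uniform: near a point |w| stays below its value
there plus one. Locally uniform convergence preserves joint continuity and holomorphy. -/
theorem tsum {ι : Type*} {F : ι → (Fin d → ℂ) → ℝ → ℂ} (hσ : σ ≤ Real.pi) (hF : ∀ i, IsBorel σ T (F i)) {u : ι → ℝ} (hu : Summable u)
    {w : (Fin d → ℂ) → ℝ} (hw : ContinuousOn w (csector d σ))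
    (hb : ∀ i, ∀ p ∈ csector d σ, ∀ t ∈ Icc 0 T, ‖F i p t‖ ≤ u i * w p) : IsBorel σ T fun p t => ∑' i, F i p t := by
  have hb' : ∀ i, ∀ p ∈ csector d σ, ∀ t ∈ Icc 0 T, ∀ M, |w p| ≤ M → ‖F i p t‖ ≤ |u i| * M := fun i p hp t ht M hM =>
    (hb i p hp t ht).trans ((le_abs_self _).trans (by rw [abs_mul]; gcongr))
  constructor
  · rintro ⟨p₀, t₀⟩ hz₀
    set D := csector d σ ×ˢ Icc 0 T
    have hwD : ContinuousOn (fun z : (Fin d → ℂ) × ℝ => |w z.1|) D := (hw.comp continuousOn_fst fun z hz => hz.1).abs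
    set s := {z ∈ D | |w z.1| < |w p₀| + 1}
    have hs : s ∈ 𝓝[D] (p₀, t₀) := by
      filter_upwards [self_mem_nhdsWithin, (hwD _ hz₀).eventually (gt_mem_nhds (show |w p₀| < |w p₀| + 1 by linarith))] with z h1 h2 using ⟨h1, h2⟩
    have hc : ContinuousOn (fun z : (Fin d → ℂ) × ℝ => ∑' i, F i z.1 z.2) s :=
      continuousOn_tsum (fun i => (hF i).cont.mono fun z hz => hz.1) (hu.abs.mul_right (|w p₀| + 1))
        fun i z hz => hb' i z.1 hz.1.1 z.2 hz.1.2 _ hz.2.le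
    exact (hc _ ⟨hz₀, by simp⟩).mono_of_mem_nhdsWithin hs
  · intro t ht p hp i z₀ hz₀
    have hwc : ContinuousOn (fun z => |w (Function.update p i z)|) (osector σ) :=
      (hw.comp (f := fun z => Function.update p i z) (by fun_prop) fun z hz => update_mem_csector_of_mem hp hz).abs
    set V := osector σ ∩ (fun z => |w (Function.update p i z)|) ⁻¹' Iio (|w (Function.update p i z₀)| + 1)
    have hV : IsOpen V := hwc.isOpen_inter_preimage (isOpen_osector hσ) isOpen_Iio
    have hz₀V : z₀ ∈ V := ⟨hz₀, by simp⟩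
    have hd := Complex.differentiableOn_tsum_of_summable_norm (F := fun j z => F j (Function.update p i z) t) (hu.abs.mul_right (|w (Function.update p i z₀)| + 1))
      (fun j => ((hF j).holo t ht p hp i).mono inter_subset_left) hV
      fun j z hz => hb' j _ (update_mem_csector_of_mem hp hz.1) t ht _ (le_of_lt hz.2)
    exact (hd.differentiableAt (hV.mem_nhds hz₀V)).differentiableWithinAt

end IsBorel

/-- The product weight on the Borel plane. -/
noncomputable def borelWeight {d : ℕ} (γ R : ℝ) (p : Fin d → ℂ) : ℝ := ∏ i, rayWeight γ R ‖p i‖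

theorem borelWeight_nonneg {d : ℕ} {γ R : ℝ} (hR : 0 < R) (p : Fin d → ℂ) : 0 ≤ borelWeight γ R p :=
  Finset.prod_nonneg fun _ _ => rayWeight_nonneg hR (norm_nonneg _)

theorem continuous_borelWeight {d : ℕ} {γ R : ℝ} (hγ : 0 ≤ γ) (hR : 0 < R) : Continuous fun p : Fin d → ℂ => borelWeight γ R p :=
  continuous_finsetProd _ fun i _ => (continuousOn_rayWeight hγ hR).comp_continuous (by fun_prop) fun p => norm_nonneg (p i)

/-- Functions on the Borel plane bounded by `K (1 + |p|)ᵃ` times the weight. -/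
structure IsKernel {d : ℕ} (σ T γ R : ℝ) (a : ℕ) (K : ℝ) (F : (Fin d → ℂ) → ℝ → ℂ) : Prop where
  borel : IsBorel σ T F
  bound : ∀ p ∈ csector d σ, ∀ t ∈ Icc 0 T, ‖F p t‖ ≤ K * (1 + ‖p‖) ^ a * borelWeight γ R p

namespace IsKernel

variable {d : ℕ} {σ T γ R K K' : ℝ} {a b : ℕ} {F G : (Fin d → ℂ) → ℝ → ℂ}

theorem mono (hR : 0 < R) (h : IsKernel σ T γ R a K F) (hK : K ≤ K') : IsKernel σ T γ R a K' F :=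
  ⟨h.borel, fun p hp t ht => (h.bound p hp t ht).trans <| by
    have := borelWeight_nonneg (γ := γ) hR p
    gcongr⟩

theorem mono_exp (hR : 0 < R) (h : IsKernel σ T γ R a K F) (hK : 0 ≤ K) (hab : a ≤ b) : IsKernel σ T γ R b K F :=
  ⟨h.borel, fun p hp t ht => (h.bound p hp t ht).trans <| by
    have := borelWeight_nonneg (γ := γ) hR p
    have h1 : 1 ≤ 1 + ‖p‖ := by linarith [norm_nonneg p]
    gcongr⟩

theorem congr (hF : IsKernel σ T γ R a K F) (h : ∀ p ∈ csector d σ, ∀ t ∈ Icc 0 T, G p t = F p t) : IsKernel σ T γ R a K G :=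
  ⟨hF.borel.congr h, fun p hp t ht => by rw [h p hp t ht]; exact hF.bound p hp t ht⟩

theorem add (hF : IsKernel σ T γ R a K F) (hG : IsKernel σ T γ R a K' G) : IsKernel σ T γ R a (K + K') fun p t => F p t + G p t :=
  ⟨hF.borel.add hG.borel, fun p hp t ht => (norm_add_le _ _).trans
    ((add_le_add (hF.bound p hp t ht) (hG.bound p hp t ht)).trans_eq (by ring))⟩

theorem sub (hF : IsKernel σ T γ R a K F) (hG : IsKernel σ T γ R a K' G) : IsKernel σ T γ R a (K + K') fun p t => F p t - G p t :=
  ⟨hF.borel.sub hG.borel, fun p hp t ht => (norm_sub_le _ _).trans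
    ((add_le_add (hF.bound p hp t ht) (hG.bound p hp t ht)).trans_eq (by ring))⟩

theorem zero (hK : 0 ≤ K) (hR : 0 < R) : IsKernel σ T γ R a K (fun (_ : Fin d → ℂ) (_ : ℝ) => (0 : ℂ)) :=
  ⟨IsBorel.of_differentiable (differentiable_const 0), fun p _ _ _ => by
    have := borelWeight_nonneg (γ := γ) hR p
    rw [norm_zero]; positivity⟩

theorem mul_left (hF : IsKernel σ T γ R a K F) {m : (Fin d → ℂ) → ℂ} (hm : Differentiable ℂ m) {M : ℝ} (hM : ∀ p, ‖m p‖ ≤ M * (1 + ‖p‖) ^ b) :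
    IsKernel σ T γ R (a + b) (M * K) fun p t => m p * F p t :=
  ⟨(IsBorel.of_differentiable hm).mul hF.borel, fun p hp t ht => by
    rw [norm_mul]
    refine (mul_le_mul (hM p) (hF.bound p hp t ht) (norm_nonneg _) ((norm_nonneg _).trans (hM p))).trans_eq ?_
    rw [pow_add]; ring⟩

theorem mul_negPow (hR : 0 < R) (hF : IsKernel σ T γ R a K F) (j : Fin d → ℕ) :
    IsKernel σ T γ R (a + ∑ i, j i) K fun p t => negPow j p * F p t := by
  have := hF.mul_left (m := negPow j) (M := 1) (b := ∑ i, j i) (by unfold negPow; fun_prop) fun p => by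
    rw [one_mul]; exact norm_negPow_le j p
  rwa [one_mul] at this

theorem tsum (hσ : σ ≤ Real.pi) (hγ : 0 ≤ γ) (hR : 0 < R) {ι : Type*} {F : ι → (Fin d → ℂ) → ℝ → ℂ} {u : ι → ℝ}
    (hF : ∀ i, IsKernel σ T γ R a (u i) (F i)) (hu : Summable u) : IsKernel σ T γ R a (∑' i, u i) fun p t => ∑' i, F i p t := by
  refine ⟨IsBorel.tsum hσ (fun i => (hF i).borel) hu (w := fun p => (1 + ‖p‖) ^ a * borelWeight γ R p) ?_ ?_, fun p hp t ht => ?_⟩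
  · have := continuous_borelWeight (d := d) hγ hR
    exact Continuous.continuousOn (by fun_prop)
  · intro i p hp t ht
    exact ((hF i).bound p hp t ht).trans_eq (by ring)
  · have h := hu.hasSum.mul_right ((1 + ‖p‖) ^ a * borelWeight γ R p)
    refine (tsum_of_norm_bounded h fun i => ?_).trans_eq (by ring)
    exact ((hF i).bound p hp t ht).trans_eq (by ring)

/-- The factor (1 + Rs)^{-(γ+2)} matters for the convolution estimates only and is dropped;
convergence of Laplace integrals needs just the exponential type R. -/
theorem growth (hγ : 0 ≤ γ) (hR : 0 < R) (h : IsKernel σ T γ R a K F) {t : ℝ} (ht : t ∈ Icc 0 T) :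
    HasExpGrowth σ a γ R (|K| * (R / 2 ^ (γ + 3)) ^ d) fun p => F p t := by
  refine ⟨h.borel.continuousOn ht, fun p hp => (h.bound p hp t ht).trans ?_⟩
  have h0 := borelWeight_nonneg (γ := γ) hR p
  have h1 : borelWeight γ R p ≤ ∏ i, (R / 2 ^ (γ + 3) * (‖p i‖ ^ γ * Real.exp (R * ‖p i‖))) :=
    Finset.prod_le_prod (fun i _ => rayWeight_nonneg hR (norm_nonneg _)) fun i _ => rayWeight_le hR hγ (norm_nonneg _)
  have h2 : (1 + ‖p‖) ^ a ≤ (∏ i, (1 + ‖p i‖)) ^ a := by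
    gcongr; exact one_add_norm_le_prod p
  calc _ ≤ |K| * (∏ i, (1 + ‖p i‖)) ^ a * ∏ i, (R / 2 ^ (γ + 3) * (‖p i‖ ^ γ * Real.exp (R * ‖p i‖))) := by
        gcongr; exact le_abs_self K
    _ = _ := by
        have : ∀ i, expWeight a γ R ‖p i‖ = (1 + ‖p i‖) ^ a * (‖p i‖ ^ γ * Real.exp (R * ‖p i‖)) := fun i => by
          unfold expWeight; ring
        simp only [this, Finset.prod_mul_distrib, Finset.prod_const, Finset.prod_pow, Finset.card_univ, Fintype.card_fin]
        ring

theorem exists_local_bound (hγ : 0 ≤ γ) (hR : 0 < R) (h : IsKernel σ T γ R a K F) (M : ℝ) :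
    ∃ C, ∀ p ∈ csector d σ, (∀ i, ‖p i‖ ≤ M) → ∀ t ∈ Icc 0 T, ‖F p t‖ ≤ C := by
  have hc : Continuous fun p : Fin d → ℂ => K * (1 + ‖p‖) ^ a * borelWeight γ R p := by
    have := continuous_borelWeight (d := d) hγ hR
    fun_prop
  obtain ⟨C, hC⟩ := (isCompact_closedBall (0 : Fin d → ℂ) |M|).bddAbove_image hc.continuousOn
  refine ⟨C, fun p hp hpM t ht => (h.bound p hp t ht).trans (hC ⟨p, ?_, rfl⟩)⟩
  rw [mem_closedBall_zero_iff, pi_norm_le_iff_of_nonneg (abs_nonneg _)]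
  exact fun i => (hpM i).trans (le_abs_self M)

end IsKernel

/-! ### Convolution of kernels -/

theorem norm_ofReal_mul {u : ℝ} (hu : 0 ≤ u) (z : ℂ) : ‖(u : ℂ) * z‖ = u * ‖z‖ := by
  rw [norm_mul, Complex.norm_real, Real.norm_of_nonneg hu]

theorem eventually_nhdsWithin_bounded {d : ℕ} (p₀ : Fin d → ℂ) (t₀ : ℝ) (D : Set ((Fin d → ℂ) × ℝ)) :
    ∀ᶠ z in 𝓝[D] (p₀, t₀), z ∈ D ∧ ∀ i, ‖z.1 i‖ ≤ ‖p₀‖ + 1 := by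
  refine eventually_mem_nhdsWithin.and (nhdsWithin_le_nhds ?_)
  have hc : Continuous fun z : (Fin d → ℂ) × ℝ => ‖z.1‖ := by fun_prop
  filter_upwards [hc.continuousAt.eventually (gt_mem_nhds (show ‖(p₀, t₀).1‖ < ‖p₀‖ + 1 by simp))] with z hz i
  exact (norm_le_pi_norm z.1 i).trans hz.le

theorem norm_update_le {d : ℕ} {p : Fin d → ℂ} {i : Fin d} {z z₀ : ℂ} (hz : z ∈ Metric.ball z₀ 1) (j : Fin d) :
    ‖Function.update p i z j‖ ≤ ‖p‖ + ‖z₀‖ + 1 := by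
  by_cases hj : j = i
  · subst hj
    rw [Function.update_self]
    rw [Metric.mem_ball, dist_eq_norm] at hz
    have := norm_sub_norm_le z z₀
    linarith [norm_nonneg p]
  · rw [Function.update_of_ne hj]
    linarith [norm_le_pi_norm p j, norm_nonneg z₀]

/-- The convolution of two functions on the Borel plane. -/
theorem IsBorel.conv {d : ℕ} {σ T α : ℝ} {F G : (Fin d → ℂ) → ℝ → ℂ} (hσ : σ ≤ Real.pi) (hα : 0 < α)
    (hF : IsBorel σ T F) (hG : IsBorel σ T G)
    (hFb : ∀ M : ℝ, ∃ C, ∀ p ∈ csector d σ, (∀ i, ‖p i‖ ≤ M) → ∀ t ∈ Icc 0 T, ‖F p t‖ ≤ C * ∏ i, ‖p i‖ ^ (α - 1))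
    (hGb : ∀ M : ℝ, ∃ C, ∀ p ∈ csector d σ, (∀ i, ‖p i‖ ≤ M) → ∀ t ∈ Icc 0 T, ‖G p t‖ ≤ C) :
    IsBorel σ T fun p t => borelConv (fun p => F p t) (fun p => G p t) p := by
  let f : (Fin d → ℂ) → ℝ → (Fin d → ℝ) → ℂ := fun p t u =>
    (∏ i, p i) * (F (fun i => u i * p i) t * G (fun i => (1 - u i : ℝ) * p i) t)
  have hmem : ∀ p ∈ csector d σ, ∀ u : Fin d → ℝ, (∀ i, u i ∈ Ioo (0 : ℝ) 1) → (fun i => (u i : ℂ) * p i) ∈ csector d σ ∧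
      (fun i => ((1 - u i : ℝ) : ℂ) * p i) ∈ csector d σ := fun p hp u hu =>
    ⟨smul_mem_csector hp fun i => (hu i).1, smul_mem_csector (u := fun i => 1 - u i) hp fun i => by linarith [(hu i).2]⟩
  have hmeas : ∀ p ∈ csector d σ, ∀ t ∈ Icc 0 T, AEStronglyMeasurable (f p t) (unitCube d) := by
    intro p hp t ht
    rw [unitCube_eq]
    refine ContinuousOn.aestronglyMeasurable ?_ (MeasurableSet.univ_pi fun _ => measurableSet_Ioo)
    refine continuousOn_const.mul (ContinuousOn.mul ?_ ?_)
    · exact (hF.continuousOn ht).comp (f := fun u : Fin d → ℝ => fun i => (u i : ℂ) * p i) (by fun_prop) fun u hu => (hmem p hp u fun i => hu i (mem_univ i)).1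
    · exact (hG.continuousOn ht).comp (f := fun u : Fin d → ℝ => fun i => ((1 - u i : ℝ) : ℂ) * p i) (by fun_prop) fun u hu => (hmem p hp u fun i => hu i (mem_univ i)).2
  -- The singularity of F is compensated by the Jacobian: |pᵢ| |uᵢ pᵢ|^{α-1} = |pᵢ|^α uᵢ^{α-1},
  -- which is integrable in uᵢ and locally bounded in p.
  have hbd : ∀ M : ℝ, ∃ B : (Fin d → ℝ) → ℝ, Integrable B (unitCube d) ∧ ∀ p ∈ csector d σ, (∀ i, ‖p i‖ ≤ M) → ∀ t ∈ Icc 0 T,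
      ∀ u : Fin d → ℝ, (∀ i, u i ∈ Ioo (0 : ℝ) 1) → ‖f p t u‖ ≤ B u := by
    intro M
    obtain ⟨C, hC⟩ := hFb M
    obtain ⟨C', hC'⟩ := hGb M
    refine ⟨fun u => (|C| * |C'|) * ∏ i, (M ^ α * (u i) ^ (α - 1)), ?_, ?_⟩
    · refine (Integrable.fintype_prod (f := fun _ u => M ^ α * u ^ (α - 1)) fun i => ?_).const_mul _
      refine Integrable.const_mul ?_ _
      have : IntegrableOn (fun u : ℝ => u ^ (α - 1)) (Ioc 0 1) := by
        rw [← intervalIntegrable_iff_integrableOn_Ioc_of_le zero_le_one]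
        exact intervalIntegral.intervalIntegrable_rpow' (by linarith)
      exact this.mono_set Ioo_subset_Ioc_self
    · intro p hp hpM t ht u hu
      obtain ⟨h1, h2⟩ := hmem p hp u hu
      have hle1 : ∀ i, ‖(u i : ℂ) * p i‖ ≤ M := fun i => by
        rw [norm_ofReal_mul (hu i).1.le]
        exact (mul_le_of_le_one_left (norm_nonneg _) (hu i).2.le).trans (hpM i)
      have hle2 : ∀ i, ‖((1 - u i : ℝ) : ℂ) * p i‖ ≤ M := fun i => by
        rw [norm_ofReal_mul (by linarith [(hu i).2])]
        exact (mul_le_of_le_one_left (norm_nonneg _) (by linarith [(hu i).1])).trans (hpM i)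
      have e1 := hC _ h1 hle1 t ht
      have e2 := hC' _ h2 hle2 t ht
      simp only [norm_ofReal_mul (hu _).1.le] at e1
      have hP : ∏ i, (‖p i‖ * (u i * ‖p i‖) ^ (α - 1)) ≤ ∏ i, (M ^ α * (u i) ^ (α - 1)) := by
        refine Finset.prod_le_prod (fun i _ => by have := (hu i).1; positivity) fun i _ => ?_
        have hp0 := norm_pos_iff.2 (hp i).1
        rw [Real.mul_rpow (hu i).1.le hp0.le, show ‖p i‖ * (u i ^ (α - 1) * ‖p i‖ ^ (α - 1)) = (‖p i‖ ^ (α - 1) * ‖p i‖) * u i ^ (α - 1) by ring,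
          ← Real.rpow_add_one hp0.ne', sub_add_cancel]
        have := (hu i).1
        gcongr
        exact hpM i
      have hQ : 0 ≤ ∏ i, (u i * ‖p i‖) ^ (α - 1) := Finset.prod_nonneg fun i _ => by have := (hu i).1; positivity
      calc ‖f p t u‖ = (∏ i, ‖p i‖) * (‖F (fun i => u i * p i) t‖ * ‖G (fun i => (1 - u i : ℝ) * p i) t‖) := by
            simp only [f, norm_mul, norm_prod]
        _ ≤ (∏ i, ‖p i‖) * ((|C| * ∏ i, (u i * ‖p i‖) ^ (α - 1)) * |C'|) := by
            refine mul_le_mul_of_nonneg_left (mul_le_mul (e1.trans ?_) (e2.trans (le_abs_self _)) (norm_nonneg _) (by positivity))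
              (Finset.prod_nonneg fun _ _ => norm_nonneg _)
            exact mul_le_mul_of_nonneg_right (le_abs_self _) hQ
        _ = (|C| * |C'|) * ∏ i, (‖p i‖ * (u i * ‖p i‖) ^ (α - 1)) := by rw [Finset.prod_mul_distrib]; ring
        _ ≤ _ := mul_le_mul_of_nonneg_left hP (by positivity)
  constructor
  · rintro ⟨p₀, t₀⟩ ⟨hp₀, ht₀⟩
    obtain ⟨B, hB, hfB⟩ := hbd (‖p₀‖ + 1)
    refine continuousWithinAt_of_dominated (F := fun z : (Fin d → ℂ) × ℝ => f z.1 z.2) (bound := B) ?_ ?_ hB ?_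
    · filter_upwards [eventually_nhdsWithin_bounded p₀ t₀ (csector d σ ×ˢ Icc 0 T)] with z hz using hmeas _ hz.1.1 _ hz.1.2
    · filter_upwards [eventually_nhdsWithin_bounded p₀ t₀ (csector d σ ×ˢ Icc 0 T)] with z hz
      filter_upwards [ae_unitCube d] with u hu using hfB _ hz.1.1 hz.2 _ hz.1.2 u hu
    · filter_upwards [ae_unitCube d] with u hu
      refine ContinuousWithinAt.mul (Continuous.continuousWithinAt (by fun_prop)) (ContinuousWithinAt.mul ?_ ?_)
      · have hc := hF.cont ((fun i => (u i : ℂ) * p₀ i), t₀) ⟨(hmem p₀ hp₀ u hu).1, ht₀⟩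
        exact hc.comp (f := fun z : (Fin d → ℂ) × ℝ => ((fun i => (u i : ℂ) * z.1 i), z.2)) (x := (p₀, t₀))
          (Continuous.continuousWithinAt (by fun_prop)) fun z hz => ⟨(hmem z.1 hz.1 u hu).1, hz.2⟩
      · have hc := hG.cont ((fun i => ((1 - u i : ℝ) : ℂ) * p₀ i), t₀) ⟨(hmem p₀ hp₀ u hu).2, ht₀⟩
        exact hc.comp (f := fun z : (Fin d → ℂ) × ℝ => ((fun i => ((1 - u i : ℝ) : ℂ) * z.1 i), z.2)) (x := (p₀, t₀))
          (Continuous.continuousWithinAt (by fun_prop)) fun z hz => ⟨(hmem z.1 hz.1 u hu).2, hz.2⟩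
  · intro t ht p hp i
    refine differentiableOn_integral_of_dominated (f := fun z => f (Function.update p i z) t) (isOpen_osector hσ) ?_ ?_ ?_
    · exact fun z hz => hmeas _ (update_mem_csector_of_mem hp hz) t ht
    · filter_upwards [ae_unitCube d] with u hu
      have hsc : ∀ (v : Fin d → ℝ) (z : ℂ), (fun j => (v j : ℂ) * Function.update p i z j) = Function.update (fun j => (v j : ℂ) * p j) i (v i * z) := by
        intro v z
        ext j
        by_cases hj : j = i
        · subst hj; simp
        · simp [hj]
      have hmaps : ∀ c : ℝ, 0 < c → MapsTo (fun z : ℂ => (c : ℂ) * z) (osector σ) (osector σ) := fun c hc z hz =>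
        ⟨mul_ne_zero (by simp [hc.ne']) hz.1, by rw [Complex.arg_real_mul _ hc]; exact hz.2⟩
      refine DifferentiableOn.mul ?_ (DifferentiableOn.mul ?_ ?_)
      · refine DifferentiableOn.fun_finsetProd fun j _ => ?_
        exact ((differentiable_pi.1 (differentiable_update p i)) j).differentiableOn
      · simp only [hsc u]
        exact (hF.holo t ht _ (hmem p hp u hu).1 i).comp (f := fun z : ℂ => (u i : ℂ) * z) (by fun_prop) (hmaps _ (hu i).1)
      · have := hsc fun j => 1 - u j
        simp only [this]
        exact (hG.holo t ht _ (hmem p hp u hu).2 i).comp (f := fun z : ℂ => ((1 - u i : ℝ) : ℂ) * z) (by fun_prop) (hmaps _ (by linarith [(hu i).2]))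
    · intro z₀ hz₀
      obtain ⟨B, hB, hfB⟩ := hbd (‖p‖ + ‖z₀‖ + 1)
      refine ⟨1, one_pos, B, hB, ?_⟩
      filter_upwards [ae_unitCube d] with u hu z hz hzU
      exact hfB _ (update_mem_csector_of_mem hp hzU) (norm_update_le hz) t ht u hu

/-- The bound of a convolution in terms of one-dimensional convolutions. -/
theorem norm_borelConv_le {d : ℕ} {γ R K K' κ : ℝ} {F G : (Fin d → ℂ) → ℂ} {p : Fin d → ℂ} {f g : ℝ → ℝ}
    (hf : ∀ s, 0 ≤ s → 0 ≤ f s) (hg : ∀ s, 0 ≤ s → 0 ≤ g s) (hK : 0 ≤ K) (hK' : 0 ≤ K')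
    (hF : ∀ u : Fin d → ℝ, (∀ i, u i ∈ Ioo (0 : ℝ) 1) → ‖F (fun i => u i * p i)‖ ≤ K * ∏ i, f (u i * ‖p i‖))
    (hG : ∀ u : Fin d → ℝ, (∀ i, u i ∈ Ioo (0 : ℝ) 1) → ‖G (fun i => (1 - u i : ℝ) * p i)‖ ≤ K' * ∏ i, g ((1 - u i) * ‖p i‖))
    (hi : ∀ i, IntegrableOn (fun u => f (u * ‖p i‖) * g ((1 - u) * ‖p i‖)) (Ioo 0 1))
    (hκ : ∀ i, ‖p i‖ * ∫ u in Ioo (0 : ℝ) 1, f (u * ‖p i‖) * g ((1 - u) * ‖p i‖) ≤ κ * rayWeight γ R ‖p i‖) :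
    ‖borelConv F G p‖ ≤ K * K' * κ ^ d * borelWeight γ R p := by
  have hb : Integrable (fun u : Fin d → ℝ => (K * K') * ∏ i, (‖p i‖ * (f (u i * ‖p i‖) * g ((1 - u i) * ‖p i‖)))) (unitCube d) :=
    (Integrable.fintype_prod (f := fun i u => ‖p i‖ * (f (u * ‖p i‖) * g ((1 - u) * ‖p i‖))) fun i => (hi i).const_mul _).const_mul _
  refine (norm_integral_le_of_norm_le hb ?_).trans ?_
  · filter_upwards [ae_unitCube d] with u hu
    rw [norm_mul, norm_mul, norm_prod]
    calc _ ≤ (∏ i, ‖p i‖) * ((K * ∏ i, f (u i * ‖p i‖)) * (K' * ∏ i, g ((1 - u i) * ‖p i‖))) := by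
          refine mul_le_mul_of_nonneg_left (mul_le_mul (hF u hu) (hG u hu) (norm_nonneg _) ((norm_nonneg _).trans (hF u hu)))
            (Finset.prod_nonneg fun _ _ => norm_nonneg _)
      _ = _ := by rw [Finset.prod_mul_distrib, Finset.prod_mul_distrib]; ring
  · rw [integral_const_mul]
    have e := integral_fintype_prod_eq_prod (μ := fun _ : Fin d => volume.restrict (Ioo (0:ℝ) 1)) (𝕜 := ℝ)
        (fun i (u : ℝ) => ‖p i‖ * (f (u * ‖p i‖) * g ((1 - u) * ‖p i‖)))
    rw [e, mul_assoc (K * K')]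
    refine mul_le_mul_of_nonneg_left ?_ (by positivity)
    have h1 : κ ^ d * borelWeight γ R p = ∏ i, (κ * rayWeight γ R ‖p i‖) := by
      rw [Finset.prod_mul_distrib, borelWeight]; simp
    rw [h1]
    refine Finset.prod_le_prod (fun i _ => ?_) fun i _ => ?_
    · rw [integral_const_mul]
      refine mul_nonneg (norm_nonneg _) (setIntegral_nonneg measurableSet_Ioo fun u hu => mul_nonneg (hf _ ?_) (hg _ ?_))
      · exact mul_nonneg hu.1.le (norm_nonneg _)
      · exact mul_nonneg (by linarith [hu.2]) (norm_nonneg _)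
    · rw [integral_const_mul]; exact hκ i

theorem norm_smul_le_of_mem {d : ℕ} {u : Fin d → ℝ} (hu : ∀ i, u i ∈ Ioo (0 : ℝ) 1) (p : Fin d → ℂ) : ‖fun i => (u i : ℂ) * p i‖ ≤ ‖p‖ := by
  rw [pi_norm_le_iff_of_nonneg (norm_nonneg _)]
  intro i
  rw [norm_ofReal_mul (hu i).1.le]
  exact (mul_le_of_le_one_left (norm_nonneg _) (hu i).2.le).trans (norm_le_pi_norm p i)

theorem one_sub_mem_Ioo {d : ℕ} {u : Fin d → ℝ} (hu : ∀ i, u i ∈ Ioo (0 : ℝ) 1) : ∀ i, (fun i => 1 - u i) i ∈ Ioo (0 : ℝ) 1 :=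
  fun i => ⟨by linarith [(hu i).2], by linarith [(hu i).1]⟩

/-- Scaling by a point of the cube does not increase ‖p‖, so the polynomial factor leaves the
convolution integral; this is why the exponents of two kernels simply add. -/
theorem IsKernel.norm_smul_le {d : ℕ} {σ T γ R K : ℝ} {a : ℕ} {F : (Fin d → ℂ) → ℝ → ℂ} (hR : 0 < R) (hK : 0 ≤ K) (hF : IsKernel σ T γ R a K F)
    {p : Fin d → ℂ} (hp : p ∈ csector d σ) {t : ℝ} (ht : t ∈ Icc 0 T) {u : Fin d → ℝ} (hu : ∀ i, u i ∈ Ioo (0 : ℝ) 1) :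
    ‖F (fun i => u i * p i) t‖ ≤ K * (1 + ‖p‖) ^ a * ∏ i, rayWeight γ R (u i * ‖p i‖) := by
  refine (hF.bound _ (smul_mem_csector hp fun i => (hu i).1) t ht).trans ?_
  simp only [borelWeight, norm_ofReal_mul (hu _).1.le]
  have : 0 ≤ ∏ i, rayWeight γ R (u i * ‖p i‖) := Finset.prod_nonneg fun i _ => rayWeight_nonneg hR (mul_nonneg (hu i).1.le (norm_nonneg _))
  have := norm_smul_le_of_mem hu p
  gcongr

/-- The kernels form an algebra under convolution. -/
theorem IsKernel.conv {d : ℕ} {σ T γ R K K' : ℝ} {a b : ℕ} {F G : (Fin d → ℂ) → ℝ → ℂ} (hσ : σ ≤ Real.pi) (hγ : 0 ≤ γ) (hR : 1 ≤ R)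
    (hK : 0 ≤ K) (hK' : 0 ≤ K') (hF : IsKernel σ T γ R a K F) (hG : IsKernel σ T γ R b K' G) :
    IsKernel σ T γ R (a + b) (K * K') fun p t => borelConv (fun p => F p t) (fun p => G p t) p := by
  have hR0 : 0 < R := by linarith
  refine ⟨IsBorel.conv (α := 1) hσ one_pos hF.borel hG.borel ?_ (hG.exists_local_bound hγ hR0), fun p hp t ht => ?_⟩
  · intro M
    obtain ⟨C, hC⟩ := hF.exists_local_bound hγ hR0 M
    exact ⟨C, by simpa using hC⟩
  · refine (norm_borelConv_le (κ := 1) (f := rayWeight γ R) (g := rayWeight γ R) (γ := γ) (R := R)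
      (K := K * (1 + ‖p‖) ^ a) (K' := K' * (1 + ‖p‖) ^ b) (fun s hs => rayWeight_nonneg hR0 hs) (fun s hs => rayWeight_nonneg hR0 hs)
      (by positivity) (by positivity) (fun u hu => hF.norm_smul_le hR0 hK hp ht hu)
      (fun u hu => hG.norm_smul_le hR0 hK' hp ht (one_sub_mem_Ioo hu)) (fun i => integrableOn_rayWeight_mul hγ hR0 (norm_nonneg _))
      (fun i => by rw [one_mul]; exact rayWeight_conv_le hγ hR (norm_nonneg _))).trans_eq ?_
    rw [pow_add, one_pow]; ring

/-! ### Convolution with Borel transforms of sectorial functions -/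

/-- The norm of the convolution with the Borel transform of a function `O(x^{-α})`. -/
noncomputable def coefConst (σ σ' γ α R : ℝ) : ℝ :=
  borelConst σ σ' * ((4 * (γ + 2)) ^ (γ + 2) * Real.Gamma α * (4 / R) ^ α)

theorem coefConst_nonneg {σ σ' γ α R : ℝ} (hγ : 0 ≤ γ) (hα : 0 < α) (hR : 0 < R) : 0 ≤ coefConst σ σ' γ α R := by
  have := Real.Gamma_pos_of_pos hα
  have := borelConst_nonneg σ σ'
  unfold coefConst; positivity

/-- The source of all smallness: since α > 0, the factor (4/R)^α makes the action of the
coefficients as weak as desired for large R. -/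
theorem tendsto_coefConst (σ σ' γ : ℝ) {α : ℝ} (hα : 0 < α) : Tendsto (fun R => coefConst σ σ' γ α R) atTop (𝓝 0) := by
  have h1 : Tendsto (fun R : ℝ => (4 / R) ^ α) atTop (𝓝 0) := by
    have h2 : Tendsto (fun R : ℝ => 4 / R) atTop (𝓝 0) := tendsto_const_nhds.div_atTop tendsto_id
    have h3 := (Real.continuousAt_rpow_const 0 α (Or.inr hα.le)).tendsto.comp h2
    rwa [Real.zero_rpow hα.ne'] at h3
  simpa [coefConst] using (h1.const_mul ((4 * (γ + 2)) ^ (γ + 2) * Real.Gamma α)).const_mul (borelConst σ σ')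

namespace IsSectorial

variable {d : ℕ} {φ ρ T α C : ℝ} {g : (Fin d → ℂ) → ℝ → ℂ} {σ σ' a : ℝ}

theorem growth (h : IsSectorial φ ρ T α C g) (h00 : 0 ≤ σ) (h1 : σ < σ') (h2 : σ' < φ)
    (h3 : φ ≤ Real.pi / 4) (hρ : 0 ≤ ρ) (hα : 0 ≤ α) (hC : 0 ≤ C) (ha : ρ < a) {t : ℝ} (ht : t ∈ Icc 0 T) :
    HasExpGrowth σ 0 (α - 1) (3 * a) (C * borelConst σ σ' ^ d) (borelTransform σ' (fun _ : Fin d => a) fun x => g x t) := by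
  refine ⟨(h.isBorel h00 h1 h2 h3 hρ hα hC ha).continuousOn ht, fun p hp => (h.norm_borel_le h00 h1 h2 h3 hρ hα hC ha hp ht).trans_eq ?_⟩
  rw [Finset.prod_mul_distrib, Finset.prod_const, Finset.card_univ, Fintype.card_fin, mul_assoc]
  simp [expWeight]

/-- The Borel transform of a coefficient need not be a kernel, as |p|^{α-1} may blow up at 0, but it
acts on kernels by convolution. The condition `6 * a ≤ R` makes its growth rate 3a at most R/2. -/
theorem conv_kernel (h : IsSectorial φ ρ T α C g) (h00 : 0 ≤ σ) (h1 : σ < σ') (h2 : σ' < φ)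
    (h3 : φ ≤ Real.pi / 4) (hρ : 0 ≤ ρ) (hα : 0 < α) (hC : 0 ≤ C) (ha : ρ < a) {γ R K : ℝ} {b : ℕ} (hγ : 0 ≤ γ) (hR : 1 ≤ R) (hRa : 6 * a ≤ R)
    (hK : 0 ≤ K) {G : (Fin d → ℂ) → ℝ → ℂ} (hG : IsKernel σ T γ R b K G) :
    IsKernel σ T γ R b (C * K * coefConst σ σ' γ α R ^ d)
      fun p t => borelConv (borelTransform σ' (fun _ => a) fun x => g x t) (fun p => G p t) p := by
  have hR0 : 0 < R := by linarith
  have hpi := Real.pi_pos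
  have ha0 : 0 < a := hρ.trans_lt ha
  have hbc := borelConst_nonneg σ σ'
  have hbd : ∀ p ∈ csector d σ, ∀ t ∈ Icc 0 T, ‖borelTransform σ' (fun _ : Fin d => a) (fun x => g x t) p‖ ≤
      (C * borelConst σ σ' ^ d) * ∏ i, (‖p i‖ ^ (α - 1) * Real.exp (3 * a * ‖p i‖)) := by
    intro p hp t ht
    refine (h.norm_borel_le h00 h1 h2 h3 hρ hα.le hC ha hp ht).trans_eq ?_
    rw [Finset.prod_mul_distrib, Finset.prod_const, Finset.card_univ, Fintype.card_fin, mul_assoc]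
  refine ⟨IsBorel.conv (by linarith) hα (h.isBorel h00 h1 h2 h3 hρ hα.le hC ha) hG.borel (fun M => ?_) (hG.exists_local_bound hγ hR0), fun p hp t ht => ?_⟩
  · refine ⟨(C * borelConst σ σ' ^ d) * Real.exp (3 * a * M) ^ d, fun p hp hpM t ht => (hbd p hp t ht).trans ?_⟩
    have hE : ∏ i, Real.exp (3 * a * ‖p i‖) ≤ Real.exp (3 * a * M) ^ d := by
      calc ∏ i, Real.exp (3 * a * ‖p i‖) ≤ ∏ i : Fin d, Real.exp (3 * a * M) :=
            Finset.prod_le_prod (fun _ _ => (Real.exp_pos _).le) fun i _ => Real.exp_le_exp.2 (by have := hpM i; gcongr)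
        _ = _ := by simp
    have hP : 0 ≤ ∏ i, ‖p i‖ ^ (α - 1) := Finset.prod_nonneg fun _ _ => by positivity
    rw [Finset.prod_mul_distrib]
    calc _ ≤ C * borelConst σ σ' ^ d * ((∏ i, ‖p i‖ ^ (α - 1)) * Real.exp (3 * a * M) ^ d) := by gcongr
      _ = _ := by ring
  · refine (norm_borelConv_le (κ := (4 * (γ + 2)) ^ (γ + 2) * Real.Gamma α * (4 / R) ^ α) (γ := γ) (R := R)
      (f := fun s => s ^ (α - 1) * Real.exp (3 * a * s)) (g := rayWeight γ R)
      (K := C * borelConst σ σ' ^ d) (K' := K * (1 + ‖p‖) ^ b) (fun s hs => by positivity) (fun s hs => rayWeight_nonneg hR0 hs)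
      (by positivity) (by positivity) (fun u hu => ?_)
      (fun u hu => hG.norm_smul_le hR0 hK hp ht (one_sub_mem_Ioo hu)) (fun i => ?_) (fun i => ?_)).trans_eq ?_
    · have := hbd _ (smul_mem_csector hp fun i => (hu i).1) t ht
      simpa only [norm_ofReal_mul (hu _).1.le] using this
    · exact integrableOn_rpow_mul_rayWeight hγ hR0 hα (norm_pos_iff.2 (hp i).1)
    · exact rpow_conv_rayWeight_le hγ hR (by linarith) hα (norm_pos_iff.2 (hp i).1)
    · rw [coefConst, mul_pow (borelConst σ σ')]; ring

theorem laplace_conv_kernel (h : IsSectorial φ ρ T α C g) (h00 : 0 ≤ σ) (h1 : σ < σ') (h2 : σ' < φ)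
    (h3 : φ ≤ Real.pi / 4) (hρ : 0 ≤ ρ) (hα : 0 < α) (hC : 0 ≤ C) (ha : ρ < a) {γ R K : ℝ} {b : ℕ} (hγ : 0 ≤ γ) (hRa : 6 * a ≤ R)
    {G : (Fin d → ℂ) → ℝ → ℂ} (hG : IsKernel σ T γ R b K G) {t : ℝ} (ht : t ∈ Icc 0 T) {x : Fin d → ℂ} (hx : x ∈ halfSpace d R) :
    laplace 0 (borelConv (borelTransform σ' (fun _ => a) fun x => g x t) fun p => G p t) x = g x t * laplace 0 (fun p => G p t) x := by
  have hpi := Real.pi_pos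
  have ha0 : 0 < a := hρ.trans_lt ha
  rw [laplace_borelConv ((h.growth h00 h1 h2 h3 hρ hα.le hC ha ht).integrable_integrand_zero (by linarith) h00 (by linarith) (halfSpace_mono (by linarith) hx))
    ((hG.growth hγ (by linarith) ht).integrable_integrand_zero (by linarith) h00 (by linarith) hx),
    h.laplace_borel (by linarith) h2 h3 hρ hα ha ht fun i => lt_of_le_of_lt (by linarith) (hx i)]

/-- The Borel transform of a function `O(x^{-(γ+1)})` is a kernel with small constant. -/
theorem isKernel {γ : ℝ} (h : IsSectorial φ ρ T (γ + 1) C g) (h00 : 0 ≤ σ) (h1 : σ < σ') (h2 : σ' < φ)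
    (h3 : φ ≤ Real.pi / 4) (hρ : 0 ≤ ρ) (hC : 0 ≤ C) (ha : ρ < a) {R : ℝ} (hγ : 0 ≤ γ) (hR : 1 ≤ R) (hRa : 6 * a ≤ R) :
    IsKernel σ T γ R 0 (C * (borelConst σ σ' * ((4 * (γ + 2)) ^ (γ + 2) * 2 ^ (γ + 3) / R)) ^ d)
      fun p t => borelTransform σ' (fun _ : Fin d => a) (fun x => g x t) p := by
  have hbc := borelConst_nonneg σ σ'
  refine ⟨h.isBorel h00 h1 h2 h3 hρ (by linarith) hC ha, fun p hp t ht => (h.norm_borel_le h00 h1 h2 h3 hρ (by linarith) hC ha hp ht).trans ?_⟩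
  rw [pow_zero, mul_one, mul_assoc]
  refine mul_le_mul_of_nonneg_left ?_ hC
  have e : (borelConst σ σ' * ((4 * (γ + 2)) ^ (γ + 2) * 2 ^ (γ + 3) / R)) ^ d * borelWeight γ R p =
      ∏ i, ((borelConst σ σ' * ((4 * (γ + 2)) ^ (γ + 2) * 2 ^ (γ + 3) / R)) * rayWeight γ R ‖p i‖) := by
    rw [Finset.prod_mul_distrib, borelWeight]; simp
  rw [e]
  refine Finset.prod_le_prod (fun i _ => by positivity) fun i _ => ?_
  rw [mul_assoc (borelConst σ σ'), add_sub_cancel_right]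
  refine mul_le_mul_of_nonneg_left ?_ hbc
  exact rpow_mul_exp_le_rayWeight hγ hR (by linarith) (norm_nonneg _)

end IsSectorial

/-! ### The scalar linear equation and Duhamel's formula -/

section ScalarODE

variable {T : ℝ} {g : ℝ → ℂ}

/-- Extending by constants beyond the end points makes the two-sided fundamental theorem of calculus
available at 0 and T as well. -/
theorem exists_continuous_extension {T : ℝ} (hT : 0 ≤ T) {g : ℝ → ℂ} (hg : ContinuousOn g (Icc 0 T)) :
    ∃ g' : ℝ → ℂ, Continuous g' ∧ EqOn g' g (Icc 0 T) :=
  ⟨IccExtend hT ((Icc 0 T).domRestrict g), (continuousOn_iff_continuous_domRestrict.1 hg).Icc_extend', fun t ht => by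
    rw [IccExtend_of_mem hT _ ht]; rfl⟩

theorem uIcc_subset_Icc_zero {t : ℝ} (ht : t ∈ Icc 0 T) : uIcc 0 t ⊆ Icc 0 T := by
  rw [uIcc_of_le ht.1]; exact Icc_subset_Icc le_rfl ht.2

theorem hasDerivWithinAt_of_integral_eq {y h : ℝ → ℂ} {y₀ : ℂ} (hh : ContinuousOn h (Icc 0 T))
    (hy : ∀ t ∈ Icc 0 T, y t = y₀ + ∫ s in (0 : ℝ)..t, h s) {t : ℝ} (ht : t ∈ Icc 0 T) : HasDerivWithinAt y (h t) (Icc 0 T) t := by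
  obtain ⟨h', hc, he⟩ := exists_continuous_extension (ht.1.trans ht.2) hh
  have h1 : HasDerivAt (fun t => y₀ + ∫ s in (0 : ℝ)..t, h' s) (h' t) t :=
    (intervalIntegral.integral_hasDerivAt_right (hc.intervalIntegrable _ _) (hc.stronglyMeasurableAtFilter _ _) hc.continuousAt).const_add y₀
  rw [he ht] at h1
  refine h1.hasDerivWithinAt.congr (fun s hs => ?_) ?_
  · rw [hy s hs, intervalIntegral.integral_congr (he.mono (uIcc_subset_Icc_zero hs))]
  · rw [hy t ht, intervalIntegral.integral_congr (he.mono (uIcc_subset_Icc_zero ht))]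

theorem integral_eq_of_hasDerivWithinAt {y h : ℝ → ℂ} (hh : ContinuousOn h (Icc 0 T))
    (hy : ∀ t ∈ Icc 0 T, HasDerivWithinAt y (h t) (Icc 0 T) t) {t : ℝ} (ht : t ∈ Icc 0 T) : y t = y 0 + ∫ s in (0 : ℝ)..t, h s := by
  have h1 : ∫ s in (0 : ℝ)..t, h s = y t - y 0 := by
    refine intervalIntegral.integral_eq_sub_of_hasDerivAt_of_le ht.1 ?_ (f := y) ?_ ?_
    · exact fun s hs => ((hy s ⟨hs.1, hs.2.trans ht.2⟩).continuousWithinAt).mono (Icc_subset_Icc le_rfl ht.2)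
    · exact fun s hs => (hy s ⟨hs.1.le, hs.2.le.trans ht.2⟩).hasDerivAt (Icc_mem_nhds hs.1 (hs.2.trans_le ht.2))
    · exact (hh.mono (uIcc_subset_Icc_zero ht)).intervalIntegrable
  rw [h1]; ring

/-- The solution of `y' = -P y + g`, `y(0) = y₀`. -/
noncomputable def duhamelSol (P y₀ : ℂ) (g : ℝ → ℂ) (t : ℝ) : ℂ :=
  Complex.exp (-P * t) * y₀ + ∫ τ in (0 : ℝ)..t, Complex.exp (-P * (t - τ)) * g τ

theorem duhamelSol_eq (P y₀ : ℂ) (g : ℝ → ℂ) (t : ℝ) :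
    duhamelSol P y₀ g t = Complex.exp (-P * t) * (y₀ + ∫ τ in (0 : ℝ)..t, Complex.exp (P * τ) * g τ) := by
  rw [duhamelSol, mul_add, ← intervalIntegral.integral_const_mul]
  congr 1
  refine intervalIntegral.integral_congr fun τ _ => ?_
  beta_reduce
  rw [← mul_assoc, ← Complex.exp_add]; congr 2; ring

theorem duhamelSol_integral_eq (P y₀ : ℂ) (hg : ContinuousOn g (Icc 0 T)) {t : ℝ} (ht : t ∈ Icc 0 T) :
    duhamelSol P y₀ g t = y₀ + ∫ s in (0 : ℝ)..t, (-P * duhamelSol P y₀ g s + g s) := by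
  have hEc : ContinuousOn (fun τ : ℝ => Complex.exp (P * τ) * g τ) (Icc 0 T) := ContinuousOn.mul (by fun_prop) hg
  have hd : ∀ s ∈ Icc 0 T, HasDerivWithinAt (duhamelSol P y₀ g) (-P * duhamelSol P y₀ g s + g s) (Icc 0 T) s := by
    intro s hs
    have h1 := hasDerivWithinAt_of_integral_eq (y := fun t => y₀ + ∫ τ in (0 : ℝ)..t, Complex.exp (P * τ) * g τ) (y₀ := y₀) hEc (fun _ _ => rfl) hs
    have h2 : HasDerivWithinAt (fun t : ℝ => Complex.exp (-P * t)) (Complex.exp (-P * s) * -P) (Icc 0 T) s := by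
      have : HasDerivAt (fun t : ℝ => -P * (t : ℂ)) (-P) s := by simpa using (Complex.ofRealCLM.hasDerivAt (x := s)).const_mul (-P)
      exact this.cexp.hasDerivWithinAt
    have h3 := h2.mul h1
    have e : duhamelSol P y₀ g = fun t : ℝ => Complex.exp (-P * t) * (y₀ + ∫ τ in (0 : ℝ)..t, Complex.exp (P * τ) * g τ) := by
      ext t; exact duhamelSol_eq P y₀ g t
    rw [e]
    refine h3.congr_deriv ?_
    have h4 : Complex.exp (-P * s) * Complex.exp (P * s) = 1 := by rw [← Complex.exp_add]; simp
    linear_combination (g s) * h4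
  have hc : ContinuousOn (duhamelSol P y₀ g) (Icc 0 T) := fun s hs => (hd s hs).continuousWithinAt
  have := integral_eq_of_hasDerivWithinAt (h := fun s => -P * duhamelSol P y₀ g s + g s) (by fun_prop) hd ht
  rwa [show duhamelSol P y₀ g 0 = y₀ by simp [duhamelSol]] at this

/-- The integrating factor e^{Pt} turns the equation into a plain antiderivative, whence uniqueness.
-/
theorem eq_duhamelSol (P y₀ : ℂ) (hg : ContinuousOn g (Icc 0 T)) {y : ℝ → ℂ} (hy : ContinuousOn y (Icc 0 T))
    (h : ∀ t ∈ Icc 0 T, y t = y₀ + ∫ s in (0 : ℝ)..t, (-P * y s + g s)) {t : ℝ} (ht : t ∈ Icc 0 T) : y t = duhamelSol P y₀ g t := by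
  have hd : ∀ s ∈ Icc 0 T, HasDerivWithinAt (fun s : ℝ => Complex.exp (P * s) * y s) (Complex.exp (P * s) * g s) (Icc 0 T) s := by
    intro s hs
    have h1 := hasDerivWithinAt_of_integral_eq (by fun_prop) h hs
    have h2 : HasDerivWithinAt (fun t : ℝ => Complex.exp (P * t)) (Complex.exp (P * s) * P) (Icc 0 T) s := by
      have : HasDerivAt (fun t : ℝ => P * (t : ℂ)) P s := by simpa using (Complex.ofRealCLM.hasDerivAt (x := s)).const_mul P
      exact this.cexp.hasDerivWithinAt
    refine (h2.mul h1).congr_deriv ?_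
    ring
  have h0 := h 0 ⟨le_rfl, ht.1.trans ht.2⟩
  rw [intervalIntegral.integral_same, add_zero] at h0
  have := integral_eq_of_hasDerivWithinAt (h := fun s : ℝ => Complex.exp (P * s) * g s) (ContinuousOn.mul (by fun_prop) hg) hd ht
  rw [h0] at this
  simp only [Complex.ofReal_zero, mul_zero, Complex.exp_zero, one_mul] at this
  rw [duhamelSol_eq, ← this, ← mul_assoc, ← Complex.exp_add]
  simp

end ScalarODE

/-! ### The Duhamel operator on kernels -/

theorem differentiable_eval_neg {d : ℕ} (P : MvPolynomial (Fin d) ℂ) : Differentiable ℂ fun p : Fin d → ℂ => MvPolynomial.eval (-p) P := by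
  simp only [eval_neg_eq_sum, negPow]
  fun_prop

theorem isBorel_exp {d : ℕ} {σ T : ℝ} (P : MvPolynomial (Fin d) ℂ) :
    IsBorel σ T fun (p : Fin d → ℂ) (t : ℝ) => Complex.exp (-MvPolynomial.eval (-p) P * t) := by
  constructor
  · have := continuous_eval_neg P
    exact (((this.comp continuous_fst).neg.mul (Complex.continuous_ofReal.comp continuous_snd)).cexp).continuousOn
  · intro t _ p _ i
    have h := (differentiable_eval_neg P).comp (differentiable_update p i)
    refine Differentiable.differentiableOn ?_
    exact ((h.neg).mul_const (t : ℂ)).cexp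

theorem norm_exp_le_of_re {c C₀ T y s : ℝ} {n : ℕ} {z : ℂ} (hC₀ : 0 ≤ C₀) (hz : c * y ^ n - C₀ ≤ z.re) (hs : 0 ≤ s) (hsT : s ≤ T) :
    ‖Complex.exp (-z * s)‖ ≤ Real.exp (C₀ * T) * Real.exp (-(c * y ^ n * s)) := by
  rw [Complex.norm_exp, ← Real.exp_add]
  refine Real.exp_le_exp.2 ?_
  have : (-z * s).re = -(z.re * s) := by simp
  rw [this]
  nlinarith [mul_le_mul_of_nonneg_right hz hs, mul_le_mul_of_nonneg_left hsT hC₀]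

/-- The parabolic gain: the summand 1 contributes at most T, and yⁿ at most 1/c, because c yⁿ e^{-c
yⁿ(t-τ)} has integral at most 1 whatever y is. -/
theorem integral_one_add_mul_exp_le {c y t T : ℝ} {n : ℕ} (hc : 0 < c) (hy : 0 ≤ y) (ht : 0 ≤ t) (htT : t ≤ T) :
    ∫ τ in (0 : ℝ)..t, (1 + y ^ n) * Real.exp (-(c * y ^ n * (t - τ))) ≤ T + 1 / c := by
  set z := c * y ^ n with hz
  have hz0 : 0 ≤ z := by positivity
  have h1 : ∫ τ in (0 : ℝ)..t, z * Real.exp (-(z * (t - τ))) ≤ 1 := by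
    have hd : ∀ τ ∈ uIcc 0 t, HasDerivAt (fun τ => Real.exp (-(z * (t - τ)))) (z * Real.exp (-(z * (t - τ)))) τ := by
      intro τ _
      have : HasDerivAt (fun τ => -(z * (t - τ))) z τ := by
        have := (((hasDerivAt_id τ).const_sub t).const_mul z).neg
        rw [mul_neg, mul_one, neg_neg] at this
        exact this
      exact this.exp.congr_deriv (mul_comm _ _)
    rw [intervalIntegral.integral_eq_sub_of_hasDerivAt hd (Continuous.intervalIntegrable (by fun_prop) _ _)]
    simp [Real.exp_nonneg]
  have h2 : ∫ τ in (0 : ℝ)..t, Real.exp (-(z * (t - τ))) ≤ t := by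
    calc _ ≤ ∫ τ in (0 : ℝ)..t, (1 : ℝ) := by
          refine intervalIntegral.integral_mono_on ht (Continuous.intervalIntegrable (by fun_prop) _ _) (by simp) fun τ hτ => ?_
          refine Real.exp_le_one_iff.2 ?_
          have := mul_nonneg hz0 (sub_nonneg.2 hτ.2)
          linarith
      _ = t := by simp
  have e : ∀ τ, (1 + y ^ n) * Real.exp (-(z * (t - τ))) = Real.exp (-(z * (t - τ))) + 1 / c * (z * Real.exp (-(z * (t - τ)))) := by
    intro τ; rw [hz]; field_simp
  simp only [e]
  rw [intervalIntegral.integral_add (Continuous.intervalIntegrable (by fun_prop) _ _) (Continuous.intervalIntegrable (by fun_prop) _ _),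
    intervalIntegral.integral_const_mul]
  have : 1 / c * ∫ τ in (0 : ℝ)..t, z * Real.exp (-(z * (t - τ))) ≤ 1 / c * 1 := by gcongr
  linarith

/-- The constant in the bound of the Duhamel operator. -/
noncomputable def duhamelConst (n : ℕ) (c C₀ T : ℝ) : ℝ := Real.exp (C₀ * T) * 2 ^ n * (T + 1 / c)

/-- The Duhamel operator gains `n` powers of `|p|`. -/
theorem IsKernel.duhamel {d n : ℕ} {σ T γ R K K₀ c C₀ : ℝ} {P : MvPolynomial (Fin d) ℂ} (hσ : σ ≤ Real.pi) (hγ : 0 ≤ γ) (hR : 0 < R)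
    (hc : 0 < c) (hC₀ : 0 ≤ C₀) (hP : ∀ p ∈ csector d σ, c * ‖p‖ ^ n - C₀ ≤ (MvPolynomial.eval (-p) P).re)
    {F₀ : (Fin d → ℂ) → ℂ} {H : (Fin d → ℂ) → ℝ → ℂ} (hF₀ : IsKernel σ T γ R 0 K₀ fun p _ => F₀ p) (hK : 0 ≤ K) (hH : IsKernel σ T γ R n K H) :
    IsKernel σ T γ R 0 (Real.exp (C₀ * T) * K₀ + duhamelConst n c C₀ T * K)
      fun p t => duhamelSol (MvPolynomial.eval (-p) P) (F₀ p) (H p) t := by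
  let f : (Fin d → ℂ) → ℝ → ℝ → ℂ := fun p t τ => Complex.exp (-MvPolynomial.eval (-p) P * (t - τ)) * H p τ
  have hPc := continuous_eval_neg P
  have hfb : ∀ p ∈ csector d σ, ∀ t ∈ Icc 0 T, ∀ τ ∈ Icc 0 t, ‖f p t τ‖ ≤ Real.exp (C₀ * T) * ‖H p τ‖ := by
    intro p hp t ht τ hτ
    have h := norm_exp_le_of_re (y := ‖p‖) (n := n) hC₀ (hP p hp) (sub_nonneg.2 hτ.2) (by linarith [ht.2, hτ.1] : t - τ ≤ T)
    rw [norm_mul]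
    refine mul_le_mul_of_nonneg_right ?_ (norm_nonneg _)
    push_cast at h
    refine h.trans (mul_le_of_le_one_right (Real.exp_pos _).le (Real.exp_le_one_iff.2 ?_))
    have : 0 ≤ c * ‖p‖ ^ n * (t - τ) := mul_nonneg (by positivity) (sub_nonneg.2 hτ.2)
    linarith
  have hfc : ∀ p ∈ csector d σ, ∀ t ∈ Icc 0 T, ContinuousOn (f p t) (Icc 0 t) := by
    intro p hp t ht
    exact ContinuousOn.mul (by fun_prop) ((hH.borel.continuousOn_time hp).mono (Icc_subset_Icc le_rfl ht.2))
  have hI : IsBorel σ T fun p t => ∫ τ in (0 : ℝ)..t, f p t τ := by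
    constructor
    -- Rescaling to the fixed interval [0, 1] removes the variable end point, so dominated
    -- convergence gives joint continuity.
    · have e : ∀ z : (Fin d → ℂ) × ℝ, ∫ τ in (0 : ℝ)..z.2, f z.1 z.2 τ = z.2 * ∫ u in (0 : ℝ)..1, f z.1 z.2 (z.2 * u) := by
        intro z
        have := intervalIntegral.smul_integral_comp_mul_left (a := 0) (b := 1) (f z.1 z.2) z.2
        rw [mul_zero, mul_one] at this
        rw [← this, Complex.real_smul]
      have hmul : ∀ t ∈ Icc 0 T, ∀ u ∈ Icc (0:ℝ) 1, t * u ∈ Icc 0 t := fun t ht u hu =>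
        ⟨mul_nonneg ht.1 hu.1, mul_le_of_le_one_right ht.1 hu.2⟩
      simp only [e]
      refine ContinuousOn.mul (by fun_prop) ?_
      rintro ⟨p₀, t₀⟩ ⟨hp₀, ht₀⟩
      obtain ⟨C, hC⟩ := hH.exists_local_bound hγ hR (‖p₀‖ + 1)
      refine intervalIntegral.continuousWithinAt_of_dominated_interval (F := fun (z : (Fin d → ℂ) × ℝ) u => f z.1 z.2 (z.2 * u))
        (bound := fun _ => Real.exp (C₀ * T) * C) ?_ ?_ (by simp) ?_
      · filter_upwards [eventually_nhdsWithin_bounded p₀ t₀ (csector d σ ×ˢ Icc 0 T)] with z hz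
        refine ContinuousOn.aestronglyMeasurable ?_ measurableSet_uIoc
        refine ((hfc z.1 hz.1.1 z.2 hz.1.2).comp (f := fun u : ℝ => z.2 * u) (by fun_prop) fun u hu => ?_)
        rw [uIoc_of_le zero_le_one] at hu
        exact hmul _ hz.1.2 u ⟨hu.1.le, hu.2⟩
      · filter_upwards [eventually_nhdsWithin_bounded p₀ t₀ (csector d σ ×ˢ Icc 0 T)] with z hz
        refine Eventually.of_forall fun u hu => ?_
        rw [uIoc_of_le zero_le_one] at hu
        have hm := hmul _ hz.1.2 u ⟨hu.1.le, hu.2⟩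
        refine (hfb _ hz.1.1 _ hz.1.2 _ hm).trans ?_
        gcongr
        exact hC _ hz.1.1 hz.2 _ ⟨hm.1, hm.2.trans hz.1.2.2⟩
      · refine Eventually.of_forall fun u hu => ?_
        rw [uIoc_of_le zero_le_one] at hu
        have hu' : u ∈ Icc (0:ℝ) 1 := ⟨hu.1.le, hu.2⟩
        refine ContinuousWithinAt.mul (Continuous.continuousWithinAt ?_) ?_
        · exact ((hPc.comp continuous_fst).neg.mul (by fun_prop)).cexp
        have hcc := hH.borel.cont (p₀, t₀ * u) ⟨hp₀, (hmul t₀ ht₀ u hu').1, (hmul t₀ ht₀ u hu').2.trans ht₀.2⟩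
        exact hcc.comp (f := fun z : (Fin d → ℂ) × ℝ => (z.1, z.2 * u)) (x := (p₀, t₀)) (Continuous.continuousWithinAt (by fun_prop))
          fun z hz => ⟨hz.1, (hmul _ hz.2 u hu').1, (hmul _ hz.2 u hu').2.trans hz.2.2⟩
    · intro t ht p hp i
      simp only [intervalIntegral.integral_of_le ht.1]
      refine differentiableOn_integral_of_dominated (f := fun z => f (Function.update p i z) t) (isOpen_osector hσ) ?_ ?_ ?_
      · intro z hz
        exact ((hfc _ (update_mem_csector_of_mem hp hz) t ht).mono Ioc_subset_Icc_self).aestronglyMeasurable measurableSet_Ioc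
      · filter_upwards [ae_restrict_mem measurableSet_Ioc] with τ hτ
        refine DifferentiableOn.mul ?_ (hH.borel.holo τ ⟨hτ.1.le, hτ.2.trans ht.2⟩ p hp i)
        have h := (differentiable_eval_neg P).comp (differentiable_update p i)
        exact Differentiable.differentiableOn ((h.neg).mul_const ((t : ℂ) - τ)).cexp
      · intro z₀ hz₀
        obtain ⟨C, hC⟩ := hH.exists_local_bound hγ hR (‖p‖ + ‖z₀‖ + 1)
        refine ⟨1, one_pos, fun _ => Real.exp (C₀ * T) * C, integrable_const _, ?_⟩
        filter_upwards [ae_restrict_mem measurableSet_Ioc] with τ hτ z hz hzU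
        refine (hfb _ (update_mem_csector_of_mem hp hzU) t ht τ ⟨hτ.1.le, hτ.2⟩).trans ?_
        gcongr
        exact hC _ (update_mem_csector_of_mem hp hzU) (norm_update_le hz) τ ⟨hτ.1.le, hτ.2.trans ht.2⟩
  refine ⟨((isBorel_exp P).mul hF₀.borel).add hI, fun p hp t ht => ?_⟩
  have hW := borelWeight_nonneg (γ := γ) hR p
  have h1 : ‖Complex.exp (-MvPolynomial.eval (-p) P * t) * F₀ p‖ ≤ Real.exp (C₀ * T) * K₀ * borelWeight γ R p := by
    rw [norm_mul, mul_assoc]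
    have h := norm_exp_le_of_re (y := ‖p‖) (n := n) hC₀ (hP p hp) ht.1 ht.2
    refine mul_le_mul (h.trans (mul_le_of_le_one_right (Real.exp_pos _).le (Real.exp_le_one_iff.2 ?_))) ?_ (norm_nonneg _) (Real.exp_pos _).le
    · have : 0 ≤ c * ‖p‖ ^ n * t := mul_nonneg (by positivity) ht.1
      linarith
    · simpa using hF₀.bound p hp t ht
  have h2 : ‖∫ τ in (0 : ℝ)..t, f p t τ‖ ≤ duhamelConst n c C₀ T * K * borelWeight γ R p := by
    have hb : ∀ τ ∈ Ioc 0 t, ‖f p t τ‖ ≤ Real.exp (C₀ * T) * (2 ^ n * (K * borelWeight γ R p)) * ((1 + ‖p‖ ^ n) * Real.exp (-(c * ‖p‖ ^ n * (t - τ)))) := by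
      intro τ hτ
      have h := norm_exp_le_of_re (y := ‖p‖) (n := n) hC₀ (hP p hp) (sub_nonneg.2 hτ.2) (by linarith [ht.2, hτ.1] : t - τ ≤ T)
      push_cast at h
      -- Brings the growth of H into the form handled by `integral_one_add_mul_exp_le`, at the cost
      -- of the factor 2ⁿ in `duhamelConst`.
      have h3 : (1 + ‖p‖) ^ n ≤ 2 ^ n * (1 + ‖p‖ ^ n) := by
        have h4 := add_pow_le zero_le_one (norm_nonneg p) n
        rw [one_pow] at h4
        refine h4.trans (mul_le_mul_of_nonneg_right (pow_le_pow_right₀ one_le_two (Nat.sub_le _ _)) (by positivity))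
      have h5 := hH.bound p hp τ ⟨hτ.1.le, hτ.2.trans ht.2⟩
      rw [norm_mul]
      calc _ ≤ (Real.exp (C₀ * T) * Real.exp (-(c * ‖p‖ ^ n * (t - τ)))) * (K * (2 ^ n * (1 + ‖p‖ ^ n)) * borelWeight γ R p) := by
            refine mul_le_mul h (h5.trans ?_) (norm_nonneg _) (by positivity)
            gcongr
        _ = _ := by ring
    refine (intervalIntegral.norm_integral_le_of_norm_le ht.1 (Eventually.of_forall hb) (Continuous.intervalIntegrable (by fun_prop) _ _)).trans ?_
    rw [intervalIntegral.integral_const_mul]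
    calc _ ≤ Real.exp (C₀ * T) * (2 ^ n * (K * borelWeight γ R p)) * (T + 1 / c) := by
          refine mul_le_mul_of_nonneg_left (integral_one_add_mul_exp_le hc (norm_nonneg _) ht.1 ht.2) (by positivity)
      _ = _ := by rw [duhamelConst]; ring
  refine (norm_add_le _ _).trans ((add_le_add h1 h2).trans_eq ?_)
  rw [pow_zero]; ring

/-! ### The cone condition -/

theorem eval_neg_homogeneousComponent {d n : ℕ} (P : MvPolynomial (Fin d) ℂ) (p : Fin d → ℂ) :
    MvPolynomial.eval (-p) (MvPolynomial.homogeneousComponent n P) =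
      ∑ k ∈ P.support with k.degree = n, P.coeff k * negPow (fun i => k i) p := by
  rw [MvPolynomial.homogeneousComponent_apply, map_sum]
  refine Finset.sum_congr rfl fun k _ => ?_
  rw [MvPolynomial.eval_monomial, negPow, Finsupp.prod_fintype _ _ (fun _ => pow_zero _)]
  rfl

theorem negPow_smul {d : ℕ} (j : Fin d → ℕ) (r : ℂ) (p : Fin d → ℂ) : negPow j (fun i => r * p i) = r ^ (∑ i, j i) * negPow j p := by
  rw [negPow, negPow, ← Finset.prod_pow_eq_pow_sum, ← Finset.prod_mul_distrib]
  exact Finset.prod_congr rfl fun i _ => by rw [← mul_pow]; ring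

theorem eval_neg_homogeneousComponent_smul {d n : ℕ} (P : MvPolynomial (Fin d) ℂ) (r : ℂ) (p : Fin d → ℂ) :
    MvPolynomial.eval (-fun i => r * p i) (MvPolynomial.homogeneousComponent n P) =
      r ^ n * MvPolynomial.eval (-p) (MvPolynomial.homogeneousComponent n P) := by
  rw [eval_neg_homogeneousComponent, eval_neg_homogeneousComponent, Finset.mul_sum]
  refine Finset.sum_congr rfl fun k hk => ?_
  rw [Finset.mem_filter, Finsupp.degree_eq_sum] at hk
  rw [negPow_smul, hk.2]; ring

theorem exists_norm_lower_order_le {d n : ℕ} (P : MvPolynomial (Fin d) ℂ) (hP : P.totalDegree ≤ n) (hn : 1 ≤ n) :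
    ∃ M : ℝ, 0 < M ∧ ∀ p : Fin d → ℂ, ‖MvPolynomial.eval (-p) P - MvPolynomial.eval (-p) (MvPolynomial.homogeneousComponent n P)‖ ≤ M * (1 + ‖p‖) ^ (n - 1) := by
  refine ⟨1 + ∑ k ∈ P.support with ¬ k.degree = n, ‖P.coeff k‖, by positivity, fun p => ?_⟩
  rw [eval_neg_homogeneousComponent, eval_neg_eq_sum, ← Finset.sum_filter_add_sum_filter_not P.support (fun k => k.degree = n), add_sub_cancel_left]
  refine (norm_sum_le _ _).trans ?_
  calc _ ≤ ∑ k ∈ P.support with ¬ k.degree = n, ‖P.coeff k‖ * (1 + ‖p‖) ^ (n - 1) := by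
        refine Finset.sum_le_sum fun k hk => ?_
        rw [Finset.mem_filter, Finsupp.degree_eq_sum] at hk
        rw [norm_mul]
        refine mul_le_mul_of_nonneg_left ((norm_negPow_le _ p).trans ?_) (norm_nonneg _)
        refine pow_le_pow_right₀ (by linarith [norm_nonneg p]) ?_
        have := MvPolynomial.le_totalDegree hk.1
        rw [Finsupp.sum_fintype _ _ (fun _ => rfl)] at this
        have := hk.2
        omega
    _ ≤ _ := by rw [← Finset.sum_mul]; gcongr; linarith

/-- Beyond Y the top power dominates; below Y the constant does. -/
theorem exists_pow_pred_le {M c : ℝ} (hM : 0 < M) (hc : 0 < c) {n : ℕ} (hn : 1 ≤ n) :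
    ∃ C₀ : ℝ, 0 ≤ C₀ ∧ ∀ y : ℝ, 0 ≤ y → M * (1 + y) ^ (n - 1) ≤ c * y ^ n + C₀ := by
  obtain ⟨k, rfl⟩ : ∃ k, n = k + 1 := ⟨n - 1, by omega⟩
  set Y := max 1 (M * 2 ^ k / c) with hY
  have hY1 : 1 ≤ Y := le_max_left _ _
  refine ⟨M * (1 + Y) ^ k, by positivity, fun y hy => ?_⟩
  rw [Nat.add_sub_cancel]
  rcases le_total y Y with h | h
  · have : M * (1 + y) ^ k ≤ M * (1 + Y) ^ k := by gcongr
    have : 0 ≤ c * y ^ (k + 1) := by positivity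
    linarith
  · have h1 : M * 2 ^ k ≤ c * y := by
      have := (le_max_right 1 (M * 2 ^ k / c)).trans h
      rw [div_le_iff₀ hc] at this
      linarith
    have h2 : (1 + y) ^ k ≤ (2 * y) ^ k := pow_le_pow_left₀ (by linarith) (by linarith) k
    have h3 : 0 ≤ M * (1 + Y) ^ k := by positivity
    calc M * (1 + y) ^ k ≤ M * (2 * y) ^ k := by gcongr
      _ = (M * 2 ^ k) * y ^ k := by rw [mul_pow]; ring
      _ ≤ (c * y) * y ^ k := by gcongr
      _ = c * y ^ (k + 1) := by ring
      _ ≤ _ := by linarith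

/-- The cone condition persists on a slightly larger cone, and controls the full symbol. -/
theorem exists_cone_bound {d n : ℕ} {P : MvPolynomial (Fin d) ℂ} {φ φ' : ℝ} (hn : 1 ≤ n) (hP : P.totalDegree ≤ n) (hφ : 0 < φ) (hφ' : φ < φ')
    (hφpi : φ' ≤ Real.pi)
    (h : ∀ p : Fin d → ℂ, p ≠ 0 → (∀ i, |Complex.arg (p i)| ≤ φ) → 0 < (MvPolynomial.eval (-p) (MvPolynomial.homogeneousComponent n P)).re) :
    ∃ σ, φ < σ ∧ σ < φ' ∧ ∃ c > 0, ∃ C₀ ≥ 0, ∀ p ∈ csector d σ, c * ‖p‖ ^ n - C₀ ≤ (MvPolynomial.eval (-p) P).re := by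
  rcases isEmpty_or_nonempty (Fin d) with hd | hd
  · refine ⟨(φ + φ') / 2, by linarith, by linarith, 1, one_pos, 1 + ‖MvPolynomial.eval (-(0 : Fin d → ℂ)) P‖, by positivity, fun p _ => ?_⟩
    have : p = 0 := Subsingleton.elim _ _
    subst this
    have h1 := (abs_le.1 (Complex.abs_re_le_norm (MvPolynomial.eval (-(0 : Fin d → ℂ)) P))).1
    rw [norm_zero, zero_pow (by omega), mul_zero]
    linarith
  let Ph : (Fin d → ℂ) → ℝ := fun p => (MvPolynomial.eval (-p) (MvPolynomial.homogeneousComponent n P)).re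
  have hPh : Continuous Ph := Complex.continuous_re.comp (continuous_eval_neg _)
  -- Polar coordinates: moduli on the unit sphere of the closed orthant and angles in a box form a
  -- compact set. Vanishing moduli belong to it, which is why the cone hypothesis has to allow zero
  -- components.
  let pt : (Fin d → ℝ) × (Fin d → ℝ) → (Fin d → ℂ) := fun z i => z.1 i * Complex.exp (z.2 i * Complex.I)
  have hpt : Continuous pt := by fun_prop
  let S : Set (Fin d → ℝ) := {s | (∀ i, 0 ≤ s i) ∧ ‖s‖ = 1}
  have hS : IsCompact S := by
    refine (isCompact_sphere (0 : Fin d → ℝ) 1).of_isClosed_subset ?_ fun s hs => by simpa using hs.2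
    have : S = (⋂ i, {s : Fin d → ℝ | 0 ≤ s i}) ∩ {s | ‖s‖ = 1} := by ext s; simp [S]
    rw [this]
    exact (isClosed_iInter fun i => isClosed_le continuous_const (by fun_prop)).inter (isClosed_eq (by fun_prop) continuous_const)
  let box : ℝ → Set (Fin d → ℝ) := fun φ => Set.pi univ fun _ => Icc (-φ) φ
  have hbox : ∀ φ, IsCompact (box φ) := fun φ => isCompact_univ_pi fun _ => isCompact_Icc
  have hne : (S ×ˢ box φ).Nonempty := by
    refine ⟨(fun _ => 1, fun _ => 0), ⟨fun _ => zero_le_one, ?_⟩, fun i _ => ⟨by simp [hφ.le], by simp [hφ.le]⟩⟩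
    simp
  obtain ⟨z₀, hz₀, hmin⟩ := (hS.prod (hbox φ)).exists_isMinOn hne (hPh.comp hpt).continuousOn
  have hpos : 0 < Ph (pt z₀) := by
    refine h _ ?_ fun i => ?_
    · intro h0
      have h1 : ∀ i, z₀.1 i = 0 := fun i => by
        have := congrFun h0 i
        simpa [pt] using this
      have h2 : ‖z₀.1‖ = 0 := by rw [norm_eq_zero]; exact funext h1
      rw [hz₀.1.2] at h2
      exact one_ne_zero h2
    · have hi := hz₀.2 i (mem_univ i)
      have habs : |z₀.2 i| ≤ φ := abs_le.2 hi
      rcases (hz₀.1.1 i).eq_or_lt with h0 | h0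
      · simp [pt, ← h0, hφ.le]
      · simp only [pt]; rw [arg_ofReal_mul_exp h0 (by linarith)]; exact habs
  set m₀ := Ph (pt z₀) with hm₀
  have huc := (hS.prod (hbox Real.pi)).uniformContinuousOn_of_continuous (hPh.comp hpt).continuousOn
  rw [Metric.uniformContinuousOn_iff] at huc
  obtain ⟨δ, hδ, hδu⟩ := huc (m₀ / 2) (by positivity)
  set σ := φ + min (δ / 2) ((φ' - φ) / 2) with hσ
  have hσ1 : φ < σ := by rw [hσ]; have : 0 < min (δ / 2) ((φ' - φ) / 2) := lt_min (by linarith) (by linarith); linarith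
  have hσ2 : σ < φ' := by have := min_le_right (δ / 2) ((φ' - φ) / 2); linarith
  have hσ3 : σ - φ ≤ δ / 2 := by have := min_le_left (δ / 2) ((φ' - φ) / 2); linarith
  have hlow : ∀ z ∈ S ×ˢ box σ, m₀ / 2 ≤ Ph (pt z) := by
    rintro ⟨s, θ⟩ ⟨hs, hθ⟩
    -- Clamping the angles to [-φ, φ] moves them by at most σ - φ ≤ δ/2, so by uniform continuity at
    -- most half of the minimum m₀ is lost.
    let θ' : Fin d → ℝ := fun i => max (-φ) (min φ (θ i))
    have hθ' : θ' ∈ box φ := fun i _ => ⟨le_max_left _ _, max_le (by linarith) (min_le_left _ _)⟩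
    have hdist : dist (s, θ) (s, θ') < δ := by
      rw [Prod.dist_eq, dist_self, max_lt_iff]
      refine ⟨hδ, lt_of_le_of_lt ((dist_pi_le_iff (by linarith : (0:ℝ) ≤ δ / 2)).2 fun i => ?_) (by linarith)⟩
      have hi := hθ i (mem_univ i)
      rw [Real.dist_eq, abs_le]
      simp only [θ']
      constructor
      · have h5 : max (-φ) (min φ (θ i)) ≤ θ i + δ / 2 := max_le (by linarith [hi.1]) ((min_le_right _ _).trans (by linarith))
        linarith
      · have h5 : θ i - δ / 2 ≤ max (-φ) (min φ (θ i)) := le_max_of_le_right (le_min (by linarith [hi.2]) (by linarith))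
        linarith
    have hsub : ∀ ψ, ψ ≤ Real.pi → box ψ ⊆ box Real.pi := fun ψ hψ => Set.pi_mono fun i _ => Icc_subset_Icc (by linarith) hψ
    have h1 := hδu (s, θ) ⟨hs, hsub σ (by linarith) hθ⟩ (s, θ') ⟨hs, hsub φ (by linarith) hθ'⟩ hdist
    rw [Real.dist_eq, abs_lt] at h1
    have h2 : m₀ ≤ Ph (pt (s, θ')) := hmin ⟨hs, hθ'⟩
    simp only [Function.comp_apply] at h1
    linarith [h1.1]
  obtain ⟨M, hM, hMb⟩ := exists_norm_lower_order_le P hP hn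
  -- Half of the coefficient m₀/2 absorbs the lower order terms, which leaves c = m₀/4.
  obtain ⟨C₀, hC₀, hCb⟩ := exists_pow_pred_le hM (c := m₀ / 4) (by positivity) hn
  refine ⟨σ, hσ1, hσ2, m₀ / 4, by positivity, C₀, hC₀, fun p hp => ?_⟩
  obtain ⟨i₀⟩ := hd
  have hp0 : p ≠ 0 := fun h => (hp i₀).1 (congrFun h i₀)
  have hpn : 0 < ‖p‖ := norm_pos_iff.2 hp0
  have hpe : p = fun i => (‖p‖ : ℂ) * pt (fun i => ‖p i‖ / ‖p‖, fun i => Complex.arg (p i)) i := by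
    ext i
    simp only [pt]
    rw [← mul_assoc, ← Complex.ofReal_mul, mul_div_cancel₀ _ hpn.ne', Complex.norm_mul_exp_arg_mul_I]
  have hmem : ((fun i => ‖p i‖ / ‖p‖, fun i => Complex.arg (p i)) : (Fin d → ℝ) × (Fin d → ℝ)) ∈ S ×ˢ box σ := by
    refine ⟨⟨fun i => by positivity, ?_⟩, fun i _ => abs_le.1 (hp i).2⟩
    have e : (fun i => ‖p i‖ / ‖p‖) = (‖p‖⁻¹ : ℝ) • fun i => ‖p i‖ := by ext i; simp [div_eq_inv_mul]
    have e2 : ‖fun i => ‖p i‖‖ = ‖p‖ := by simp [Pi.norm_def]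
    simp only
    rw [e, norm_smul, e2, norm_inv, norm_norm, inv_mul_cancel₀ hpn.ne']
  have h1 : m₀ / 2 * ‖p‖ ^ n ≤ Ph p := by
    have h2 := hlow _ hmem
    have h3 : Ph p = ‖p‖ ^ n * Ph (pt (fun i => ‖p i‖ / ‖p‖, fun i => Complex.arg (p i))) := by
      conv_lhs => rw [hpe]
      simp only [Ph]
      rw [eval_neg_homogeneousComponent_smul, ← Complex.ofReal_pow, Complex.re_ofReal_mul]
    rw [h3, mul_comm]
    gcongr
  have h2 := (Complex.abs_re_le_norm _).trans (hMb p)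
  rw [abs_le, Complex.sub_re] at h2
  have h3 := hCb ‖p‖ hpn.le
  simp only [Ph] at h1
  linarith [h2.1]

/-! ### Laplace transforms of kernels and the evolution equation -/

theorem laplaceIntegrand_zero_norm_le {d : ℕ} {σ γ R C : ℝ} {a : ℕ} {F : (Fin d → ℂ) → ℂ} (h : HasExpGrowth σ a γ R C F) (hσ0 : 0 ≤ σ) (hσ : σ < Real.pi)
    (x : Fin d → ℂ) {s : Fin d → ℝ} (hs : ∀ i, 0 < s i) :
    ‖laplaceIntegrand 0 F x s‖ ≤ C * ∏ i, (expWeight a γ R (s i) * Real.exp (-((x i).re * s i))) := by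
  simpa using h.norm_integrand_le hσ (θ := 0) (by simpa using fun _ => hσ0) x hs

theorem laplace_add {d : ℕ} {F G : (Fin d → ℂ) → ℂ} {x : Fin d → ℂ} (hF : Integrable (laplaceIntegrand 0 F x) (orthant d))
    (hG : Integrable (laplaceIntegrand 0 G x) (orthant d)) : laplace 0 (fun p => F p + G p) x = laplace 0 F x + laplace 0 G x := by
  simp only [laplace_eq]
  rw [← integral_add hF hG]
  refine integral_congr_ae (Eventually.of_forall fun s => ?_)
  simp only [laplaceIntegrand]; ring

theorem laplace_sub {d : ℕ} {F G : (Fin d → ℂ) → ℂ} {x : Fin d → ℂ} (hF : Integrable (laplaceIntegrand 0 F x) (orthant d))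
    (hG : Integrable (laplaceIntegrand 0 G x) (orthant d)) : laplace 0 (fun p => F p - G p) x = laplace 0 F x - laplace 0 G x := by
  simp only [laplace_eq]
  rw [← integral_sub hF hG]
  refine integral_congr_ae (Eventually.of_forall fun s => ?_)
  simp only [laplaceIntegrand]; ring

theorem laplace_congr {d : ℕ} {σ : ℝ} (hσ : 0 ≤ σ) {F G : (Fin d → ℂ) → ℂ} (h : EqOn F G (csector d σ)) : laplace 0 F = laplace 0 G := by
  ext x
  simp only [laplace_eq]
  refine integral_congr_ae ?_
  filter_upwards [ae_orthant_pos d] with s hs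
  rw [laplaceIntegrand_zero, laplaceIntegrand_zero, h (ofReal_mem_csector hσ hs)]

namespace IsKernel

variable {d : ℕ} {σ T γ R K K' : ℝ} {a b : ℕ} {F G : (Fin d → ℂ) → ℝ → ℂ}

theorem integrable (hσ0 : 0 ≤ σ) (hσ : σ < Real.pi) (hγ : 0 ≤ γ) (hR : 0 < R) (h : IsKernel σ T γ R a K F) {t : ℝ} (ht : t ∈ Icc 0 T)
    {x : Fin d → ℂ} (hx : x ∈ halfSpace d R) : Integrable (laplaceIntegrand 0 (fun p => F p t) x) (orthant d) :=
  (h.growth hγ hR ht).integrable_integrand_zero (by linarith) hσ0 hσ hx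

/-- B depends on x but not on the kernel, so Laplace evaluation at x is continuous in the size of
the kernel. This is what sums series of kernels and passes to the limit in the iteration. -/
theorem norm_laplace_zero_le (hσ0 : 0 ≤ σ) (hσ : σ < Real.pi) (hγ : 0 ≤ γ) (hR : 0 < R) {x : Fin d → ℂ} (hx : x ∈ halfSpace d R) :
    ∃ B : ℝ, 0 ≤ B ∧ ∀ (K : ℝ) (F : (Fin d → ℂ) → ℝ → ℂ), 0 ≤ K → IsKernel σ T γ R a K F → ∀ t ∈ Icc 0 T,
      (∫ s, ‖laplaceIntegrand 0 (fun p => F p t) x s‖ ∂orthant d) ≤ K * B ∧ ‖laplace 0 (fun p => F p t) x‖ ≤ K * B := by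
  refine ⟨(R / 2 ^ (γ + 3)) ^ d * ∫ s, ∏ i, (expWeight a γ R (s i) * Real.exp (-((x i).re * s i))) ∂orthant d, ?_, fun K F hK h t ht => ?_⟩
  · refine mul_nonneg (by positivity) (integral_nonneg_of_ae ?_)
    filter_upwards [ae_orthant_pos d] with s hs
    exact Finset.prod_nonneg fun i _ => mul_nonneg (expWeight_nonneg (hs i).le) (Real.exp_pos _).le
  · have h1 : (∫ s, ‖laplaceIntegrand 0 (fun p => F p t) x s‖ ∂orthant d) ≤ K * ((R / 2 ^ (γ + 3)) ^ d * ∫ s, ∏ i, (expWeight a γ R (s i) * Real.exp (-((x i).re * s i))) ∂orthant d) := by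
      rw [← mul_assoc, ← integral_const_mul]
      refine integral_mono_ae (h.integrable hσ0 hσ hγ hR ht hx).norm (HasExpGrowth.integrable_bound (by linarith) hx) ?_
      filter_upwards [ae_orthant_pos d] with s hs
      have := laplaceIntegrand_zero_norm_le (h.growth hγ hR ht) hσ0 hσ x hs
      rwa [abs_of_nonneg hK] at this
    exact ⟨h1, (norm_integral_le_integral_norm _).trans h1⟩

theorem hasSum_laplace (hσ0 : 0 ≤ σ) (hσ : σ < Real.pi) (hγ : 0 ≤ γ) (hR : 0 < R) {ι : Type*} [Countable ι] {F : ι → (Fin d → ℂ) → ℝ → ℂ} {u : ι → ℝ}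
    (hF : ∀ i, IsKernel σ T γ R a (u i) (F i)) (hu0 : ∀ i, 0 ≤ u i) (hu : Summable u) {t : ℝ} (ht : t ∈ Icc 0 T)
    {x : Fin d → ℂ} (hx : x ∈ halfSpace d R) :
    HasSum (fun i => laplace 0 (fun p => F i p t) x) (laplace 0 (fun p => ∑' i, F i p t) x) := by
  obtain ⟨B, hB0, hB⟩ := norm_laplace_zero_le (T := T) (a := a) hσ0 hσ hγ hR hx
  have h := hasSum_integral_of_summable_integral_norm (F := fun i => laplaceIntegrand 0 (fun p => F i p t) x) (μ := orthant d)
    (fun i => (hF i).integrable hσ0 hσ hγ hR ht hx)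
    (Summable.of_nonneg_of_le (fun i => integral_nonneg fun s => norm_nonneg _) (fun i => (hB _ _ (hu0 i) (hF i) t ht).1) (hu.mul_right B))
  have e : laplace 0 (fun p => ∑' i, F i p t) x = ∫ s, ∑' i, laplaceIntegrand 0 (fun p => F i p t) x s ∂orthant d := by
   rw [laplace_eq]
   refine integral_congr_ae (Eventually.of_forall fun s => ?_)
   simp only [laplaceIntegrand]
   rw [tsum_mul_right]
  rw [e]
  exact h

theorem continuousOn_laplace (hσ0 : 0 ≤ σ) (hσ : σ < Real.pi) (hγ : 0 ≤ γ) (hR : 0 < R) (h : IsKernel σ T γ R a K F)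
    {x : Fin d → ℂ} (hx : x ∈ halfSpace d R) : ContinuousOn (fun t => laplace 0 (fun p => F p t) x) (Icc 0 T) := by
  intro t₀ ht₀
  refine continuousWithinAt_of_dominated (F := fun t s => laplaceIntegrand 0 (fun p => F p t) x s)
    (bound := fun s => (|K| * (R / 2 ^ (γ + 3)) ^ d) * ∏ i, (expWeight a γ R (s i) * Real.exp (-((x i).re * s i)))) ?_ ?_
    (HasExpGrowth.integrable_bound (by linarith) hx) ?_
  · filter_upwards [self_mem_nhdsWithin] with t ht using (h.integrable hσ0 hσ hγ hR ht hx).aestronglyMeasurable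
  · filter_upwards [self_mem_nhdsWithin] with t ht
    filter_upwards [ae_orthant_pos d] with s hs using laplaceIntegrand_zero_norm_le (h.growth hγ hR ht) hσ0 hσ x hs
  · filter_upwards [ae_orthant_pos d] with s hs
    simp only [laplaceIntegrand_zero]
    exact (h.borel.continuousOn_time (ofReal_mem_csector hσ0 hs) t₀ ht₀).mul continuousWithinAt_const

/-- Fubini's theorem for the Laplace transform of a time integral. -/
theorem integral_laplace (hσ0 : 0 ≤ σ) (hσ : σ < Real.pi) (hγ : 0 ≤ γ) (hR : 0 < R) (h : IsKernel σ T γ R a K F)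
    {x : Fin d → ℂ} (hx : x ∈ halfSpace d R) {t : ℝ} (ht : t ∈ Icc 0 T) :
    Integrable (laplaceIntegrand 0 (fun p => ∫ τ in (0 : ℝ)..t, F p τ) x) (orthant d) ∧
    ∫ τ in (0 : ℝ)..t, laplace 0 (fun p => F p τ) x = laplace 0 (fun p => ∫ τ in (0 : ℝ)..t, F p τ) x := by
  have hI : Integrable (fun z : ℝ × (Fin d → ℝ) => laplaceIntegrand 0 (fun p => F p z.1) x z.2) ((volume.restrict (Ioc 0 t)).prod (orthant d)) := by
    have hB := (HasExpGrowth.integrable_bound (C := |K| * (R / 2 ^ (γ + 3)) ^ d) (a := a) (γ := γ) (R := R) (by linarith) hx)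
    refine ((integrable_const (1 : ℝ) (μ := volume.restrict (Ioc 0 t))).mul_prod hB).mono' ?_ ?_
    · rw [orthant_eq, Measure.prod_restrict]
      refine ContinuousOn.aestronglyMeasurable ?_ (measurableSet_Ioc.prod (measurableSet_orthant d))
      simp only [laplaceIntegrand_zero]
      refine ContinuousOn.mul ?_ (by fun_prop)
      exact h.borel.cont.comp (f := fun z : ℝ × (Fin d → ℝ) => ((fun i => (z.2 i : ℂ)), z.1)) (by fun_prop)
        fun z hz => ⟨ofReal_mem_csector hσ0 fun i => hz.2 i (mem_univ i), hz.1.1.le, hz.1.2.trans ht.2⟩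
    · have h1 : ∀ᵐ z : ℝ × (Fin d → ℝ) ∂(volume.restrict (Ioc 0 t)).prod (orthant d), z.1 ∈ Ioc 0 t :=
        Measure.quasiMeasurePreserving_fst.ae (ae_restrict_mem measurableSet_Ioc)
      have h2 : ∀ᵐ z : ℝ × (Fin d → ℝ) ∂(volume.restrict (Ioc 0 t)).prod (orthant d), ∀ i, 0 < z.2 i :=
        Measure.quasiMeasurePreserving_snd.ae (ae_orthant_pos d)
      filter_upwards [h1, h2] with z hz1 hz2
      rw [one_mul]
      exact laplaceIntegrand_zero_norm_le (h.growth hγ hR ⟨hz1.1.le, hz1.2.trans ht.2⟩) hσ0 hσ x hz2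
  have e : laplaceIntegrand 0 (fun p => ∫ τ in (0 : ℝ)..t, F p τ) x = fun s => ∫ τ in Ioc 0 t, laplaceIntegrand 0 (fun p => F p τ) x s := by
    ext s
    simp only [laplaceIntegrand]
    rw [integral_mul_const, intervalIntegral.integral_of_le ht.1]
  refine ⟨?_, ?_⟩
  · rw [e]; exact hI.integral_prod_right
  · rw [intervalIntegral.integral_of_le ht.1, laplace_eq, e]
    simp only [laplace_eq]
    exact integral_integral_swap hI

theorem continuousOn_integral (hγ : 0 ≤ γ) (hR : 0 < R) (h : IsKernel σ T γ R a K F) {t : ℝ} (ht : t ∈ Icc 0 T) :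
    ContinuousOn (fun p => ∫ τ in (0 : ℝ)..t, F p τ) (csector d σ) := by
  intro p₀ hp₀
  obtain ⟨C, hC⟩ := h.exists_local_bound hγ hR (‖p₀‖ + 1)
  have hev : ∀ᶠ p in 𝓝[csector d σ] p₀, p ∈ csector d σ ∧ ∀ i, ‖p i‖ ≤ ‖p₀‖ + 1 := by
    refine eventually_mem_nhdsWithin.and (nhdsWithin_le_nhds ?_)
    filter_upwards [continuous_norm.continuousAt.eventually (gt_mem_nhds (show ‖p₀‖ < ‖p₀‖ + 1 by simp))] with p hp i
    exact (norm_le_pi_norm p i).trans hp.le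
  have hsub : ∀ τ, τ ∈ uIoc 0 t → τ ∈ Icc 0 T := fun τ hτ => by
    rw [uIoc_of_le ht.1] at hτ; exact ⟨hτ.1.le, hτ.2.trans ht.2⟩
  refine intervalIntegral.continuousWithinAt_of_dominated_interval (bound := fun _ => C) ?_ ?_ (by simp) ?_
  · filter_upwards [hev] with p hp
    exact ((h.borel.continuousOn_time hp.1).mono hsub).aestronglyMeasurable measurableSet_uIoc
  · filter_upwards [hev] with p hp
    exact Eventually.of_forall fun τ hτ => hC p hp.1 hp.2 τ (hsub τ hτ)
  · exact Eventually.of_forall fun τ hτ => h.borel.continuousOn (hsub τ hτ) p₀ hp₀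

/-- The kernel of the right-hand side of the evolution equation. -/
theorem evolution {n : ℕ} {P : MvPolynomial (Fin d) ℂ} {M : ℝ} (hR : 0 < R) (hM : ∀ p : Fin d → ℂ, ‖MvPolynomial.eval (-p) P‖ ≤ M * (1 + ‖p‖) ^ n)
    (hF : IsKernel σ T γ R 0 K F) (hG : IsKernel σ T γ R n K' G) :
    IsKernel σ T γ R n (M * K + K') fun p t => -MvPolynomial.eval (-p) P * F p t + G p t := by
  have h1 := hF.mul_left (differentiable_eval_neg P).neg (M := M) (b := n) fun p => by
    rw [Pi.neg_apply, norm_neg]; exact hM p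
  rw [zero_add] at h1
  exact h1.add hG

theorem laplace_evolution {n : ℕ} {P : MvPolynomial (Fin d) ℂ} (hP : P.totalDegree ≤ n) (hσ0 : 0 ≤ σ) (hσ : σ < Real.pi) (hγ : 0 ≤ γ) (hR : 0 < R)
    (hF : IsKernel σ T γ R 0 K F) (hG : IsKernel σ T γ R n K' G) {x : Fin d → ℂ} (hx : x ∈ halfSpace d R) {t : ℝ} (ht : t ∈ Icc 0 T) :
    laplace 0 (fun p => -MvPolynomial.eval (-p) P * F p t + G p t) x =
      -polyDiffOp P (laplace 0 fun p => F p t) x + laplace 0 (fun p => G p t) x := by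
  obtain ⟨M, -, hM⟩ := exists_norm_eval_neg_le P hP
  have h1 := hF.mul_left (differentiable_eval_neg P).neg (M := M) (b := n) fun p => by
    rw [Pi.neg_apply, norm_neg]; exact hM p
  have h2 := laplace_add (h1.integrable hσ0 hσ hγ hR ht hx) (hG.integrable hσ0 hσ hγ hR ht hx)
  simp only [Pi.neg_apply] at h2
  rw [h2, (hF.growth hγ hR ht).polyDiffOp_laplace (by linarith) hσ0 hσ P hx]
  congr 1
  simp only [laplace_eq]
  rw [← integral_neg]
  refine integral_congr_ae (Eventually.of_forall fun s => ?_)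
  simp only [laplaceIntegrand]; ring

/-- A kernel whose Laplace transform solves the evolution equation with zero initial value is given
by the Duhamel formula. -/
theorem eq_duhamelSol_of_hasDerivWithinAt {n : ℕ} {P : MvPolynomial (Fin d) ℂ} (hP : P.totalDegree ≤ n) (hγ : 0 ≤ γ) (hR : 0 < R)
    (hF : IsKernel 0 T γ R 0 K F) (hG : IsKernel 0 T γ R n K' G)
    (h0 : ∀ x ∈ halfSpace d R, laplace 0 (fun p => F p 0) x = 0)
    (h : ∀ x ∈ halfSpace d R, ∀ t ∈ Icc 0 T, HasDerivWithinAt (fun t => laplace 0 (fun p => F p t) x)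
      (-polyDiffOp P (laplace 0 fun p => F p t) x + laplace 0 (fun p => G p t) x) (Icc 0 T) t)
    {p : Fin d → ℂ} (hp : p ∈ csector d 0) {t : ℝ} (ht : t ∈ Icc 0 T) :
    F p t = duhamelSol (MvPolynomial.eval (-p) P) 0 (G p) t := by
  have hpi := Real.pi_pos
  obtain ⟨M, -, hM⟩ := exists_norm_eval_neg_le P hP
  have hΨ := hF.evolution hR hM hG
  refine eq_duhamelSol _ 0 (hG.borel.continuousOn_time hp) (hF.borel.continuousOn_time hp) (fun t ht => ?_) ht
  rw [zero_add]
  -- The defect of the time-integrated equation is itself of exponential growth, so injectivity of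
  -- the Laplace transform applies to it.
  have hgr : HasExpGrowth 0 n γ R ((|K| + |M * K + K'| * T) * (R / 2 ^ (γ + 3)) ^ d)
      (fun p => F p t - ∫ s in (0 : ℝ)..t, (-MvPolynomial.eval (-p) P * F p s + G p s)) := by
    refine ⟨(hF.borel.continuousOn ht).sub (hΨ.continuousOn_integral hγ hR ht), fun p hp => ?_⟩
    have hpr : 0 ≤ ∏ i, expWeight n γ R ‖p i‖ := Finset.prod_nonneg fun i _ => expWeight_nonneg (norm_nonneg _)
    have h1 := (((hF.mono hR (le_abs_self K)).mono_exp hR (abs_nonneg K) (Nat.zero_le n)).growth hγ hR ht).bound p hp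
    rw [abs_abs] at h1
    have h2 : ‖∫ s in (0 : ℝ)..t, (-MvPolynomial.eval (-p) P * F p s + G p s)‖ ≤
        (|M * K + K'| * (R / 2 ^ (γ + 3)) ^ d * ∏ i, expWeight n γ R ‖p i‖) * |t - 0| := by
      refine intervalIntegral.norm_integral_le_of_norm_le_const fun s hs => ?_
      rw [uIoc_of_le ht.1] at hs
      exact (hΨ.growth hγ hR ⟨hs.1.le, hs.2.trans ht.2⟩).bound p hp
    rw [sub_zero, abs_of_nonneg ht.1] at h2
    refine (norm_sub_le _ _).trans ?_
    calc _ ≤ |K| * (R / 2 ^ (γ + 3)) ^ d * ∏ i, expWeight n γ R ‖p i‖ + (|M * K + K'| * (R / 2 ^ (γ + 3)) ^ d * ∏ i, expWeight n γ R ‖p i‖) * T := by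
          refine add_le_add h1 (h2.trans ?_)
          gcongr
          exact ht.2
      _ = _ := by ring
  have hz := hgr.eq_zero_of_laplace_eq_zero (by linarith) le_rfl hpi (s := fun i => ‖p i‖) (fun x hx => ?_) fun i => norm_pos_iff.2 (hp i).1
  -- For σ = 0 the closed polysector is exactly the positive orthant, the set on which injectivity
  -- gives information.
  · have hpe : (fun i => ((‖p i‖ : ℝ) : ℂ)) = p := by
      ext i
      have h1 : Complex.arg (p i) = 0 := by simpa using (hp i).2
      conv_rhs => rw [← Complex.norm_mul_exp_arg_mul_I (p i), h1]
      simp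
    rw [hpe] at hz
    exact sub_eq_zero.1 hz
  · obtain ⟨h1, h2⟩ := hΨ.integral_laplace le_rfl hpi hγ hR hx ht
    rw [laplace_sub (hF.integrable le_rfl hpi hγ hR ht hx) h1, ← h2,
      integral_eq_of_hasDerivWithinAt (y := fun t => laplace 0 (fun p => F p t) x) (hΨ.continuousOn_laplace le_rfl hpi hγ hR hx) (fun s hs => ?_) ht, h0 x hx, zero_add, sub_self]
    rw [hF.laplace_evolution hP le_rfl hpi hγ hR hG hx hs]
    exact h x hx s hs

end IsKernel

/-! ### Products of Laplace transforms of kernels -/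

/-- `X` is, on a product of half planes, the Laplace transform of a kernel. -/
def HasKernelRep {d : ℕ} (σ T γ R : ℝ) (a : ℕ) (K : ℝ) (X : (Fin d → ℂ) → ℝ → ℂ) : Prop :=
  ∃ F, IsKernel σ T γ R a K F ∧ ∀ t ∈ Icc 0 T, ∀ x ∈ halfSpace d R, laplace 0 (fun p => F p t) x = X x t

namespace HasKernelRep

variable {d : ℕ} {σ T γ R K K' : ℝ} {a b : ℕ} {X Y : (Fin d → ℂ) → ℝ → ℂ}

theorem congr (hX : HasKernelRep σ T γ R a K X) (h : ∀ t ∈ Icc 0 T, ∀ x ∈ halfSpace d R, X x t = Y x t) :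
    HasKernelRep σ T γ R a K Y := by
  obtain ⟨F, hF, hL⟩ := hX
  exact ⟨F, hF, fun t ht x hx => (hL t ht x hx).trans (h t ht x hx)⟩

theorem mono (hR : 0 < R) (hX : HasKernelRep σ T γ R a K X) (hK : 0 ≤ K) (hab : a ≤ b) (hKK : K ≤ K') :
    HasKernelRep σ T γ R b K' X := by
  obtain ⟨F, hF, hL⟩ := hX
  exact ⟨F, (hF.mono_exp hR hK hab).mono hR hKK, hL⟩

theorem add (hσ0 : 0 ≤ σ) (hσ : σ < Real.pi) (hγ : 0 ≤ γ) (hR : 0 < R) (hX : HasKernelRep σ T γ R a K X)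
    (hY : HasKernelRep σ T γ R a K' Y) : HasKernelRep σ T γ R a (K + K') fun x t => X x t + Y x t := by
  obtain ⟨F, hF, hL⟩ := hX
  obtain ⟨G, hG, hM⟩ := hY
  refine ⟨_, hF.add hG, fun t ht x hx => ?_⟩
  rw [laplace_add (hF.integrable hσ0 hσ hγ hR ht hx) (hG.integrable hσ0 hσ hγ hR ht hx), hL t ht x hx, hM t ht x hx]

theorem mul (hσ0 : 0 ≤ σ) (hσ : σ < Real.pi) (hγ : 0 ≤ γ) (hR : 1 ≤ R) (hK : 0 ≤ K) (hK' : 0 ≤ K') (hX : HasKernelRep σ T γ R a K X)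
    (hY : HasKernelRep σ T γ R b K' Y) : HasKernelRep σ T γ R (a + b) (K * K') fun x t => X x t * Y x t := by
  obtain ⟨F, hF, hL⟩ := hX
  obtain ⟨G, hG, hM⟩ := hY
  have hR0 : 0 < R := one_pos.trans_le hR
  refine ⟨_, hF.conv hσ.le hγ hR hK hK' hG, fun t ht x hx => ?_⟩
  rw [laplace_borelConv (hF.integrable hσ0 hσ hγ hR0 ht hx) (hG.integrable hσ0 hσ hγ hR0 ht hx), hL t ht x hx, hM t ht x hx]

theorem zero (hK : 0 ≤ K) (hR : 0 < R) : HasKernelRep σ T γ R a K fun (_ : Fin d → ℂ) _ => 0 :=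
  ⟨_, IsKernel.zero hK hR, fun t _ x _ => by simp [laplace]⟩

theorem tsum (hσ0 : 0 ≤ σ) (hσ : σ < Real.pi) (hγ : 0 ≤ γ) (hR : 0 < R) {ι : Type*} [Countable ι] {X : ι → (Fin d → ℂ) → ℝ → ℂ} {u : ι → ℝ}
    (hX : ∀ i, HasKernelRep σ T γ R a (u i) (X i)) (hu0 : ∀ i, 0 ≤ u i) (hu : Summable u) :
    HasKernelRep σ T γ R a (∑' i, u i) fun x t => ∑' i, X i x t := by
  choose F hF hL using hX
  refine ⟨_, IsKernel.tsum hσ.le hγ hR hF hu, fun t ht x hx => ?_⟩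
  rw [← (IsKernel.hasSum_laplace hσ0 hσ hγ hR hF hu0 hu ht hx).tsum_eq]
  exact tsum_congr fun i => hL i t ht x hx

theorem sum (hσ0 : 0 ≤ σ) (hσ : σ < Real.pi) (hγ : 0 ≤ γ) (hR : 0 < R) {ι : Type*} (s : Finset ι) {X : ι → (Fin d → ℂ) → ℝ → ℂ} {u : ι → ℝ}
    (hX : ∀ i ∈ s, HasKernelRep σ T γ R a (u i) (X i)) :
    HasKernelRep σ T γ R a (∑ i ∈ s, u i) fun x t => ∑ i ∈ s, X i x t := by
  classical
  induction s using Finset.induction_on with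
  | empty => simpa using HasKernelRep.zero le_rfl hR
  | insert i s hi ih =>
    simp only [Finset.sum_insert hi]
    exact (hX i (Finset.mem_insert_self _ _)).add hσ0 hσ hγ hR (ih fun j hj => hX j (Finset.mem_insert_of_mem hj))

end HasKernelRep

/-- `X` and `Y` are products of `D` factors of size `r`, with pairwise distance `r δ`. -/
def ProdRep {d : ℕ} (σ T γ R r δ : ℝ) (D a : ℕ) (X Y : (Fin d → ℂ) → ℝ → ℂ) : Prop :=
  (D = 0 ∧ X = (fun _ _ => 1) ∧ Y = fun _ _ => 1) ∨
  (HasKernelRep σ T γ R a (r ^ D) X ∧ HasKernelRep σ T γ R a (r ^ D) Y ∧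
    HasKernelRep σ T γ R a (D * r ^ D * δ) fun x t => X x t - Y x t)

namespace ProdRep

variable {d : ℕ} {σ T γ R r δ : ℝ} {D D' a a' : ℕ} {X Y X' Y' : (Fin d → ℂ) → ℝ → ℂ}

/-- The reason for the alternative D = 0 in `ProdRep`: for d ≥ 1 the constant 1 does not decay as Re
x → ∞, so it would require a delta mass rather than a kernel. -/
theorem one : ProdRep σ T γ R r δ 0 a (fun (_ : Fin d → ℂ) _ => 1) fun _ _ => 1 := Or.inl ⟨rfl, rfl, rfl⟩

/-- The splitting XX' - YY' = (X - Y)X' + Y(X' - Y') makes the factor D in the distance additive. -/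
theorem mul (hσ0 : 0 ≤ σ) (hσ : σ < Real.pi) (hγ : 0 ≤ γ) (hR : 1 ≤ R) (hr : 0 ≤ r) (hδ : 0 ≤ δ)
    (h : ProdRep σ T γ R r δ D a X Y) (h' : ProdRep σ T γ R r δ D' a' X' Y') :
    ProdRep σ T γ R r δ (D + D') (a + a') (fun x t => X x t * X' x t) fun x t => Y x t * Y' x t := by
  have hR0 : 0 < R := one_pos.trans_le hR
  rcases h with ⟨rfl, rfl, rfl⟩ | ⟨h1, h2, h3⟩
  · rcases h' with ⟨rfl, rfl, rfl⟩ | ⟨h1, h2, h3⟩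
    · exact Or.inl ⟨rfl, by simp, by simp⟩
    · refine Or.inr ?_
      simp only [one_mul, zero_add]
      exact ⟨h1.mono hR0 (by positivity) (by omega) le_rfl, h2.mono hR0 (by positivity) (by omega) le_rfl, h3.mono hR0 (by positivity) (by omega) le_rfl⟩
  · rcases h' with ⟨rfl, rfl, rfl⟩ | ⟨h1', h2', h3'⟩
    · refine Or.inr ?_
      simp only [mul_one, add_zero]
      exact ⟨h1.mono hR0 (by positivity) (by omega) le_rfl, h2.mono hR0 (by positivity) (by omega) le_rfl, h3.mono hR0 (by positivity) (by omega) le_rfl⟩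
    · refine Or.inr ⟨?_, ?_, ?_⟩
      · rw [pow_add]; exact h1.mul hσ0 hσ hγ hR (by positivity) (by positivity) h1'
      · rw [pow_add]; exact h2.mul hσ0 hσ hγ hR (by positivity) (by positivity) h2'
      · have e1 := h3.mul hσ0 hσ hγ hR (by positivity) (by positivity) h1'
        have e2 := h2.mul hσ0 hσ hγ hR (by positivity) (by positivity) h3'
        have e3 := (e1.add hσ0 hσ hγ hR0 e2).congr (Y := fun x t => X x t * X' x t - Y x t * Y' x t) fun t _ x _ => by ring
        convert e3 using 1
        push_cast; ring

theorem pow (hσ0 : 0 ≤ σ) (hσ : σ < Real.pi) (hγ : 0 ≤ γ) (hR : 1 ≤ R) (hr : 0 ≤ r) (hδ : 0 ≤ δ)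
    (h : ProdRep σ T γ R r δ D a X Y) (k : ℕ) :
    ProdRep σ T γ R r δ (D * k) (a * k) (fun x t => X x t ^ k) fun x t => Y x t ^ k := by
  induction k with
  | zero => simpa using one
  | succ k ih => simpa only [pow_succ, mul_add, mul_one] using ih.mul hσ0 hσ hγ hR hr hδ h

theorem prod (hσ0 : 0 ≤ σ) (hσ : σ < Real.pi) (hγ : 0 ≤ γ) (hR : 1 ≤ R) (hr : 0 ≤ r) (hδ : 0 ≤ δ)
    {ι : Type*} (s : Finset ι) {D a : ι → ℕ} {X Y : ι → (Fin d → ℂ) → ℝ → ℂ}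
    (h : ∀ i ∈ s, ProdRep σ T γ R r δ (D i) (a i) (X i) (Y i)) :
    ProdRep σ T γ R r δ (∑ i ∈ s, D i) (∑ i ∈ s, a i) (fun x t => ∏ i ∈ s, X i x t) fun x t => ∏ i ∈ s, Y i x t := by
  classical
  induction s using Finset.induction_on with
  | empty => simpa using one
  | insert i s hi ih =>
    simp only [Finset.sum_insert hi, Finset.prod_insert hi]
    exact (h i (Finset.mem_insert_self _ _)).mul hσ0 hσ hγ hR hr hδ (ih fun j hj => h j (Finset.mem_insert_of_mem hj))

/-- A derivative counts as one factor, whatever its order: on the Borel side it is multiplication by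
(-p)^j, so the order enters only through the polynomial exponent. -/
theorem multiDeriv (hσ0 : 0 ≤ σ) (hσ : σ < Real.pi) (hγ : 0 ≤ γ) (hR : 0 < R) {F G : (Fin d → ℂ) → ℝ → ℂ}
    (hF : IsKernel σ T γ R 0 r F) (hG : IsKernel σ T γ R 0 r G) (hFG : IsKernel σ T γ R 0 (r * δ) fun p t => F p t - G p t) (j : Fin d → ℕ) :
    ProdRep σ T γ R r δ 1 (∑ i, j i) (fun x t => multiDeriv j (laplace 0 fun p => F p t) x)
      fun x t => multiDeriv j (laplace 0 fun p => G p t) x := by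
  have key : ∀ {K : ℝ} {F : (Fin d → ℂ) → ℝ → ℂ}, IsKernel σ T γ R 0 K F →
      HasKernelRep σ T γ R (∑ i, j i) K fun x t => _root_.multiDeriv j (laplace 0 fun p => F p t) x := fun {K F} h => by
    refine ⟨_, by simpa only [zero_add] using h.mul_negPow hR j, fun t ht x hx => ?_⟩
    exact ((h.growth hγ hR ht).multiDeriv_laplace (by linarith) hσ0 hσ j hx).symm
  refine Or.inr ⟨by simpa using key hF, by simpa using key hG, ?_⟩
  simp only [pow_one, Nat.cast_one, one_mul]
  refine (key hFG).congr fun t ht x hx => ?_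
  have e : ∀ {K : ℝ} {F : (Fin d → ℂ) → ℝ → ℂ}, IsKernel σ T γ R 0 K F → 
      _root_.multiDeriv j (laplace 0 fun p => F p t) x = laplace 0 (fun p => negPow j p * F p t) x := fun h =>
    (h.growth hγ hR ht).multiDeriv_laplace (by linarith) hσ0 hσ j hx
  rw [e hF, e hG, e hFG, ← laplace_sub ((hF.mul_negPow hR j).integrable hσ0 hσ hγ hR ht hx) ((hG.mul_negPow hR j).integrable hσ0 hσ hγ hR ht hx)]
  simp only [mul_sub]

end ProdRep

/-! ### Taylor coefficients by Cauchy's formula on a torus -/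

theorem hasSum_prod_pow {r : ℝ} (h0 : 0 ≤ r) (h1 : r < 1) (m : ℕ) : HasSum (fun k : Fin m → ℕ => ∏ i, r ^ k i) ((1 - r)⁻¹ ^ m) := by
  induction m with
  | zero => simp
  | succ m ih =>
    have hg := hasSum_geometric_of_lt_one h0 h1
    have hs : Summable fun p : ℕ × (Fin m → ℕ) => r ^ p.1 * ∏ i, r ^ p.2 i :=
      Summable.mul_of_nonneg (f := fun k : ℕ => r ^ k) (g := fun k : Fin m → ℕ => ∏ i, r ^ k i) hg.summable ih.summable
        (fun k => pow_nonneg h0 k) fun k => Finset.prod_nonneg fun i _ => pow_nonneg h0 (k i)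
    have h := hg.mul ih hs
    rw [← pow_succ'] at h
    rw [← (Fin.consEquiv fun _ : Fin (m + 1) => ℕ).hasSum_iff]
    refine h.congr_fun fun p => ?_
    simp [Fin.prod_univ_succ, Fin.consEquiv]

/-- The points of the torus of radius `r`. -/
noncomputable def torusPt {m : ℕ} (r : ℝ) (θ : Fin m → ℝ) : Fin m → ℂ := fun i => r * Complex.exp (θ i * Complex.I)

noncomputable abbrev torusMeasure (m : ℕ) : Measure (Fin m → ℝ) := Measure.pi fun _ => volume.restrict (Ioc 0 (2 * Real.pi))

/-- The factor in Cauchy's formula for the `k`-th Taylor coefficient. -/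
noncomputable def cauchyFactor (r : ℝ) (k : ℕ) (θ : ℝ) : ℂ := (2 * Real.pi)⁻¹ * (r ^ k)⁻¹ * Complex.exp (-(k * θ * Complex.I))

/-- Cauchy's integral for the Taylor coefficients at `0` of a function of `m` variables. -/
noncomputable def taylorCoeff {m : ℕ} (r : ℝ) (k : Fin m → ℕ) (g : (Fin m → ℂ) → ℂ) : ℂ :=
  ∫ θ, g (torusPt r θ) * ∏ i, cauchyFactor r (k i) (θ i) ∂torusMeasure m

theorem continuous_torusPt {m : ℕ} (r : ℝ) : Continuous (torusPt (m := m) r) := by unfold torusPt; fun_prop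

theorem continuous_cauchyFactor (r : ℝ) (k : ℕ) : Continuous (cauchyFactor r k) := by unfold cauchyFactor; fun_prop

theorem norm_cauchyFactor {r : ℝ} (hr : 0 < r) (k : ℕ) (θ : ℝ) : ‖cauchyFactor r k θ‖ = (2 * Real.pi)⁻¹ * (r ^ k)⁻¹ := by
  have : -((k : ℂ) * θ * Complex.I) = ((-(k * θ) : ℝ) : ℂ) * Complex.I := by push_cast; ring
  rw [cauchyFactor, norm_mul, this, Complex.norm_exp_ofReal_mul_I, mul_one]
  simp [abs_of_pos hr, abs_of_pos Real.pi_pos]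

theorem norm_torusPt_apply {m : ℕ} {r : ℝ} (hr : 0 < r) (θ : Fin m → ℝ) (i : Fin m) : ‖torusPt r θ i‖ = r := by
  simp [torusPt, Complex.norm_exp_ofReal_mul_I, abs_of_pos hr]

theorem integral_pow_mul_cauchyFactor {r : ℝ} (hr : 0 < r) (k k' : ℕ) :
    ∫ θ in Ioc 0 (2 * Real.pi), (r * Complex.exp (θ * Complex.I)) ^ k' * cauchyFactor r k θ = if k' = k then 1 else 0 := by
  have e : ∀ θ : ℝ, ((r : ℂ) * Complex.exp (θ * Complex.I)) ^ k' * cauchyFactor r k θ =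
      ((r : ℂ) ^ k' * ((2 * Real.pi)⁻¹ * (r ^ k)⁻¹)) * Complex.exp ((((k' : ℂ) - k) * Complex.I) * θ) := fun θ => by
    have : ((((k' : ℂ) - k) * Complex.I) * θ) = k' * (θ * Complex.I) + (-(k * θ * Complex.I)) := by ring
    rw [this, Complex.exp_add, mul_pow, ← Complex.exp_nat_mul, cauchyFactor]
    ring
  simp_rw [e]
  rw [integral_const_mul, ← intervalIntegral.integral_of_le Real.two_pi_pos.le]
  have hrc : (r : ℂ) ≠ 0 := by exact_mod_cast hr.ne'
  split_ifs with h
  · subst h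
    have hpi : (Real.pi : ℂ) ≠ 0 := by exact_mod_cast Real.pi_ne_zero
    simp only [sub_self, zero_mul, Complex.exp_zero, intervalIntegral.integral_const]
    push_cast
    rw [sub_zero, Complex.real_smul]
    push_cast
    field_simp
  · have hne : ((k' : ℂ) - k) * Complex.I ≠ 0 := mul_ne_zero (sub_ne_zero.2 (by exact_mod_cast h)) Complex.I_ne_zero
    rw [integral_exp_mul_complex hne]
    have : ((k' : ℂ) - k) * Complex.I * ((2 * Real.pi : ℝ) : ℂ) = ((k' - k : ℤ) : ℂ) * (2 * Real.pi * Complex.I) := by push_cast; ring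
    rw [this, Complex.exp_int_mul_two_pi_mul_I]
    simp

/-- Orthogonality of the characters of the torus, applied term by term; absolute summability at
radius r justifies the exchange of sum and integral. -/
theorem taylorCoeff_eq {m : ℕ} {r : ℝ} (hr : 0 < r) {g : (Fin m → ℂ) → ℂ} {c : (Fin m → ℕ) → ℂ}
    (hc : Summable fun k => ‖c k‖ * ∏ i, r ^ k i) (h : ∀ θ, HasSum (fun k => (∏ i, torusPt r θ i ^ k i) * c k) (g (torusPt r θ)))
    (k : Fin m → ℕ) : taylorCoeff r k g = c k := by
  set W : (Fin m → ℝ) → ℂ := fun θ => ∏ i, cauchyFactor r (k i) (θ i) with hW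
  have hWc : Continuous W := continuous_finsetProd _ fun i _ => (continuous_cauchyFactor r (k i)).comp (continuous_apply i)
  set F : (Fin m → ℕ) → (Fin m → ℝ) → ℂ := fun k' θ => (∏ i, torusPt r θ i ^ k' i) * c k' * W θ with hF
  set B : ℝ := ∏ i, ((2 * Real.pi)⁻¹ * (r ^ k i)⁻¹) with hB
  have hn : ∀ k' θ, ‖F k' θ‖ = ‖c k'‖ * (∏ i, r ^ k' i) * B := fun k' θ => by
    simp only [hF, hW, norm_mul, norm_prod, norm_pow, norm_torusPt_apply hr, norm_cauchyFactor hr, hB]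
    ring
  have hFc : ∀ k', Continuous (F k') := fun k' =>
    ((continuous_finsetProd _ fun i _ => ((continuous_apply i).comp (continuous_torusPt r)).pow _).mul continuous_const).mul hWc
  have hFi : ∀ k', Integrable (F k') (torusMeasure m) := fun k' =>
    Integrable.of_bound (hFc k').aestronglyMeasurable _ (Eventually.of_forall fun θ => (hn k' θ).le)
  have hs := hasSum_integral_of_summable_integral_norm hFi (by
    simp_rw [hn, integral_const, smul_eq_mul]
    exact (hc.mul_right B).mul_left _)
  have e1 : ∫ θ, ∑' k', F k' θ ∂torusMeasure m = taylorCoeff r k g := by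
    refine integral_congr_ae (Eventually.of_forall fun θ => ?_)
    exact ((h θ).mul_right (W θ)).tsum_eq
  have e2 : ∀ k', ∫ θ, F k' θ ∂torusMeasure m = if k' = k then c k else 0 := fun k' => by
    have : ∀ θ, F k' θ = c k' * ∏ i, ((r * Complex.exp (θ i * Complex.I)) ^ k' i * cauchyFactor r (k i) (θ i)) := fun θ => by
      simp only [hF, hW, torusPt, Finset.prod_mul_distrib]; ring
    simp_rw [this]
    rw [integral_const_mul, integral_fintype_prod_eq_prod (𝕜 := ℂ) (fun i (x : ℝ) => (r * Complex.exp (x * Complex.I)) ^ k' i * cauchyFactor r (k i) x)]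
    simp_rw [integral_pow_mul_cauchyFactor hr]
    by_cases hk : k' = k
    · simp [hk]
    · obtain ⟨i, hi⟩ := Function.ne_iff.1 hk
      rw [if_neg hk, Finset.prod_eq_zero (Finset.mem_univ i) (if_neg hi), mul_zero]
  simp_rw [e2] at hs
  rw [e1] at hs
  exact hs.unique (hasSum_ite_eq k (c k))

/-- The Taylor coefficients of a function of `y` depending on `x` and `t`: they are sectorial, and sum up to the function. -/
theorem isSectorial_taylorCoeff {d m : ℕ} {φ ρ T α ε A r : ℝ} (hφ : φ ≤ Real.pi / 2) (hρ : 0 < ρ) (hα : 0 ≤ α) (hA : 0 ≤ A)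
    (hr : 0 < r) (hr1 : r ≤ 1 / 2) (hrε : m * r < ε) {g : (Fin d → ℂ) → ℝ → (Fin m → ℂ) → ℂ}
    (ha : ∀ t ∈ Icc 0 T, AnalyticOnNhd ℂ (fun z : (Fin d → ℂ) × (Fin m → ℂ) => g z.1 t z.2) (polysector d φ ρ ×ˢ {y | l1norm y < ε}))
    (hc : ∀ x ∈ polysector d φ ρ, ∀ y, l1norm y < ε → ContinuousOn (fun t => g x t y) (Icc 0 T))
    (hg : ∀ x ∈ polysector d φ ρ, ∀ t ∈ Icc 0 T, ∃ c : (Fin m → ℕ) → ℂ,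
      (∀ y, l1norm y < ε → HasSum (fun k => (∏ i, y i ^ k i) * c k) (g x t y)) ∧ ∀ k, ‖c k‖ ≤ A * ∏ i, ‖x i‖ ^ (-α)) :
    (∀ k, IsSectorial φ ρ T α A fun x t => taylorCoeff r k (g x t)) ∧
    ∀ x ∈ polysector d φ ρ, ∀ t ∈ Icc 0 T, ∀ y, l1norm y < ε →
      HasSum (fun k => (∏ i, y i ^ k i) * taylorCoeff r k (g x t)) (g x t y) := by
  have hgeo := hasSum_prod_pow hr.le (by linarith : r < 1) m
  have hy : ∀ θ : Fin m → ℝ, l1norm (torusPt r θ) < ε := fun θ => by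
    simpa [l1norm, norm_torusPt_apply hr] using hrε
  -- The hypothesis supplies coefficients for each (x, t) separately, without any regularity. Their
  -- identification with a torus integral makes them jointly continuous and holomorphic in x.
  have hcoef : ∀ x ∈ polysector d φ ρ, ∀ t ∈ Icc 0 T, ∀ c : (Fin m → ℕ) → ℂ,
      (∀ y, l1norm y < ε → HasSum (fun k => (∏ i, y i ^ k i) * c k) (g x t y)) → (∀ k, ‖c k‖ ≤ A * ∏ i, ‖x i‖ ^ (-α)) →
      ∀ k, taylorCoeff r k (g x t) = c k := fun x hx t ht c h1 h2 k =>
    taylorCoeff_eq hr (Summable.of_nonneg_of_le (fun k => by positivity) (fun k => mul_le_mul_of_nonneg_right (h2 k) (by positivity)) (hgeo.summable.mul_left _))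
      (fun θ => h1 _ (hy θ)) k
  have hX : ∀ x ∈ polysector d φ ρ, ∏ i, ‖x i‖ ^ (-α) ≤ ∏ i : Fin d, ρ ^ (-α) := fun x hx =>
    Finset.prod_le_prod (fun i _ => by positivity) fun i _ => Real.rpow_le_rpow_of_nonpos hρ (hx i).2.le (by linarith)
  set M : ℝ := A * (∏ i : Fin d, ρ ^ (-α)) * (1 - r)⁻¹ ^ m with hM
  have hbd : ∀ x ∈ polysector d φ ρ, ∀ t ∈ Icc 0 T, ∀ θ, ‖g x t (torusPt r θ)‖ ≤ M := fun x hx t ht θ => by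
    obtain ⟨c, h1, h2⟩ := hg x hx t ht
    rw [← (h1 _ (hy θ)).tsum_eq]
    refine tsum_of_norm_bounded (hgeo.mul_left _) fun k => ?_
    rw [norm_mul, norm_prod, mul_comm]
    simp_rw [norm_pow, norm_torusPt_apply hr]
    exact mul_le_mul_of_nonneg_right ((h2 k).trans (mul_le_mul_of_nonneg_left (hX x hx) hA)) (by positivity)
  have hopen : IsOpen (polysector d φ ρ) := isOpen_polysector hφ hρ.le
  have hdx : ∀ t ∈ Icc 0 T, ∀ y, l1norm y < ε → DifferentiableOn ℂ (fun x => g x t y) (polysector d φ ρ) := fun t ht y hy x hx =>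
    (DifferentiableAt.comp (g := fun z : (Fin d → ℂ) × (Fin m → ℂ) => g z.1 t z.2) (f := fun x => (x, y)) x
      (ha t ht (x, y) ⟨hx, hy⟩).differentiableAt (differentiableAt_id.prodMk (differentiableAt_const y))).differentiableWithinAt
  have hcθ : ∀ x ∈ polysector d φ ρ, ∀ t ∈ Icc 0 T, Continuous fun θ : Fin m → ℝ => g x t (torusPt r θ) := fun x hx t ht =>
    continuous_iff_continuousAt.2 fun θ => by
      have h1 : ContinuousAt (fun z : (Fin d → ℂ) × (Fin m → ℂ) => g z.1 t z.2) (x, torusPt r θ) :=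
        (ha t ht (x, torusPt r θ) ⟨hx, hy θ⟩).continuousAt
      exact h1.comp_of_eq (f := fun θ => (x, torusPt r θ)) (by have := continuous_torusPt (m := m) r; fun_prop) rfl
  refine ⟨fun k => ?_, fun x hx t ht y hy => ?_⟩
  · have hWc : Continuous fun θ : Fin m → ℝ => ∏ i, cauchyFactor r (k i) (θ i) :=
      continuous_finsetProd _ fun i _ => (continuous_cauchyFactor r (k i)).comp (continuous_apply i)
    set B : ℝ := ∏ i, ((2 * Real.pi)⁻¹ * (r ^ k i)⁻¹) with hB
    have hWn : ∀ θ : Fin m → ℝ, ‖∏ i, cauchyFactor r (k i) (θ i)‖ = B := fun θ => by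
      simp_rw [norm_prod, norm_cauchyFactor hr]; rfl
    have hB0 : 0 ≤ B := (hWn 0) ▸ norm_nonneg _
    have hint : ∀ x ∈ polysector d φ ρ, ∀ t ∈ Icc 0 T, ∀ θ, ‖g x t (torusPt r θ) * ∏ i, cauchyFactor r (k i) (θ i)‖ ≤ M * B := fun x hx t ht θ => by
      rw [norm_mul, hWn]; exact mul_le_mul_of_nonneg_right (hbd x hx t ht θ) hB0
    refine ⟨?_, ?_, ?_⟩
    · have : ∀ z ∈ polysector d φ ρ ×ˢ Icc 0 T, ∀ θ, ‖g z.1 z.2 (torusPt r θ) * ∏ i, cauchyFactor r (k i) (θ i)‖ ≤ M * B := fun z hz => hint z.1 hz.1 z.2 hz.2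
      unfold taylorCoeff
      refine fun z hz => continuousWithinAt_of_dominated (bound := fun _ => M * B) ?_ ?_ (integrable_const _) ?_
      · filter_upwards [self_mem_nhdsWithin] with w hw using ((hcθ w.1 hw.1 w.2 hw.2).mul hWc).aestronglyMeasurable
      · filter_upwards [self_mem_nhdsWithin] with w hw using Eventually.of_forall (this w hw)
      · refine Eventually.of_forall fun θ => ContinuousWithinAt.mul ?_ continuousWithinAt_const
        exact continuousOn_prod_of_differentiableOn hopen (fun t ht => hdx t ht _ (hy θ)) (fun x hx => hc x hx _ (hy θ))
          (fun x _ => ⟨1, one_pos, M, fun y _ hyU t ht => hbd y hyU t ht θ⟩) z hz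
    · intro t ht x hx i
      have hmem : ∀ z ∈ sector φ ρ, Function.update x i z ∈ polysector d φ ρ := fun z hz => update_mem_polysector hz fun j _ => hx j
      refine differentiableOn_integral_of_dominated (isOpen_sector hφ hρ.le) (fun z hz => ((hcθ _ (hmem z hz) t ht).mul hWc).aestronglyMeasurable)
        (Eventually.of_forall fun θ => ?_) fun z₀ _ => ⟨1, one_pos, fun _ => M * B, integrable_const _, Eventually.of_forall fun θ z _ hz => hint _ (hmem z hz) t ht θ⟩
      exact ((hdx t ht _ (hy θ)).comp (differentiable_update x i).differentiableOn hmem).mul_const _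
    · intro x hx t ht
      obtain ⟨c, h1, h2⟩ := hg x hx t ht
      rw [hcoef x hx t ht c h1 h2 k]; exact h2 k
  · obtain ⟨c, h1, h2⟩ := hg x hx t ht
    simp_rw [hcoef x hx t ht c h1 h2]
    exact h1 y hy

/-! ### The nonlinearity on the Borel plane -/

theorem multiDeriv_zero {d : ℕ} (g : (Fin d → ℂ) → ℂ) : multiDeriv (fun _ => 0) g = g := by
  unfold multiDeriv
  induction List.finRange d with
  | nil => rfl
  | cons i l ih => simp

theorem HasKernelRep.coef_mul {d : ℕ} {φ ρ T α C a σ σ' γ R K : ℝ} {b : ℕ} {g X : (Fin d → ℂ) → ℝ → ℂ} (h : IsSectorial φ ρ T α C g)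
    (h00 : 0 ≤ σ) (h1 : σ < σ') (h2 : σ' < φ) (h3 : φ ≤ Real.pi / 4) (hρ : 0 ≤ ρ) (hα : 0 < α) (hC : 0 ≤ C) (ha : ρ < a)
    (hγ : 0 ≤ γ) (hR : 1 ≤ R) (hRa : 6 * a ≤ R) (hK : 0 ≤ K) (hX : HasKernelRep σ T γ R b K X) :
    HasKernelRep σ T γ R b (C * K * coefConst σ σ' γ α R ^ d) fun x t => g x t * X x t := by
  obtain ⟨F, hF, hL⟩ := hX
  refine ⟨_, h.conv_kernel h00 h1 h2 h3 hρ hα hC ha hγ hR hRa hK hF, fun t ht x hx => ?_⟩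
  rw [h.laplace_conv_kernel h00 h1 h2 h3 hρ hα hC ha hγ hRa hF ht hx, hL t ht x hx]

/-- The Laplace transform of a vector of kernels. -/
noncomputable def laplaceVec {d m : ℕ} (F : Fin m → (Fin d → ℂ) → ℝ → ℂ) (x : Fin d → ℂ) (t : ℝ) : Fin m → ℂ :=
  fun l => laplace 0 (fun p => F l p t) x

/-- The monomials `y^k ∏ (∂^j y_l)^{q_{l,j}}`. -/
noncomputable def derivMonomial {d m n : ℕ} (k : Fin m → ℕ) (q : Fin m → multiIdx d n → ℕ) (f : (Fin d → ℂ) → Fin m → ℂ) (x : Fin d → ℂ) : ℂ :=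
  (∏ l, f x l ^ k l) * ∏ l, ∏ j : multiIdx d n, multiDeriv j.1 (fun y => f y l) x ^ q l j

/-- The nonlinear part of the right hand side. -/
noncomputable def QuasilinearData.nonlin {d m n : ℕ} (S : QuasilinearData d m n) (f : (Fin d → ℂ) → Fin m → ℂ) (t : ℝ) (x : Fin d → ℂ) (l : Fin m) : ℂ :=
  ∑ q ∈ expIdx d m n, S.b q x t (f x) l * ∏ l' : Fin m, ∏ j : multiIdx d n, multiDeriv j.1 (fun y => f y l') x ^ q l' j

/-- The degree counts all factors, while the polynomial exponent counts only derivatives, weighted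
by their order. For q in `expIdx` the latter is at most n, which is what the Duhamel operator can
absorb. -/
theorem ProdRep.derivMonomial {d m n : ℕ} {σ T γ R r δ : ℝ} (hσ0 : 0 ≤ σ) (hσ : σ < Real.pi) (hγ : 0 ≤ γ) (hR : 1 ≤ R) (hr : 0 ≤ r) (hδ : 0 ≤ δ)
    {F G : Fin m → (Fin d → ℂ) → ℝ → ℂ}
    (hF : ∀ l, IsKernel σ T γ R 0 r (F l)) (hG : ∀ l, IsKernel σ T γ R 0 r (G l)) (hFG : ∀ l, IsKernel σ T γ R 0 (r * δ) fun p t => F l p t - G l p t)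
    (k : Fin m → ℕ) (q : Fin m → multiIdx d n → ℕ) :
    ProdRep σ T γ R r δ (∑ l, k l + ∑ l, ∑ j, q l j) (∑ l, ∑ j : multiIdx d n, (∑ i, j.1 i) * q l j)
      (fun x t => derivMonomial k q (fun x => laplaceVec F x t) x) fun x t => derivMonomial k q (fun x => laplaceVec G x t) x := by
  have hR0 : 0 < R := one_pos.trans_le hR
  have h0 : ∀ l, ProdRep σ T γ R r δ 1 0 (fun x t => laplaceVec F x t l) fun x t => laplaceVec G x t l := fun l => by
    have := ProdRep.multiDeriv hσ0 hσ hγ hR0 (hF l) (hG l) (hFG l) fun _ => 0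
    simp only [multiDeriv_zero, Finset.sum_const_zero] at this
    exact this
  have h1 := ProdRep.prod hσ0 hσ hγ hR hr hδ Finset.univ fun l _ => (h0 l).pow hσ0 hσ hγ hR hr hδ (k l)
  have h2 := ProdRep.prod hσ0 hσ hγ hR hr hδ Finset.univ fun (l : Fin m) _ => ProdRep.prod hσ0 hσ hγ hR hr hδ Finset.univ fun (j : multiIdx d n) _ =>
    (ProdRep.multiDeriv hσ0 hσ hγ hR0 (hF l) (hG l) (hFG l) j.1).pow hσ0 hσ hγ hR hr hδ (q l j)
  have h3 := h1.mul hσ0 hσ hγ hR hr hδ h2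
  simp only [one_mul, zero_mul, Finset.sum_const_zero, zero_add] at h3
  exact h3

/-- Tames the factor D in `ProdRep`: kernels of size 1/4 still leave a convergent geometric series
over the Taylor exponents. -/
theorem nat_mul_quarter_pow_le (D : ℕ) : (D : ℝ) * (1 / 4) ^ D ≤ (1 / 2) ^ D := by
  have h : (D : ℝ) ≤ 2 ^ D := by exact_mod_cast Nat.lt_two_pow_self.le
  calc (D : ℝ) * (1 / 4) ^ D ≤ 2 ^ D * (1 / 4) ^ D := by gcongr
    _ = (1 / 2) ^ D := by rw [← mul_pow]; norm_num

namespace StandingAssumptions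

variable {d m n : ℕ} {S : QuasilinearData d m n} {φ ρ₀ ε T αr : ℝ} {αq : (Fin m → multiIdx d n → ℕ) → ℝ}

/-- A role of n ≥ 2: all angles in play stay below π/4, so that σ + σ' ≤ π/2 as the Hankel estimates
require. -/
theorem half_pi_div_le (hn : 2 ≤ n) : Real.pi / (2 * n) ≤ Real.pi / 4 := by
  have : (2 : ℝ) ≤ n := by exact_mod_cast hn
  have := Real.pi_pos
  gcongr
  linarith

theorem exists_coeff (hS : StandingAssumptions S φ ρ₀ ε T αr αq) (hn : 2 ≤ n) (hρ₀ : 0 < ρ₀) (hε : 0 < ε) :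
    ∃ A : ℝ, 0 ≤ A ∧ ∃ c : (Fin m → multiIdx d n → ℕ) → Fin m → (Fin m → ℕ) → (Fin d → ℂ) → ℝ → ℂ,
      (∀ q ∈ expIdx d m n, ∀ l k, IsSectorial (Real.pi / (2 * n)) ρ₀ T (αq q) A (c q l k)) ∧
      (∀ q ∈ expIdx d m n, ∀ l, ∀ x ∈ polysector d (Real.pi / (2 * n)) ρ₀, ∀ t ∈ Icc 0 T, ∀ y, l1norm y < ε →
        HasSum (fun k => (∏ i, y i ^ k i) * c q l k x t) (S.b q x t y l)) ∧
      ∀ l, ∀ x ∈ polysector d (Real.pi / (2 * n)) ρ₀, ∀ t ∈ Icc 0 T, c 0 l 0 x t = 0 := by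
  obtain ⟨Ab, hAb⟩ := hS.b_bound
  have hpi := Real.pi_pos
  -- The torus radius must be at most 1/2 for the geometric series, and m r < ε puts the torus
  -- inside the ℓ¹ ball.
  set r : ℝ := min (1 / 2) (ε / (2 * (m + 1))) with hr
  have hr0 : 0 < r := by positivity
  have hrε : m * r < ε := by
    calc m * r ≤ m * (ε / (2 * (m + 1))) := by gcongr; exact min_le_right _ _
      _ < ε := by rw [← mul_div_assoc, div_lt_iff₀ (by positivity)]; nlinarith
  have key : ∀ q ∈ expIdx d m n, ∀ l, _ := fun q hq l =>
    isSectorial_taylorCoeff (d := d) (m := m) (φ := Real.pi / (2 * n)) (ρ := ρ₀) (T := T) (α := αq q) (ε := ε) (A := |Ab|) (r := r)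
      (by linarith [half_pi_div_le hn]) hρ₀ (hS.αq_pos q hq).le (abs_nonneg _) hr0 (min_le_left _ _) hrε
      (g := fun x t y => S.b q x t y l) (fun t ht z hz => analyticAt_pi_iff.1 (hS.b_analytic q hq t ht z hz) l)
      (fun x hx y hy => continuousOn_pi.1 (hS.b_continuous q hq x hx y hy) l) fun x hx t ht => by
        obtain ⟨c, hc, hb⟩ := hAb q hq x hx t ht
        refine ⟨fun k => c k l, fun y hy => by simpa using Pi.hasSum.1 (hc y hy) l, fun k => ?_⟩
        have hx0 : ∀ i, 0 < ‖x i‖ := fun i => hρ₀.trans (hx i).2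
        have h1 : ‖c k l‖ ≤ l1norm (c k) := Finset.single_le_sum (f := fun i => ‖c k i‖) (fun _ _ => norm_nonneg _) (Finset.mem_univ l)
        have h2 : absPow x (αq q) * ∏ i, ‖x i‖ ^ (-αq q) = 1 := by
          rw [absPow, ← Finset.prod_mul_distrib]
          exact Finset.prod_eq_one fun i _ => by rw [← Real.rpow_add (hx0 i)]; simp
        have h3 : 0 ≤ ∏ i, ‖x i‖ ^ (-αq q) := by positivity
        have h4 := mul_le_mul_of_nonneg_right ((hb k).trans (le_abs_self Ab)) h3
        calc ‖c k l‖ ≤ l1norm (c k) := h1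
          _ = absPow x (αq q) * l1norm (c k) * ∏ i, ‖x i‖ ^ (-αq q) := by rw [mul_right_comm, h2, one_mul]
          _ ≤ _ := h4
  refine ⟨|Ab|, abs_nonneg _, fun q l k x t => taylorCoeff r k fun y => S.b q x t y l, fun q hq l => (key q hq l).1, fun q hq l => (key q hq l).2, ?_⟩
  intro l x hx t ht
  have h0 : (0 : Fin m → multiIdx d n → ℕ) ∈ expIdx d m n := by simp [mem_expIdx]
  -- At y = 0 only the term k = 0 survives, so b_{0,0} = 0 says that this coefficient vanishes.
  have h1 := (key 0 h0 l).2 x hx t ht 0 (by simpa [l1norm] using hε)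
  have h2 := hasSum_single (f := fun k : Fin m → ℕ => (∏ i, (0 : Fin m → ℂ) i ^ k i) * taylorCoeff r k fun y => S.b 0 x t y l) 0 fun k hk => by
    obtain ⟨i, hi⟩ := Function.ne_iff.1 hk
    rw [Finset.prod_eq_zero (Finset.mem_univ i) (by simpa using hi), zero_mul]
  have h3 := h2.unique h1
  simpa [hS.b_zero x hx t ht] using h3

/-- The nonlinearity is a Lipschitz map of the kernels, with arbitrarily small constant for large `R`. -/
theorem exists_lipschitz (hS : StandingAssumptions S φ ρ₀ ε T αr αq) (hd : 1 ≤ d) (hn : 2 ≤ n) (hρ₀ : 0 < ρ₀) (hε : 0 < ε)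
    {σ γ η : ℝ} (hσ0 : 0 ≤ σ) (hσ : σ < Real.pi / (2 * n)) (hγ : 0 ≤ γ) (hη : 0 < η) :
    ∃ R₀ : ℝ, 1 ≤ R₀ ∧ ∀ R ≥ R₀, ∀ δ : ℝ, 0 ≤ δ → ∀ F G : Fin m → (Fin d → ℂ) → ℝ → ℂ,
      (∀ l, IsKernel σ T γ R 0 (1 / 4) (F l)) → (∀ l, IsKernel σ T γ R 0 (1 / 4) (G l)) →
      (∀ l, IsKernel σ T γ R 0 δ fun p t => F l p t - G l p t) → ∀ l, ∃ H, IsKernel σ T γ R n (η * δ) H ∧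
        ∀ t ∈ Icc 0 T, ∀ x ∈ halfSpace d R, l1norm (laplaceVec F x t) < ε → l1norm (laplaceVec G x t) < ε →
          laplace 0 (fun p => H p t) x = S.nonlin (fun x => laplaceVec F x t) t x l - S.nonlin (fun x => laplaceVec G x t) t x l := by
  obtain ⟨A, hA, c, hc, hsum, hc0⟩ := hS.exists_coeff hn hρ₀ hε
  have hpi := Real.pi_pos
  have hπ := half_pi_div_le hn
  set σ' : ℝ := (σ + Real.pi / (2 * n)) / 2 with hσ'
  -- The total Lipschitz constant: 4 is the inverse of the kernel size 1/4, and 2^m is the sum of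
  -- (1/2)^{|k|} over k. The limit 0 ^ d vanishes because d ≥ 1.
  have hlim : Tendsto (fun R => ∑ q ∈ expIdx d m n, A * 4 * 2 ^ m * coefConst σ σ' γ (αq q) R ^ d) atTop (𝓝 0) := by
    have : Tendsto (fun R => ∑ q ∈ expIdx d m n, A * 4 * 2 ^ m * coefConst σ σ' γ (αq q) R ^ d) atTop (𝓝 (∑ q ∈ expIdx d m n, A * 4 * 2 ^ m * 0 ^ d)) :=
      tendsto_finsetSum _ fun q hq => ((tendsto_coefConst σ σ' γ (hS.αq_pos q hq)).pow d).const_mul _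
    simpa [zero_pow (by omega : d ≠ 0)] using this
  obtain ⟨R₁, hR₁⟩ := eventually_atTop.1 (hlim.eventually (gt_mem_nhds hη))
  refine ⟨max (max 1 (6 * (ρ₀ + 1))) R₁, le_max_of_le_left (le_max_left _ _), fun R hR δ hδ F G hF hG hFG l => ?_⟩
  have hR1 : 1 ≤ R := (le_max_of_le_left (le_max_left _ _)).trans hR
  have hRa : 6 * (ρ₀ + 1) ≤ R := (le_max_of_le_left (le_max_right _ _)).trans hR
  have hR0 : 0 < R := one_pos.trans_le hR1
  have hhalf : ∀ x ∈ halfSpace d R, x ∈ polysector d (Real.pi / (2 * n)) ρ₀ := fun x hx i =>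
    mem_sector_of_lt_re (by positivity) hρ₀.le (lt_of_le_of_lt (by linarith) (hx i))
  have hcc : ∀ q ∈ expIdx d m n, 0 ≤ coefConst σ σ' γ (αq q) R := fun q hq => coefConst_nonneg hγ (hS.αq_pos q hq) hR0
  have hgeo := hasSum_prod_pow (by norm_num : (0 : ℝ) ≤ 1 / 2) (by norm_num) m
  norm_num only at hgeo
  have hterm : ∀ q ∈ expIdx d m n, ∀ k, HasKernelRep σ T γ R n ((∏ i, (1 / 2 : ℝ) ^ k i) * (A * 4 * coefConst σ σ' γ (αq q) R ^ d * δ)) fun x t =>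
      c q l k x t * (derivMonomial k q (fun x => laplaceVec F x t) x - derivMonomial k q (fun x => laplaceVec G x t) x) := by
    intro q hq k
    have hcq := hcc q hq
    -- `ProdRep` measures distances relative to the size r = 1/4, so δ is written as r · 4δ.
    rcases ProdRep.derivMonomial (δ := 4 * δ) hσ0 (by linarith) hγ hR1 (by norm_num) (by positivity) hF hG (fun l => by convert hFG l using 1; ring) k q
      with ⟨hD, -, -⟩ | ⟨-, -, h⟩
    -- Degree zero: the monomial is the constant 1 and has no kernel, but its coefficient vanishes
    -- by the normalization.
    · have hk : k = 0 := by
        funext i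
        have := Finset.single_le_sum (f := k) (fun _ _ => Nat.zero_le _) (Finset.mem_univ i)
        simp only [Pi.zero_apply]; omega
      have hq0 : q = 0 := by
        funext l j
        have h1 := Finset.single_le_sum (f := fun l => ∑ j, q l j) (fun _ _ => Nat.zero_le _) (Finset.mem_univ l)
        have h2 := Finset.single_le_sum (f := q l) (fun _ _ => Nat.zero_le _) (Finset.mem_univ j)
        simp only [Pi.zero_apply]; omega
      subst hk hq0
      refine (HasKernelRep.zero (by positivity) hR0).congr fun t ht x hx => ?_
      rw [hc0 l x (hhalf x hx) t ht, zero_mul]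
    · have h1 := (h.coef_mul (σ' := σ') (hc q hq l k) hσ0 (by linarith) (by linarith) hπ hρ₀.le (hS.αq_pos q hq) hA (by linarith : ρ₀ < ρ₀ + 1) hγ hR1 hRa (by positivity))
      refine h1.mono hR0 (by positivity) ((mem_expIdx q).1 hq) ?_
      have h2 : ((∑ l, k l + ∑ l, ∑ j, q l j : ℕ) : ℝ) * (1 / 4) ^ (∑ l, k l + ∑ l, ∑ j, q l j) ≤ ∏ i, (1 / 2 : ℝ) ^ k i := by
        rw [Finset.prod_pow_eq_pow_sum]
        exact (nat_mul_quarter_pow_le _).trans (pow_le_pow_of_le_one (by norm_num) (by norm_num) (Nat.le_add_right _ _))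
      calc _ = (((∑ l, k l + ∑ l, ∑ j, q l j : ℕ) : ℝ) * (1 / 4) ^ (∑ l, k l + ∑ l, ∑ j, q l j)) * (A * 4 * coefConst σ σ' γ (αq q) R ^ d * δ) := by ring
        _ ≤ _ := mul_le_mul_of_nonneg_right h2 (by positivity)
  have hq : ∀ q ∈ expIdx d m n, HasKernelRep σ T γ R n (A * 4 * 2 ^ m * coefConst σ σ' γ (αq q) R ^ d * δ) fun x t =>
      ∑' k, c q l k x t * (derivMonomial k q (fun x => laplaceVec F x t) x - derivMonomial k q (fun x => laplaceVec G x t) x) := fun q hq => by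
    have hcq := hcc q hq
    have hs := hgeo.mul_right (A * 4 * coefConst σ σ' γ (αq q) R ^ d * δ)
    have := HasKernelRep.tsum hσ0 (by linarith) hγ hR0 (hterm q hq) (fun k => by positivity) hs.summable
    rw [hs.tsum_eq] at this
    convert this using 1
    ring
  obtain ⟨H, hH, hL⟩ := HasKernelRep.sum hσ0 (by linarith) hγ hR0 (expIdx d m n) hq
  refine ⟨H, hH.mono hR0 ?_, fun t ht x hx hFε hGε => ?_⟩
  · rw [← Finset.sum_mul]
    exact mul_le_mul_of_nonneg_right (hR₁ R ((le_max_right _ _).trans hR)).le hδ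
  · rw [hL t ht x hx, QuasilinearData.nonlin, QuasilinearData.nonlin, ← Finset.sum_sub_distrib]
    refine Finset.sum_congr rfl fun q hq => ?_
    refine HasSum.tsum_eq ?_
    refine (((hsum q hq l x (hhalf x hx) t ht _ hFε).mul_right _).sub ((hsum q hq l x (hhalf x hx) t ht _ hGε).mul_right _)).congr_fun fun k => ?_
    simp only [derivMonomial]
    ring

end StandingAssumptions

/-! ### Uniqueness -/

theorem halfSpace_subset_polysector {d : ℕ} {φ ρ R : ℝ} (hφ : 0 ≤ φ) (hρ : 0 ≤ ρ) (hR : ρ ≤ R) : halfSpace d R ⊆ polysector d φ ρ :=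
  fun _ hx i => mem_sector_of_lt_re hφ hρ (hR.trans_lt (hx i))

/-- Laplace transforms along the real rays see only a half space; the identity theorem on the
connected polysector carries the resulting equalities further. -/
theorem eqOn_polysector_of_eqOn_halfSpace {d : ℕ} {φ ρ R : ℝ} (hφ : 0 ≤ φ) (hφ2 : φ ≤ Real.pi / 2) (hρ : 0 < ρ) (hR : ρ ≤ R)
    {E : Type*} [NormedAddCommGroup E] [NormedSpace ℂ E] {f g : (Fin d → ℂ) → E} (hf : AnalyticOnNhd ℂ f (polysector d φ ρ))
    (hg : AnalyticOnNhd ℂ g (polysector d φ ρ)) (h : EqOn f g (halfSpace d R)) : EqOn f g (polysector d φ ρ) := by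
  have hx : (fun _ => ((R + 1 : ℝ) : ℂ)) ∈ halfSpace d R := fun i => by simp
  exact hf.eqOn_of_preconnected_of_eventuallyEq hg (isPreconnected_polysector hφ2 hρ) (halfSpace_subset_polysector hφ hρ.le hR hx)
    (h.eventuallyEq_of_mem ((isOpen_halfSpace d R).mem_nhds hx))

theorem csector_mono {d : ℕ} {σ σ' : ℝ} (h : σ ≤ σ') : csector d σ ⊆ csector d σ' := fun _ hp i => ⟨(hp i).1, (hp i).2.trans h⟩

theorem norm_apply_le_l1norm {m : ℕ} (u : Fin m → ℂ) (l : Fin m) : ‖u l‖ ≤ l1norm u :=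
  Finset.single_le_sum (f := fun i => ‖u i‖) (fun _ _ => norm_nonneg _) (Finset.mem_univ l)

/-- Continuity in t for each fixed x suffices: with holomorphy in x and the uniform bound it becomes
joint continuity. -/
theorem isSectorial_of_analyticOnNhd {d m : ℕ} {φ ρ T α A : ℝ} (hφ : φ ≤ Real.pi / 2) (hρ : 0 < ρ) (hα : 0 ≤ α) {g : (Fin d → ℂ) → ℝ → (Fin m → ℂ)}
    (ha : ∀ t ∈ Icc 0 T, AnalyticOnNhd ℂ (fun x => g x t) (polysector d φ ρ)) (hc : ∀ x ∈ polysector d φ ρ, ContinuousOn (g x) (Icc 0 T))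
    (hb : ∀ x ∈ polysector d φ ρ, ∀ t ∈ Icc 0 T, absPow x α * l1norm (g x t) ≤ A) (l : Fin m) : IsSectorial φ ρ T α |A| fun x t => g x t l := by
  have hdiff : ∀ t ∈ Icc 0 T, DifferentiableOn ℂ (fun x => g x t l) (polysector d φ ρ) := fun t ht x hx =>
    (analyticAt_pi_iff.1 (ha t ht x hx) l).differentiableAt.differentiableWithinAt
  have hb : ∀ x ∈ polysector d φ ρ, ∀ t ∈ Icc 0 T, ‖g x t l‖ ≤ |A| * ∏ i, ‖x i‖ ^ (-α) := fun x hx t ht => by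
    have hx0 : ∀ i, 0 < ‖x i‖ := fun i => hρ.trans (hx i).2
    have h1 := (hb x hx t ht).trans (le_abs_self A)
    have h2 : ∏ i, ‖x i‖ ^ (-α) = (absPow x α)⁻¹ := by
      rw [absPow, ← Finset.prod_inv_distrib]
      exact Finset.prod_congr rfl fun i _ => Real.rpow_neg (hx0 i).le α
    have h3 : 0 < absPow x α := Finset.prod_pos fun i _ => Real.rpow_pos_of_pos (hx0 i) α
    rw [h2, ← div_eq_mul_inv, le_div_iff₀ h3, mul_comm]
    exact (mul_le_mul_of_nonneg_left (norm_apply_le_l1norm _ l) h3.le).trans h1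
  refine ⟨?_, ?_, hb⟩
  · refine continuousOn_prod_of_differentiableOn (isOpen_polysector hφ hρ.le) hdiff
      (fun x hx => continuousOn_pi.1 (hc x hx) l) fun x _ => ⟨1, one_pos, |A| * ∏ i : Fin d, ρ ^ (-α), fun y _ hy t ht => ?_⟩
    refine (hb y hy t ht).trans (mul_le_mul_of_nonneg_left ?_ (abs_nonneg _))
    exact Finset.prod_le_prod (fun i _ => by positivity) fun i _ => Real.rpow_le_rpow_of_nonpos hρ (hy i).2.le (by linarith)
  · intro t ht x hx i
    exact (hdiff t ht).comp (differentiable_update x i).differentiableOn fun z hz => update_mem_polysector hz fun j _ => hx j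

/-- For large `R` a sectorial function is the Laplace transform of a small kernel, its Borel transform. -/
theorem IsSectorial.exists_isKernel_borelTransform {d : ℕ} {ι : Type*} {φ ρ T γ A σ κ : ℝ} {g : ι → (Fin d → ℂ) → ℝ → ℂ}
    (h : ∀ l, IsSectorial φ ρ T (γ + 1) A (g l)) (hd : 1 ≤ d) (hA : 0 ≤ A) (hγ : 0 ≤ γ) (hσ0 : 0 ≤ σ) (hσ : σ < φ) (hφ : φ ≤ Real.pi / 4) (hρ : 0 < ρ) (hκ : 0 < κ) :
    ∃ R₀, ∀ R ≥ R₀, ∀ l, IsKernel σ T γ R 0 κ (fun p t => borelTransform ((σ + φ) / 2) (fun _ => ρ + 1) (fun x => g l x t) p) ∧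
      ∀ t ∈ Icc 0 T, ∀ x ∈ halfSpace d R, laplace 0 (borelTransform ((σ + φ) / 2) (fun _ => ρ + 1) fun x => g l x t) x = g l x t := by
  have hlim : Tendsto (fun R : ℝ => A * (borelConst σ ((σ + φ) / 2) * ((4 * (γ + 2)) ^ (γ + 2) * 2 ^ (γ + 3) / R)) ^ d) atTop (𝓝 (A * (borelConst σ ((σ + φ) / 2) * 0) ^ d)) :=
    (((tendsto_const_nhds.div_atTop tendsto_id).const_mul _).pow d).const_mul _
  rw [mul_zero, zero_pow (by omega), mul_zero] at hlim
  obtain ⟨R₁, hR₁⟩ := eventually_atTop.1 (hlim.eventually (gt_mem_nhds hκ))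
  refine ⟨max (max 1 (6 * (ρ + 1))) R₁, fun R hR l => ?_⟩
  have hR1 : 1 ≤ R := (le_max_of_le_left (le_max_left _ _)).trans hR
  have hRa : 6 * (ρ + 1) ≤ R := (le_max_of_le_left (le_max_right _ _)).trans hR
  refine ⟨?_, fun t ht x hx => ?_⟩
  · exact ((h l).isKernel hσ0 (by linarith) (by linarith) hφ hρ.le hA (by linarith) hγ hR1 hRa).mono (by linarith) (hR₁ R ((le_max_right _ _).trans hR)).le
  · exact (h l).laplace_borel (by linarith) (by linarith) hφ hρ.le (by linarith) (by linarith) ht fun i => lt_of_le_of_lt (by linarith) (hx i)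

namespace StandingAssumptions

variable {d m n : ℕ} {S : QuasilinearData d m n} {φ ρ₀ ε T αr : ℝ} {αq : (Fin m → multiIdx d n → ℕ) → ℝ}

/-- There are finitely many components, so the smallest σ and c and the largest C₀ serve all of
them. -/
theorem exists_cone (hS : StandingAssumptions S φ ρ₀ ε T αr αq) (hn : 2 ≤ n) : ∃ σ, φ < σ ∧ σ < Real.pi / (2 * n) ∧
    ∃ c > 0, ∃ C₀ ≥ 0, ∀ l, ∀ p ∈ csector d σ, c * ‖p‖ ^ n - C₀ ≤ (MvPolynomial.eval (-p) (S.P l)).re := by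
  have h : ∀ s : Finset (Fin m), ∃ σ, φ < σ ∧ σ < Real.pi / (2 * n) ∧ ∃ c > 0, ∃ C₀ ≥ 0,
      ∀ l ∈ s, ∀ p ∈ csector d σ, c * ‖p‖ ^ n - C₀ ≤ (MvPolynomial.eval (-p) (S.P l)).re := by
    intro s
    induction s using Finset.induction_on with
    | empty => obtain ⟨σ, h1, h2⟩ := exists_between hS.phi_lt; exact ⟨σ, h1, h2, 1, one_pos, 0, le_rfl, by simp⟩
    | insert l s _ ih =>
      obtain ⟨σ, h1, h2, c, hc, C₀, hC, h⟩ := ih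
      obtain ⟨σ', h1', h2', c', hc', C₀', hC', h'⟩ := exists_cone_bound (by omega) (hS.order_le l) hS.phi_pos hS.phi_lt
        (by linarith [half_pi_div_le hn, Real.pi_pos]) (hS.cone l)
      refine ⟨min σ σ', lt_min h1 h1', (min_le_left _ _).trans_lt h2, min c c', lt_min hc hc', max C₀ C₀', le_max_of_le_left hC, fun l' hl' p hp => ?_⟩
      rcases Finset.mem_insert.1 hl' with rfl | hl'
      · refine le_trans ?_ (h' p (csector_mono (min_le_right _ _) hp))
        gcongr; exacts [min_le_right _ _, le_max_right _ _]
      · refine le_trans ?_ (h l' hl' p (csector_mono (min_le_left _ _) hp))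
        gcongr; exacts [min_le_left _ _, le_max_left _ _]
  simpa using h Finset.univ

end StandingAssumptions

theorem QuasilinearData.nonlin_congr {d m n : ℕ} (S : QuasilinearData d m n) {U : Set (Fin d → ℂ)} (hU : IsOpen U) {f g : (Fin d → ℂ) → Fin m → ℂ}
    (h : EqOn f g U) (t : ℝ) {x : Fin d → ℂ} (hx : x ∈ U) (l : Fin m) : S.nonlin f t x l = S.nonlin g t x l := by
  have : ∀ j l', multiDeriv j (fun y => f y l') x = multiDeriv j (fun y => g y l') x := fun j l' =>
    multiDeriv_congr hU (fun y hy => congrFun (h hy) l') hx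
  simp only [QuasilinearData.nonlin, this, h hx]

namespace IsDecayingSolution

variable {d m n : ℕ} {S : QuasilinearData d m n} {φ ρ ε T : ℝ} {f g : (Fin d → ℂ) → ℝ → (Fin m → ℂ)}

theorem hasDerivWithinAt (hf : IsDecayingSolution S φ ρ ε T f) {x : Fin d → ℂ} (hx : x ∈ polysector d φ ρ) {t : ℝ} (ht : t ∈ Icc 0 T) (l : Fin m) :
    HasDerivWithinAt (fun s => f x s l) (-polyDiffOp (S.P l) (fun y => f y t l) x + S.nonlin (fun y => f y t) t x l + S.r x t l) (Icc 0 T) t :=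
  hasDerivWithinAt_pi.1 (hf.equation x hx t ht) l

/-- For large `R` a decaying solution is the Laplace transform of small kernels. -/
theorem exists_kernel (hf : IsDecayingSolution S φ ρ ε T f) (hd : 1 ≤ d) (hφ0 : 0 < φ) (hφ : φ ≤ Real.pi / 4) (hρ : 0 < ρ) {κ : ℝ} (hκ : 0 < κ) :
    ∃ R₀, ∀ R ≥ R₀, ∃ F : Fin m → (Fin d → ℂ) → ℝ → ℂ, (∀ l, IsKernel 0 T 0 R 0 κ (F l)) ∧
      ∀ t ∈ Icc 0 T, ∀ x ∈ halfSpace d R, laplaceVec F x t = f x t := by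
  obtain ⟨A, hA⟩ := hf.bounded
  have h : ∀ l, IsSectorial φ ρ T (0 + 1) |A| fun x t => f x t l := isSectorial_of_analyticOnNhd (by linarith [Real.pi_pos]) hρ (by norm_num) hf.analytic
    (fun x hx => continuousOn_pi.2 fun l t ht => (hf.hasDerivWithinAt hx ht l).continuousWithinAt) fun x hx t ht => by
      simpa [absPow] using hA x hx t ht
  obtain ⟨R₀, hR₀⟩ := IsSectorial.exists_isKernel_borelTransform (fun l => h l) hd (abs_nonneg A) le_rfl le_rfl hφ0 hφ hρ hκ
  refine ⟨R₀, fun R hR => ⟨_, fun l => (hR₀ R hR l).1, fun t ht x hx => funext fun l => (hR₀ R hR l).2 t ht x hx⟩⟩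

/-- Both solutions are O(x^{-1}), hence Laplace transforms of small kernels on the positive orthant
for the same large R; here γ = 0 and σ = 0. The difference of the kernels satisfies a Duhamel
equation whose right-hand side is controlled by that difference itself, so any bound for it can be
halved. -/
theorem unique {ρ₀ αr : ℝ} {αq : (Fin m → multiIdx d n → ℕ) → ℝ} (hd : 1 ≤ d) (hn : 2 ≤ n) (hρ₀ : 0 < ρ₀) (hε : 0 < ε) (hT : 0 ≤ T)
    (hS : StandingAssumptions S φ ρ₀ ε T αr αq) (hρ : ρ₀ ≤ ρ) (hf : IsDecayingSolution S φ ρ ε T f) (hg : IsDecayingSolution S φ ρ ε T g)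
    {t : ℝ} (ht : t ∈ Icc 0 T) : EqOn (fun x => f x t) (fun x => g x t) (polysector d φ ρ) := by
  have hpi := Real.pi_pos
  have hπ := StandingAssumptions.half_pi_div_le hn
  have hφ0 := hS.phi_pos
  have hφ := hS.phi_lt
  have hρ0 : 0 < ρ := hρ₀.trans_le hρ
  obtain ⟨σ, hσ1, -, c, hc, C₀, hC₀, hcone⟩ := hS.exists_cone hn
  -- The Duhamel operator costs `duhamelConst`; this Lipschitz constant makes their product at most
  -- 1/2.
  set η : ℝ := 1 / (2 * (|duhamelConst n c C₀ T| + 1)) with hη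
  obtain ⟨R₀, hR₀, hlip⟩ := hS.exists_lipschitz hd hn hρ₀ hε le_rfl (hφ0.trans hφ) le_rfl (by positivity : 0 < η)
  obtain ⟨R₁, hR₁⟩ := hf.exists_kernel hd hφ0 (by linarith) hρ0 (by norm_num : (0 : ℝ) < 1 / 8)
  obtain ⟨R₂, hR₂⟩ := hg.exists_kernel hd hφ0 (by linarith) hρ0 (by norm_num : (0 : ℝ) < 1 / 8)
  set R : ℝ := max (max R₀ ρ) (max R₁ R₂) with hR
  have hRR : R₀ ≤ R := le_max_of_le_left (le_max_left _ _)
  have hR0 : 0 < R := one_pos.trans_le (hR₀.trans hRR)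
  have hsub : halfSpace d R ⊆ polysector d φ ρ := halfSpace_subset_polysector hφ0.le hρ0.le (le_max_of_le_left (le_max_right _ _))
  obtain ⟨F, hF, hLF⟩ := hR₁ R (le_max_of_le_right (le_max_left _ _))
  obtain ⟨G, hG, hLG⟩ := hR₂ R (le_max_of_le_right (le_max_right _ _))
  have hFG : ∀ l, IsKernel 0 T 0 R 0 (1 / 4) fun p t => F l p t - G l p t := fun l => by
    convert (hF l).sub (hG l) using 1; norm_num
  have hL : ∀ l, ∀ t ∈ Icc 0 T, ∀ x ∈ halfSpace d R, laplace 0 (fun p => F l p t - G l p t) x = f x t l - g x t l := fun l t ht x hx => by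
    rw [laplace_sub ((hF l).integrable le_rfl hpi le_rfl hR0 ht hx) ((hG l).integrable le_rfl hpi le_rfl hR0 ht hx), ← hLF t ht x hx, ← hLG t ht x hx]
    rfl
  have hstep : ∀ δ, 0 ≤ δ → (∀ l, IsKernel 0 T 0 R 0 δ fun p t => F l p t - G l p t) → ∀ l, IsKernel 0 T 0 R 0 (δ * (1 / 2)) fun p t => F l p t - G l p t := by
    intro δ hδ hδFG l
    obtain ⟨H, hH, hLH⟩ := hlip R hRR δ hδ F G (fun l => (hF l).mono hR0 (by norm_num)) (fun l => (hG l).mono hR0 (by norm_num)) hδFG l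
    have hcone0 : ∀ p ∈ csector d 0, c * ‖p‖ ^ n - C₀ ≤ (MvPolynomial.eval (-p) (S.P l)).re := fun p hp => hcone l p (csector_mono (by linarith) hp)
    have hdu := IsKernel.duhamel (T := T) (γ := 0) hpi.le le_rfl hR0 hc hC₀ hcone0 (IsKernel.zero le_rfl hR0) (by positivity) hH
    refine (hdu.mono hR0 ?_).congr fun p hp t ht => ?_
    · rw [mul_zero, zero_add]
      have h1 := le_abs_self (duhamelConst n c C₀ T)
      have h2 : duhamelConst n c C₀ T * η ≤ 1 / 2 := by
        rw [hη, mul_one_div, div_le_iff₀ (by positivity)]; linarith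
      rw [← mul_assoc, mul_comm δ]
      exact mul_le_mul_of_nonneg_right h2 hδ
    · refine IsKernel.eq_duhamelSol_of_hasDerivWithinAt (hS.order_le l) le_rfl hR0 (hFG l) hH (fun x hx => ?_) (fun x hx t ht => ?_) hp ht
      · rw [hL l 0 ⟨le_rfl, hT⟩ x hx, hf.initial x (hsub hx), hg.initial x (hsub hx), sub_self]
      · have e1 := (hf.hasDerivWithinAt (hsub hx) ht l).sub (hg.hasDerivWithinAt (hsub hx) ht l)
        have eN : laplace 0 (fun p => H p t) x = S.nonlin (fun y => f y t) t x l - S.nonlin (fun y => g y t) t x l := by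
          rw [hLH t ht x hx (by rw [hLF t ht x hx]; exact hf.mem_domain x (hsub hx) t ht) (by rw [hLG t ht x hx]; exact hg.mem_domain x (hsub hx) t ht),
            S.nonlin_congr (isOpen_halfSpace d R) (fun y hy => hLF t ht y hy) t hx, S.nonlin_congr (isOpen_halfSpace d R) (fun y hy => hLG t ht y hy) t hx]
        -- Additivity of P(∂ₓ) is read off on the Borel side: `IsKernel.laplace_evolution` with zero
        -- forcing is applied to both kernels and to their difference.
        have eP : polyDiffOp (S.P l) (laplace 0 fun p => F l p t - G l p t) x = polyDiffOp (S.P l) (fun y => f y t l) x - polyDiffOp (S.P l) (fun y => g y t l) x := by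
          have z : IsKernel (d := d) 0 T 0 R n 0 fun _ _ => 0 := IsKernel.zero le_rfl hR0
          have q1 := IsKernel.laplace_evolution (hS.order_le l) le_rfl hpi le_rfl hR0 (hF l) z hx ht
          have q2 := IsKernel.laplace_evolution (hS.order_le l) le_rfl hpi le_rfl hR0 (hG l) z hx ht
          have q3 := IsKernel.laplace_evolution (hS.order_le l) le_rfl hpi le_rfl hR0 (hFG l) z hx ht
          obtain ⟨M, -, hM⟩ := exists_norm_eval_neg_le (S.P l) (hS.order_le l)
          have q4 := laplace_sub ((IsKernel.evolution hR0 hM (hF l) z).integrable le_rfl hpi le_rfl hR0 ht hx)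
            ((IsKernel.evolution hR0 hM (hG l) z).integrable le_rfl hpi le_rfl hR0 ht hx)
          have q5 : (fun p : Fin d → ℂ => -MvPolynomial.eval (-p) (S.P l) * (F l p t - G l p t) + 0) =
              fun p => (-MvPolynomial.eval (-p) (S.P l) * F l p t + 0) - (-MvPolynomial.eval (-p) (S.P l) * G l p t + 0) := by funext p; ring
          have q6 : polyDiffOp (S.P l) (laplace 0 fun p => F l p t) x = polyDiffOp (S.P l) (fun y => f y t l) x :=
            polyDiffOp_congr (isOpen_halfSpace d R) (fun y hy => congrFun (hLF t ht y hy) l) hx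
          have q7 : polyDiffOp (S.P l) (laplace 0 fun p => G l p t) x = polyDiffOp (S.P l) (fun y => g y t l) x :=
            polyDiffOp_congr (isOpen_halfSpace d R) (fun y hy => congrFun (hLG t ht y hy) l) hx
          rw [q5, q4, q1, q2, q6, q7] at q3
          have q8 : laplace 0 (fun _ : Fin d → ℂ => (0 : ℂ)) x = 0 := by simp [laplace]
          linear_combination q3 + q8
        rw [eN, eP]
        refine (e1.congr (fun s hs => hL l s hs x hx) (hL l t ht x hx)).congr_deriv ?_
        ring
  -- Starting from 1/4, the bound becomes 2^{-k}/4 for every k.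
  have hzero : ∀ l, ∀ p ∈ csector d 0, ∀ t ∈ Icc 0 T, F l p t - G l p t = 0 := by
    have hk : ∀ k : ℕ, ∀ l, IsKernel 0 T 0 R 0 (1 / 4 * (1 / 2) ^ k) fun p t => F l p t - G l p t := fun k => by
      induction k with
      | zero => simpa using hFG
      | succ k ih => simpa only [pow_succ, mul_assoc] using hstep _ (by positivity) ih
    intro l p hp t ht
    have hlim : Tendsto (fun k : ℕ => 1 / 4 * (1 / 2 : ℝ) ^ k * (1 + ‖p‖) ^ 0 * borelWeight 0 R p) atTop (𝓝 (1 / 4 * 0 * (1 + ‖p‖) ^ 0 * borelWeight 0 R p)) :=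
      (((tendsto_pow_atTop_nhds_zero_of_lt_one (by norm_num) (by norm_num)).const_mul _).mul_const _).mul_const _
    have := ge_of_tendsto' hlim fun k => (hk k l).bound p hp t ht
    exact norm_le_zero_iff.1 (by simpa using this)
  refine eqOn_polysector_of_eqOn_halfSpace hφ0.le (by linarith) hρ0 (le_max_of_le_left (le_max_right _ _) : ρ ≤ R) (hf.analytic t ht) (hg.analytic t ht) fun x hx => funext fun l => ?_
  rw [← sub_eq_zero, ← hL l t ht x hx, laplace_congr le_rfl (G := fun _ => 0) fun p hp => hzero l p hp t ht]
  simp [laplace]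

end IsDecayingSolution

/-! ### Construction of the kernel by successive approximations -/

theorem duhamelSol_add {T : ℝ} (P y : ℂ) {g h : ℝ → ℂ} (hg : ContinuousOn g (Icc 0 T)) (hh : ContinuousOn h (Icc 0 T)) {t : ℝ} (ht : t ∈ Icc 0 T) :
    duhamelSol P y g t + duhamelSol P 0 h t = duhamelSol P y (fun τ => g τ + h τ) t := by
  have hE : ∀ {g : ℝ → ℂ}, ContinuousOn g (Icc 0 T) → IntervalIntegrable (fun τ : ℝ => Complex.exp (P * τ) * g τ) volume 0 t := fun hg =>
    (ContinuousOn.mono (ContinuousOn.mul (by fun_prop) hg) (uIcc_subset_Icc_zero ht)).intervalIntegrable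
  simp only [duhamelSol_eq, mul_add]
  rw [intervalIntegral.integral_add (hE hg) (hE hh)]
  ring

/-- Adding up the integral equations of the increments yields the one for the limit of the
iteration. -/
theorem hasSum_duhamelSol {T : ℝ} (P : ℂ) {ι : Type*} [Countable ι] {g : ι → ℝ → ℂ} {u : ι → ℝ} (hg : ∀ k, ContinuousOn (g k) (Icc 0 T)) (hu : Summable u)
    (hb : ∀ k, ∀ τ ∈ Icc 0 T, ‖g k τ‖ ≤ u k) {t : ℝ} (ht : t ∈ Icc 0 T) :
    HasSum (fun k => duhamelSol P 0 (g k) t) (duhamelSol P 0 (fun τ => ∑' k, g k τ) t) := by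
  have hsub : uIoc 0 t ⊆ Icc 0 T := uIoc_subset_uIcc.trans (uIcc_subset_Icc_zero ht)
  simp only [duhamelSol_eq, zero_add]
  refine HasSum.mul_left _ (intervalIntegral.hasSum_integral_of_dominated_convergence (fun k (τ : ℝ) => ‖Complex.exp (P * τ)‖ * u k) (fun k => ?_)
    (fun k => Eventually.of_forall fun τ hτ => ?_) (Eventually.of_forall fun τ _ => hu.mul_left _) ?_ (Eventually.of_forall fun τ hτ => ?_))
  · exact ContinuousOn.aestronglyMeasurable (ContinuousOn.mono (ContinuousOn.mul (by fun_prop) (hg k)) hsub) measurableSet_uIoc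
  · rw [norm_mul]; exact mul_le_mul_of_nonneg_left (hb k τ (hsub hτ)) (norm_nonneg _)
  · simp only [tsum_mul_left]
    exact Continuous.intervalIntegrable (by fun_prop) _ _
  · exact ((Summable.of_norm_bounded hu fun k => hb k τ (hsub hτ)).hasSum).mul_left _

theorem duhamelConst_nonneg {n : ℕ} {c C₀ T : ℝ} (hc : 0 < c) (hT : 0 ≤ T) : 0 ≤ duhamelConst n c C₀ T := by
  unfold duhamelConst; positivity

/-- The Laplace integral of s^γ e^{Rs} is Euler's Gamma integral. This is where the decay exponent γ
+ 1 = α_r comes from. -/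
theorem IsKernel.norm_laplace_le_prod {d : ℕ} {σ T γ R K : ℝ} {F : (Fin d → ℂ) → ℝ → ℂ} (hσ : σ < Real.pi) (hγ : 0 ≤ γ) (hR : 0 < R) (hK : 0 ≤ K)
    (h : IsKernel σ T γ R 0 K F) {t : ℝ} (ht : t ∈ Icc 0 T) {θ : Fin d → ℝ} (hθ : ∀ i, |θ i| ≤ σ) {x : Fin d → ℂ}
    (hx : ∀ i, R < (Complex.exp (θ i * Complex.I) * x i).re) :
    ‖laplace θ (fun p => F p t) x‖ ≤ K * (R / 2 ^ (γ + 3)) ^ d *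
      ∏ i, (1 / ((Complex.exp (θ i * Complex.I) * x i).re - R)) ^ (γ + 1) * Real.Gamma (γ + 1) := by
  have h1 := (h.growth hγ hR ht).norm_laplace_le (by linarith) hσ hθ hx
  rw [abs_of_nonneg hK] at h1
  refine h1.trans_eq ?_
  congr 1
  refine Finset.prod_congr rfl fun i _ => ?_
  rw [← Real.integral_rpow_mul_exp_neg_mul_Ioi (by linarith : 0 < γ + 1) (sub_pos.2 (hx i))]
  refine setIntegral_congr_fun measurableSet_Ioi fun s _ => ?_
  simp only [expWeight, pow_zero, one_mul, add_sub_cancel_right]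
  rw [mul_assoc, ← Real.exp_add]
  congr 2; ring

/-- Far enough to the right, the Laplace transforms take values in the ball where the Taylor series
of b_q converge. R' is uniform over kernels of size 1/4, so it serves all iterates and the limit at
once. -/
theorem exists_l1norm_laplaceVec_lt {d : ℕ} (m : ℕ) {σ T γ R ε : ℝ} (hd : 1 ≤ d) (hσ0 : 0 ≤ σ) (hσ : σ < Real.pi) (hγ : 0 ≤ γ) (hR : 0 < R) (hε : 0 < ε) :
    ∃ R' ≥ R, ∀ F : Fin m → (Fin d → ℂ) → ℝ → ℂ, (∀ l, IsKernel σ T γ R 0 (1 / 4) (F l)) → ∀ t ∈ Icc 0 T, ∀ x ∈ halfSpace d R', l1norm (laplaceVec F x t) < ε := by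
  have hΓ := Real.Gamma_pos_of_pos (by linarith : 0 < γ + 1)
  have hlim : Tendsto (fun Y : ℝ => m * (1 / 4 * (R / 2 ^ (γ + 3)) ^ d * ((1 / Y) ^ (γ + 1) * Real.Gamma (γ + 1)) ^ d)) atTop (𝓝 0) := by
    have h2 : Tendsto (fun Y : ℝ => 1 / Y) atTop (𝓝 0) := tendsto_const_nhds.div_atTop tendsto_id
    have h3 := (Real.continuousAt_rpow_const 0 (γ + 1) (Or.inr (by linarith))).tendsto.comp h2
    rw [Real.zero_rpow (by linarith)] at h3
    have h4 := ((((h3.mul_const (Real.Gamma (γ + 1))).pow d).const_mul (1 / 4 * (R / 2 ^ (γ + 3)) ^ d)).const_mul (m : ℝ))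
    simpa [zero_pow (by omega : d ≠ 0)] using h4
  obtain ⟨Y, hY0, hY⟩ := ((eventually_gt_atTop 0).and (hlim.eventually (gt_mem_nhds hε))).exists
  refine ⟨R + Y, by linarith, fun F hF t ht x hx => lt_of_le_of_lt ?_ hY⟩
  have hx' : ∀ i, R + Y < (Complex.exp (((0 : Fin d → ℝ) i : ℂ) * Complex.I) * x i).re := fun i => by simpa using hx i
  calc l1norm (laplaceVec F x t) ≤ ∑ _l : Fin m, (1 / 4 * (R / 2 ^ (γ + 3)) ^ d * ((1 / Y) ^ (γ + 1) * Real.Gamma (γ + 1)) ^ d) := by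
        refine Finset.sum_le_sum fun l _ => ?_
        refine ((hF l).norm_laplace_le_prod hσ hγ hR (by norm_num) ht (fun _ => by simpa using hσ0) fun i => by linarith [hx' i]).trans ?_
        refine mul_le_mul_of_nonneg_left ?_ (by positivity)
        have hle : ∀ i ∈ Finset.univ, (1 / ((Complex.exp (((0 : Fin d → ℝ) i : ℂ) * Complex.I) * x i).re - R)) ^ (γ + 1) * Real.Gamma (γ + 1) ≤
            (1 / Y) ^ (γ + 1) * Real.Gamma (γ + 1) := fun i _ => by
          have := hx' i
          have h5 : 0 ≤ 1 / ((Complex.exp (((0 : Fin d → ℝ) i : ℂ) * Complex.I) * x i).re - R) := by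
            apply div_nonneg zero_le_one; linarith
          gcongr; linarith
        refine (Finset.prod_le_prod (fun i _ => ?_) hle).trans_eq (by simp)
        have := hx' i
        have h5 : 0 ≤ 1 / ((Complex.exp (((0 : Fin d → ℝ) i : ℂ) * Complex.I) * x i).re - R) := by
          apply div_nonneg zero_le_one; linarith
        positivity
    _ = _ := by simp

theorem multiDeriv_zero_fun {d : ℕ} (j : Fin d → ℕ) : multiDeriv j (fun _ => (0 : ℂ)) = fun _ => 0 := by
  have h : ∀ i, partialDeriv (d := d) i (fun _ => (0 : ℂ)) = fun _ => 0 := fun i => by funext x; simp [partialDeriv]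
  unfold multiDeriv
  induction List.finRange d with
  | nil => rfl
  | cons i l ih => rw [List.foldr_cons, ih]; exact Function.iterate_fixed (h i) (j i)

namespace StandingAssumptions

variable {d m n : ℕ} {S : QuasilinearData d m n} {φ ρ₀ ε T αr : ℝ} {αq : (Fin m → multiIdx d n → ℕ) → ℝ}

/-- The nonlinearity is controlled only through differences; starting the iteration at 0, this is
the base of the telescoping sum. -/
theorem nonlin_zero (hS : StandingAssumptions S φ ρ₀ ε T αr αq) {x : Fin d → ℂ} (hx : x ∈ polysector d (Real.pi / (2 * n)) ρ₀) {t : ℝ} (ht : t ∈ Icc 0 T) (l : Fin m) :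
    S.nonlin (fun _ => 0) t x l = 0 := by
  refine Finset.sum_eq_zero fun q _ => ?_
  by_cases hq : q = 0
  · rw [hq, hS.b_zero x hx t ht]; simp
  · obtain ⟨l', hl'⟩ := Function.ne_iff.1 hq
    obtain ⟨j, hj⟩ := Function.ne_iff.1 hl'
    have h : multiDeriv j.1 (fun _ : Fin d → ℂ => (0 : ℂ)) x ^ q l' j = 0 := by rw [multiDeriv_zero_fun]; exact zero_pow hj
    exact mul_eq_zero_of_right _ (Finset.prod_eq_zero (Finset.mem_univ l') (Finset.prod_eq_zero (Finset.mem_univ j) h))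

/-- Solution of the integral equation on the Borel plane by successive approximations. -/
theorem exists_kernel_solution (hS : StandingAssumptions S φ ρ₀ ε T αr αq) (hd : 1 ≤ d) (hn : 2 ≤ n) (hρ₀ : 0 < ρ₀) (hε : 0 < ε) (hT : 0 ≤ T)
    {σ c C₀ : ℝ} (hσ0 : 0 ≤ σ) (hσ : σ < Real.pi / (2 * n)) (hc : 0 < c) (hC₀ : 0 ≤ C₀)
    (hcone : ∀ l, ∀ p ∈ csector d σ, c * ‖p‖ ^ n - C₀ ≤ (MvPolynomial.eval (-p) (S.P l)).re) :
    ∃ R ≥ 1, ∃ R' ≥ R, ∃ K, ∃ (F G : Fin m → (Fin d → ℂ) → ℝ → ℂ) (F₀ : Fin m → (Fin d → ℂ) → ℂ),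
      (∀ l, IsKernel σ T (αr - 1) R 0 (1 / 4) (F l)) ∧ (∀ l, IsKernel σ T (αr - 1) R n K (G l)) ∧
      (∀ l, ∀ p ∈ csector d σ, ∀ t ∈ Icc 0 T, F l p t = duhamelSol (MvPolynomial.eval (-p) (S.P l)) (F₀ l p) (G l p) t) ∧
      (∀ l, ∀ x ∈ halfSpace d R', laplace 0 (F₀ l) x = S.fI x l) ∧
      ∀ t ∈ Icc 0 T, ∀ x ∈ halfSpace d R', ∀ l, laplace 0 (fun p => G l p t) x = S.nonlin (fun y => laplaceVec F y t) t x l + S.r x t l := by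
  have hpi := Real.pi_pos
  have hπ := half_pi_div_le hn
  have hγ : 0 ≤ αr - 1 := by linarith [hS.one_le_αr]
  set γ := αr - 1 with hγd
  have hσπ : σ < Real.pi := by linarith
  obtain ⟨Ar, hAr⟩ := hS.r_bound
  obtain ⟨Af, hAf⟩ := hS.fI_bound
  have hr : ∀ l, IsSectorial (Real.pi / (2 * n)) ρ₀ T (γ + 1) |Ar| fun x t => S.r x t l :=
    isSectorial_of_analyticOnNhd (by linarith) hρ₀ (by linarith) hS.r_analytic hS.r_continuous (by simpa [hγd] using hAr)
  have hf : ∀ l, IsSectorial (Real.pi / (2 * n)) ρ₀ T (γ + 1) |Af| fun x _ => S.fI x l :=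
    isSectorial_of_analyticOnNhd (g := fun x _ => S.fI x) (by linarith) hρ₀ (by linarith) (fun _ _ => hS.fI_analytic) (fun _ _ => continuousOn_const)
      (fun x hx _ _ => by simpa [hγd] using hAf x hx)
  set D := duhamelConst n c C₀ T with hD
  have hD0 : 0 ≤ D := duhamelConst_nonneg hc hT
  -- Chosen so that the first increment, of size at most (e^{C₀T} + D) κ, is at most 1/8. Below, η
  -- makes Dη ≤ 1/2.
  set κ : ℝ := 1 / (8 * (Real.exp (C₀ * T) + D + 1)) with hκ
  have hκ0 : 0 < κ := by positivity
  set η : ℝ := 1 / (2 * (D + 1)) with hη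
  have hη0 : 0 < η := by positivity
  obtain ⟨R₁, hR₁⟩ := IsSectorial.exists_isKernel_borelTransform (fun l => hr l) hd (abs_nonneg Ar) hγ hσ0 hσ hπ hρ₀ hκ0
  obtain ⟨R₂, hR₂⟩ := IsSectorial.exists_isKernel_borelTransform (fun l => hf l) hd (abs_nonneg Af) hγ hσ0 hσ hπ hρ₀ hκ0
  obtain ⟨R₃, hR₃, hlip⟩ := hS.exists_lipschitz hd hn hρ₀ hε hσ0 hσ hγ hη0
  set R : ℝ := max (max R₁ R₂) (max R₃ ρ₀) with hRd
  have hRR₃ : R₃ ≤ R := le_max_of_le_right (le_max_left _ _)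
  have hR1 : 1 ≤ R := hR₃.trans hRR₃
  have hR : 0 < R := one_pos.trans_le hR1
  have hr' := hR₁ R (le_max_of_le_left (le_max_left _ _))
  have hf' := hR₂ R (le_max_of_le_left (le_max_right _ _))
  obtain ⟨R', hRR', hsmall⟩ := exists_l1norm_laplaceVec_lt (d := d) (T := T) m hd hσ0 hσπ hγ hR hε
  have hhalf : halfSpace d R' ⊆ halfSpace d R := halfSpace_mono hRR'
  set rB : Fin m → (Fin d → ℂ) → ℝ → ℂ := fun l p t => borelTransform ((σ + Real.pi / (2 * n)) / 2) (fun _ => ρ₀ + 1) (fun x => S.r x t l) p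
  set F₀ : Fin m → (Fin d → ℂ) → ℂ := fun l p => borelTransform ((σ + Real.pi / (2 * n)) / 2) (fun _ => ρ₀ + 1) (fun x => S.fI x l) p
  have hrBn : ∀ l, IsKernel σ T γ R n κ (rB l) := fun l => (hr' l).1.mono_exp hR hκ0.le (Nat.zero_le _)
  let X := Fin m → (Fin d → ℂ) → ℝ → ℂ
  -- A state is a pair (current approximation, next increment). Increments of size 2^{-k}/8 add up
  -- to 1/4, so every partial sum stays where the Lipschitz estimate applies.
  let Inv : ℕ → X × X → Prop := fun k s => (∀ l, IsKernel σ T γ R 0 (1 / 4 * (1 - (1 / 2) ^ k)) (s.1 l)) ∧ ∀ l, IsKernel σ T γ R 0 (1 / 8 * (1 / 2) ^ k) (s.2 l)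
  have hquarter : ∀ k s, Inv k s → ∀ l, IsKernel σ T γ R 0 (1 / 4) (s.1 l) := fun k s hs l => (hs.1 l).mono hR (by
    have : (0 : ℝ) ≤ (1 / 2) ^ k := by positivity
    linarith)
  -- The forcing H is known only by existence, so one step is an existence statement. It is
  -- formulated for all states, vacuously where the invariant fails, so that `choose` gives total
  -- functions to iterate.
  have hstep : ∀ (k : ℕ) (s : X × X), ∃ (s' : X × X) (H : X), Inv k s → Inv (k + 1) s' ∧ (s'.1 = fun l p t => s.1 l p t + s.2 l p t) ∧
      (s'.2 = fun l p t => duhamelSol (MvPolynomial.eval (-p) (S.P l)) 0 (H l p) t) ∧ (∀ l, IsKernel σ T γ R n (η * (1 / 8 * (1 / 2) ^ k)) (H l)) ∧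
      ∀ l, ∀ t ∈ Icc 0 T, ∀ x ∈ halfSpace d R', laplace 0 (fun p => H l p t) x =
        S.nonlin (fun y => laplaceVec s'.1 y t) t x l - S.nonlin (fun y => laplaceVec s.1 y t) t x l := by
    intro k s
    by_cases hs : Inv k s
    swap
    · exact ⟨s, s.1, fun h => absurd h hs⟩
    have hk : (0 : ℝ) ≤ (1 / 2) ^ k := by positivity
    have h1 : ∀ l, IsKernel σ T γ R 0 (1 / 4 * (1 - (1 / 2) ^ (k + 1))) fun p t => s.1 l p t + s.2 l p t := fun l => by
      convert (hs.1 l).add (hs.2 l) using 1; rw [pow_succ]; ring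
    have h1' : ∀ l, IsKernel σ T γ R 0 (1 / 4) fun p t => s.1 l p t + s.2 l p t := fun l => (h1 l).mono hR (by
      rw [pow_succ]; linarith)
    choose H hH hLH using hlip R hRR₃ (1 / 8 * (1 / 2) ^ k) (by positivity) (fun l p t => s.1 l p t + s.2 l p t) s.1 h1' (hquarter k s hs)
      fun l => (hs.2 l).congr fun p _ t _ => by ring
    refine ⟨(fun l p t => s.1 l p t + s.2 l p t, fun l p t => duhamelSol (MvPolynomial.eval (-p) (S.P l)) 0 (H l p) t), H, fun _ => ⟨⟨h1, fun l => ?_⟩, rfl, rfl, hH, fun l t ht x hx => ?_⟩⟩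
    · refine (IsKernel.duhamel hσπ.le hγ hR hc hC₀ (hcone l) (IsKernel.zero le_rfl hR) (by positivity) (hH l)).mono hR ?_
      have h2 : D * η ≤ 1 / 2 := by
        rw [hη, mul_one_div, div_le_iff₀ (by positivity)]; linarith
      rw [mul_zero, zero_add, ← mul_assoc, pow_succ]
      nlinarith
    · exact hLH l t ht x (hhalf hx) (hsmall _ h1' t ht x hx) (hsmall _ (hquarter k s hs) t ht x hx)
  choose next H hnext using hstep
  let s₀ : X × X := (fun _ _ _ => 0, fun l p t => duhamelSol (MvPolynomial.eval (-p) (S.P l)) (F₀ l p) (rB l p) t)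
  let seq : ℕ → X × X := fun k => Nat.rec s₀ next k
  have hseq : ∀ k, seq (k + 1) = next k (seq k) := fun _ => rfl
  have hinv : ∀ k, Inv k (seq k) := by
    intro k
    induction k with
    | zero =>
      refine ⟨fun l => IsKernel.zero (by simp) hR, fun l => ?_⟩
      refine (IsKernel.duhamel hσπ.le hγ hR hc hC₀ (hcone l) (hf' l).1 hκ0.le (hrBn l)).mono hR ?_
      rw [← add_mul, ← hD, hκ, mul_one_div, div_le_iff₀ (by positivity)]
      linarith
    | succ k ih => exact (hnext k (seq k) ih).1
  have hrel := fun k => (hnext k (seq k) (hinv k)).2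
  set Δ : ℕ → X := fun k => (seq k).2 with hΔ
  set Hs : ℕ → X := fun k => H k (seq k) with hHs
  have hΔk : ∀ k l, IsKernel σ T γ R 0 (1 / 8 * (1 / 2) ^ k) (Δ k l) := fun k => (hinv k).2
  have hHk : ∀ k l, IsKernel σ T γ R n (η * (1 / 8 * (1 / 2) ^ k)) (Hs k l) := fun k => (hrel k).2.2.1
  have hgeo : ∀ a : ℝ, HasSum (fun k : ℕ => a * (1 / 2) ^ k) (a * 2) := fun a => hasSum_geometric_two.mul_left a
  have hHsum : Summable fun k : ℕ => η * (1 / 8 * (1 / 2 : ℝ) ^ k) := (hgeo _).summable.mul_left _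
  set F : X := fun l p t => ∑' k, Δ k l p t with hF
  have hFk : ∀ l, IsKernel σ T γ R 0 (1 / 4) (F l) := fun l => by
    have := IsKernel.tsum hσπ.le hγ hR (fun k => hΔk k l) (hgeo _).summable
    rwa [(hgeo _).tsum_eq, show (1 / 8 * 2 : ℝ) = 1 / 4 by norm_num] at this
  have hΔsum : ∀ l, ∀ p ∈ csector d σ, ∀ t ∈ Icc 0 T, Summable fun k => Δ k l p t := fun l p hp t ht =>
    Summable.of_norm_bounded (((hgeo (1 / 8)).summable.mul_right ((1 + ‖p‖) ^ 0)).mul_right _) fun k => (hΔk k l).bound p hp t ht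
  have hpart : ∀ k l p t, (seq k).1 l p t = ∑ i ∈ Finset.range k, Δ i l p t := by
    intro k l p t
    induction k with
    | zero => simp [seq, s₀]
    | succ k ih => rw [Finset.sum_range_succ, ← ih, hseq, (hrel k).1]
  have hdiff : ∀ k l, IsKernel σ T γ R 0 (1 / 4 * (1 / 2) ^ k) fun p t => F l p t - (seq k).1 l p t := fun k l => by
    have hs : HasSum (fun i : ℕ => 1 / 8 * (1 / 2 : ℝ) ^ (i + k)) (1 / 4 * (1 / 2) ^ k) := by
      have h := hgeo (1 / 8 * (1 / 2 : ℝ) ^ k)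
      rw [show 1 / 8 * (1 / 2 : ℝ) ^ k * 2 = 1 / 4 * (1 / 2) ^ k by ring] at h
      exact h.congr_fun fun i => by rw [pow_add]; ring
    have h1 := IsKernel.tsum hσπ.le hγ hR (fun i => hΔk (i + k) l) hs.summable
    rw [hs.tsum_eq] at h1
    refine h1.congr fun p hp t ht => ?_
    rw [hpart, sub_eq_iff_eq_add', (hΔsum l p hp t ht).sum_add_tsum_nat_add k]
  -- The transforms of the forcing increments telescope to the nonlinearity at the k-th
  -- approximation. The Lipschitz estimate between F and that approximation, with
  -- `norm_laplace_zero_le`, identifies the limit.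
  have hlap : ∀ l, ∀ t ∈ Icc 0 T, ∀ x ∈ halfSpace d R', laplace 0 (fun p => ∑' k, Hs k l p t) x = S.nonlin (fun y => laplaceVec F y t) t x l := by
    intro l t ht x hx
    have h1 := (IsKernel.hasSum_laplace hσ0 hσπ hγ hR (fun k => hHk k l) (fun k => by positivity) hHsum ht (hhalf hx)).tendsto_sum_nat
    have hx' : x ∈ polysector d (Real.pi / (2 * n)) ρ₀ :=
      halfSpace_subset_polysector (by positivity) hρ₀.le ((le_max_of_le_right (le_max_right _ _) : ρ₀ ≤ R).trans hRR') hx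
    have h2 : ∀ k, ∑ i ∈ Finset.range k, laplace 0 (fun p => Hs i l p t) x = S.nonlin (fun y => laplaceVec (seq k).1 y t) t x l := fun k => by
      induction k with
      | zero =>
        have : (fun y => laplaceVec (seq 0).1 y t) = fun _ => 0 := by funext y l; simp [seq, s₀, laplaceVec, laplace]
        rw [this, hS.nonlin_zero hx' ht l]; rfl
      | succ k ih => rw [Finset.sum_range_succ, ih, (hrel k).2.2.2 l t ht x hx, hseq]; ring
    simp_rw [h2] at h1
    refine tendsto_nhds_unique h1 ?_
    obtain ⟨B, hB0, hB⟩ := IsKernel.norm_laplace_zero_le (T := T) (a := n) hσ0 hσπ hγ hR (hhalf hx)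
    rw [← tendsto_sub_nhds_zero_iff]
    have hlim : Tendsto (fun k : ℕ => η * (1 / 4 * (1 / 2 : ℝ) ^ k) * B) atTop (𝓝 (η * (1 / 4 * 0) * B)) :=
      (((tendsto_pow_atTop_nhds_zero_of_lt_one (by norm_num) (by norm_num)).const_mul _).const_mul _).mul_const _
    rw [mul_zero, mul_zero, zero_mul] at hlim
    refine squeeze_zero_norm (fun k => ?_) hlim
    obtain ⟨H', hH', hL'⟩ := hlip R hRR₃ (1 / 4 * (1 / 2) ^ k) (by positivity) F (seq k).1 hFk (hquarter k _ (hinv k)) (hdiff k) l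
    rw [norm_sub_rev, ← hL' t ht x (hhalf hx) (hsmall _ hFk t ht x hx) (hsmall _ (hquarter k _ (hinv k)) t ht x hx)]
    exact (hB _ H' (by positivity) hH' t ht).2
  have hHsk : ∀ l, IsKernel σ T γ R n (∑' k : ℕ, η * (1 / 8 * (1 / 2 : ℝ) ^ k)) fun p t => ∑' k, Hs k l p t := fun l => IsKernel.tsum hσπ.le hγ hR (fun k => hHk k l) hHsum
  refine ⟨R, hR1, R', hRR', κ + ∑' k : ℕ, η * (1 / 8 * (1 / 2 : ℝ) ^ k), F, fun l p t => rB l p t + ∑' k, Hs k l p t, F₀, hFk, fun l => (hrBn l).add (hHsk l), ?_, ?_, ?_⟩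
  · intro l p hp t ht
    rw [← duhamelSol_add _ _ ((hrBn l).borel.continuousOn_time hp) ((hHsk l).borel.continuousOn_time hp) ht]
    rw [hF]
    simp only
    rw [(hΔsum l p hp t ht).tsum_eq_zero_add]
    congr 1
    rw [← (hasSum_duhamelSol _ (fun k => (hHk k l).borel.continuousOn_time hp) ((hHsum.mul_right ((1 + ‖p‖) ^ n)).mul_right _)
      (fun k τ hτ => (hHk k l).bound p hp τ hτ) ht).tsum_eq]
    exact tsum_congr fun k => by simp only [hΔ, hseq, (hrel k).2.1, hHs]
  · intro l x hx
    exact (hf' l).2 0 ⟨le_rfl, hT⟩ x (hhalf hx)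
  · intro t ht x hx l
    rw [laplace_add ((hrBn l).integrable hσ0 hσπ hγ hR ht (hhalf hx)) ((hHsk l).integrable hσ0 hσπ hγ hR ht (hhalf hx)), hlap l t ht x hx, add_comm]
    congr 1
    exact (hr' l).2 t ht x (hhalf hx)

end StandingAssumptions

/-! ### From the kernel to a solution on the polysector -/

/-- The restriction of a kernel to the rays `arg pᵢ = θᵢ`. -/
theorem IsKernel.rotate {d : ℕ} {σ T γ R K : ℝ} {a : ℕ} {F : (Fin d → ℂ) → ℝ → ℂ} (hσ : σ < Real.pi) (h : IsKernel σ T γ R a K F) {θ : Fin d → ℝ} (hθ : ∀ i, |θ i| ≤ σ) :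
    IsKernel 0 T γ R a K fun p t => F (fun i => p i * Complex.exp (θ i * Complex.I)) t := by
  have hmem : ∀ p ∈ csector d 0, (fun i => p i * Complex.exp (θ i * Complex.I)) ∈ csector d σ := fun p hp => by
    have e : ∀ i, p i = (‖p i‖ : ℂ) := fun i => by
      have := Complex.norm_mul_exp_arg_mul_I (p i)
      rw [abs_nonpos_iff.1 (hp i).2] at this
      simpa using this.symm
    have := ray_mem_csector hσ hθ (s := fun i => ‖p i‖) fun i => norm_pos_iff.2 (hp i).1
    simpa only [← e] using this
  refine ⟨⟨?_, fun t _ p _ i z hz => absurd hz.2 (not_lt.2 (abs_nonneg _))⟩, fun p hp t ht => ?_⟩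
  · exact h.borel.cont.comp (f := fun z : (Fin d → ℂ) × ℝ => ((fun i => z.1 i * Complex.exp (θ i * Complex.I)), z.2)) (by fun_prop) fun z hz => ⟨hmem z.1 hz.1, hz.2⟩
  · have hn : ∀ i, ‖p i * Complex.exp (θ i * Complex.I)‖ = ‖p i‖ := fun i => by rw [norm_mul, Complex.norm_exp_ofReal_mul_I, mul_one]
    have hn' : ‖fun i => p i * Complex.exp (θ i * Complex.I)‖ = ‖p‖ := by
      simp only [Pi.norm_def, nnnorm_mul, show ∀ i, ‖Complex.exp (θ i * Complex.I)‖₊ = 1 from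
        fun i => NNReal.eq (Complex.norm_exp_ofReal_mul_I _), mul_one]
    have := h.bound _ (hmem p hp) t ht
    simpa only [borelWeight, hn, hn'] using this

/-- Rotating the rays amounts to rotating x and the kernel, so statements for angle 0 transfer to
all admissible angles through `IsKernel.rotate`. -/
theorem laplace_eq_rotate {d : ℕ} (θ : Fin d → ℝ) (F : (Fin d → ℂ) → ℂ) (x : Fin d → ℂ) :
    laplace θ F x = (∏ i, Complex.exp (θ i * Complex.I)) *
      laplace 0 (fun p => F fun i => p i * Complex.exp (θ i * Complex.I)) fun i => Complex.exp (θ i * Complex.I) * x i := by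
  rw [laplace_zero, laplace, ← integral_const_mul]
  refine integral_congr_ae (Eventually.of_forall fun s => ?_)
  simp only [Finset.prod_mul_distrib, mul_assoc]
  ring

theorem IsKernel.hasDerivWithinAt_laplace {d n : ℕ} {σ T γ R K K' : ℝ} {F E : (Fin d → ℂ) → ℝ → ℂ} (hσ : σ < Real.pi) (hγ : 0 ≤ γ) (hR : 0 < R)
    (hF : IsKernel σ T γ R 0 K F) (hE : IsKernel σ T γ R n K' E) (h : ∀ p ∈ csector d σ, ∀ t ∈ Icc 0 T, F p t = F p 0 + ∫ τ in (0 : ℝ)..t, E p τ)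
    {θ : Fin d → ℝ} (hθ : ∀ i, |θ i| ≤ σ) {x : Fin d → ℂ} (hx : ∀ i, R < (Complex.exp (θ i * Complex.I) * x i).re) {t : ℝ} (ht : t ∈ Icc 0 T) :
    HasDerivWithinAt (fun t => laplace θ (fun p => F p t) x) (laplace θ (fun p => E p t) x) (Icc 0 T) t := by
  have hpi := Real.pi_pos
  have hF' := hF.rotate hσ hθ
  have hE' := hE.rotate hσ hθ
  simp only [laplace_eq_rotate θ]
  refine HasDerivWithinAt.const_mul _ ?_
  refine hasDerivWithinAt_of_integral_eq
    (y₀ := laplace 0 (fun p => F (fun i => p i * Complex.exp (θ i * Complex.I)) 0) fun i => Complex.exp (θ i * Complex.I) * x i) (hE'.continuousOn_laplace le_rfl hpi hγ hR hx) (fun t ht => ?_) ht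
  obtain ⟨h1, h2⟩ := hE'.integral_laplace le_rfl hpi hγ hR hx ht
  rw [h2, ← laplace_add (hF'.integrable le_rfl hpi hγ hR ⟨le_rfl, ht.1.trans ht.2⟩ hx) h1, laplace_zero, laplace_zero]
  refine integral_congr_ae ?_
  filter_upwards [ae_orthant_pos d] with s hs
  rw [h _ (ray_mem_csector hσ hθ hs) t ht]

/-- The angles of the rays of integration for the Laplace transform at `x`. -/
noncomputable def sectorAngle {d : ℕ} (σ : ℝ) (x : Fin d → ℂ) : Fin d → ℝ := fun i => if 0 ≤ (x i).im then -σ else σ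

/-- The Laplace transform on a polysector. -/
noncomputable def sectorLaplace {d : ℕ} (σ : ℝ) (F : (Fin d → ℂ) → ℂ) (x : Fin d → ℂ) : ℂ := laplace (sectorAngle σ x) F x

theorem abs_sectorAngle {d : ℕ} {σ : ℝ} (hσ : 0 ≤ σ) (x : Fin d → ℂ) (i : Fin d) : |sectorAngle σ x i| ≤ σ := by
  unfold sectorAngle; split_ifs <;> simp [abs_of_nonneg hσ]

/-- Rotating against the sign of arg x makes the real part |x| cos(|arg x| - σ). For |arg x| ≤ 2σ
the cosine is at least cos σ. Beyond that, |arg x| - σ < π/2 - (σ - φ) gives sin(σ - φ), which is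
positive because σ > φ. -/
theorem le_re_sectorAngle {d : ℕ} {σ φ ρ : ℝ} (hφ : 0 ≤ φ) (hφσ : φ < σ) (hσ : σ < Real.pi / 2) {x : Fin d → ℂ} (hx : x ∈ polysector d φ ρ) (i : Fin d) :
    min (Real.cos σ) (Real.sin (σ - φ)) * ‖x i‖ ≤ (Complex.exp (sectorAngle σ x i * Complex.I) * x i).re := by
  have key : (Complex.exp (sectorAngle σ x i * Complex.I) * x i).re = ‖x i‖ * Real.cos (|Complex.arg (x i)| - σ) := by
    rw [re_exp_mul_I_mul, Real.cos_sub]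
    have h1 := Complex.norm_mul_cos_arg (x i)
    have h2 := Complex.norm_mul_sin_arg (x i)
    unfold sectorAngle
    split_ifs with h
    · rw [abs_of_nonneg (Complex.arg_nonneg_iff.2 h), Real.cos_neg, Real.sin_neg, ← h1, ← h2]; ring
    · rw [abs_of_neg (Complex.arg_neg_iff.2 (not_le.1 h)), Real.cos_neg, Real.sin_neg, ← h1, ← h2]; ring
  rw [key, mul_comm]
  refine mul_le_mul_of_nonneg_left ?_ (norm_nonneg _)
  have ha := (hx i).1
  have ha0 := abs_nonneg (Complex.arg (x i))
  rcases le_total (|Complex.arg (x i)|) (2 * σ) with h | h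
  · refine (min_le_left _ _).trans ?_
    rw [← Real.cos_abs (|Complex.arg (x i)| - σ)]
    exact Real.cos_le_cos_of_nonneg_of_le_pi (abs_nonneg _) (by linarith) (abs_le.2 ⟨by linarith, by linarith⟩)
  · refine (min_le_right _ _).trans ?_
    rw [← Real.cos_pi_div_two_sub]
    exact Real.cos_le_cos_of_nonneg_of_le_pi (by linarith) (by linarith) (by linarith)

/-- The angle jumps where an imaginary part changes sign. Near a given point, however, the angles of
that point remain admissible, and by rotation invariance they give the same value. -/
theorem HasExpGrowth.analyticOnNhd_sectorLaplace {d : ℕ} {σ γ R C : ℝ} {a : ℕ} {F : (Fin d → ℂ) → ℂ} (h : HasExpGrowth σ a γ R C F)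
    (hd : ∀ p ∈ csector d σ, ∀ i, DifferentiableOn ℂ (fun z => F (Function.update p i z)) (osector σ)) (hσ0 : 0 ≤ σ) (hσ : σ < Real.pi / 2) (hγ : 0 ≤ γ) (hR : 0 ≤ R)
    {U : Set (Fin d → ℂ)} (hU : IsOpen U) (hx : ∀ x ∈ U, ∀ i, R < (Complex.exp (sectorAngle σ x i * Complex.I) * x i).re) :
    AnalyticOnNhd ℂ (sectorLaplace σ F) U := by
  intro x₀ hx₀
  refine (h.analyticAt_laplace (by linarith) (by linarith) (abs_sectorAngle hσ0 x₀) (hx x₀ hx₀)).congr ?_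
  have hev : ∀ᶠ x in 𝓝 x₀, ∀ i, R < (Complex.exp (sectorAngle σ x₀ i * Complex.I) * x i).re := eventually_all.2 fun i =>
    (Continuous.continuousAt (by fun_prop : Continuous fun x : Fin d → ℂ => (Complex.exp (sectorAngle σ x₀ i * Complex.I) * x i).re)).eventually (lt_mem_nhds (hx x₀ hx₀ i))
  filter_upwards [hev, hU.mem_nhds hx₀] with x h1 h2
  exact h.laplace_rotate hd hσ0 hσ (by linarith) hR (abs_sectorAngle hσ0 x₀) (abs_sectorAngle hσ0 x) h1 (hx x h2)

theorem HasExpGrowth.sectorLaplace_eq {d : ℕ} {σ γ R C : ℝ} {a : ℕ} {F : (Fin d → ℂ) → ℂ} (h : HasExpGrowth σ a γ R C F)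
    (hd : ∀ p ∈ csector d σ, ∀ i, DifferentiableOn ℂ (fun z => F (Function.update p i z)) (osector σ)) (hσ0 : 0 ≤ σ) (hσ : σ < Real.pi / 2) (hγ : 0 ≤ γ) (hR : 0 ≤ R)
    {x : Fin d → ℂ} (hx : ∀ i, R < (Complex.exp (sectorAngle σ x i * Complex.I) * x i).re) (hx' : x ∈ halfSpace d R) :
    sectorLaplace σ F x = laplace 0 F x :=
  h.laplace_rotate hd hσ0 hσ (by linarith) hR (abs_sectorAngle hσ0 x) (fun _ => by simpa using hσ0) hx fun i => by simpa using hx' i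

theorem analyticOnNhd_multiDeriv {d : ℕ} {U : Set (Fin d → ℂ)} {g : (Fin d → ℂ) → ℂ} (hg : AnalyticOnNhd ℂ g U) (j : Fin d → ℕ) : AnalyticOnNhd ℂ (multiDeriv j g) U := by
  have h1 : ∀ (i : Fin d) {g : (Fin d → ℂ) → ℂ}, AnalyticOnNhd ℂ g U → AnalyticOnNhd ℂ (partialDeriv i g) U := fun i g hg x hx =>
    ((ContinuousLinearMap.apply ℂ ℂ (Pi.single i (1 : ℂ) : Fin d → ℂ)).analyticAt _).comp (hg.fderiv x hx)
  unfold multiDeriv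
  induction List.finRange d with
  | nil => exact hg
  | cons i l ih =>
    rw [List.foldr_cons]
    induction j i with
    | zero => exact ih
    | succ _ ihk => rw [Function.iterate_succ_apply']; exact h1 i ihk

theorem analyticOnNhd_polyDiffOp {d : ℕ} {U : Set (Fin d → ℂ)} {g : (Fin d → ℂ) → ℂ} (hg : AnalyticOnNhd ℂ g U) (P : MvPolynomial (Fin d) ℂ) :
    AnalyticOnNhd ℂ (polyDiffOp P g) U := fun x hx =>
  Finset.analyticAt_fun_sum _ fun _ _ => analyticAt_const.mul (analyticOnNhd_multiDeriv hg _ x hx)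

theorem StandingAssumptions.analyticOnNhd_nonlin {d m n : ℕ} {S : QuasilinearData d m n} {φ ρ₀ ε T αr : ℝ} {αq : (Fin m → multiIdx d n → ℕ) → ℝ}
    (hS : StandingAssumptions S φ ρ₀ ε T αr αq) {U : Set (Fin d → ℂ)} (hU : U ⊆ polysector d (Real.pi / (2 * n)) ρ₀) {f : (Fin d → ℂ) → Fin m → ℂ}
    (hf : AnalyticOnNhd ℂ f U) (hfε : ∀ x ∈ U, l1norm (f x) < ε) {t : ℝ} (ht : t ∈ Icc 0 T) (l : Fin m) :
    AnalyticOnNhd ℂ (fun x => S.nonlin f t x l) U := fun x hx => by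
  refine Finset.analyticAt_fun_sum _ fun q hq => AnalyticAt.mul ?_ (Finset.analyticAt_fun_prod _ fun l' _ => Finset.analyticAt_fun_prod _ fun j _ =>
    (analyticOnNhd_multiDeriv (fun y hy => analyticAt_pi_iff.1 (hf y hy) l') j.1 x hx).pow _)
  have h1 := analyticAt_pi_iff.1 (hS.b_analytic q hq t ht (x, f x) ⟨hU hx, hfε x hx⟩) l
  exact h1.comp₂ (f := fun x => x) (h := fun z : (Fin d → ℂ) × (Fin m → ℂ) => S.b q z.1 t z.2 l) analyticAt_id (hf x hx)

/-- For |xᵢ| > 2R/μ at least μ|xᵢ|/2 survives the subtraction of R, so each coordinate contributes a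
multiple of |xᵢ|^{-(γ+1)}. -/
theorem IsKernel.norm_sectorLaplace_le {d : ℕ} {σ T γ R K φ ρ : ℝ} {F : (Fin d → ℂ) → ℝ → ℂ} (hφ : 0 ≤ φ) (hφσ : φ < σ) (hσ : σ < Real.pi / 2) (hγ : 0 ≤ γ) (hR : 0 < R) (hK : 0 ≤ K)
    (h : IsKernel σ T γ R 0 K F) (hρ : 2 * R / min (Real.cos σ) (Real.sin (σ - φ)) ≤ ρ) {t : ℝ} (ht : t ∈ Icc 0 T) {x : Fin d → ℂ} (hx : x ∈ polysector d φ ρ) :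
    ‖sectorLaplace σ (fun p => F p t) x‖ ≤ K * (R / 2 ^ (γ + 3)) ^ d *
      ((2 / min (Real.cos σ) (Real.sin (σ - φ))) ^ (γ + 1) * Real.Gamma (γ + 1)) ^ d * absPow x (-(γ + 1)) := by
  have hpi := Real.pi_pos
  set μ := min (Real.cos σ) (Real.sin (σ - φ)) with hμ
  have hμ0 : 0 < μ := lt_min (Real.cos_pos_of_mem_Ioo ⟨by linarith, hσ⟩) (Real.sin_pos_of_pos_of_lt_pi (by linarith) (by linarith))
  have hΓ := Real.Gamma_pos_of_pos (by linarith : 0 < γ + 1)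
  have h1 : ∀ i, 2 * R < μ * ‖x i‖ := fun i => by
    have := (div_le_iff₀ hμ0).1 hρ
    nlinarith [(hx i).2]
  have h2 : ∀ i, μ * ‖x i‖ / 2 ≤ (Complex.exp (sectorAngle σ x i * Complex.I) * x i).re - R := fun i => by
    linarith [h1 i, le_re_sectorAngle hφ hφσ hσ hx i]
  have hx0 : ∀ i, 0 < ‖x i‖ := fun i => by
    by_contra hc
    nlinarith [h1 i, norm_nonneg (x i)]
  refine (h.norm_laplace_le_prod (by linarith) hγ hR hK ht (abs_sectorAngle (by linarith) x) fun i => by linarith [h1 i, h2 i]).trans ?_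
  rw [mul_assoc (K * _)]
  refine mul_le_mul_of_nonneg_left ?_ (by positivity)
  have h3 : ((2 / μ) ^ (γ + 1) * Real.Gamma (γ + 1)) ^ d * absPow x (-(γ + 1)) = ∏ i, ((2 / μ) ^ (γ + 1) * Real.Gamma (γ + 1)) * ‖x i‖ ^ (-(γ + 1)) := by
    rw [Finset.prod_mul_distrib, Finset.prod_const, Finset.card_univ, Fintype.card_fin, absPow]
  rw [h3]
  have h4 : ∀ i, 0 < (Complex.exp (sectorAngle σ x i * Complex.I) * x i).re - R := fun i => by linarith [h1 i, h2 i]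
  refine Finset.prod_le_prod (fun i _ => by have := h4 i; positivity) fun i _ => ?_
  have h5 : 1 / ((Complex.exp (sectorAngle σ x i * Complex.I) * x i).re - R) ≤ 2 / μ * ‖x i‖⁻¹ := by
    calc _ ≤ 1 / (μ * ‖x i‖ / 2) := one_div_le_one_div_of_le (by have := hx0 i; positivity) (h2 i)
      _ = _ := by have := hx0 i; field_simp
  rw [mul_right_comm, Real.rpow_neg (hx0 i).le, ← Real.inv_rpow (hx0 i).le, ← Real.mul_rpow (by positivity) (by positivity)]
  have := h4 i
  gcongr

theorem absPow_neg_le {d : ℕ} {φ ρ α : ℝ} (hd : 1 ≤ d) (hρ : 1 ≤ ρ) (hα : 1 ≤ α) {x : Fin d → ℂ} (hx : x ∈ polysector d φ ρ) :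
    (∏ i, ‖x i‖) * absPow x (-α) ≤ 1 ∧ absPow x (-α) ≤ ρ⁻¹ := by
  have h1 : ∀ i, 1 < ‖x i‖ := fun i => hρ.trans_lt (hx i).2
  have h2 : ∀ i, ‖x i‖ ^ (-α) ≤ ‖x i‖⁻¹ := fun i => by
    rw [← Real.rpow_neg_one]; exact Real.rpow_le_rpow_of_exponent_le (h1 i).le (by linarith)
  have h0 : ∀ i, 0 < ‖x i‖ := fun i => one_pos.trans (h1 i)
  constructor
  · rw [absPow, ← Finset.prod_mul_distrib]
    refine Finset.prod_le_one (fun i _ => by positivity) fun i _ => ?_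
    calc ‖x i‖ * ‖x i‖ ^ (-α) ≤ ‖x i‖ * ‖x i‖⁻¹ := by gcongr; exact h2 i
      _ = 1 := mul_inv_cancel₀ (h0 i).ne'
  · calc absPow x (-α) ≤ ∏ _i : Fin d, ρ⁻¹ := Finset.prod_le_prod (fun i _ => by positivity) fun i _ =>
          (h2 i).trans (inv_anti₀ (by linarith) (hx i).2.le)
      _ = ρ⁻¹ ^ d := by simp
      _ ≤ ρ⁻¹ := pow_le_of_le_one (by positivity) (inv_le_one_of_one_le₀ hρ) (by omega)

/-- The Borel-plane solution lives on a sector with σ > φ strictly; this surplus angle makes the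
rotated Laplace integrals converge on the full polysector with opening π/2 + φ. The constant K is
the same for all ρ, and the decay bound comes with the construction. -/
theorem StandingAssumptions.exists_isDecayingSolution {d m n : ℕ} {S : QuasilinearData d m n} {φ ρ₀ ε T αr : ℝ} {αq : (Fin m → multiIdx d n → ℕ) → ℝ}
    (hS : StandingAssumptions S φ ρ₀ ε T αr αq) (hd : 1 ≤ d) (hn : 2 ≤ n) (hρ₀ : 0 < ρ₀) (hε : 0 < ε) (hT : 0 ≤ T) :
    ∃ ρ₁ ≥ ρ₀, ∃ K : ℝ, ∀ ρ ≥ ρ₁, ∃ f, IsDecayingSolution S φ ρ ε T f ∧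
      ∀ x ∈ polysector d φ ρ, ∀ t ∈ Icc 0 T, l1norm (f x t) ≤ K * absPow x (-αr) := by
  have hpi := Real.pi_pos
  have hπ := half_pi_div_le hn
  have hφ0 := hS.phi_pos
  have hφn := hS.phi_lt
  have hγ : 0 ≤ αr - 1 := by linarith [hS.one_le_αr]
  obtain ⟨σ, hφσ, hσ, c, hc, C₀, hC₀, hcone⟩ := hS.exists_cone hn
  have hσ0 : 0 ≤ σ := by linarith
  have hσπ : σ < Real.pi := by linarith
  have hσ2 : σ < Real.pi / 2 := by linarith
  obtain ⟨R, hR1, R', hRR', K', F, G, F₀, hF, hG, hduh, hinit, hLG⟩ := hS.exists_kernel_solution hd hn hρ₀ hε hT hσ0 hσ hc hC₀ hcone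
  have hR : 0 < R := one_pos.trans_le hR1
  set γ := αr - 1 with hγd
  have hγα : γ + 1 = αr := by rw [hγd]; ring
  set μ := min (Real.cos σ) (Real.sin (σ - φ)) with hμ
  have hμ0 : 0 < μ := lt_min (Real.cos_pos_of_mem_Ioo ⟨by linarith, hσ2⟩) (Real.sin_pos_of_pos_of_lt_pi (by linarith) (by linarith))
  have hΓ := Real.Gamma_pos_of_pos (by linarith : 0 < γ + 1)
  set B : ℝ := 1 / 4 * (R / 2 ^ (γ + 3)) ^ d * ((2 / μ) ^ (γ + 1) * Real.Gamma (γ + 1)) ^ d with hB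
  have hB0 : 0 ≤ B := by positivity
  -- 2R/μ gives convergence of the rotated integrals, mB/ε + 1 forces |f| < ε, and 1 ensures
  -- |xᵢ|^{-α_r} ≤ |xᵢ|^{-1}.
  refine ⟨max (max ρ₀ 1) (max (2 * R / μ) (m * B / ε + 1)), le_max_of_le_left (le_max_left _ _), m * B, fun ρ hρ => ?_⟩
  have hρρ₀ : ρ₀ ≤ ρ := (le_max_of_le_left (le_max_left _ _)).trans hρ
  have hρ1 : 1 ≤ ρ := (le_max_of_le_left (le_max_right _ _)).trans hρ
  have hρR : 2 * R / μ ≤ ρ := (le_max_of_le_right (le_max_left _ _)).trans hρ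
  have hρB : m * B / ε < ρ := by
    have : m * B / ε + 1 ≤ ρ := (le_max_of_le_right (le_max_right _ _)).trans hρ
    linarith
  have hρ0 : 0 < ρ := hρ₀.trans_le hρρ₀
  set U := polysector d φ ρ with hU
  have hUo : IsOpen U := isOpen_polysector (by linarith) hρ0.le
  have hsub : U ⊆ polysector d (Real.pi / (2 * n)) ρ₀ := polysector_mono hφn.le hρρ₀
  have hre : ∀ x ∈ U, ∀ i, R < (Complex.exp (sectorAngle σ x i * Complex.I) * x i).re := fun x hx i => by
    have h1 := (div_le_iff₀ hμ0).1 hρR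
    have h2 := le_re_sectorAngle hφ0.le hφσ hσ2 hx i
    nlinarith [(hx i).2]
  set f : (Fin d → ℂ) → ℝ → Fin m → ℂ := fun x t l => sectorLaplace σ (fun p => F l p t) x with hf
  have han : ∀ {a : ℕ} {K : ℝ} {F : (Fin d → ℂ) → ℝ → ℂ}, IsKernel σ T γ R a K F → ∀ t ∈ Icc 0 T, AnalyticOnNhd ℂ (sectorLaplace σ fun p => F p t) U := fun h t ht =>
    (h.growth hγ hR ht).analyticOnNhd_sectorLaplace (h.borel.holo t ht) hσ0 hσ2 hγ hR.le hUo hre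
  set R'' := max R' ρ with hR''
  have hhU : halfSpace d R'' ⊆ U := halfSpace_subset_polysector hφ0.le hρ0.le (le_max_right _ _)
  have hhR' : halfSpace d R'' ⊆ halfSpace d R' := halfSpace_mono (le_max_left _ _)
  have hhR : halfSpace d R'' ⊆ halfSpace d R := hhR'.trans (halfSpace_mono hRR')
  have heq : ∀ {a : ℕ} {K : ℝ} {F : (Fin d → ℂ) → ℝ → ℂ}, IsKernel σ T γ R a K F → ∀ t ∈ Icc 0 T, ∀ x ∈ halfSpace d R'',
      sectorLaplace σ (fun p => F p t) x = laplace 0 (fun p => F p t) x := fun h t ht x hx =>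
    (h.growth hγ hR ht).sectorLaplace_eq (h.borel.holo t ht) hσ0 hσ2 hγ hR.le (hre x (hhU hx)) (hhR hx)
  have hfan : ∀ t ∈ Icc 0 T, AnalyticOnNhd ℂ (fun x => f x t) U := fun t ht x hx => analyticAt_pi_iff.2 fun l => han (hF l) t ht x hx
  have hfL : ∀ t ∈ Icc 0 T, EqOn (fun x => f x t) (fun x => laplaceVec F x t) (halfSpace d R'') := fun t ht x hx => funext fun l => heq (hF l) t ht x hx
  have hbound : ∀ x ∈ U, ∀ t ∈ Icc 0 T, l1norm (f x t) ≤ m * B * absPow x (-αr) := fun x hx t ht => by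
    calc l1norm (f x t) ≤ ∑ _l : Fin m, B * absPow x (-αr) := Finset.sum_le_sum fun l _ => by
          have := (hF l).norm_sectorLaplace_le hφ0.le hφσ hσ2 hγ hR (by norm_num) hρR ht hx
          rwa [show -(γ + 1) = -αr by rw [hγα]] at this
      _ = _ := by simp [mul_assoc]
  have hmem : ∀ x ∈ U, ∀ t ∈ Icc 0 T, l1norm (f x t) < ε := fun x hx t ht => by
    refine (hbound x hx t ht).trans_lt ?_
    have h1 := (absPow_neg_le hd hρ1 hS.one_le_αr hx).2
    calc m * B * absPow x (-αr) ≤ m * B * ρ⁻¹ := by gcongr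
      _ < ε := by
        rw [← div_eq_mul_inv, div_lt_iff₀ hρ0]
        rw [div_lt_iff₀ hε] at hρB
        linarith
  refine ⟨f, ⟨hfan, ⟨m * B, fun x hx t ht => ?_⟩, hmem, fun x hx => ?_, fun x hx t ht => hasDerivWithinAt_pi.2 fun l => ?_⟩, hbound⟩
  · have h0 : 0 ≤ ∏ i, ‖x i‖ := Finset.prod_nonneg fun _ _ => norm_nonneg _
    calc (∏ i, ‖x i‖) * l1norm (f x t) ≤ (∏ i, ‖x i‖) * (m * B * absPow x (-αr)) := mul_le_mul_of_nonneg_left (hbound x hx t ht) h0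
      _ = m * B * ((∏ i, ‖x i‖) * absPow x (-αr)) := by ring
      _ ≤ m * B * 1 := by gcongr; exact (absPow_neg_le hd hρ1 hS.one_le_αr hx).1
      _ = m * B := mul_one _
  · refine eqOn_polysector_of_eqOn_halfSpace hφ0.le (by linarith) hρ0 (le_max_right R' ρ) (hfan 0 ⟨le_rfl, hT⟩) (fun y hy => hS.fI_analytic y (hsub hy)) (fun y hy => ?_) hx
    refine (hfL 0 ⟨le_rfl, hT⟩ hy).trans (funext fun l => ?_)
    rw [← hinit l y (hhR' hy)]
    refine congrFun (laplace_congr hσ0 fun p hp => ?_) y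
    simp [hduh l p hp 0 ⟨le_rfl, hT⟩, duhamelSol]
  · obtain ⟨M, -, hM⟩ := exists_norm_eval_neg_le (S.P l) (hS.order_le l)
    have hE := IsKernel.evolution hR hM (hF l) (hG l)
    have hint : ∀ p ∈ csector d σ, ∀ t ∈ Icc 0 T, F l p t = F l p 0 + ∫ τ in (0 : ℝ)..t, (-MvPolynomial.eval (-p) (S.P l) * F l p τ + G l p τ) := fun p hp t ht => by
      rw [intervalIntegral.integral_congr (g := fun τ => -MvPolynomial.eval (-p) (S.P l) * duhamelSol (MvPolynomial.eval (-p) (S.P l)) (F₀ l p) (G l p) τ + G l p τ)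
        fun τ hτ => by simp only [hduh l p hp τ (uIcc_subset_Icc_zero ht hτ)],
        hduh l p hp t ht, duhamelSol_integral_eq _ _ ((hG l).borel.continuousOn_time hp) ht, hduh l p hp 0 ⟨le_rfl, hT⟩]
      simp [duhamelSol]
    have hder := IsKernel.hasDerivWithinAt_laplace hσπ hγ hR (hF l) hE hint (abs_sectorAngle hσ0 x) (hre x hx) ht
    refine hder.congr_deriv ?_
    have hfl : AnalyticOnNhd ℂ (fun y => f y t l) U := fun y hy => analyticAt_pi_iff.1 (hfan t ht y hy) l
    -- Both sides of the equation are analytic in x, so it is enough to compare them on a half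
    -- space, where the real rays can be used and the Borel-plane identities apply.
    have := eqOn_polysector_of_eqOn_halfSpace hφ0.le (by linarith) hρ0 (le_max_right R' ρ) (han hE t ht)
      (g := fun x => -polyDiffOp (S.P l) (fun y => f y t l) x + S.nonlin (fun y => f y t) t x l + S.r x t l)
      (fun y hy => (((analyticOnNhd_polyDiffOp hfl (S.P l) y hy).neg).add (hS.analyticOnNhd_nonlin hsub (hfan t ht) (fun y hy => hmem y hy t ht) ht l y hy)).add
        (analyticAt_pi_iff.1 (hS.r_analytic t ht y (hsub hy)) l)) (fun y hy => ?_)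
    · exact this hx
    · rw [heq hE t ht y hy, IsKernel.laplace_evolution (hS.order_le l) hσ0 hσπ hγ hR (hF l) (hG l) (hhR hy) ht, hLG t ht y (hhR' hy) l]
      have e1 : polyDiffOp (S.P l) (fun y => f y t l) y = polyDiffOp (S.P l) (laplace 0 fun p => F l p t) y :=
        polyDiffOp_congr (isOpen_halfSpace d R'') (fun z hz => congrFun (hfL t ht hz) l) hy
      simp only
      rw [e1, S.nonlin_congr (isOpen_halfSpace d R'') (hfL t ht) t hy l]
      ring

theorem IsDecayingSolution.mono {d m n : ℕ} {S : QuasilinearData d m n} {φ ρ ρ' ε T : ℝ} {f : (Fin d → ℂ) → ℝ → Fin m → ℂ}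
    (hf : IsDecayingSolution S φ ρ ε T f) (h : ρ ≤ ρ') : IsDecayingSolution S φ ρ' ε T f := by
  have hs : polysector d φ ρ' ⊆ polysector d φ ρ := polysector_mono le_rfl h
  obtain ⟨A, hA⟩ := hf.bounded
  exact ⟨fun t ht x hx => hf.analytic t ht x (hs hx), ⟨A, fun x hx => hA x (hs hx)⟩, fun x hx => hf.mem_domain x (hs hx),
    fun x hx => hf.initial x (hs hx), fun x hx => hf.equation x (hs hx)⟩

end

theorem theorem1 {d m n : ℕ} (hd : 1 ≤ d) (hn : 2 ≤ n) (S : QuasilinearData d m n)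
    (φ ρ₀ ε T αr : ℝ) (αq : (Fin m → multiIdx d n → ℕ) → ℝ)
    (hρ₀ : 0 < ρ₀) (hε : 0 < ε) (hT : 0 < T)
    (hS : StandingAssumptions S φ ρ₀ ε T αr αq) :
    -- existence of a solution for large `|x|`
    (∃ ρ₁ ≥ ρ₀, ∀ ρ ≥ ρ₁, ∃ f, IsDecayingSolution S φ ρ ε T f) ∧
    -- uniqueness, for every `ρ ≥ ρ₀`
    (∀ ρ ≥ ρ₀, ∀ f g, IsDecayingSolution S φ ρ ε T f → IsDecayingSolution S φ ρ ε T g →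
      ∀ x ∈ polysector d φ ρ, ∀ t ∈ Set.Icc 0 T, f x t = g x t) ∧
    -- decay of the solution, for every `ρ ≥ ρ₀`
    (∀ ρ ≥ ρ₀, ∀ f, IsDecayingSolution S φ ρ ε T f →
      ∃ ρ' ≥ ρ, ∃ K : ℝ, ∀ x ∈ polysector d φ ρ', ∀ t ∈ Set.Icc 0 T,
        l1norm (f x t) ≤ K * absPow x (-αr)) := by
  obtain ⟨ρ₁, hρ₁, K, h⟩ := hS.exists_isDecayingSolution hd hn hρ₀ hε hT.le
  refine ⟨⟨ρ₁, hρ₁, fun ρ hρ => ?_⟩, fun ρ hρ f g hf hg x hx t ht => ?_, fun ρ hρ f hf => ?_⟩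
  · obtain ⟨f, hf, -⟩ := h ρ hρ
    exact ⟨f, hf⟩
  · exact IsDecayingSolution.unique hd hn hρ₀ hε hT.le hS hρ hf hg ht hx
  -- On the smaller domain of radius max ρ ρ₁ uniqueness identifies f with the constructed solution,
  -- whose bound it inherits.
  · obtain ⟨g, hg, hK⟩ := h (max ρ ρ₁) (le_max_right _ _)
    refine ⟨max ρ ρ₁, le_max_left _ _, K, fun x hx t ht => ?_⟩
    have e : f x t = g x t :=
      IsDecayingSolution.unique hd hn hρ₀ hε hT.le hS (hρ.trans (le_max_left _ _)) (hf.mono (le_max_left _ _)) hg ht hx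
    rw [e]
    exact hK x hx t ht
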